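/- **Setting.** Let $K$ be a henselian discrete valuation field of characteristic $0$ with ring of integers $O_K$ and residue field $k$ of characteristic $p>0$ ($k$ need not be perfect); put $B=\operatorname{Spec}O_K$, $s=\operatorname{Spec}k$. Let $X$ be a regular scheme of finite type over $B$, $D$ a (possibly empty) reduced divisor on $X$ flat over $B$, $Y=(X\times_B s)_{\mathrm{red}}$ and $U=X\smallsetminus(Y\cup D)$. Assume that $Y\cup D$ has normal crossings on $X$, that $Y$ is a normal crossing variety over $k$ (pure-dimensional, separated of finite type, and étale locally isomorphic to $\operatorname{Spec}k[T_1,\dots,T_d]/(T_1\cdots T_a)$ with $1\le a\le d=\dim Y+1$), and that $(D\times_B s)_{\mathrm{red}}$ is an admissible divisor on $Y$ (étale locally around each of its points it is the locus $T_{a+1}\cdots T_{a+b}=0$ in such a model, $a,b\ge1$, $a+b\le d$). Let $i:Y\to X$ and $\psi:U\to X$ be the immersions. Let $\tilde\omega^1_Y$ be the étale sheaf on $Y$ obtained from $\Omega^1_{Y/\mathbb Z}\oplus(\mathcal O_Y\otimes_{\mathbb Z}i^{-1}\psi_*\mathcal O_U^\times)$ by imposing the relations $(d\bar x,0)=(0,\bar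 x\otimes x)$ for local sections $x$ of $i^{-1}(\psi_*\mathcal O_U^\times\cap\mathcal O_X)$ with image $\bar x$ in $\mathcal O_Y$; let $\operatorname{dlog}(x)$ be the class of $(0,1\otimes x)$, let $\tilde\omega^q_Y=\bigwedge^q_{\mathcal O_Y}\tilde\omega^1_Y$ with its exterior derivative $d$, and let $\tilde\omega^q_{Y,\log}\subset\tilde\omega^q_Y$ be the subsheaf of abelian groups generated by the forms $\operatorname{dlog}(y_1)\wedge\cdots\wedge\operatorname{dlog}(y_q)$. Let $\{Y_\lambda\}_{\lambda\in\Lambda}$ be the irreducible components of $Y$, $\mathcal I_\lambda\subset\mathcal O_X$ the ideal of $Y_\lambda$, and $\mathcal I^{(m)}=\prod_\lambda\mathcal I_\lambda^{m_\lambda}$ for $m\in\mathbb N^\Lambda$. For $m,l\in\mathbb N^\Lambda$ put $$\omega^q_{m,l}=\mathcal I^{(m)}/\mathcal I^{(m+l)}\otimes_{\mathcal O_X}\tilde\omega^q_Y .$$ **Theorem.** Let $m,l\in\mathbb N^\Lambda$ with $0\le l_\lambda\le 1$ for all $\lambda$. 1. There is a unique differential $d:\omega^q_{m,l}\to\omega^{q+1}_{m,l}$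 ($q\ge0$), $d\circ d=0$, such that $$d\Big(\prod_\lambda\pi_\lambda^{m_\lambda}\otimes\omega\Big)=\prod_\lambda\pi_\lambda^{m_\lambda}\otimes\Big(d\omega+\sum_\lambda m_\lambda\operatorname{dlog}(\pi_\lambda)\wedge\omega\Big)$$ for all local uniformizers $\pi_\lambda$ of the $Y_\lambda$ and all local sections $\omega$ of $\tilde\omega^q_Y$. This makes $\omega^\bullet_{m,l}$ a complex of étale sheaves of abelian groups. 2. Let $m'\in\mathbb N^\Lambda$ be the smallest element with $p\,m'\ge m$, and let $l'_\lambda=1$ if $l_\lambda=1$ and $p\mid m_\lambda$, and $l'_\lambda=0$ otherwise. Then for every $q\ge 0$ there is an isomorphism of étale sheaves of abelian groups $$C^{-1}:\omega^q_{m',l'}\xrightarrow{\ \sim\ }\mathcal H^q(\omega^\bullet_{m,l}),\qquad x\otimes\omega\mapsto\text{class of }x^p\otimes\omega,$$ for local sections $x$ of $\mathcal I^{(m')}$ and $\omega$ of $\tilde\omega^q_{Y,\log}$. 3. In particular, if $\mu\in\Lambda$, $p\nmid m_\mu$, and $\delta_\mu\in\mathbb N^\Lambda$ is the multi-index with entry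 $1$ at $\mu$ and $0$ elsewhere, then the complex $\omega^\bullet_{m,\delta_\mu}$ is acyclic. -/

import Mathlib

open scoped TensorProduct
open KaehlerDifferential
open CategoryTheory Limits AlgebraicGeometry TopologicalSpace Opposite

universe u v

namespace KatoCartier

noncomputable section

/-! ### Logarithmic differential forms over a ring

`A` plays the role of the sections of `𝒪_X`, `I` of the ideal of `Y`, `B` of the sections of
`𝒪_X` over the complement of the boundary, and `ι` of the restriction map. -/

section LogForms

variable {A B : Type u} [CommRing A] [CommRing B] (ι : A →+* B) (I : Ideal A)

/-- The relations `(dx̄, 0) - (0, x̄ ⊗ x)`, for those `x : A` that become a unit `y` of `B`. -/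
def logRelations :
    Submodule (A ⧸ I) (Ω[A ⧸ I⁄ℤ] × ((A ⧸ I) ⊗[ℤ] Additive Bˣ)) :=
  Submodule.span (A ⧸ I)
    {z | ∃ (x : A) (y : Bˣ), ι x = y ∧
      z = (D ℤ (A ⧸ I) (Ideal.Quotient.mk I x), 0) -
          (0, Ideal.Quotient.mk I x ⊗ₜ[ℤ] Additive.ofMul y)}

/-- The module `ω̃¹` of absolute differentials with log poles: the quotient of
`Ω_{(A/I)/ℤ} ⊕ (A/I) ⊗_ℤ Bˣ` by the relations `dx̄ = x̄ ⊗ x`. -/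
abbrev LogForm1 : Type u :=
  (Ω[A ⧸ I⁄ℤ] × ((A ⧸ I) ⊗[ℤ] Additive Bˣ)) ⧸ logRelations ι I

namespace LogForm1

/-- The universal derivation `A/I → ω̃¹`. -/
def d : Derivation ℤ (A ⧸ I) (LogForm1 ι I) :=
  ((logRelations ι I).mkQ ∘ₗ LinearMap.inl (A ⧸ I) _ _).compDer (D ℤ (A ⧸ I))

/-- The logarithmic differential `dlog : Bˣ → ω̃¹`. -/
def dlog : Additive Bˣ →+ LogForm1 ι I where
  toFun y := (logRelations ι I).mkQ (0, 1 ⊗ₜ[ℤ] y)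
  map_zero' := by rw [TensorProduct.tmul_zero, Prod.mk_zero_zero, map_zero]
  map_add' y z := by
    rw [← map_add, Prod.mk_add_mk, add_zero, TensorProduct.tmul_add]

theorem d_mk (x : A) (y : Bˣ) (h : ι x = y) :
    d ι I (Ideal.Quotient.mk I x) = Ideal.Quotient.mk I x • dlog ι I (Additive.ofMul y) := by
  have : (logRelations ι I).mkQ ((D ℤ (A ⧸ I) (Ideal.Quotient.mk I x), 0) -
          (0, Ideal.Quotient.mk I x ⊗ₜ[ℤ] Additive.ofMul y)) = 0 := by
    rw [Submodule.mkQ_apply, Submodule.Quotient.mk_eq_zero]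
    exact Submodule.subset_span ⟨x, y, h, rfl⟩
  rw [map_sub, sub_eq_zero] at this
  refine this.trans ?_
  change _ = Ideal.Quotient.mk I x • (logRelations ι I).mkQ (0, 1 ⊗ₜ[ℤ] _)
  rw [← map_smul, Prod.smul_mk, smul_zero, TensorProduct.smul_tmul', smul_eq_mul, mul_one]

theorem span_eq_top :
    Submodule.span (A ⧸ I) (Set.range (d ι I) ∪ Set.range (dlog ι I)) = ⊤ := by
  rw [eq_top_iff]
  rintro z -
  obtain ⟨⟨w, t⟩, rfl⟩ := (logRelations ι I).mkQ_surjective z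
  have e : ((w, t) : Ω[A ⧸ I⁄ℤ] × ((A ⧸ I) ⊗[ℤ] Additive Bˣ)) = (w, 0) + (0, t) := by simp
  rw [e, map_add]
  refine add_mem ?_ ?_
  · have hw : w ∈ Submodule.span (A ⧸ I) (Set.range (D ℤ (A ⧸ I))) := by
      rw [KaehlerDifferential.span_range_derivation]; trivial
    induction hw using Submodule.span_induction with
    | mem x h =>
      obtain ⟨r, rfl⟩ := h
      exact Submodule.subset_span (Or.inl ⟨r, rfl⟩)
    | zero => rw [Prod.mk_zero_zero, map_zero]; exact zero_mem _
    | add x y _ _ hx hy =>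
      have := add_mem (hx (by simp)) (hy (by simp))
      rwa [← map_add, Prod.mk_add_mk, add_zero] at this
    | smul a x _ hx =>
      have := Submodule.smul_mem _ a (hx (by simp))
      rwa [← map_smul, Prod.smul_mk, smul_zero] at this
  · clear e
    induction t using TensorProduct.induction_on with
    | zero => rw [Prod.mk_zero_zero, map_zero]; exact zero_mem _
    | tmul r y =>
      have : (logRelations ι I).mkQ (0, r ⊗ₜ[ℤ] y) = r • dlog ι I y := by
        change _ = r • (logRelations ι I).mkQ (0, 1 ⊗ₜ[ℤ] _)
        rw [← map_smul, Prod.smul_mk, smul_zero, TensorProduct.smul_tmul', smul_eq_mul, mul_one]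
      rw [this]
      exact Submodule.smul_mem _ _ (Submodule.subset_span (Or.inr ⟨y, rfl⟩))
    | add x y hx hy =>
      have := add_mem hx hy
      rwa [← map_add, Prod.mk_add_mk, add_zero] at this

variable {ι I} {N : Type*} [AddCommGroup N] [Module (A ⧸ I) N]

/-- The universal property of `ω̃¹`. -/
def lift (δ : Derivation ℤ (A ⧸ I) N) (g : Additive Bˣ →+ N)
    (h : ∀ (x : A) (y : Bˣ), ι x = y →
      δ (Ideal.Quotient.mk I x) = Ideal.Quotient.mk I x • g (Additive.ofMul y)) :
    LogForm1 ι I →ₗ[A ⧸ I] N :=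
  (logRelations ι I).liftQ
    (LinearMap.coprod δ.liftKaehlerDifferential (g.toIntLinearMap.liftBaseChange (A ⧸ I))) <| by
    rw [logRelations, Submodule.span_le]
    rintro _ ⟨x, y, hxy, rfl⟩
    simp [h x y hxy]

@[simp]
theorem lift_d (δ : Derivation ℤ (A ⧸ I) N) (g : Additive Bˣ →+ N) (h) (r : A ⧸ I) :
    lift (ι := ι) δ g h (d ι I r) = δ r := by
  change lift (ι := ι) δ g h ((logRelations ι I).mkQ (D ℤ _ r, 0)) = _
  simp [lift]

@[simp]
theorem lift_dlog (δ : Derivation ℤ (A ⧸ I) N) (g : Additive Bˣ →+ N) (h) (y : Additive Bˣ) :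
    lift (ι := ι) δ g h (dlog ι I y) = g y := by
  change lift (ι := ι) δ g h ((logRelations ι I).mkQ (0, 1 ⊗ₜ[ℤ] y)) = _
  simp [lift]

end LogForm1

end LogForms

/-! ### The exterior derivative

For a derivation `δ : R → M` the algebra `E ⊕ E ε`, with `E = ⋀ M`, `ε² = 0` and
`ε x = (-1)^{|x|} x ε`, becomes an `R`-algebra through `r ↦ r + δ(r) ε`. An odd derivation of `E`
extending `δ` is then the same as an algebra homomorphism `E → E ⊕ E ε` lifting the identity.
This is how the exterior derivative is constructed; it is characterized by `extD_algebraMap`,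
`extD_dlog` and `extD_mul` below. -/

section Twist

variable {R : Type u} {M : Type u} [CommRing R] [AddCommGroup M] [Module R M]

/-- Graded commutation with elements of degree one. -/
theorem involute_mul_ι (x : ExteriorAlgebra R M) (m : M) :
    CliffordAlgebra.involute x * ExteriorAlgebra.ι R m = ExteriorAlgebra.ι R m * x := by
  induction x using ExteriorAlgebra.induction with
  | algebraMap r => rw [AlgHom.commutes]; exact Algebra.commutes _ _
  | ι n =>
    have := CliffordAlgebra.involute_ι (Q := (0 : QuadraticForm R M)) n
    rw [show CliffordAlgebra.involute (ExteriorAlgebra.ι R n) = - ExteriorAlgebra.ι R n from this]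
    have := ExteriorAlgebra.ι_add_mul_swap (R := R) n m
    rw [neg_mul]
    exact neg_eq_of_add_eq_zero_right this
  | mul a b ha hb => rw [map_mul, mul_assoc, hb, ← mul_assoc, ha, mul_assoc]
  | add a b ha hb => rw [map_add, add_mul, ha, hb, mul_add]

variable (R M) in
/-- `⋀ M` as a bimodule over itself, with the left action twisted by the grading involution. -/
def TwistedBimodule : Type u := ExteriorAlgebra R M

namespace TwistedBimodule

instance : AddCommGroup (TwistedBimodule R M) :=
  inferInstanceAs (AddCommGroup (ExteriorAlgebra R M))

instance : Module (ExteriorAlgebra R M) (TwistedBimodule R M) :=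
  Module.compHom (ExteriorAlgebra R M)
    (CliffordAlgebra.involute (Q := (0 : QuadraticForm R M))).toRingHom

instance : Module (ExteriorAlgebra R M)ᵐᵒᵖ (TwistedBimodule R M) :=
  inferInstanceAs (Module (ExteriorAlgebra R M)ᵐᵒᵖ (ExteriorAlgebra R M))

instance : SMulCommClass (ExteriorAlgebra R M) (ExteriorAlgebra R M)ᵐᵒᵖ (TwistedBimodule R M) where
  smul_comm a b x := by
    change CliffordAlgebra.involute a * ((show ExteriorAlgebra R M from x) * b.unop) = (CliffordAlgebra.involute a * (show ExteriorAlgebra R M from x)) * b.unop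
    rw [mul_assoc]

end TwistedBimodule

variable (R M) in
/-- The algebra `E ⊕ E ε`, where `E = ⋀ M`. -/
abbrev TwistedExt : Type u := TrivSqZeroExt (ExteriorAlgebra R M) (TwistedBimodule R M)

namespace TwistedExt

/-- The element `x + y ε`. -/
def mk (x y : ExteriorAlgebra R M) : TwistedExt R M := ⟨x, y⟩

/-- The coefficient of `ε`. -/
def im (x : TwistedExt R M) : ExteriorAlgebra R M := x.snd

@[simp] theorem fst_mk (x y : ExteriorAlgebra R M) : (mk x y).fst = x := rfl

@[simp] theorem im_mk (x y : ExteriorAlgebra R M) : (mk x y).im = y := rfl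

theorem ext' {x y : TwistedExt R M} (h : x.fst = y.fst) (h' : x.im = y.im) : x = y :=
  TrivSqZeroExt.ext h h'

@[simp] theorem fst_mul (x y : TwistedExt R M) : (x * y).fst = x.fst * y.fst := rfl

@[simp] theorem im_mul (x y : TwistedExt R M) :
    (x * y).im = CliffordAlgebra.involute x.fst * y.im + x.im * y.fst := rfl

@[simp] theorem im_add (x y : TwistedExt R M) : (x + y).im = x.im + y.im := rfl
@[simp] theorem im_sub (x y : TwistedExt R M) : (x - y).im = x.im - y.im := rfl
@[simp] theorem im_zero : (0 : TwistedExt R M).im = 0 := rfl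
@[simp] theorem im_one : (1 : TwistedExt R M).im = 0 := rfl

/-- The ring homomorphism `r ↦ r + δ(r) ε`. -/
def ofDerivation (δ : Derivation ℤ R M) : R →+* TwistedExt R M where
  toFun r := mk (algebraMap R _ r) (ExteriorAlgebra.ι R (δ r))
  map_one' := ext' (by simp) (by simp)
  map_mul' r s := ext' (by simp) (by
    simp only [im_mk, im_mul, fst_mk, AlgHom.commutes, ← Algebra.commutes s, ← Algebra.smul_def]
    simp)
  map_zero' := ext' (by simp) (by simp)
  map_add' r s := ext' (by simp) (by simp)

/-- The `R`-algebra structure on `E ⊕ E ε` given by a derivation. -/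
abbrev algebra (δ : Derivation ℤ R M) : Algebra R (TwistedExt R M) :=
  (ofDerivation δ).toAlgebra' fun r x ↦ ext' (Algebra.commutes r x.fst) (by
    simp only [ofDerivation, RingHom.coe_mk, MonoidHom.coe_mk, OneHom.coe_mk, im_mul, fst_mk,
      im_mk, AlgHom.commutes, involute_mul_ι, Algebra.commutes r x.im]
    rw [add_comm])

end TwistedExt

end Twist

section ExteriorDerivative

variable {A B : Type u} [CommRing A] [CommRing B] (ι : A →+* B) (I : Ideal A)

/-- The exterior algebra of `ω̃¹`. -/
abbrev LogForms : Type u := ExteriorAlgebra (A ⧸ I) (LogForm1 ι I)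

/-- The module `ω̃^q = ⋀^q ω̃¹`. -/
abbrev LogForm (q : ℕ) : Submodule (A ⧸ I) (LogForms ι I) := ⋀[A ⧸ I]^q (LogForm1 ι I)

/-- The algebra structure given by the universal derivation. -/
abbrev twAlg : Algebra (A ⧸ I) (TwistedExt (A ⧸ I) (LogForm1 ι I)) :=
  TwistedExt.algebra (LogForm1.d ι I)

attribute [local instance] twAlg

theorem twAlg_smul_def (r : A ⧸ I) (x : TwistedExt (A ⧸ I) (LogForm1 ι I)) :
    r • x = TwistedExt.mk (algebraMap (A ⧸ I) _ r) (ExteriorAlgebra.ι _ (LogForm1.d ι I r)) * x :=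
  rfl

@[simp] theorem twAlg_smul_fst (r : A ⧸ I) (x : TwistedExt (A ⧸ I) (LogForm1 ι I)) :
    (r • x).fst = r • x.fst := by
  rw [twAlg_smul_def, TwistedExt.fst_mul, TwistedExt.fst_mk, Algebra.smul_def]

@[simp] theorem twAlg_smul_im (r : A ⧸ I) (x : TwistedExt (A ⧸ I) (LogForm1 ι I)) :
    (r • x).im = r • x.im + ExteriorAlgebra.ι _ (LogForm1.d ι I r) * x.fst := by
  rw [twAlg_smul_def, TwistedExt.im_mul]
  simp [Algebra.smul_def]

/-- The linear map `m ↦ m + (dm) ε`. -/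
def twistLin : LogForm1 ι I →ₗ[A ⧸ I] TwistedExt (A ⧸ I) (LogForm1 ι I) :=
  LogForm1.lift
    (Derivation.mk'
      (AddMonoidHom.toIntLinearMap
        { toFun := fun r ↦ TwistedExt.mk (ExteriorAlgebra.ι (A ⧸ I) (LogForm1.d ι I r)) 0
          map_zero' := TwistedExt.ext' (by simp) (by simp)
          map_add' := fun r s ↦ TwistedExt.ext' (by simp) (by simp) })
      fun r s ↦ TwistedExt.ext' (by simp) (by
        have := ExteriorAlgebra.ι_add_mul_swap (R := A ⧸ I) (LogForm1.d ι I r) (LogForm1.d ι I s)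
        simp))
    { toFun := fun y ↦ TwistedExt.mk (ExteriorAlgebra.ι (A ⧸ I) (LogForm1.dlog ι I y)) 0
      map_zero' := TwistedExt.ext' (by simp) (by simp)
      map_add' := fun r s ↦ TwistedExt.ext' (by simp) (by simp) }
    fun x y h ↦ TwistedExt.ext' (by simp [LogForm1.d_mk ι I x y h])
      (by simp [LogForm1.d_mk ι I x y h])


variable {ι I} in
theorem LogForm1.induction {p : LogForm1 ι I → Prop} (m : LogForm1 ι I)
    (d : ∀ r, p (LogForm1.d ι I r)) (dlog : ∀ y, p (LogForm1.dlog ι I y))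
    (zero : p 0) (add : ∀ x y, p x → p y → p (x + y)) (smul : ∀ (r : A ⧸ I) x, p x → p (r • x)) :
    p m := by
  have hm : m ∈ Submodule.span (A ⧸ I) (Set.range (LogForm1.d ι I) ∪ Set.range (LogForm1.dlog ι I)) := by
    rw [LogForm1.span_eq_top]; trivial
  induction hm using Submodule.span_induction with
  | mem x h =>
    rcases h with ⟨r, rfl⟩ | ⟨y, rfl⟩
    · exact d r
    · exact dlog y
  | zero => exact zero
  | add x y _ _ hx hy => exact add x y hx hy
  | smul a x _ hx => exact smul a x hx

@[simp] theorem twistLin_d (r : A ⧸ I) : twistLin ι I (LogForm1.d ι I r) =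
    TwistedExt.mk (ExteriorAlgebra.ι (A ⧸ I) (LogForm1.d ι I r)) 0 :=
  LogForm1.lift_d ..

@[simp] theorem twistLin_dlog (y : Additive Bˣ) : twistLin ι I (LogForm1.dlog ι I y) =
    TwistedExt.mk (ExteriorAlgebra.ι (A ⧸ I) (LogForm1.dlog ι I y)) 0 :=
  LogForm1.lift_dlog ..

@[simp] theorem twistLin_fst (m : LogForm1 ι I) :
    (twistLin ι I m).fst = ExteriorAlgebra.ι (A ⧸ I) m := by
  induction m using LogForm1.induction with
  | d r => simp
  | dlog y => simp
  | zero => simp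
  | add x y hx hy => simp [hx, hy]
  | smul r x hx => simp [hx]

theorem ι_mem (m : LogForm1 ι I) : ExteriorAlgebra.ι (A ⧸ I) m ∈ LogForm ι I 1 := by
  change _ ∈ LinearMap.range _ ^ 1
  rw [pow_one]
  exact ⟨m, rfl⟩

variable {ι I} in
theorem mul_mem {a b : ℕ} {x y : LogForms ι I} (hx : x ∈ LogForm ι I a) (hy : y ∈ LogForm ι I b) :
    x * y ∈ LogForm ι I (a + b) := by
  change _ ∈ LinearMap.range _ ^ (a + b)
  rw [pow_add]
  exact Submodule.mul_mem_mul hx hy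

theorem twistLin_im_mem (m : LogForm1 ι I) : (twistLin ι I m).im ∈ LogForm ι I 2 := by
  induction m using LogForm1.induction with
  | d r => simp
  | dlog y => simp
  | zero => simp
  | add x y hx hy => simpa using add_mem hx hy
  | smul r x hx =>
    simpa using add_mem (Submodule.smul_mem _ r hx) (mul_mem (ι_mem ι I _) (ι_mem ι I x))

variable {ι I} in
theorem commute_of_mem_two {x : LogForms ι I} (hx : x ∈ LogForm ι I 2) (m : LogForm1 ι I) :
    x * ExteriorAlgebra.ι (A ⧸ I) m = ExteriorAlgebra.ι (A ⧸ I) m * x := by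
  rw [← involute_mul_ι]
  congr 1
  change x ∈ LinearMap.range _ ^ 2 at hx
  rw [pow_two] at hx
  induction hx using Submodule.mul_induction_on' with
  | mem_mul_mem a ha b hb =>
    obtain ⟨a, rfl⟩ := ha
    obtain ⟨b, rfl⟩ := hb
    have h (c : LogForm1 ι I) : CliffordAlgebra.involute (ExteriorAlgebra.ι (A ⧸ I) c) =
        - ExteriorAlgebra.ι (A ⧸ I) c := CliffordAlgebra.involute_ι c
    rw [map_mul, h, h, neg_mul_neg]
  | add a _ b _ ha hb => rw [map_add, ← ha, ← hb]

/-- The algebra homomorphism `x ↦ x + (dx) ε`. -/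
def twistHom : LogForms ι I →ₐ[A ⧸ I] TwistedExt (A ⧸ I) (LogForm1 ι I) :=
  ExteriorAlgebra.lift (A ⧸ I) ⟨twistLin ι I, fun m ↦ TwistedExt.ext' (by simp) (by
    have h : CliffordAlgebra.involute (ExteriorAlgebra.ι (A ⧸ I) m) =
        - ExteriorAlgebra.ι (A ⧸ I) m := CliffordAlgebra.involute_ι m
    simp [h, commute_of_mem_two (twistLin_im_mem ι I m)])⟩

@[simp] theorem twistHom_algebraMap (r : A ⧸ I) : twistHom ι I (algebraMap _ _ r) =
    TwistedExt.mk (algebraMap (A ⧸ I) _ r) (ExteriorAlgebra.ι (A ⧸ I) (LogForm1.d ι I r)) :=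
  AlgHom.commutes _ r

@[simp] theorem twistHom_ι (m : LogForm1 ι I) :
    twistHom ι I (ExteriorAlgebra.ι (A ⧸ I) m) = twistLin ι I m :=
  ExteriorAlgebra.lift_ι_apply ..

@[simp] theorem twistHom_fst (x : LogForms ι I) : (twistHom ι I x).fst = x := by
  induction x using ExteriorAlgebra.induction with
  | algebraMap r => rw [twistHom_algebraMap, TwistedExt.fst_mk]
  | ι n => simp
  | mul a b ha hb => simp [ha, hb]
  | add a b ha hb => simp [ha, hb]

/-- The exterior derivative on `⋀ ω̃¹`. -/
def extD : LogForms ι I →+ LogForms ι I where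
  toFun x := (twistHom ι I x).im
  map_zero' := by simp
  map_add' x y := by simp

theorem extD_algebraMap (r : A ⧸ I) :
    extD ι I (algebraMap _ _ r) = ExteriorAlgebra.ι (A ⧸ I) (LogForm1.d ι I r) := by
  change (twistHom ι I _).im = _
  rw [twistHom_algebraMap, TwistedExt.im_mk]

theorem extD_d (r : A ⧸ I) : extD ι I (ExteriorAlgebra.ι (A ⧸ I) (LogForm1.d ι I r)) = 0 := by
  simp [extD]

theorem extD_dlog (y : Additive Bˣ) :
    extD ι I (ExteriorAlgebra.ι (A ⧸ I) (LogForm1.dlog ι I y)) = 0 := by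
  simp [extD]

theorem extD_mul (x y : LogForms ι I) :
    extD ι I (x * y) = extD ι I x * y + CliffordAlgebra.involute x * extD ι I y := by
  change (twistHom ι I (x * y)).im = _
  rw [map_mul, TwistedExt.im_mul, twistHom_fst, twistHom_fst, add_comm]
  rfl

theorem extD_mem {q : ℕ} {x : LogForms ι I} (hx : x ∈ LogForm ι I q) :
    extD ι I x ∈ LogForm ι I (q + 1) := by
  change x ∈ LinearMap.range _ ^ q at hx
  induction hx using Submodule.pow_induction_on_left' with
  | algebraMap r => rw [extD_algebraMap]; exact ι_mem ι I _
  | add x y i _ _ hx hy => rw [map_add]; exact add_mem hx hy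
  | mem_mul m hm i x hx ih =>
    obtain ⟨m, rfl⟩ := hm
    have h : CliffordAlgebra.involute (ExteriorAlgebra.ι (A ⧸ I) m) =
        - ExteriorAlgebra.ι (A ⧸ I) m := CliffordAlgebra.involute_ι m
    rw [extD_mul, h]
    refine add_mem ?_ ?_
    · have : extD ι I (ExteriorAlgebra.ι (A ⧸ I) m) ∈ LogForm ι I 2 := by
        simpa [extD] using twistLin_im_mem ι I m
      have h3 := mul_mem this (b := i) (y := x) hx
      rwa [show 2 + i = i.succ + 1 by omega] at h3
    · have h3 := mul_mem (ι_mem ι I m) ih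
      rw [neg_mul]
      rw [show 1 + (i + 1) = i.succ + 1 by omega] at h3
      exact neg_mem h3

/-- The exterior derivative `d : ω̃^q → ω̃^{q+1}`. -/
def LogForm.d (q : ℕ) : LogForm ι I q →+ LogForm ι I (q + 1) where
  toFun ω := ⟨extD ι I ω, extD_mem ι I ω.2⟩
  map_zero' := Subtype.ext (by simp)
  map_add' x y := Subtype.ext (by simp)

/-- The form `dlog y ∧ ω`. -/
def LogForm.dlogMul {q : ℕ} (y : Bˣ) (ω : LogForm ι I q) : LogForm ι I (q + 1) :=
  ⟨ExteriorAlgebra.ι (A ⧸ I) (LogForm1.dlog ι I (Additive.ofMul y)) * ω, by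
    rw [add_comm]; exact mul_mem (ι_mem ι I _) ω.2⟩

/-- The subgroup of `ω̃^q` generated by the forms `dlog y₁ ∧ ⋯ ∧ dlog y_q`. -/
def LogForm.logSubgroup (q : ℕ) : AddSubgroup (LogForm ι I q) :=
  AddSubgroup.closure (Set.range fun y : Fin q → Bˣ ↦
    exteriorPower.ιMulti (A ⧸ I) q fun i ↦ LogForm1.dlog ι I (Additive.ofMul (y i)))

end ExteriorDerivative

/-! ### Functoriality and twists -/

section Functoriality

/-- The ring-theoretic data over one étale neighbourhood: `A`, `B`, `ι` and `I` as above, and the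
ideals `comp i` of the components of `Y`. -/
structure LogDatum (Λ : Type v) where
  A : Type u
  B : Type u
  [commRingA : CommRing A]
  [commRingB : CommRing B]
  ι : A →+* B
  I : Ideal A
  comp : Λ → Ideal A

attribute [instance] LogDatum.commRingA LogDatum.commRingB

namespace LogDatum

variable {Λ : Type v}

/-- Restriction maps between such data. -/
@[ext]
structure Hom (P Q : LogDatum.{u} Λ) where
  φ : P.A →+* Q.A
  ψ : P.B →+* Q.B
  comm : ∀ a, ψ (P.ι a) = Q.ι (φ a)
  map_I : P.I ≤ Q.I.comap φ
  map_comp : ∀ i, P.comp i ≤ (Q.comp i).comap φ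

instance : Category (LogDatum.{u} Λ) where
  Hom := Hom
  id P := ⟨RingHom.id _, RingHom.id _, fun _ ↦ rfl, le_rfl, fun _ ↦ le_rfl⟩
  comp f g := ⟨g.φ.comp f.φ, g.ψ.comp f.ψ,
    fun a ↦ (congrArg g.ψ (f.comm a)).trans (g.comm _),
    fun a ha ↦ g.map_I (f.map_I ha), fun i a ha ↦ g.map_comp i (f.map_comp i ha)⟩

/-- The exterior algebra of `ω̃¹`. -/
abbrev Forms (P : LogDatum.{u} Λ) : Type u := LogForms P.ι P.I

/-- The module `ω̃^q`. -/
abbrev Form (P : LogDatum.{u} Λ) (q : ℕ) : Submodule (P.A ⧸ P.I) P.Forms := LogForm P.ι P.I q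

/-- The ideal `I^{(m)} = ∏ I_i ^ m_i`. -/
def ideal (P : LogDatum.{u} Λ) (m : Λ →₀ ℕ) : Ideal P.A := m.prod fun i n ↦ P.comp i ^ n

theorem ideal_anti (P : LogDatum.{u} Λ) {m n : Λ →₀ ℕ} (h : m ≤ n) : P.ideal n ≤ P.ideal m := by
  classical
  obtain ⟨k, rfl⟩ := exists_add_of_le h
  rw [ideal, Finsupp.prod_add_index' (h := fun i n ↦ P.comp i ^ n) (fun _ ↦ pow_zero _)
    (fun _ _ _ ↦ pow_add _ _ _)]
  exact (Ideal.mul_le_left : P.ideal m * P.ideal k ≤ P.ideal m)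

theorem Hom.map_ideal {P Q : LogDatum.{u} Λ} (f : P ⟶ Q) (m : Λ →₀ ℕ) :
    P.ideal m ≤ (Q.ideal m).comap f.φ := by
  rw [← Ideal.map_le_iff_le_comap, ideal, ideal, Finsupp.prod, Finsupp.prod]
  change Ideal.mapHom f.φ _ ≤ _
  rw [map_prod]
  simp only [map_pow]
  exact Finset.prod_le_prod' fun i _ ↦ Ideal.pow_right_mono
    (Ideal.map_le_iff_le_comap.2 (f.map_comp i)) _

/-- The quotient `I^{(m)} / I^{(m+l)}`. -/
abbrev Gr (P : LogDatum.{u} Λ) (m l : Λ →₀ ℕ) : Type u :=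
  P.ideal m ⧸ (P.ideal (m + l)).submoduleOf (P.ideal m)

/-- The module `I^{(m)} / I^{(m+l)} ⊗_A ω̃^q`. -/
abbrev TwistedForm (P : LogDatum.{u} Λ) (m l : Λ →₀ ℕ) (q : ℕ) : Type u :=
  P.Gr m l ⊗[P.A] P.Form q

namespace Hom

variable {P Q : LogDatum.{u} Λ} (f : P ⟶ Q)

/-- The induced map on `A/I`. -/
def quot : P.A ⧸ P.I →+* Q.A ⧸ Q.I := Ideal.quotientMap Q.I f.φ f.map_I

/-- Forms over the target as an algebra over the source. -/
abbrev formsAlgebra : Algebra (P.A ⧸ P.I) Q.Forms :=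
  ((algebraMap (Q.A ⧸ Q.I) Q.Forms).comp (quot f)).toAlgebra' fun r x ↦
    Algebra.commutes (quot f r) x

end Hom

/-- Restriction of 1-forms. -/
def pullForm1 {P Q : LogDatum.{u} Λ} (f : P ⟶ Q) :
    letI := Hom.formsAlgebra f
    LogForm1 P.ι P.I →ₗ[P.A ⧸ P.I] Q.Forms :=
  letI := Hom.formsAlgebra f
  have hsmul : ∀ (r : P.A ⧸ P.I) (x : Q.Forms), r • x = (Hom.quot f r) • x :=
    fun r x ↦ (Algebra.smul_def (Hom.quot f r) x).symm
  LogForm1.lift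
    (Derivation.mk'
      (AddMonoidHom.toIntLinearMap
        { toFun := fun r ↦ ExteriorAlgebra.ι (Q.A ⧸ Q.I) (LogForm1.d Q.ι Q.I (Hom.quot f r))
          map_zero' := by simp
          map_add' := fun r s ↦ by simp })
      fun r s ↦ by simp [hsmul])
    { toFun := fun y ↦ ExteriorAlgebra.ι (Q.A ⧸ Q.I)
        (LogForm1.dlog Q.ι Q.I (Additive.ofMul (Units.map f.ψ y.toMul)))
      map_zero' := by simp
      map_add' := fun r s ↦ by simp }
    fun x y h ↦ by
      have h' : Q.ι (f.φ x) = Units.map (f.ψ : P.B →* Q.B) y := by simp [← f.comm, h]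
      have := LogForm1.d_mk Q.ι Q.I _ _ h'
      simp [hsmul, Hom.quot, this]

theorem pullForm1_d {P Q : LogDatum.{u} Λ} (f : P ⟶ Q) (r : P.A ⧸ P.I) :
    pullForm1 f (LogForm1.d P.ι P.I r) =
      ExteriorAlgebra.ι (Q.A ⧸ Q.I) (LogForm1.d Q.ι Q.I (Hom.quot f r)) := by
  let := Hom.formsAlgebra f
  rw [pullForm1, LogForm1.lift_d]
  rfl

theorem pullForm1_dlog {P Q : LogDatum.{u} Λ} (f : P ⟶ Q) (y : Additive P.Bˣ) :
    pullForm1 f (LogForm1.dlog P.ι P.I y) =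
      ExteriorAlgebra.ι (Q.A ⧸ Q.I)
        (LogForm1.dlog Q.ι Q.I (Additive.ofMul (Units.map f.ψ y.toMul))) := by
  let := Hom.formsAlgebra f
  rw [pullForm1, LogForm1.lift_dlog]
  rfl

theorem pullForm1_smul {P Q : LogDatum.{u} Λ} (f : P ⟶ Q) (r : P.A ⧸ P.I)
    (x : LogForm1 P.ι P.I) : pullForm1 f (r • x) = Hom.quot f r • pullForm1 f x :=
  letI := Hom.formsAlgebra f
  (map_smul (pullForm1 f) r x).trans (Algebra.smul_def (Hom.quot f r) _).symm

theorem pullForm1_mem {P Q : LogDatum.{u} Λ} (f : P ⟶ Q) (x : LogForm1 P.ι P.I) :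
    pullForm1 f x ∈ LinearMap.range (ExteriorAlgebra.ι (Q.A ⧸ Q.I) (M := LogForm1 Q.ι Q.I)) := by
  let := Hom.formsAlgebra f
  induction x using LogForm1.induction with
  | d r => rw [pullForm1_d]; exact ⟨_, rfl⟩
  | dlog y => rw [pullForm1_dlog]; exact ⟨_, rfl⟩
  | zero => rw [map_zero]; exact zero_mem _
  | add x y hx hy => rw [map_add]; exact add_mem hx hy
  | smul r x hx => rw [pullForm1_smul]; exact Submodule.smul_mem _ _ hx

/-- Restriction of forms. -/
def pull {P Q : LogDatum.{u} Λ} (f : P ⟶ Q) : P.Forms →+* Q.Forms :=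
  letI := Hom.formsAlgebra f
  (ExteriorAlgebra.lift (P.A ⧸ P.I) ⟨pullForm1 f, fun x ↦ by
    obtain ⟨m, hm⟩ := pullForm1_mem f x
    rw [← hm, ExteriorAlgebra.ι_sq_zero]⟩).toRingHom

theorem pull_algebraMap {P Q : LogDatum.{u} Λ} (f : P ⟶ Q) (r : P.A ⧸ P.I) :
    pull f (algebraMap _ _ r) = algebraMap _ _ (Hom.quot f r) :=
  letI := Hom.formsAlgebra f
  AlgHom.commutes (ExteriorAlgebra.lift (P.A ⧸ P.I) ⟨pullForm1 f, _⟩) r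

theorem pull_ι {P Q : LogDatum.{u} Λ} (f : P ⟶ Q) (x : LogForm1 P.ι P.I) :
    pull f (ExteriorAlgebra.ι (P.A ⧸ P.I) x) = pullForm1 f x :=
  letI := Hom.formsAlgebra f
  ExteriorAlgebra.lift_ι_apply ..

theorem pull_smul {P Q : LogDatum.{u} Λ} (f : P ⟶ Q) (r : P.A ⧸ P.I) (x : P.Forms) :
    pull f (r • x) = Hom.quot f r • pull f x := by
  rw [Algebra.smul_def, map_mul, pull_algebraMap, Algebra.smul_def]

theorem forms_hom_ext {P : LogDatum.{u} Λ} {E : Type*} [Ring E] {g h : P.Forms →+* E}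
    (h₁ : ∀ r : P.A ⧸ P.I, g (algebraMap _ P.Forms r) = h (algebraMap _ P.Forms r))
    (h₂ : ∀ r, g (ExteriorAlgebra.ι (P.A ⧸ P.I) (LogForm1.d P.ι P.I r)) =
      h (ExteriorAlgebra.ι (P.A ⧸ P.I) (LogForm1.d P.ι P.I r)))
    (h₃ : ∀ y, g (ExteriorAlgebra.ι (P.A ⧸ P.I) (LogForm1.dlog P.ι P.I y)) =
      h (ExteriorAlgebra.ι (P.A ⧸ P.I) (LogForm1.dlog P.ι P.I y))) (x : P.Forms) : g x = h x := by
  induction x using ExteriorAlgebra.induction with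
  | algebraMap r => exact h₁ r
  | ι n =>
    induction n using LogForm1.induction with
    | d r => exact h₂ r
    | dlog y => exact h₃ y
    | zero => simp
    | add x y hx hy => simp [hx, hy]
    | smul r x hx => rw [map_smul, Algebra.smul_def, map_mul, map_mul, hx, h₁]
  | mul a b ha hb => rw [map_mul, map_mul, ha, hb]
  | add a b ha hb => rw [map_add, map_add, ha, hb]

theorem pull_id {P : LogDatum.{u} Λ} (x : P.Forms) : pull (𝟙 P) x = x := by
  have hq (r : P.A ⧸ P.I) : Hom.quot (𝟙 P) r = r := by
    obtain ⟨r, rfl⟩ := Ideal.Quotient.mk_surjective r; rfl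
  refine forms_hom_ext (h := RingHom.id _) (fun r ↦ ?_) (fun r ↦ ?_) (fun y ↦ ?_) x
  · rw [pull_algebraMap, hq]; rfl
  · rw [pull_ι, pullForm1_d, hq]; rfl
  · rw [pull_ι, pullForm1_dlog]; rfl

theorem pull_comp {P Q S : LogDatum.{u} Λ} (f : P ⟶ Q) (g : Q ⟶ S) (x : P.Forms) :
    pull (f ≫ g) x = pull g (pull f x) := by
  have hq (r : P.A ⧸ P.I) : Hom.quot (f ≫ g) r = Hom.quot g (Hom.quot f r) := by
    obtain ⟨r, rfl⟩ := Ideal.Quotient.mk_surjective r; rfl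
  refine forms_hom_ext (h := (pull g).comp (pull f)) (fun r ↦ ?_) (fun r ↦ ?_) (fun y ↦ ?_) x
  · rw [RingHom.comp_apply, pull_algebraMap, pull_algebraMap, pull_algebraMap, hq]
  · rw [RingHom.comp_apply, pull_ι, pull_ι, pullForm1_d, pullForm1_d, pull_ι, pullForm1_d, hq]
  · rw [RingHom.comp_apply, pull_ι, pull_ι, pullForm1_dlog, pullForm1_dlog, pull_ι,
      pullForm1_dlog]
    rfl

theorem pull_mem {P Q : LogDatum.{u} Λ} (f : P ⟶ Q) {q : ℕ} {x : P.Forms} (hx : x ∈ P.Form q) :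
    pull f x ∈ Q.Form q := by
  change x ∈ LinearMap.range _ ^ q at hx
  induction hx using Submodule.pow_induction_on_left' with
  | algebraMap r =>
    rw [pull_algebraMap]
    change _ ∈ LinearMap.range _ ^ 0
    rw [pow_zero]
    exact Submodule.algebraMap_mem _
  | add x y i _ _ hx hy => rw [map_add]; exact add_mem hx hy
  | mem_mul m hm i x hx ih =>
    obtain ⟨m, rfl⟩ := hm
    rw [map_mul, pull_ι]
    change _ ∈ LinearMap.range _ ^ (i + 1)
    rw [pow_succ']
    exact Submodule.mul_mem_mul (pullForm1_mem f m) ih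

/-- Restriction of `q`-forms. -/
def Form.map {P Q : LogDatum.{u} Λ} (f : P ⟶ Q) (q : ℕ) : P.Form q →+ Q.Form q where
  toFun ω := ⟨pull f ω, pull_mem f ω.2⟩
  map_zero' := Subtype.ext (map_zero _)
  map_add' _ _ := Subtype.ext (map_add _ _ _)

/-- Restriction on `I^{(m)} / I^{(m+l)}`. -/
def Gr.map {P Q : LogDatum.{u} Λ} (f : P ⟶ Q) (m l : Λ →₀ ℕ) : P.Gr m l →+ Q.Gr m l :=
  QuotientAddGroup.map _ _
    { toFun := fun x : P.ideal m ↦ (⟨f.φ x, Hom.map_ideal f m x.2⟩ : Q.ideal m)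
      map_zero' := Subtype.ext (map_zero _)
      map_add' := fun _ _ ↦ Subtype.ext (map_add _ _ _) }
    fun _ hx ↦ Hom.map_ideal f (m + l) hx

/-- Restriction on `I^{(m)} / I^{(m+l)} ⊗_A ω̃^q`. -/
def TwistedForm.map {P Q : LogDatum.{u} Λ} (f : P ⟶ Q) (m l : Λ →₀ ℕ) (q : ℕ) :
    P.TwistedForm m l q →+ Q.TwistedForm m l q :=
  TensorProduct.liftAddHom
    { toFun := fun x ↦ ((TensorProduct.mk Q.A _ _ (Gr.map f m l x)).toAddMonoidHom.comp
        (Form.map f q))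
      map_zero' := by ext; simp
      map_add' := fun x y ↦ by ext; simp }
    fun r x ω ↦ by
      have h₁ : Gr.map f m l (r • x) = f.φ r • Gr.map f m l x := by
        obtain ⟨x, rfl⟩ := Submodule.Quotient.mk_surjective _ x
        refine congrArg (Submodule.Quotient.mk) (Subtype.ext ?_)
        exact map_mul f.φ _ _
      have h₂ : Form.map f q (r • ω) = f.φ r • Form.map f q ω :=
        Subtype.ext (pull_smul f (Ideal.Quotient.mk _ r) ω)
      change Gr.map f m l (r • x) ⊗ₜ[Q.A] _ = _ ⊗ₜ[Q.A] Form.map f q (r • ω)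
      rw [h₁, h₂, TensorProduct.smul_tmul]

theorem TwistedForm.map_tmul {P Q : LogDatum.{u} Λ} (f : P ⟶ Q) (m l : Λ →₀ ℕ) (q : ℕ)
    (x : P.ideal m) (ω : P.Form q) :
    TwistedForm.map f m l q (Submodule.Quotient.mk x ⊗ₜ ω) =
      Submodule.Quotient.mk ⟨f.φ x, Hom.map_ideal f m x.2⟩ ⊗ₜ ⟨pull f ω, pull_mem f ω.2⟩ := rfl

/-- The functor `I^{(m)} / I^{(m+l)} ⊗_A ω̃^q`. -/
def twistedForms (m l : Λ →₀ ℕ) (q : ℕ) : LogDatum.{u} Λ ⥤ AddCommGrpCat.{u} where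
  obj P := AddCommGrpCat.of (P.TwistedForm m l q)
  map f := AddCommGrpCat.ofHom (TwistedForm.map f m l q)
  map_id P := by
    ext x
    change TwistedForm.map (𝟙 P) m l q x = x
    induction x using TensorProduct.induction_on with
    | zero => exact map_zero _
    | tmul x ω =>
      obtain ⟨x, rfl⟩ := Submodule.Quotient.mk_surjective _ x
      rw [TwistedForm.map_tmul]
      exact congrArg _ (Subtype.ext (pull_id _))
    | add x y hx hy => rw [map_add, hx, hy]
  map_comp {P Q S} f g := by
    ext x
    change TwistedForm.map (f ≫ g) m l q x = TwistedForm.map g m l q (TwistedForm.map f m l q x)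
    induction x using TensorProduct.induction_on with
    | zero => simp only [map_zero]
    | tmul x ω =>
      obtain ⟨x, rfl⟩ := Submodule.Quotient.mk_surjective _ x
      rw [TwistedForm.map_tmul, TwistedForm.map_tmul, TwistedForm.map_tmul]
      exact congrArg _ (Subtype.ext (pull_comp _ _ _))
    | add x y hx hy => simp only [map_add, hx, hy]

section

variable (P : LogDatum.{u} Λ)

theorem prod_mem_ideal {π : Λ → P.A} (h : ∀ i, π i ∈ P.comp i) (m : Λ →₀ ℕ) :
    (m.prod fun i n ↦ π i ^ n) ∈ P.ideal m :=
  Ideal.prod_mem_prod fun i _ ↦ Ideal.pow_mem_pow (h i) _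

theorem pow_mem_ideal {m m' : Λ →₀ ℕ} {p : ℕ} (h : m ≤ p • m') {x : P.A} (hx : x ∈ P.ideal m') :
    x ^ p ∈ P.ideal m := by
  refine P.ideal_anti h ?_
  have e : P.ideal (p • m') = P.ideal m' ^ p := by
    rcases p.eq_zero_or_pos with rfl | hp
    · simp [ideal]
    · rw [ideal, Finsupp.prod, Finsupp.support_smul_eq hp.ne', ideal, Finsupp.prod,
        ← Finset.prod_pow]
      simp [mul_comm p, pow_mul]
  rw [e]
  exact Ideal.pow_mem_pow hx p

/-- The element `x ⊗ ω`, for `x ∈ I^{(m)}`. -/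
def tmul {m l : Λ →₀ ℕ} {q : ℕ} {x : P.A} (hx : x ∈ P.ideal m) (ω : P.Form q) :
    P.TwistedForm m l q :=
  Submodule.Quotient.mk ⟨x, hx⟩ ⊗ₜ[P.A] ω

/-- A choice of a uniformizer `π i` (a generator of `I_i`) for each component, together with the
unit of `B` that it induces (`π i` is invertible on the complement of `Y`). -/
structure Uniformizers where
  π : Λ → P.A
  unit : Λ → P.Bˣ
  ι_π : ∀ i, P.ι (π i) = unit i
  span_π : ∀ i, P.comp i = Ideal.span {π i}

variable {P} in
theorem Uniformizers.prod_mem (t : P.Uniformizers) (m : Λ →₀ ℕ) :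
    (m.prod fun i n ↦ t.π i ^ n) ∈ P.ideal m :=
  P.prod_mem_ideal (fun i ↦ t.span_π i ▸ Ideal.mem_span_singleton_self _) m

variable {P} in
/-- The form `dω + ∑ m_i dlog(π_i) ∧ ω`. -/
def Uniformizers.twistedD (t : P.Uniformizers) (m : Λ →₀ ℕ) {q : ℕ} (ω : P.Form q) :
    P.Form (q + 1) :=
  LogForm.d P.ι P.I q ω + m.sum fun i n ↦ n • LogForm.dlogMul P.ι P.I (t.unit i) ω

end

end LogDatum

end Functoriality

/-! ### The ring-theoretic data on the small affine étale site of `X` -/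

section Site

variable {X : Scheme.{u}} {Λ : Type v}

/-- The ring of an affine scheme étale over `X`. -/
abbrev ringOf (U : X.AffineEtale) : CommRingCat.{u} := U.left.unop

/-- Its structure morphism. -/
abbrev specHom (U : X.AffineEtale) : Spec (ringOf U) ⟶ X := U.hom

/-- The data on `U → X` étale with `U = Spec A`: the ring `A`, the ring of functions on the
preimage of the open `W`, and the ideals of functions vanishing on the preimages of `Z` and of
the `comp i`. As `U → X` is étale, the latter are the pullbacks to `U` of the radical ideal sheaves
of these closed subsets of `X`. -/
def datumObj (W : X.Opens) (Z : Set X) (comp : Λ → Set X) (U : X.AffineEtale) : LogDatum.{u} Λ where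
  A := ringOf U
  B := Γ(Spec (ringOf U), specHom U ⁻¹ᵁ W)
  ι := ((Scheme.ΓSpecIso (ringOf U)).inv ≫
    (Spec (ringOf U)).presheaf.map (homOfLE le_top : specHom U ⁻¹ᵁ W ⟶ ⊤).op).hom
  I := PrimeSpectrum.vanishingIdeal (specHom U ⁻¹' Z)
  comp i := PrimeSpectrum.vanishingIdeal (specHom U ⁻¹' comp i)

/-- The ring homomorphism of a morphism of the site. -/
def ringHomOf {U V : X.AffineEtale} (h : U ⟶ V) : ringOf V ⟶ ringOf U := h.left.unop

theorem ringHomOf_w {U V : X.AffineEtale} (h : U ⟶ V) :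
    Spec.map (ringHomOf h) ≫ specHom V = specHom U := by
  exact CostructuredArrow.w h.hom

theorem vanishing_le (S : Set X) {U V : X.AffineEtale} (h : U ⟶ V) :
    PrimeSpectrum.vanishingIdeal (specHom V ⁻¹' S) ≤
      (PrimeSpectrum.vanishingIdeal (specHom U ⁻¹' S)).comap (ringHomOf h).hom := by
  intro a ha
  rw [Ideal.mem_comap, PrimeSpectrum.mem_vanishingIdeal]
  intro x hx
  rw [PrimeSpectrum.mem_vanishingIdeal] at ha
  refine ha (Spec.map (ringHomOf h) x) ?_
  have (x : Spec (ringOf U)) : specHom V (Spec.map (ringHomOf h) x) = specHom U x := by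
    rw [← Scheme.Hom.comp_apply, ringHomOf_w]
  exact (congrArg (· ∈ S) (this x)).mpr hx

theorem toSections_comm (W : X.Opens) {U V : X.AffineEtale} (h : U ⟶ V) :
    ((Scheme.ΓSpecIso (ringOf V)).inv ≫
      (Spec (ringOf V)).presheaf.map (homOfLE le_top : specHom V ⁻¹ᵁ W ⟶ ⊤).op) ≫
      (Spec.map (ringHomOf h)).appLE (specHom V ⁻¹ᵁ W) (specHom U ⁻¹ᵁ W)
        (by rw [← Scheme.Hom.comp_preimage, ringHomOf_w]) =
    ringHomOf h ≫ ((Scheme.ΓSpecIso (ringOf U)).inv ≫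
      (Spec (ringOf U)).presheaf.map (homOfLE le_top : specHom U ⁻¹ᵁ W ⟶ ⊤).op) := by
  rw [Category.assoc, Scheme.Hom.map_appLE, Scheme.ΓSpecIso_inv_naturality_assoc]
  rfl

/-- Restriction maps. -/
def datumMap (W : X.Opens) (Z : Set X) (comp : Λ → Set X) {U V : X.AffineEtale} (h : U ⟶ V) :
    datumObj W Z comp V ⟶ datumObj W Z comp U where
  φ := (ringHomOf h).hom
  ψ := ((Spec.map (ringHomOf h)).appLE (specHom V ⁻¹ᵁ W) (specHom U ⁻¹ᵁ W)
    (by rw [← Scheme.Hom.comp_preimage, ringHomOf_w])).hom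
  comm a := congr($(toSections_comm W h).hom a)
  map_I := vanishing_le Z h
  map_comp i := vanishing_le (comp i) h

theorem appLE_of_eq_id {R : CommRingCat.{u}} {a : R ⟶ R} (ha : a = 𝟙 R) (V : (Spec R).Opens)
    (e : V ≤ Spec.map a ⁻¹ᵁ V) : (Spec.map a).appLE V V e = 𝟙 _ := by
  subst ha
  have (g : Spec R ⟶ Spec R) (hg : g = 𝟙 _) (e : V ≤ g ⁻¹ᵁ V) : g.appLE V V e = 𝟙 _ := by
    subst hg
    simp only [Scheme.Hom.appLE, Scheme.Hom.id_app]
    exact (Spec R).presheaf.map_id _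
  exact this _ (Spec.map_id R) e

theorem appLE_of_eq_comp {R S T : CommRingCat.{u}} {a : R ⟶ S} {b : S ⟶ T} {c : R ⟶ T}
    (hc : c = a ≫ b) (V₁ : (Spec R).Opens) (V₂ : (Spec S).Opens) (V₃ : (Spec T).Opens)
    (ea : V₂ ≤ Spec.map a ⁻¹ᵁ V₁) (eb : V₃ ≤ Spec.map b ⁻¹ᵁ V₂) (ec : V₃ ≤ Spec.map c ⁻¹ᵁ V₁) :
    (Spec.map c).appLE V₁ V₃ ec = (Spec.map a).appLE V₁ V₂ ea ≫ (Spec.map b).appLE V₂ V₃ eb := by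
  rw [Scheme.Hom.appLE_comp_appLE]
  have (g : Spec T ⟶ Spec R) (hg : g = Spec.map c) (e : V₃ ≤ g ⁻¹ᵁ V₁) :
      g.appLE V₁ V₃ e = (Spec.map c).appLE V₁ V₃ ec := by
    subst hg; rfl
  exact (this _ (by rw [hc, Spec.map_comp]) _).symm

/-- The data as a presheaf on the small affine étale site. -/
def datum (W : X.Opens) (Z : Set X) (comp : Λ → Set X) : (X.AffineEtale)ᵒᵖ ⥤ LogDatum.{u} Λ where
  obj U := datumObj W Z comp U.unop
  map h := datumMap W Z comp h.unop
  map_id U := LogDatum.Hom.ext rfl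
    (congrArg CommRingCat.Hom.hom (appLE_of_eq_id (a := ringHomOf (𝟙 U.unop)) rfl _ _))
  map_comp f g := LogDatum.Hom.ext rfl
    (congrArg CommRingCat.Hom.hom (appLE_of_eq_comp (a := ringHomOf f.unop)
      (b := ringHomOf g.unop) (c := ringHomOf (g.unop ≫ f.unop)) rfl _ _ _ _ _ _))

end Site

/-! ### The étale sheaves `ω^q_{m,l}` and the complex they form -/

section Sheaves

variable {X : Scheme.{u}} {Λ : Type v}

variable (X) in
/-- Sheaves of abelian groups on the small affine étale site of `X`. (By
`Scheme.AffineEtale.sheafEquiv` they are the same as abelian sheaves on the small étale site.) -/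
abbrev EtaleAbSheaf : Type (u + 1) :=
  Sheaf (Scheme.AffineEtale.topology X) AddCommGrpCat.{u}

variable (P : (X.AffineEtale)ᵒᵖ ⥤ LogDatum.{u} Λ) (m l : Λ →₀ ℕ)

/-- The étale sheaf `ω^q_{m,l} = I^{(m)} / I^{(m+l)} ⊗_{𝒪_X} ω̃^q`, as the sheafification of
`U ↦ I^{(m)}(U) / I^{(m+l)}(U) ⊗ ω̃^q(U)`. -/
def omega (q : ℕ) : EtaleAbSheaf X :=
  (presheafToSheaf (Scheme.AffineEtale.topology X) AddCommGrpCat.{u}).obj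
    (P ⋙ LogDatum.twistedForms m l q)

/-- The section of `ω^q_{m,l}` over `U` given by an element of
`I^{(m)}(U) / I^{(m+l)}(U) ⊗ ω̃^q(U)`. -/
def toOmega (q : ℕ) (U : X.AffineEtale) :
    (P.obj (op U)).TwistedForm m l q →+ (omega P m l q).obj.obj (op U) :=
  ((toSheafify (Scheme.AffineEtale.topology X)
    (P ⋙ LogDatum.twistedForms m l q)).app (op U)).hom

/-- A differential on `ω^•_{m,l}` given by the local assignment
`∏ π_i^{m_i} ⊗ ω ↦ ∏ π_i^{m_i} ⊗ (dω + ∑ m_i dlog(π_i) ∧ ω)`, where the `π_i` are arbitrary local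
uniformizers of the components. -/
@[ext]
structure TwistedDifferential where
  d (q : ℕ) : omega P m l q ⟶ omega P m l (q + 1)
  d_comp_d (q : ℕ) : d q ≫ d (q + 1) = 0
  d_tmul (U : X.AffineEtale) (t : (P.obj (op U)).Uniformizers) (q : ℕ)
    (ω : (P.obj (op U)).Form q) :
    (d q).hom.app (op U) (toOmega P m l q U ((P.obj (op U)).tmul (t.prod_mem m) ω)) =
      toOmega P m l (q + 1) U ((P.obj (op U)).tmul (t.prod_mem m) (t.twistedD m ω))

variable {P m l}

/-- The complex of étale sheaves `ω^•_{m,l}`. -/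
def TwistedDifferential.complex (δ : TwistedDifferential P m l) :
    CochainComplex (EtaleAbSheaf X) ℕ :=
  CochainComplex.of (omega P m l) δ.d δ.d_comp_d

/-- The map `C` from `ω^q_{m',l'}` to the cohomology sheaf `H^q(ω^•_{m,l})` is given by
`x ⊗ ω ↦ x^p ⊗ ω` for sections `x` of `I^{(m')}` and logarithmic forms `ω`: the section
`x^p ⊗ ω` of `ω^q_{m,l}` is a cocycle `z`, and `C` sends `x ⊗ ω` to the class of `z`. -/
def IsInverseCartier (δ : TwistedDifferential P m l) {p : ℕ} {m' : Λ →₀ ℕ} (h : m ≤ p • m')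
    (l' : Λ →₀ ℕ) (q : ℕ) (C : omega P m' l' q ⟶ δ.complex.homology q) : Prop :=
  ∀ (U : X.AffineEtale) (x : (P.obj (op U)).A) (hx : x ∈ (P.obj (op U)).ideal m')
    (ω : (P.obj (op U)).Form q),
    ω ∈ LogForm.logSubgroup (P.obj (op U)).ι (P.obj (op U)).I q →
    ∃ z : (δ.complex.cycles q).obj.obj (op U),
      (δ.complex.iCycles q).hom.app (op U) z =
        toOmega P m l q U ((P.obj (op U)).tmul ((P.obj (op U)).pow_mem_ideal h hx) ω) ∧
      C.hom.app (op U) (toOmega P m' l' q U ((P.obj (op U)).tmul hx ω)) =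
        (δ.complex.homologyπ q).hom.app (op U) z

end Sheaves

/-! ### Normal crossings -/

section NormalCrossings

/-- A closed subset `Z` of a scheme `X`, with its reduced structure, is a divisor with normal
crossings: around each point of `Z` there is an étale neighbourhood `Spec R → X` with a
regular system of parameters `t` at a point `w` over it, such that the ideal of `Z` is generated
by the product of some of the `t i`. -/
def IsNormalCrossingDivisor {X : Scheme.{u}} (Z : Set X) : Prop :=
  ∀ x ∈ Z, ∃ (R : CommRingCat.{u}) (g : Spec R ⟶ X) (w : PrimeSpectrum R) (n : ℕ) (t : Fin n → R)
    (S : Finset (Fin n)),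
    Etale g ∧ g w = x ∧
    IsRegularLocalRing (Localization.AtPrime w.asIdeal) ∧
    ringKrullDim (Localization.AtPrime w.asIdeal) = n ∧
    Ideal.span (Set.range fun i ↦ algebraMap R (Localization.AtPrime w.asIdeal) (t i)) =
      IsLocalRing.maximalIdeal (Localization.AtPrime w.asIdeal) ∧
    PrimeSpectrum.vanishingIdeal (g ⁻¹' Z) = Ideal.span {∏ i ∈ S, t i}

variable (k : Type u) [Field k]

/-- The ring `k[T_1, …, T_n] / (T_1 ⋯ T_a)`. -/
abbrev NCModel (n a : ℕ) : Type u :=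
  MvPolynomial (Fin n) k ⧸ Ideal.span {∏ i : Fin n with i.val < a, MvPolynomial.X (R := k) i}

/-- The element `T_{a+1} ⋯ T_{a+b}` of `k[T_1, …, T_n] / (T_1 ⋯ T_a)`. -/
def ncModelDivisor (n a b : ℕ) : NCModel k n a :=
  Ideal.Quotient.mk _ (∏ i : Fin n with a ≤ i.val ∧ i.val < a + b, MvPolynomial.X i)

/-- The structure morphism of `Spec (k[T_1, …, T_n] / (T_1 ⋯ T_a))`. -/
def ncModelHom (n a : ℕ) : Spec (.of (NCModel k n a)) ⟶ Spec (.of k) :=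
  Spec.map (CommRingCat.ofHom (algebraMap k (NCModel k n a)))

variable {k} {Y : Scheme.{u}} (h : Y ⟶ Spec (.of k))

/-- `Y` is a normal crossing variety over `k`, pure of dimension `n - 1`: it is separated of finite
type and étale locally isomorphic to `Spec (k[T_1, …, T_n] / (T_1 ⋯ T_a))` with `1 ≤ a ≤ n`.
(The models are pure of dimension `n - 1`, hence so is `Y`.) -/
def IsNormalCrossingVariety (n : ℕ) : Prop :=
  IsSeparated h ∧ LocallyOfFiniteType h ∧ QuasiCompact h ∧
  ∀ y : Y, ∃ a : ℕ, 1 ≤ a ∧ a ≤ n ∧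
    ∃ (V : Scheme.{u}) (g : V ⟶ Y) (e : V ⟶ Spec (.of (NCModel k n a))),
      Etale g ∧ Etale e ∧ g ≫ h = e ≫ ncModelHom k n a ∧ y ∈ Set.range g

/-- The closed subset `E` of the normal crossing variety `Y`, with its reduced structure, is an
admissible divisor: étale locally around each of its points, `E ⊂ Y` is isomorphic to the zero
locus of `T_{a+1} ⋯ T_{a+b}` in `Spec (k[T_1, …, T_n] / (T_1 ⋯ T_a))` with `a, b ≥ 1` and
`a + b ≤ n`. -/
def IsAdmissibleDivisor (n : ℕ) (E : Set Y) : Prop :=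
  ∀ y ∈ E, ∃ a b : ℕ, 1 ≤ a ∧ 1 ≤ b ∧ a + b ≤ n ∧
    ∃ (V : Scheme.{u}) (g : V ⟶ Y) (e : V ⟶ Spec (.of (NCModel k n a))),
      Etale g ∧ Etale e ∧ g ≫ h = e ≫ ncModelHom k n a ∧ y ∈ Set.range g ∧
      g ⁻¹' E = {v | ncModelDivisor k n a b ∈ (e v).asIdeal}

end NormalCrossings

/-! ### The geometric setting -/

section Setting

variable {O : Type u} [CommRing O] [IsLocalRing O] {X : Scheme.{u}} (f : X ⟶ Spec (.of O))

/-- The closed fibre `X ×_B s`. -/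
abbrev closedFibre : Scheme.{u} :=
  pullback f (Spec.map (CommRingCat.ofHom (IsLocalRing.residue O)))

/-- The reduced closed fibre `Y = (X ×_B s)_red`. -/
abbrev reducedFibre : Scheme.{u} := (closedFibre f).nilradical.subscheme

/-- The closed immersion `Y → X`. -/
def reducedFibreι : reducedFibre f ⟶ X :=
  (closedFibre f).nilradical.subschemeι ≫
    pullback.fst f (Spec.map (CommRingCat.ofHom (IsLocalRing.residue O)))

/-- The structure morphism of `Y` over the residue field. -/
def reducedFibreHom : reducedFibre f ⟶ Spec (.of (IsLocalRing.ResidueField O)) :=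
  (closedFibre f).nilradical.subschemeι ≫
    pullback.snd f (Spec.map (CommRingCat.ofHom (IsLocalRing.residue O)))

theorem isClosed_range_reducedFibreι : IsClosed (Set.range (reducedFibreι f)) := by
  have : IsClosedImmersion (Spec.map (CommRingCat.ofHom (IsLocalRing.residue O))) :=
    IsClosedImmersion.spec_of_surjective _ IsLocalRing.residue_surjective
  have : IsClosedImmersion (reducedFibreι f) := by
    unfold reducedFibreι
    infer_instance
  exact (reducedFibreι f).isClosedEmbedding.isClosed_range

/-- The standing assumptions on `f : X → B = Spec O` and the divisor `D`, a closed subset of `X`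
with its reduced structure: `X` is regular of finite type over `B`, `D` is flat over `B`, `Y ∪ D`
has normal crossings on `X`, the reduced closed fibre `Y` is a normal crossing variety over the
residue field, and `(D ×_B s)_red` is an admissible divisor on `Y`. -/
structure IsNormalCrossingSetting (D : Closeds X) : Prop where
  locallyOfFiniteType : LocallyOfFiniteType f
  quasiCompact : QuasiCompact f
  regular (x : X) : IsRegularLocalRing (X.presheaf.stalk x)
  flat : Flat ((Scheme.IdealSheafData.vanishingIdeal D).subschemeι ≫ f)
  normalCrossing : IsNormalCrossingDivisor (Set.range (reducedFibreι f) ∪ (D : Set X))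
  exists_dim : ∃ n : ℕ, IsNormalCrossingVariety (reducedFibreHom f) n ∧
    IsAdmissibleDivisor (reducedFibreHom f) n (reducedFibreι f ⁻¹' (D : Set X))

/-- The open subset `U = X \ (Y ∪ D)`. -/
def boundaryCompl (D : Closeds X) : X.Opens :=
  ⟨(Set.range (reducedFibreι f) ∪ (D : Set X))ᶜ,
    ((isClosed_range_reducedFibreι f).union D.isClosed).isOpen_compl⟩

/-- The index set of the irreducible components `Y_i` of `Y`. (It is finite, so finitely supported
functions on it are the same as all functions.) -/
abbrev FibreComponents : Type u := irreducibleComponents (reducedFibre f)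

/-- The ring-theoretic data attached to `X`, `Y`, `D` and the components `Y_i`, on the small affine
étale site of `X`. Étale sheaves on `Y` are regarded as sheaves on `X` supported on `Y`. -/
def fibreDatum (D : Closeds X) : (X.AffineEtale)ᵒᵖ ⥤ LogDatum.{u} (FibreComponents f) :=
  datum (boundaryCompl f D) (Set.range (reducedFibreι f))
    fun i : FibreComponents f ↦ reducedFibreι f '' i.1

end Setting

end

end KatoCartier

/-!
The proof is a computation in local coordinates that is then glued over the étale site.

*Charts.* Étale locally on `X`, the ring `A/I` of functions on `Y` contains elements `x_s` with
the following properties (`LogCoordinates`, `CartierChart`). Their logarithmic differentials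
`e_s = dlog x_s` form a basis of `ω̃¹`; the monomials `x^α` with exponents in `[0, p - 1]`
generate `A/I` over its `p`-th powers, and the relations among them are only those forced by the
fact that the product of the equations of the branches of `Y` is zero; the uniformizers of the
components are, on `Y`, squarefree monomials in the `x_s`.

*The local computation.* Let `G` be the ring endomorphism of `ω̃^•` that is the Frobenius on
functions and fixes every `e_s` (`LogCoordinates.frobLift`). Each form is a sum `∑_α x^α G(η_α)`
(`LogCoordinates.formExpand`). In terms of a generator `π^m` of `I^{(m)}` the differential becomes
`ω ↦ dω + ∑ m_i dlog π_i ∧ ω`, and it maps `x^α G(η)` to `x^α G(θ_α ∧ η)`, where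
`θ_α = ∑_s (α_s + m_s) e_s` (`LogCoordinates.twistedExtD_formExpand`). If a coefficient of `θ_α`
is nonzero modulo `p`, contraction with the dual vector is a homotopy that kills the `α`-part; if
all of them vanish, then `α = -m` modulo `p`, and the differential is zero on that part. Hence
`η ↦ π^{p m' - m} G(η)` induces a bijection onto the cohomology. Modulo `π^l` with `l ≤ 1` the
same argument applies: by the relations, `η_α` matters only modulo the product of those `x_s`
dividing `π^l` for which `α_s = 0`. For `α = -m` these are the coordinates of the components with
`p ∣ m_i`, and their product is `π^{l'}` (`CartierChart.exists_of_differential_eq_zero`,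
`CartierChart.eq_zero_of_cartier_mem`).

*Gluing.* The map `G` depends on the chart, but its class modulo exact forms does not: `G(da)` is
`a^{p-1} da` and `G(dlog y)` is `dlog y` up to exact forms (`pull_frobLift`). So the local maps
agree in cohomology, and they define a morphism of sheaves with the prescribed values on
logarithmic forms (`exists_inverseCartier`). The differential itself is given by the same formula
in every chart.

*Existence of charts* (`IsNormalCrossingSetting.locally_hasChart`). Every field of characteristic
`p` has a `p`-basis, polynomial rings over it inherit one together with the variables, and so do
étale algebras, because the relative Frobenius of an étale algebra is an isomorphism
(`IsPBasis.of_etale`). Dividing by the product of some of the variables gives the monomial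
coordinates on `Y`. On the other hand `Y ∪ D` is cut out on the regular scheme `X` by a product of
members of a regular system of parameters. Both systems define the same branches of `Y` and of
`D ∩ Y` at a point, so they agree up to units there (`exists_local_matching`); the flatness of `D`
ensures that the branches not contained in `Y` are those of `D`. These relations extend to a
neighbourhood (`exists_hasChart_away`). Then the coordinates at the boundary lift to primes `t_s`
of `A`, every unit of `A[1/∏ t_s]` is a unit of `A` times a monomial in the `t_s`, and the
derivations `x_s ∂/∂x_s` extend to `ω̃¹` as functionals dual to the `e_s`.

If `p ∤ m_μ` and `l = δ_μ`, then `l' = 0`, so the source of the isomorphism is zero and the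
complex is acyclic (`acyclic_of_not_dvd`).
-/

namespace KatoCartier

noncomputable section

set_option linter.unusedSectionVars false

set_option maxHeartbeats 2000000

/-! ### Frobenius and `p`-bases -/

section Frobenius

variable (p : ℕ) [Fact p.Prime] (R : Type*) [CommRing R] [Fact ((p : R) = 0)]

/-- The Frobenius endomorphism of a ring in which `p = 0`; the zero ring is allowed. -/
def frob : R →+* R where
  toFun a := a ^ p
  map_one' := one_pow _
  map_mul' a b := mul_pow a b p
  map_zero' := zero_pow (Fact.out : p.Prime).ne_zero
  map_add' a b := by
    obtain ⟨r, hr⟩ := exists_add_pow_prime_eq (Fact.out : p.Prime) a b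
    rw [hr, (Fact.out : (p : R) = 0)]
    ring

variable {R}

@[simp] theorem frob_apply (a : R) : frob p R a = a ^ p := rfl

end Frobenius

section Monomials

variable (p : ℕ) [Fact p.Prime] {R : Type*} [CommRing R] {σ : Type*} (x : σ → R)

/-- The monomial `∏ x_s ^ α_s`, with the exponents `α_s ∈ ℤ/p` represented in `[0, p - 1]`. -/
def mon (α : σ →₀ ZMod p) : R := α.prod fun s a ↦ x s ^ a.val

variable {p}

@[simp] theorem mon_zero : mon p x 0 = 1 := Finsupp.prod_zero_index

theorem mon_eq_prod (α : σ →₀ ZMod p) {F : Finset σ} (h : α.support ⊆ F) :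
    mon p x α = ∏ s ∈ F, x s ^ (α s).val :=
  Finsupp.prod_of_support_subset _ h _ fun s _ ↦ by rw [ZMod.val_zero, pow_zero]

theorem map_mon {R' : Type*} [CommRing R'] (f : R →+* R') (α : σ →₀ ZMod p) :
    f (mon p x α) = mon p (fun s ↦ f (x s)) α := by
  simp [mon, Finsupp.prod]

theorem exists_mon_mul_mon (α β : σ →₀ ZMod p) :
    ∃ z, mon p x α * mon p x β = mon p x (α + β) * z ^ p := by
  classical
  let F := α.support ∪ β.support
  have hk (a b : ZMod p) : ∃ k, a.val + b.val = (a + b).val + k * p := by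
    refine ⟨(a.val + b.val) / p, ?_⟩
    rw [ZMod.val_add, Nat.mod_add_div']
  choose k hk using hk
  refine ⟨∏ s ∈ F, x s ^ k (α s) (β s), ?_⟩
  rw [mon_eq_prod x α (F := F) Finset.subset_union_left,
    mon_eq_prod x β (F := F) Finset.subset_union_right,
    mon_eq_prod x (α + β) (F := F) Finsupp.support_add, ← Finset.prod_mul_distrib,
    ← Finset.prod_pow, ← Finset.prod_mul_distrib]
  refine Finset.prod_congr rfl fun s _ ↦ ?_
  rw [← pow_add, hk, pow_add, pow_mul, Finsupp.add_apply]

/-- The exponent vector of the squarefree monomial `∏_{s ∈ L} x_s`. -/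
def expInd (p : ℕ) (L : Finset σ) : σ →₀ ZMod p :=
  Finsupp.indicator L fun _ _ ↦ 1

open Classical in
theorem expInd_apply (L : Finset σ) (s : σ) : expInd p L s = if s ∈ L then 1 else 0 := by
  simp [expInd, Finsupp.indicator_apply]

open Classical in
/-- Multiplying a reduced monomial by a squarefree one: the exponents that reach `p` are carried
over into a `p`-th power. -/
theorem prod_mul_mon (L : Finset σ) (β : σ →₀ ZMod p) :
    (∏ s ∈ L, x s) * mon p x β =
      mon p x (β + expInd p L) * (∏ s ∈ L with (β + expInd p L) s = 0, x s) ^ p := by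
  have hp := (Fact.out : p.Prime)
  let F := β.support ∪ L
  have h1 : (β + expInd p L).support ⊆ F := by
    intro s hs
    rw [Finsupp.mem_support_iff, Finsupp.add_apply, expInd_apply] at hs
    by_contra h
    simp only [F, Finset.mem_union, Finsupp.mem_support_iff, not_or, not_not] at h
    simp [h] at hs
  have h2 : (∏ s ∈ L, x s) = ∏ s ∈ F, if s ∈ L then x s else 1 := by
    rw [Finset.prod_ite_mem, Finset.inter_eq_right.2 Finset.subset_union_right]
  have h3 : (∏ s ∈ L with (β + expInd p L) s = 0, x s) =
      ∏ s ∈ F, if s ∈ L ∧ (β + expInd p L) s = 0 then x s else 1 := by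
    rw [← Finset.prod_filter]
    congr 1
    ext s
    simp only [Finset.mem_filter, F, Finset.mem_union]
    tauto
  rw [h2, h3, mon_eq_prod x β (F := F) Finset.subset_union_left, mon_eq_prod x _ h1,
    ← Finset.prod_pow, ← Finset.prod_mul_distrib, ← Finset.prod_mul_distrib]
  refine Finset.prod_congr rfl fun s _ ↦ ?_
  rw [Finsupp.add_apply, expInd_apply]
  by_cases hs : s ∈ L
  · simp only [hs, if_true, true_and]
    have : Fact (1 < p) := ⟨hp.one_lt⟩
    by_cases h0 : β s + 1 = 0
    · have : (β s).val + 1 = p := by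
        have h4 : β s = -1 := eq_neg_of_add_eq_zero_left h0
        obtain ⟨n, rfl⟩ := Nat.exists_eq_succ_of_ne_zero hp.ne_zero
        rw [h4, ZMod.val_neg_one]
      rw [if_pos h0, h0, ZMod.val_zero, pow_zero, one_mul, ← pow_succ', this]
    · have : (β s + 1).val = (β s).val + 1 := by
        have h4 := ZMod.val_add (β s) 1
        rw [ZMod.val_one] at h4
        rw [h4]
        refine Nat.mod_eq_of_lt (lt_of_le_of_ne (ZMod.val_lt _) fun h5 ↦ h0 ?_)
        rw [← ZMod.val_eq_zero, h4, h5, Nat.mod_self]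
      rw [if_neg h0, one_pow, mul_one, ← pow_succ', this]
  · simp [hs]

end Monomials

section PBasis

variable (p : ℕ) [Fact p.Prime] {R : Type*} [CommRing R] [Fact ((p : R) = 0)] {σ : Type*}

/-- The additive map `(c_α)_α ↦ ∑ x^α c_α^p`, where `α` runs through the exponents with entries
in `[0, p - 1]`. -/
def pExpand (x : σ → R) : ((σ →₀ ZMod p) →₀ R) →+ R :=
  Finsupp.liftAddHom fun α ↦ (AddMonoidHom.mulLeft (mon p x α)).comp (frob p R).toAddMonoidHom

@[simp] theorem pExpand_single (x : σ → R) (α : σ →₀ ZMod p) (c : R) :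
    pExpand p x (Finsupp.single α c) = mon p x α * c ^ p := by
  rw [pExpand, Finsupp.liftAddHom_apply_single]
  rfl

/-- The family `x` is a `p`-basis of `R`: the monomials with exponents in `[0, p - 1]` form a basis
of `R` as a module over itself through Frobenius. -/
def IsPBasis (x : σ → R) : Prop := Function.Bijective (pExpand p x)

variable {p}

theorem pExpand_map {R' : Type*} [CommRing R'] [Fact ((p : R') = 0)] (f : R →+* R') (x : σ → R)
    (c : (σ →₀ ZMod p) →₀ R) :
    f (pExpand p x c) = pExpand p (fun s ↦ f (x s)) (c.mapRange f (map_zero f)) := by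
  induction c using Finsupp.induction_linear with
  | zero => simp
  | add c d hc hd => rw [map_add, map_add, hc, hd, ← map_add, ← Finsupp.mapRange_add (map_add f)]
  | single α c => simp [map_mon]

theorem IsPBasis.map_ringEquiv {R' : Type*} [CommRing R'] [Fact ((p : R') = 0)] (f : R ≃+* R')
    {x : σ → R} (h : IsPBasis p x) : IsPBasis p (fun s ↦ f (x s)) := by
  have e : ⇑(pExpand p (fun s ↦ f (x s))) =
      f ∘ pExpand p x ∘ Finsupp.mapRange f.symm (map_zero _) := by
    ext c
    have := pExpand_map (p := p) (f : R →+* R') x (c.mapRange f.symm (map_zero _))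
    simp only [Function.comp_apply]
    refine Eq.trans ?_ this.symm
    congr 1
    ext; simp
  rw [IsPBasis, e]
  refine f.bijective.comp (h.comp ?_)
  exact (Finsupp.mapRange.addEquiv f.symm.toAddEquiv).bijective

theorem pExpand_mapDomain {τ : Type*} {j : τ → σ} (hj : Function.Injective j) (x : σ → R)
    (c : (τ →₀ ZMod p) →₀ R) :
    pExpand p x (c.mapDomain (Finsupp.mapDomain j)) = pExpand p (fun s ↦ x (j s)) c := by
  induction c using Finsupp.induction_linear with
  | zero => simp
  | add c d hc hd => rw [Finsupp.mapDomain_add, map_add, hc, hd, map_add]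
  | single α c =>
    rw [Finsupp.mapDomain_single, pExpand_single, pExpand_single, mon,
      Finsupp.prod_mapDomain_index_inj hj]
    rfl

end PBasis

/-! ### Étale algebras inherit `p`-bases -/

section Etale

variable (p : ℕ) [Fact p.Prime]

/-- The ring `R`, regarded as an algebra over itself through Frobenius. -/
def FrobTwist (_ : ℕ) (R : Type*) : Type _ := R

variable (R R' : Type*) [CommRing R] [CommRing R'] [Fact ((p : R') = 0)] [Algebra R R']

instance : CommRing (FrobTwist p R) := inferInstanceAs (CommRing R)

instance : Algebra R (FrobTwist p R') :=
  ((frob p R').comp (algebraMap R R')).toAlgebra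

/-- The identity map from `R` to its Frobenius twist. -/
def FrobTwist.equiv : R ≃+* FrobTwist p R := RingEquiv.refl R

theorem FrobTwist.smul_equiv [Fact ((p : R) = 0)] (r a : R) :
    r • FrobTwist.equiv p R a = FrobTwist.equiv p R (r ^ p * a) := rfl

instance : Algebra (FrobTwist p R) (FrobTwist p R') := inferInstanceAs (Algebra R R')

instance [Fact ((p : R) = 0)] : IsScalarTower R (FrobTwist p R) (FrobTwist p R') :=
  .of_algebraMap_eq fun r ↦ (map_pow (algebraMap R R') r p).symm

variable [Fact ((p : R) = 0)]

/-- The relative Frobenius `b ⊗ a ↦ b a ^ p`. -/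
def relFrob : FrobTwist p R ⊗[R] R' →ₐ[FrobTwist p R] FrobTwist p R' :=
  Algebra.TensorProduct.lift (Algebra.ofId _ _)
    (A := FrobTwist p R) (B := R') (C := FrobTwist p R')
    { toRingHom := frob p R'
      commutes' := fun _ ↦ rfl } fun _ _ ↦ Commute.all _ _

theorem relFrob_tmul (b : R) (a : R') :
    relFrob p R R' ((show FrobTwist p R from b) ⊗ₜ a) = (algebraMap R R' b * a ^ p : R') :=
  Algebra.TensorProduct.lift_tmul ..

instance : Fact ((p : FrobTwist p R ⊗[R] R') = 0) := ⟨by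
  have h : ((p : FrobTwist p R) = 0) := (Fact.out : (p : R) = 0)
  rw [← map_natCast (algebraMap (FrobTwist p R) (FrobTwist p R ⊗[R] R')), h, map_zero]⟩

theorem one_tmul_relFrob (z : FrobTwist p R ⊗[R] R') :
    (1 : FrobTwist p R) ⊗ₜ[R] (show R' from relFrob p R R' z) = z ^ p := by
  induction z using TensorProduct.induction_on with
  | zero =>
    rw [map_zero, zero_pow (Fact.out : p.Prime).ne_zero]
    exact TensorProduct.tmul_zero _ _
  | tmul b a =>
    rw [Algebra.TensorProduct.tmul_pow]
    refine (congrArg (fun z : R' ↦ (1 : FrobTwist p R) ⊗ₜ[R] z)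
      (relFrob_tmul p R R' (show R from b) a)).trans ?_
    rw [← Algebra.smul_def, ← TensorProduct.smul_tmul]
    congr 1
    rw [Algebra.smul_def, mul_one]
    rfl
  | add x y hx hy =>
    rw [← frob_apply p (x + y), map_add (frob p _), frob_apply, frob_apply, ← hx, ← hy,
      ← TensorProduct.tmul_add, map_add]
    rfl

variable [Algebra.Etale R R']

/-- The relative Frobenius of an étale algebra is surjective: over its image `S` the algebra `R'`
is finite and unramified, and the diagonal ideal of `R' ⊗_S R'` is nil since `a ^ p ∈ S`. This
ideal is idempotent, hence zero, so `S → R'` is a finite epimorphism. -/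
theorem relFrob_surjective : Function.Surjective (relFrob p R R') := by
  have het : Algebra.Etale (FrobTwist p R) (FrobTwist p R') :=
    inferInstanceAs (Algebra.Etale R R')
  let S := (relFrob p R R').range
  have hpow (a : FrobTwist p R') : a ^ p ∈ S :=
    ⟨1 ⊗ₜ (show R' from a), (relFrob_tmul p R R' 1 a).trans (by simp; rfl)⟩
  have hft : Algebra.FiniteType S (FrobTwist p R') :=
    .of_restrictScalars_finiteType (FrobTwist p R) _ _
  have hint : Algebra.IsIntegral S (FrobTwist p R') := ⟨fun a ↦ by
    refine IsIntegral.of_pow (Fact.out : p.Prime).pos (n := p) ?_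
    exact isIntegral_algebraMap (x := (⟨a ^ p, hpow a⟩ : S))⟩
  have hfin : Module.Finite S (FrobTwist p R') := Algebra.IsIntegral.finite
  have hunr : Algebra.FormallyUnramified S (FrobTwist p R') :=
    .of_restrictScalars (FrobTwist p R) _ _
  have hnil (z) (hz : z ∈ KaehlerDifferential.ideal S (FrobTwist p R')) : IsNilpotent z := by
    have hp0 : ((p : FrobTwist p R' ⊗[S] FrobTwist p R') = 0) := by
      have h : ((p : FrobTwist p R') = 0) := (Fact.out : (p : R') = 0)
      rw [← map_natCast (algebraMap (FrobTwist p R') _), h, map_zero]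
    have : Fact ((p : FrobTwist p R' ⊗[S] FrobTwist p R') = 0) := ⟨hp0⟩
    rw [← mem_nilradical]
    revert z
    change KaehlerDifferential.ideal S (FrobTwist p R') ≤ _
    rw [← KaehlerDifferential.span_range_eq_ideal, Ideal.span_le]
    rintro _ ⟨a, rfl⟩
    refine ⟨p, ?_⟩
    rw [← frob_apply, map_sub, frob_apply, frob_apply, Algebra.TensorProduct.tmul_pow,
      Algebra.TensorProduct.tmul_pow, one_pow]
    refine (Submodule.mem_bot _).2 (sub_eq_zero.2 ?_)
    have := TensorProduct.smul_tmul (R := S) (⟨a ^ p, hpow a⟩ : S) (1 : FrobTwist p R')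
      (1 : FrobTwist p R')
    rw [Algebra.smul_def, mul_one] at this
    exact this.symm
  have hid : IsIdempotentElem (KaehlerDifferential.ideal S (FrobTwist p R')) := by
    have := hunr.subsingleton_kaehlerDifferential
    exact (Ideal.cotangent_subsingleton_iff _).1 this
  obtain ⟨e, he, hspan⟩ := (Ideal.isIdempotentElem_iff_of_fg _
    (KaehlerDifferential.ideal_fg S (FrobTwist p R'))).1 hid
  obtain ⟨n, hn⟩ := hnil e (hspan ▸ Ideal.mem_span_singleton_self e)
  have he0 : e = 0 := by
    rcases n.eq_zero_or_pos with rfl | h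
    · rw [pow_zero] at hn
      rw [← mul_one e, hn, mul_zero]
    · rwa [he.pow_eq h.ne'] at hn
  have hepi : Algebra.IsEpi S (FrobTwist p R') := by
    refine (Algebra.isEpi_iff_forall_one_tmul_eq _ _).2 fun a ↦ ?_
    have := KaehlerDifferential.one_smul_sub_smul_one_mem_ideal S a
    change 1 ⊗ₜ a - a ⊗ₜ 1 ∈ KaehlerDifferential.ideal S (FrobTwist p R') at this
    rw [hspan, he0] at this
    simpa [sub_eq_zero] using this
  intro a
  obtain ⟨⟨_, z, rfl⟩, rfl⟩ := (Algebra.isEpi_iff_surjective_algebraMap_of_finite).1 hepi a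
  exact ⟨z, rfl⟩

/-- The relative Frobenius of an étale algebra is an isomorphism: it is a surjection between étale
algebras, so its kernel is generated by an idempotent, and this kernel is nil. -/
theorem relFrob_bijective : Function.Bijective (relFrob p R R') := by
  have het : Algebra.Etale (FrobTwist p R) (FrobTwist p R') :=
    inferInstanceAs (Algebra.Etale R R')
  have hs := relFrob_surjective p R R'
  refine ⟨(injective_iff_map_eq_zero _).2 fun z hz ↦ ?_, hs⟩
  let := (relFrob p R R').toRingHom.toAlgebra
  have : IsScalarTower (FrobTwist p R) (FrobTwist p R ⊗[R] R') (FrobTwist p R') :=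
    .of_algebraMap_eq' (relFrob p R R').comp_algebraMap.symm
  obtain ⟨e, he, hfe⟩ :=
    (Ideal.isIdempotentElem_iff_of_fg _
      (Algebra.FinitePresentation.ker_fG_of_surjective (relFrob p R R') hs)).mp
      ((Algebra.FormallyEtale.iff_of_surjective hs).mp
        (.of_restrictScalars (R := FrobTwist p R)))
  have hker (z) (hz : relFrob p R R' z = 0) : z ^ p = 0 := by
    rw [← one_tmul_relFrob, hz]
    exact TensorProduct.tmul_zero _ _
  have he0 : e = 0 := by
    have : e ∈ RingHom.ker (relFrob p R R').toRingHom :=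
      hfe.symm ▸ Ideal.mem_span_singleton_self e
    rw [← he.pow_eq (Fact.out : p.Prime).ne_zero]
    exact hker e this
  have hz' : z ∈ Ideal.span {e} := (SetLike.ext_iff.1 hfe z).1 hz
  simpa [he0] using hz'

variable {p R} in
/-- A `p`-basis remains one in an étale algebra, by base change along the Frobenius of `R`, since
the relative Frobenius is an isomorphism. -/
theorem IsPBasis.of_etale {σ : Type*} {x : σ → R} (h : IsPBasis p x) :
    IsPBasis p (fun s ↦ algebraMap R R' (x s)) := by
  classical
  let E : ((σ →₀ ZMod p) →₀ R) ≃ₗ[R] FrobTwist p R :=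
    LinearEquiv.ofBijective
      ({ toFun := fun c ↦ FrobTwist.equiv p R (pExpand p x c)
         map_add' := fun c d ↦ by rw [map_add, map_add]
         map_smul' := fun r c ↦ by
          rw [RingHom.id_apply, FrobTwist.smul_equiv]
          congr 1
          induction c using Finsupp.induction_linear with
          | zero => simp
          | add c d hc hd => rw [smul_add, map_add, hc, hd, map_add, mul_add]
          | single α c =>
            rw [Finsupp.smul_single, pExpand_single, pExpand_single, smul_eq_mul, mul_pow]
            ring } : ((σ →₀ ZMod p) →₀ R) →ₗ[R] FrobTwist p R) h
  let b : Module.Basis (σ →₀ ZMod p) R (FrobTwist p R) := ⟨E.symm⟩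
  have hb (α) : b α = mon p x α := by
    change pExpand p x (Finsupp.single α 1) = _
    simp
  have e : ⇑(pExpand p fun s ↦ algebraMap R R' (x s)) =
      relFrob p R R' ∘ (TensorProduct.equivFinsuppOfBasisLeft (N := R') b).symm := by
    ext c
    rw [Function.comp_apply, TensorProduct.equivFinsuppOfBasisLeft_symm_apply, Finsupp.sum, map_sum]
    change _ = ∑ α ∈ c.support, (show R' from relFrob p R R' (b α ⊗ₜ[R] c α))
    rw [pExpand, Finsupp.liftAddHom_apply, Finsupp.sum]
    refine Finset.sum_congr rfl fun α _ ↦ ?_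
    rw [hb, relFrob_tmul, map_mon]
    rfl
  rw [IsPBasis, e]
  exact (relFrob_bijective p R R').comp (LinearEquiv.bijective _)

end Etale

/-! ### `p`-bases of polynomial rings and of fields -/

section MvPolynomial

variable {p : ℕ} [Fact p.Prime] {k : Type*} [CommRing k] [Fact ((p : k) = 0)] {σ τ : Type*}

instance : Fact ((p : MvPolynomial τ k) = 0) := ⟨by
  rw [← map_natCast (MvPolynomial.C (σ := τ) (R := k)), (Fact.out : (p : k) = 0), map_zero]⟩

/-- The exponent vector `α + p v` of a monomial, split into its residue modulo `p`, represented in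
`[0, p - 1]`, and its quotient. -/
def splitExp (α : τ →₀ ZMod p) (v : τ →₀ ℕ) : τ →₀ ℕ :=
  α.mapRange ZMod.val ZMod.val_zero + p • v

theorem splitExp_inj {α α' : τ →₀ ZMod p} {v v' : τ →₀ ℕ} (h : splitExp α v = splitExp α' v') :
    α = α' ∧ v = v' := by
  have hp := (Fact.out : p.Prime)
  have h1 (s) : (α s).val + p * v s = (α' s).val + p * v' s := by
    simpa [splitExp] using DFunLike.congr_fun h s
  have h2 (s) : α s = α' s := by
    have := congrArg (Nat.cast : ℕ → ZMod p) (h1 s)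
    simpa using this
  refine ⟨Finsupp.ext h2, Finsupp.ext fun s ↦ ?_⟩
  have := h1 s
  rw [h2 s] at this
  exact Nat.eq_of_mul_eq_mul_left hp.pos (Nat.add_left_cancel this)

theorem exists_splitExp (w : τ →₀ ℕ) : ∃ (α : τ →₀ ZMod p) (v : τ →₀ ℕ), splitExp α v = w := by
  refine ⟨w.mapRange (fun n : ℕ ↦ (n : ZMod p)) Nat.cast_zero,
    w.mapRange (fun n : ℕ ↦ n / p) (Nat.zero_div p), Finsupp.ext fun s ↦ ?_⟩
  simp [splitExp, ZMod.val_natCast, Nat.mod_add_div]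

/-- The variables and the elements of a family in the base ring. -/
abbrev withVars (τ : Type*) (b : σ → k) : τ ⊕ σ → MvPolynomial τ k :=
  Sum.elim MvPolynomial.X fun s ↦ MvPolynomial.C (b s)

theorem mon_withVars (b : σ → k) (α : τ →₀ ZMod p) (γ : σ →₀ ZMod p) :
    mon p (withVars τ b) (Finsupp.sumElim α γ) =
      MvPolynomial.monomial (α.mapRange ZMod.val ZMod.val_zero) (mon p b γ) := by
  classical
  rw [← mul_one (mon p b γ), ← MvPolynomial.C_mul_monomial, mul_comm,
    mon_eq_prod (F := α.support.disjSum γ.support), Finset.prod_disjSum]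
  · congr 1
    · rw [MvPolynomial.monomial_eq, MvPolynomial.C_1, one_mul, Finsupp.prod_mapRange_index]
      · simp [Finsupp.prod]
      · simp
    · simp [mon, Finsupp.prod]
  · intro s
    rcases s with s | s <;> simp

theorem monomial_mul_monomial_pow (b : σ → k) (α : τ →₀ ZMod p) (γ : σ →₀ ZMod p) (w : τ →₀ ℕ)
    (a : k) :
    mon p (withVars τ b) (Finsupp.sumElim α γ) * (MvPolynomial.monomial w a) ^ p =
      MvPolynomial.monomial (splitExp α w) (mon p b γ * a ^ p) := by
  rw [mon_withVars, MvPolynomial.monomial_pow, MvPolynomial.monomial_mul]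
  rfl

/-- The coefficients of the polynomials `c_{(α, γ)}` at `v`, as a function of `γ`. -/
def coeffFamily (α : τ →₀ ZMod p) (v : τ →₀ ℕ) :
    ((τ ⊕ σ →₀ ZMod p) →₀ MvPolynomial τ k) →+ ((σ →₀ ZMod p) →₀ k) :=
  (Finsupp.mapRange.addMonoidHom (MvPolynomial.lcoeff k v).toAddMonoidHom).comp
    (Finsupp.comapDomain.addMonoidHom (f := fun γ : σ →₀ ZMod p ↦ Finsupp.sumElim α γ)
      fun γ γ' h ↦ by
        ext s
        simpa using DFunLike.congr_fun h (Sum.inr s))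

theorem coeffFamily_apply (α : τ →₀ ZMod p) (v : τ →₀ ℕ)
    (c : (τ ⊕ σ →₀ ZMod p) →₀ MvPolynomial τ k) (γ : σ →₀ ZMod p) :
    coeffFamily α v c γ = (c (Finsupp.sumElim α γ)).coeff v := rfl

/-- The coefficients of a `p`-expansion over a polynomial ring are `p`-expansions over the base
field: the exponent of a variable splits uniquely as `α + p v` with `α < p`. -/
theorem coeff_pExpand_withVars (b : σ → k) (α : τ →₀ ZMod p) (v : τ →₀ ℕ)
    (c : (τ ⊕ σ →₀ ZMod p) →₀ MvPolynomial τ k) :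
    (pExpand p (withVars τ b) c).coeff (splitExp α v) = pExpand p b (coeffFamily α v c) := by
  classical
  induction c using Finsupp.induction_linear with
  | zero => simp
  | add c d hc hd => rw [map_add, MvPolynomial.coeff_add, hc, hd, map_add, map_add]
  | single β f =>
    obtain ⟨⟨α', γ'⟩, rfl⟩ := Finsupp.sumFinsuppEquivProdFinsupp.symm.surjective β
    change MvPolynomial.coeff _ (pExpand p _ (Finsupp.single (Finsupp.sumElim α' γ') f)) =
      pExpand p b (coeffFamily α v (Finsupp.single (Finsupp.sumElim α' γ') f))
    have key (γ : σ →₀ ZMod p) : Finsupp.sumElim α γ = Finsupp.sumElim α' γ' ↔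
        α = α' ∧ γ = γ' := by
      refine ⟨fun h ↦ ⟨Finsupp.ext fun s ↦ ?_, Finsupp.ext fun s ↦ ?_⟩, fun h ↦ by rw [h.1, h.2]⟩
      · simpa using DFunLike.congr_fun h (Sum.inl s)
      · simpa using DFunLike.congr_fun h (Sum.inr s)
    have h2 : coeffFamily α v (Finsupp.single (Finsupp.sumElim α' γ') f) =
        if α = α' then Finsupp.single γ' (f.coeff v) else 0 := by
      ext γ
      rw [coeffFamily_apply, Finsupp.single_apply]
      by_cases h : α = α'
      · subst h
        by_cases h' : γ = γ'
        · subst h'; simp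
        · rw [if_neg, if_pos rfl, Finsupp.single_eq_of_ne h', MvPolynomial.coeff_zero]
          intro h3
          exact h' ((key γ).1 h3.symm).2
      · rw [if_neg, if_neg h]
        · simp
        · intro h3
          exact h ((key γ).1 h3.symm).1
    rw [h2, pExpand_single]
    clear h2 key
    rw [← frob_apply]
    induction f using MvPolynomial.induction_on' with
    | monomial w a =>
      rw [frob_apply, monomial_mul_monomial_pow, MvPolynomial.coeff_monomial,
        MvPolynomial.coeff_monomial]
      by_cases h : α = α'
      · subst h
        by_cases h' : w = v
        · subst h'; simp
        · rw [if_neg fun h3 ↦ h' (splitExp_inj h3).2, if_neg h']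
          simp
      · rw [if_neg fun h3 ↦ h (splitExp_inj h3).1.symm, if_neg h, map_zero]
    | add f g hf hg =>
      rw [map_add, mul_add, MvPolynomial.coeff_add, hf, hg, ← map_add]
      congr 1
      split_ifs
      · rw [← Finsupp.single_add, MvPolynomial.coeff_add]
      · rw [add_zero]

variable (τ) in
theorem IsPBasis.withVars {b : σ → k} (h : IsPBasis p b) : IsPBasis p (withVars τ b) := by
  refine ⟨(injective_iff_map_eq_zero _).2 fun c hc ↦ Finsupp.ext fun β ↦ ?_, fun f ↦ ?_⟩
  · obtain ⟨⟨α, γ⟩, rfl⟩ := Finsupp.sumFinsuppEquivProdFinsupp.symm.surjective β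
    ext v
    have h1 := coeff_pExpand_withVars b α v c
    rw [hc, MvPolynomial.coeff_zero, ← map_zero (pExpand p b)] at h1
    exact (DFunLike.congr_fun (h.1 h1) γ).symm
  · change f ∈ (pExpand p (KatoCartier.withVars τ b)).range
    induction f using MvPolynomial.induction_on' with
    | monomial u a =>
      obtain ⟨α, v, rfl⟩ := exists_splitExp (p := p) u
      obtain ⟨c, rfl⟩ := h.2 a
      induction c using Finsupp.induction_linear with
      | zero => rw [map_zero, map_zero]; exact zero_mem _
      | add c d hc hd => rw [map_add, map_add]; exact add_mem hc hd
      | single γ c =>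
        exact ⟨Finsupp.single (Finsupp.sumElim α γ) (MvPolynomial.monomial v c), by
          rw [pExpand_single, pExpand_single, monomial_mul_monomial_pow]⟩
    | add f g hf hg => exact add_mem hf hg

/-- Translating the variables preserves the `p`-basis. -/
theorem IsPBasis.withVars_sub {b : σ → k} (h : IsPBasis p b) (ε : τ → k) :
    IsPBasis p (Sum.elim (fun j : τ ↦ MvPolynomial.X j - MvPolynomial.C (ε j))
      fun s ↦ MvPolynomial.C (b s) : τ ⊕ σ → MvPolynomial τ k) := by
  let f (ε : τ → k) : MvPolynomial τ k →ₐ[k] MvPolynomial τ k :=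
    MvPolynomial.aeval fun j ↦ MvPolynomial.X j - MvPolynomial.C (ε j)
  have hf (ε) : (f ε).comp (f (-ε)) = AlgHom.id k _ := by
    ext j
    simp [f]
  let e : MvPolynomial τ k ≃ₐ[k] MvPolynomial τ k :=
    AlgEquiv.ofAlgHom (f ε) (f (-ε)) (hf ε) (by simpa using hf (-ε))
  have := (h.withVars τ).map_ringEquiv (e : MvPolynomial τ k ≃+* MvPolynomial τ k)
  convert this using 1
  ext1 s
  rcases s with s | s
  · simp [e, f]
  · simp [e, f]

end MvPolynomial

section Field

variable {p : ℕ} [Fact p.Prime] {k : Type*} [Field k] [Fact ((p : k) = 0)] {σ : Type*}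

/-- The subring `R^p[x_s]` of `R`. -/
def pSubring {R : Type*} [CommRing R] [Fact ((p : R) = 0)] (x : σ → R) : Subring R where
  carrier := (pExpand p x).range
  zero_mem' := zero_mem _
  add_mem' := add_mem
  neg_mem' := neg_mem
  one_mem' := ⟨Finsupp.single 0 1, by simp⟩
  mul_mem' := by
    rintro _ _ ⟨c, rfl⟩ ⟨d, rfl⟩
    change _ ∈ (pExpand p x).range
    induction c using Finsupp.induction_linear with
    | zero => rw [map_zero, zero_mul]; exact zero_mem _
    | add c c' hc hc' => rw [map_add, add_mul]; exact add_mem hc hc'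
    | single α c =>
      induction d using Finsupp.induction_linear with
      | zero => rw [map_zero, mul_zero]; exact zero_mem _
      | add c c' hc hc' => rw [map_add, mul_add]; exact add_mem hc hc'
      | single β d =>
        obtain ⟨z, hz⟩ := exists_mon_mul_mon (p := p) x α β
        refine ⟨Finsupp.single (α + β) (z * c * d), ?_⟩
        rw [pExpand_single, pExpand_single, pExpand_single, mul_pow, mul_pow]
        linear_combination (-(c ^ p * d ^ p)) * hz

theorem pow_mem_pSubring {R : Type*} [CommRing R] [Fact ((p : R) = 0)] (x : σ → R) (a : R) :
    a ^ p ∈ pSubring (p := p) x :=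
  ⟨Finsupp.single 0 a, by simp⟩

variable (p) in
/-- The subfield `k^p(x_s)` of `k`. -/
def pSubfield (x : σ → k) : Subfield k where
  toSubring := pSubring (p := p) x
  inv_mem' a ha := by
    have hp := (Fact.out : p.Prime)
    rcases eq_or_ne a 0 with rfl | h
    · rw [inv_zero]; exact zero_mem (pSubring (p := p) x)
    · have : a⁻¹ = a⁻¹ ^ p * a ^ (p - 1) := by
        obtain ⟨n, rfl⟩ := Nat.exists_eq_succ_of_ne_zero hp.ne_zero
        rw [Nat.succ_sub_one, pow_succ', mul_assoc, ← mul_pow, inv_mul_cancel₀ h, one_pow, mul_one]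
      rw [this]
      exact (pSubring x).mul_mem (pow_mem_pSubring x _) ((pSubring x).pow_mem ha _)

/-- Extend an exponent vector by one entry. -/
def consExp (i : ZMod p) : (σ →₀ ZMod p) → (Option σ →₀ ZMod p) := fun γ ↦
  γ.embDomain .some + Finsupp.single none i

theorem consExp_none (i : ZMod p) (γ : σ →₀ ZMod p) : consExp i γ none = i := by
  simp [consExp, Finsupp.embDomain_of_notMem_range]

theorem consExp_some (i : ZMod p) (γ : σ →₀ ZMod p) (s : σ) : consExp i γ (some s) = γ s := by
  have := Finsupp.embDomain_apply_self Function.Embedding.some γ s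
  simp only [Function.Embedding.some_apply] at this
  simp [consExp, this]

theorem consExp_injective (i : ZMod p) : Function.Injective (consExp (σ := σ) i) :=
  fun γ γ' h ↦ Finsupp.ext fun s ↦ by
    rw [← consExp_some i γ, h, consExp_some]

theorem exists_consExp (α : Option σ →₀ ZMod p) : ∃ i γ, consExp i γ = α := by
  refine ⟨α none, α.some, Finsupp.ext fun s ↦ ?_⟩
  rcases s with _ | s
  · rw [consExp_none]
  · rw [consExp_some, Finsupp.some_apply]

theorem mon_consExp (x : Option σ → k) (i : ZMod p) (γ : σ →₀ ZMod p) :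
    mon p x (consExp i γ) = x none ^ i.val * mon p (fun s ↦ x (some s)) γ := by
  classical
  rw [mon_eq_prod (F := insert none (γ.support.map .some)), Finset.prod_insert (by simp),
    consExp_none, Finset.prod_map]
  · simp only [Function.Embedding.some_apply, consExp_some]
    rfl
  · intro s hs
    rcases s with _ | s
    · simp
    · simpa [consExp_some] using hs

/-- The part of a family with a given first exponent. -/
def headFamily (i : ZMod p) :
    ((Option σ →₀ ZMod p) →₀ k) →+ ((σ →₀ ZMod p) →₀ k) :=
  Finsupp.comapDomain.addMonoidHom (consExp_injective i)

theorem headFamily_apply (i : ZMod p) (c : (Option σ →₀ ZMod p) →₀ k) (γ : σ →₀ ZMod p) :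
    headFamily i c γ = c (consExp i γ) := rfl

theorem pExpand_option (x : Option σ → k) (c : (Option σ →₀ ZMod p) →₀ k) :
    pExpand p x c =
      ∑ i : ZMod p, x none ^ i.val * pExpand p (fun s ↦ x (some s)) (headFamily i c) := by
  classical
  induction c using Finsupp.induction_linear with
  | zero => simp
  | add c d hc hd => simp only [map_add, hc, hd, mul_add, Finset.sum_add_distrib]
  | single α c =>
    obtain ⟨j, γ, rfl⟩ := exists_consExp α
    have h (i) : headFamily i (Finsupp.single (consExp j γ) c) =
        if i = j then Finsupp.single γ c else 0 := by
      ext γ'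
      rw [headFamily_apply]
      split_ifs with h
      · subst h
        by_cases h' : γ' = γ
        · subst h'; simp
        · rw [Finsupp.single_eq_of_ne h', Finsupp.single_eq_of_ne]
          exact fun h3 ↦ h' (consExp_injective i h3)
      · rw [Finsupp.single_eq_of_ne]
        · rfl
        · intro h3
          have := DFunLike.congr_fun h3 none
          rw [consExp_none, consExp_none] at this
          exact h this
    simp only [h, pExpand_single, mon_consExp]
    rw [Finset.sum_eq_single j]
    · simp [mul_assoc]
    · intro i _ hi
      simp [hi]
    · simp

/-- Adding an element outside `k^p(x_s)` preserves `p`-independence: its minimal polynomial over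
that subfield has degree `p`. -/
theorem pExpand_option_injective {x : Option σ → k}
    (h : Function.Injective (pExpand p fun s ↦ x (some s)))
    (hx : x none ∉ pSubfield p fun s ↦ x (some s)) : Function.Injective (pExpand p x) := by
  classical
  have hp := (Fact.out : p.Prime)
  have : ExpChar k p := by
    have : CharP k p := (CharP.charP_iff_prime_eq_zero hp).2 Fact.out
    exact .prime hp
  set L := pSubfield p fun s ↦ x (some s)
  set a := x none
  have hpow : a ^ p ∈ L := pow_mem_pSubring _ a
  -- `X ^ p - a ^ p` is irreducible over `L`: the only `p`-th root of `a ^ p` is `a`, which is not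
  -- in `L`
  have hirr : Irreducible (Polynomial.X ^ p - Polynomial.C (⟨a ^ p, hpow⟩ : L)) := by
    refine X_pow_sub_C_irreducible_of_prime hp fun b hb ↦ hx ?_
    have : (b : k) ^ p = a ^ p := congrArg Subtype.val hb
    rw [← frobenius_inj k p this]
    exact b.2
  have hmin : minpoly L a = Polynomial.X ^ p - Polynomial.C (⟨a ^ p, hpow⟩ : L) := by
    refine (minpoly.eq_of_irreducible_of_monic hirr ?_ (Polynomial.monic_X_pow_sub_C _
        hp.ne_zero)).symm
    simp [Algebra.algebraMap_ofSubsemiring_apply]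
  refine (injective_iff_map_eq_zero _).2 fun c hc ↦ Finsupp.ext fun α ↦ ?_
  obtain ⟨j, γ, rfl⟩ := exists_consExp α
  -- a relation is a polynomial of degree less than `p` over `L` that vanishes at `a`
  let l (i : ZMod p) : L := ⟨pExpand p (fun s ↦ x (some s)) (headFamily i c), _, rfl⟩
  let f : Polynomial L := ∑ i : ZMod p, Polynomial.C (l i) * Polynomial.X ^ i.val
  have hf : Polynomial.aeval a f = 0 := by
    rw [← hc, pExpand_option, map_sum]
    refine Finset.sum_congr rfl fun i _ ↦ ?_
    rw [map_mul, Polynomial.aeval_C, map_pow, Polynomial.aeval_X, mul_comm]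
    rfl
  have hdeg : f.natDegree < p := by
    have : f.natDegree ≤ p - 1 := by
      refine Polynomial.natDegree_sum_le_of_forall_le _ _ fun i _ ↦ ?_
      refine (Polynomial.natDegree_C_mul_X_pow_le _ _).trans ?_
      have := ZMod.val_lt i
      omega
    have := hp.pos
    omega
  have hf0 : f = 0 := by
    by_contra hne
    have := Polynomial.natDegree_le_of_dvd (minpoly.dvd L a hf) hne
    rw [hmin, Polynomial.natDegree_X_pow_sub_C] at this
    omega
  have hl : l j = 0 := by
    have := congrArg (fun g ↦ Polynomial.coeff g j.val) hf0
    simp only [f, Polynomial.finsetSum_coeff, Polynomial.coeff_C_mul_X_pow,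
      Polynomial.coeff_zero] at this
    rw [Finset.sum_eq_single j] at this
    · simpa using this
    · intro i _ hi
      rw [if_neg]
      exact fun h3 ↦ hi (ZMod.val_injective p h3.symm)
    · simp
  have h0 : headFamily j c = 0 := by
    refine h ?_
    rw [map_zero]
    exact congrArg Subtype.val hl
  exact DFunLike.congr_fun h0 γ

variable (p k) in
/-- Every field of characteristic `p` has a `p`-basis. -/
theorem exists_isPBasis : ∃ S : Set k, IsPBasis p (Subtype.val : S → k) := by
  classical
  obtain ⟨S, hS⟩ := zorn_subset
    {S : Set k | Function.Injective (pExpand p (Subtype.val : S → k))} fun c hc hch ↦ by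
    refine ⟨⋃₀ c, ?_, fun s hs ↦ Set.subset_sUnion_of_mem hs⟩
    refine (injective_iff_map_eq_zero _).2 fun f hf ↦ ?_
    -- only finitely many elements occur in `f`, so all of them lie in one member of the chain
    obtain ⟨S, hSc, hS⟩ : ∃ S : Set k, S ⊆ ⋃₀ c ∧
        Function.Injective (pExpand p (Subtype.val : S → k)) ∧
        ∀ α ∈ f.support, ∀ s ∈ α.support, (s : k) ∈ S := by
      let F : Finset k := f.support.biUnion fun α ↦ α.support.map (.subtype _)
      have hF (α) (hα : α ∈ f.support) (s) (hs : s ∈ α.support) : (s : k) ∈ F :=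
        Finset.mem_biUnion.2 ⟨α, hα, Finset.mem_map_of_mem (.subtype _) hs⟩
      rcases c.eq_empty_or_nonempty with rfl | hne
      · refine ⟨∅, Set.empty_subset _, ?_, fun α hα s hs ↦ ?_⟩
        · refine (injective_iff_map_eq_zero _).2 fun g hg ↦ Finsupp.ext fun α ↦ ?_
          have h0 : g = Finsupp.single 0 (g 0) := Finsupp.ext fun β ↦ by
            rw [Subsingleton.elim β 0, Finsupp.single_eq_same]
          rw [h0, pExpand_single, mon_zero, one_mul] at hg
          rw [h0, pow_eq_zero_iff (Fact.out : p.Prime).ne_zero |>.1 hg, Finsupp.single_zero]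
        · exact absurd s.2 (by simp)
      · obtain ⟨S, hS, hFS⟩ := hch.directedOn.exists_mem_subset_of_finite_of_subset_sUnion hne
          (s := (F : Set k)) F.finite_toSet (by
            intro s hs
            obtain ⟨α, _, h⟩ := Finset.mem_biUnion.1 (Finset.mem_coe.1 hs)
            obtain ⟨s, _, rfl⟩ := Finset.mem_map.1 h
            exact s.2)
        exact ⟨S, Set.subset_sUnion_of_mem hS, hc hS, fun α hα s hs ↦ hFS (hF α hα s hs)⟩
    have hj := Set.inclusion_injective hSc
    have hj' : Function.Injective (Finsupp.mapDomain (M := ZMod p) (Set.inclusion hSc)) :=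
      Finsupp.mapDomain_injective hj
    have hrange : (f.support : Set _) ⊆ Set.range (Finsupp.mapDomain (M := ZMod p)
        (Set.inclusion hSc)) := fun α hα ↦ by
      refine ⟨α.comapDomain (Set.inclusion hSc) hj.injOn,
        Finsupp.mapDomain_comapDomain _ hj _ fun s hs ↦ ?_⟩
      exact ⟨⟨s, hS.2 α hα s hs⟩, rfl⟩
    rw [← Finsupp.mapDomain_comapDomain _ hj' f hrange, pExpand_mapDomain hj] at hf
    rw [← Finsupp.mapDomain_comapDomain _ hj' f hrange,
      hS.1 (hf.trans (map_zero _).symm), Finsupp.mapDomain_zero]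
  -- an element without an expansion could be added to a maximal independent set
  refine ⟨S, hS.prop, fun a ↦ ?_⟩
  by_contra ha
  have h1 : Function.Injective (pExpand p (Subtype.val : ↥(insert a S) → k)) := by
    let x : Option S → k := fun o ↦ o.elim a Subtype.val
    have hx : Function.Injective (pExpand p x) := pExpand_option_injective hS.prop ha
    have hmem (s : ↥(insert a S)) (h : (s : k) ≠ a) : (s : k) ∈ S := s.2.resolve_left h
    let j : ↥(insert a S) → Option S := fun s ↦ if h : (s : k) = a then none else some ⟨s, hmem s h⟩
    have hxj (s) : x (j s) = s := by
      by_cases h : (s : k) = a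
      · simp [j, h, x]
      · simp [j, h, x]
    have hj : Function.Injective j := fun s t h ↦ Subtype.ext (by rw [← hxj, h, hxj])
    have hj' : Function.Injective (Finsupp.mapDomain (M := ZMod p) j) :=
      Finsupp.mapDomain_injective hj
    refine (injective_iff_map_eq_zero _).2 fun f hf ↦ ?_
    have := pExpand_mapDomain hj x f
    simp only [hxj] at this
    refine Finsupp.mapDomain_injective hj' (hx ?_)
    rw [this, hf, Finsupp.mapDomain_zero, map_zero]
  have h2 := hS.eq_of_subset h1 (Set.subset_insert a S)
  refine ha ⟨Finsupp.single (Finsupp.single ⟨a, h2 ▸ Set.mem_insert a S⟩ 1) 1, ?_⟩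
  have : Fact (1 < p) := ⟨(Fact.out : p.Prime).one_lt⟩
  simp [mon, ZMod.val_one]

end Field

/-! ### Differential calculus on forms -/

section Calculus

variable {A B : Type u} [CommRing A] [CommRing B] (ι : A →+* B) (I : Ideal A)

theorem extD_smul (r : A ⧸ I) (x : LogForms ι I) :
    extD ι I (r • x) =
      ExteriorAlgebra.ι (A ⧸ I) (LogForm1.d ι I r) * x + r • extD ι I x := by
  rw [Algebra.smul_def, extD_mul, extD_algebraMap, AlgHom.commutes, ← Algebra.smul_def]

theorem extD_ι_mul {m : LogForm1 ι I} (h : extD ι I (ExteriorAlgebra.ι (A ⧸ I) m) = 0)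
    (x : LogForms ι I) :
    extD ι I (ExteriorAlgebra.ι (A ⧸ I) m * x) = -(ExteriorAlgebra.ι (A ⧸ I) m * extD ι I x) := by
  have : CliffordAlgebra.involute (ExteriorAlgebra.ι (A ⧸ I) m) =
    - ExteriorAlgebra.ι (A ⧸ I) m := CliffordAlgebra.involute_ι m
  rw [extD_mul, h, this, zero_mul, zero_add, neg_mul]

theorem ι_mul_ι_mul_self (m : LogForm1 ι I) (x : LogForms ι I) :
    ExteriorAlgebra.ι (A ⧸ I) m * (ExteriorAlgebra.ι (A ⧸ I) m * x) = 0 := by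
  rw [← mul_assoc, ExteriorAlgebra.ι_sq_zero, zero_mul]

theorem ι_smul_mul (r : A ⧸ I) (m : LogForm1 ι I) (x : LogForms ι I) :
    ExteriorAlgebra.ι (A ⧸ I) (r • m) * x = r • (ExteriorAlgebra.ι (A ⧸ I) m * x) := by
  rw [map_smul, smul_mul_assoc]

theorem extD_involute (x : LogForms ι I) :
    extD ι I (CliffordAlgebra.involute x) = - CliffordAlgebra.involute (extD ι I x) := by
  have hι (m : LogForm1 ι I) : CliffordAlgebra.involute (ExteriorAlgebra.ι (A ⧸ I) m) =
    - ExteriorAlgebra.ι (A ⧸ I) m := CliffordAlgebra.involute_ι m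
  induction x using ExteriorAlgebra.induction with
  | algebraMap r => rw [AlgHom.commutes, extD_algebraMap, hι, neg_neg]
  | ι n =>
    rw [hι, map_neg]
    congr 1
    induction n using LogForm1.induction with
    | d r => rw [extD_d, map_zero]
    | dlog r => rw [extD_dlog, map_zero]
    | zero => rw [map_zero, map_zero, map_zero]
    | add x y hx hy => rw [map_add, map_add, map_add, ← hx, ← hy]
    | smul r x hx => rw [map_smul, extD_smul, map_add, map_mul, hι, hι, neg_mul_neg, map_smul, ← hx]
  | mul a b ha hb =>
    simp only [extD_mul, map_mul, ha, hb, map_add, CliffordAlgebra.involute_involute,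
      neg_add, neg_mul, mul_neg]
  | add a b ha hb => simp only [map_add, ha, hb, neg_add]

theorem extD_extD (x : LogForms ι I) : extD ι I (extD ι I x) = 0 := by
  have hι (m : LogForm1 ι I) : CliffordAlgebra.involute (ExteriorAlgebra.ι (A ⧸ I) m) =
    - ExteriorAlgebra.ι (A ⧸ I) m := CliffordAlgebra.involute_ι m
  induction x using ExteriorAlgebra.induction with
  | algebraMap r => rw [extD_algebraMap, extD_d]
  | ι n =>
    induction n using LogForm1.induction with
    | d r => rw [extD_d, map_zero]
    | dlog r => rw [extD_dlog, map_zero]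
    | zero => simp
    | add x y hx hy => simp only [map_add, hx, hy, add_zero]
    | smul r x hx =>
      rw [map_smul, extD_smul, map_add, extD_ι_mul ι I (extD_d ι I r), extD_smul, hx, smul_zero,
        add_zero, neg_add_cancel]
  | mul a b ha hb =>
    rw [extD_mul, map_add, extD_mul, extD_mul, ha, hb, extD_involute,
      CliffordAlgebra.involute_involute]
    simp
  | add a b ha hb => simp only [map_add, ha, hb, add_zero]

variable {ι I} in
/-- The product of an exact form and a closed form is exact. -/
theorem exact_mul_closed {x y : LogForms ι I} (hx : x ∈ (extD ι I).range) (hy : extD ι I y = 0) :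
    x * y ∈ (extD ι I).range := by
  obtain ⟨z, rfl⟩ := hx
  exact ⟨z * y, by rw [extD_mul, hy, mul_zero, add_zero]⟩

variable {ι I} in
theorem closed_mul_exact {x y : LogForms ι I} (hx : extD ι I x = 0) (hy : y ∈ (extD ι I).range) :
    x * y ∈ (extD ι I).range := by
  obtain ⟨z, rfl⟩ := hy
  exact ⟨CliffordAlgebra.involute x * z, by
    rw [extD_mul, extD_involute, hx, map_zero, neg_zero, zero_mul, zero_add,
      CliffordAlgebra.involute_involute]⟩

theorem involute_ι (m : LogForm1 ι I) : CliffordAlgebra.involute (ExteriorAlgebra.ι (A ⧸ I) m) =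
    - ExteriorAlgebra.ι (A ⧸ I) m := CliffordAlgebra.involute_ι m

theorem pull_involute {Λ : Type v} {P Q : LogDatum.{u} Λ} (f : P ⟶ Q) (x : P.Forms) :
    LogDatum.pull f (CliffordAlgebra.involute x) =
      CliffordAlgebra.involute (LogDatum.pull f x) := by
  induction x using ExteriorAlgebra.induction with
  | algebraMap r => rw [AlgHom.commutes, LogDatum.pull_algebraMap, AlgHom.commutes]
  | ι n =>
    rw [involute_ι, map_neg, LogDatum.pull_ι]
    obtain ⟨m, hm⟩ := LogDatum.pullForm1_mem f n
    rw [← hm, involute_ι]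
  | mul a b ha hb => simp only [map_mul, ha, hb]
  | add a b ha hb => simp only [map_add, ha, hb]

theorem pull_extD {Λ : Type v} {P Q : LogDatum.{u} Λ} (f : P ⟶ Q) (x : P.Forms) :
    LogDatum.pull f (extD P.ι P.I x) = extD Q.ι Q.I (LogDatum.pull f x) := by
  induction x using ExteriorAlgebra.induction with
  | algebraMap r =>
    rw [extD_algebraMap, LogDatum.pull_ι, LogDatum.pullForm1_d, LogDatum.pull_algebraMap,
      extD_algebraMap]
  | ι n =>
    induction n using LogForm1.induction with
    | d r => rw [extD_d, LogDatum.pull_ι, LogDatum.pullForm1_d, extD_d, map_zero]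
    | dlog r => rw [extD_dlog, LogDatum.pull_ι, LogDatum.pullForm1_dlog, extD_dlog, map_zero]
    | zero => simp
    | add x y hx hy => simp only [map_add, hx, hy]
    | smul r x hx =>
      rw [map_smul, extD_smul, map_add, LogDatum.pull_smul, LogDatum.pull_smul, extD_smul, hx,
        map_mul, LogDatum.pull_ι f (LogForm1.d _ _ _), LogDatum.pullForm1_d]
  | mul a b ha hb =>
    rw [extD_mul, map_add, map_mul, map_mul, map_mul, extD_mul, ha, hb, pull_involute]
  | add a b ha hb => simp only [map_add, ha, hb]

end Calculus

/-! ### Logarithmic `p`-coordinates and the Frobenius lift on forms -/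

section Coordinates

variable (p : ℕ) [Fact p.Prime] {A B : Type u} [CommRing A] [CommRing B] (ι : A →+* B) (I : Ideal A)

/-- Logarithmic `p`-coordinates: functions `x_s` on `A/I` and a basis `e_s` of `ω̃¹` consisting of
closed forms with `dx_s = x_s e_s`, such that `A/I` is generated over its `p`-th powers by the
monomials in the `x_s`, with control of the relations along products of the `x_s` for `s ∈ J`.
The `e_s` are of the form `dlog y` or `b⁻¹ db`, and conversely they account for all forms `dlog y`
up to forms `u⁻¹ du`. -/
structure LogCoordinates [Fact ((p : A ⧸ I) = 0)] where
  σ : Type u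
  x : σ → A ⧸ I
  e : Module.Basis σ (A ⧸ I) (LogForm1 ι I)
  d_x (s : σ) : LogForm1.d ι I (x s) = x s • e s
  e_eq (s : σ) : (∃ y, e s = LogForm1.dlog ι I y) ∨
    ∃ b : (A ⧸ I)ˣ, e s = (↑b⁻¹ : A ⧸ I) • LogForm1.d ι I b
  dlog_eq (y : Additive Bˣ) : ∃ (b : (A ⧸ I)ˣ) (n : σ →₀ ℤ), LogForm1.dlog ι I y =
    (↑b⁻¹ : A ⧸ I) • LogForm1.d ι I b + n.sum fun s i ↦ i • e s
  J : Set σ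
  surjective : Function.Surjective (pExpand p x)
  mem_of_mem (L : Finset σ) (hL : ↑L ⊆ J) (c : (σ →₀ ZMod p) →₀ A ⧸ I)
    (h : pExpand p x c ∈ Ideal.span {∏ s ∈ L, x s}) (α : σ →₀ ZMod p) :
    open Classical in c α ∈ Ideal.span {∏ s ∈ L with α s = 0, x s}

namespace LogCoordinates

variable {p ι I} [Fact ((p : A ⧸ I) = 0)] (K : LogCoordinates p ι I)

/-- The linear order on the coordinates is only used for indexing exterior products. -/
instance : LinearOrder K.σ :=
  letI := Classical.decRel (WellOrderingRel (α := K.σ))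
  linearOrderOfSTO WellOrderingRel

/-- The ring of forms, as an algebra through Frobenius. -/
def FrobForms (_ : ℕ) {A B : Type u} [CommRing A] [CommRing B] (ι : A →+* B) (I : Ideal A) :
    Type u := LogForms ι I

instance : Ring (FrobForms p ι I) := inferInstanceAs (Ring (LogForms ι I))

instance : Algebra (A ⧸ I) (FrobForms p ι I) :=
  ((algebraMap (A ⧸ I) (LogForms ι I)).comp (frob p (A ⧸ I))).toAlgebra' fun r x ↦
    Algebra.commutes (A := LogForms ι I) (frob p (A ⧸ I) r) x

variable (p ι I) in
/-- The identity map. -/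
def FrobForms.equiv : LogForms ι I ≃+* FrobForms p ι I := RingEquiv.refl _

theorem FrobForms.equiv_symm_smul (r : A ⧸ I) (x : FrobForms p ι I) :
    (FrobForms.equiv p ι I).symm (r • x) = r ^ p • (FrobForms.equiv p ι I).symm x :=
  (Algebra.smul_def (r ^ p) ((FrobForms.equiv p ι I).symm x)).symm

/-- The Frobenius lift on `ω̃¹`, as a linear map to the forms viewed as an algebra through the
Frobenius. -/
def frobLift1Aux : LogForm1 ι I →ₗ[A ⧸ I] FrobForms p ι I :=
  K.e.constr ℕ fun s ↦ FrobForms.equiv p ι I (ExteriorAlgebra.ι (A ⧸ I) (K.e s))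

/-- The restriction of the Frobenius lift to `ω̃¹`. -/
def frobLift1 : LogForm1 ι I →+ LogForms ι I :=
  (FrobForms.equiv p ι I).symm.toAddEquiv.toAddMonoidHom.comp K.frobLift1Aux.toAddMonoidHom

theorem frobLift1_e (s : K.σ) : K.frobLift1 (K.e s) = ExteriorAlgebra.ι (A ⧸ I) (K.e s) :=
  (congrArg (FrobForms.equiv p ι I).symm (K.e.constr_basis ℕ _ s)).trans
    (RingEquiv.symm_apply_apply _ _)

theorem frobLift1_smul (r : A ⧸ I) (m : LogForm1 ι I) :
    K.frobLift1 (r • m) = r ^ p • K.frobLift1 m :=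
  (congrArg (FrobForms.equiv p ι I).symm (map_smul K.frobLift1Aux r m)).trans
    (FrobForms.equiv_symm_smul r _)

/-- Induction over the basis `e`. -/
theorem induction_basis {motive : LogForm1 ι I → Prop} (m : LogForm1 ι I) (e : ∀ s, motive (K.e s))
    (zero : motive 0) (add : ∀ x y, motive x → motive y → motive (x + y))
    (smul : ∀ (r : A ⧸ I) x, motive x → motive (r • x)) : motive m := by
  have hm : m ∈ Submodule.span (A ⧸ I) (Set.range K.e) := by
    rw [K.e.span_eq]; trivial
  induction hm using Submodule.span_induction with
  | mem x h => obtain ⟨s, rfl⟩ := h; exact e s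
  | zero => exact zero
  | add x y _ _ hx hy => exact add x y hx hy
  | smul a x _ hx => exact smul a x hx

theorem frobLift1_mem_range (m : LogForm1 ι I) :
    K.frobLift1 m ∈ LinearMap.range (ExteriorAlgebra.ι (A ⧸ I) (M := LogForm1 ι I)) := by
  induction m using K.induction_basis with
  | e s => rw [frobLift1_e]; exact ⟨_, rfl⟩
  | zero => rw [map_zero]; exact zero_mem _
  | add x y hx hy => rw [map_add]; exact add_mem hx hy
  | smul r x hx => rw [frobLift1_smul]; exact Submodule.smul_mem _ _ hx

/-- The Frobenius lift on forms, as an algebra homomorphism to the forms viewed as an algebra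
through
the Frobenius. -/
def frobLiftAux : LogForms ι I →ₐ[A ⧸ I] FrobForms p ι I :=
  ExteriorAlgebra.lift (A ⧸ I) ⟨K.frobLift1Aux, fun x ↦ by
    obtain ⟨m, hm⟩ := K.frobLift1_mem_range x
    have := ExteriorAlgebra.ι_sq_zero (R := A ⧸ I) m
    rw [hm] at this
    exact this⟩

/-- The Frobenius lift: the Frobenius-semilinear ring endomorphism of the forms that
fixes the basis `e`. -/
def frobLift : LogForms ι I →+* LogForms ι I :=
  (FrobForms.equiv p ι I).symm.toRingHom.comp K.frobLiftAux.toRingHom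

theorem frobLift_algebraMap (r : A ⧸ I) :
    K.frobLift (algebraMap _ _ r) = algebraMap _ _ (r ^ p) :=
  congrArg (FrobForms.equiv p ι I).symm (AlgHom.commutes K.frobLiftAux r)

theorem frobLift_ι (m : LogForm1 ι I) :
    K.frobLift (ExteriorAlgebra.ι (A ⧸ I) m) = K.frobLift1 m :=
  congrArg (FrobForms.equiv p ι I).symm (ExteriorAlgebra.lift_ι_apply ..)

theorem frobLift_smul (r : A ⧸ I) (x : LogForms ι I) :
    K.frobLift (r • x) = r ^ p • K.frobLift x := by
  rw [Algebra.smul_def, map_mul, frobLift_algebraMap, Algebra.smul_def]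

theorem frobLift_ι_e (s : K.σ) :
    K.frobLift (ExteriorAlgebra.ι (A ⧸ I) (K.e s)) = ExteriorAlgebra.ι (A ⧸ I) (K.e s) := by
  rw [frobLift_ι, frobLift1_e]

theorem frobLift_mem {q : ℕ} {x : LogForms ι I} (hx : x ∈ LogForm ι I q) :
    K.frobLift x ∈ LogForm ι I q := by
  change x ∈ LinearMap.range _ ^ q at hx
  induction hx using Submodule.pow_induction_on_left' with
  | algebraMap r =>
    rw [frobLift_algebraMap]
    change _ ∈ LinearMap.range _ ^ 0
    rw [pow_zero]
    exact Submodule.algebraMap_mem _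
  | add x y i _ _ hx hy => rw [map_add]; exact add_mem hx hy
  | mem_mul m hm i x hx ih =>
    obtain ⟨m, rfl⟩ := hm
    rw [map_mul, frobLift_ι]
    change _ ∈ LinearMap.range _ ^ (i + 1)
    rw [pow_succ']
    exact Submodule.mul_mem_mul (K.frobLift1_mem_range m) ih

theorem extD_inv_smul_d (b : (A ⧸ I)ˣ) : extD ι I (ExteriorAlgebra.ι (A ⧸ I)
    ((↑b⁻¹ : A ⧸ I) • LogForm1.d ι I b)) = 0 := by
  have h : LogForm1.d ι I (↑b⁻¹ : A ⧸ I) =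
      -((↑b⁻¹ : A ⧸ I) * ↑b⁻¹) • LogForm1.d ι I b := by
    have h1 := (LogForm1.d ι I).leibniz (b : A ⧸ I) (↑b⁻¹ : A ⧸ I)
    rw [Units.mul_inv, Derivation.map_one_eq_zero] at h1
    have h2 := congrArg (fun m ↦ (↑b⁻¹ : A ⧸ I) • m) h1
    simp only [smul_zero, smul_add, smul_smul, Units.inv_mul, one_smul] at h2
    rw [neg_smul]
    exact eq_neg_of_add_eq_zero_left h2.symm
  rw [map_smul, extD_smul, extD_d, smul_zero, add_zero, h, ι_smul_mul, ExteriorAlgebra.ι_sq_zero,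
    smul_zero]

theorem extD_e (s : K.σ) : extD ι I (ExteriorAlgebra.ι (A ⧸ I) (K.e s)) = 0 := by
  rcases K.e_eq s with ⟨y, hy⟩ | ⟨b, hb⟩
  · rw [hy, extD_dlog]
  · rw [hb, extD_inv_smul_d]

theorem d_pow (r : A ⧸ I) : LogForm1.d ι I (r ^ p) = 0 := by
  rw [Derivation.leibniz_pow, ← Nat.cast_smul_eq_nsmul (A ⧸ I), (Fact.out : (p : A ⧸ I) = 0),
    zero_smul]

theorem extD_pow_smul (r : A ⧸ I) (x : LogForms ι I) :
    extD ι I (r ^ p • x) = r ^ p • extD ι I x := by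
  rw [extD_smul, d_pow, map_zero, zero_mul, zero_add]

theorem extD_frobLift (x : LogForms ι I) : extD ι I (K.frobLift x) = 0 := by
  induction x using ExteriorAlgebra.induction with
  | algebraMap r => rw [frobLift_algebraMap, extD_algebraMap, d_pow, map_zero]
  | ι n =>
    rw [frobLift_ι]
    induction n using K.induction_basis with
    | e s => rw [frobLift1_e, extD_e]
    | zero => rw [map_zero, map_zero]
    | add x y hx hy => rw [map_add, map_add, hx, hy, add_zero]
    | smul r x hx => rw [frobLift1_smul, extD_pow_smul, hx, smul_zero]
  | mul a b ha hb => rw [map_mul, extD_mul, ha, hb, zero_mul, mul_zero, add_zero]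
  | add a b ha hb => rw [map_add, map_add, ha, hb, add_zero]

/-! ### Expansion of forms in monomials -/

/-- The standard basis of the algebra of forms, by products of the `e_s`. -/
def formBasis : Module.Basis (Finset K.σ) (A ⧸ I) (LogForms ι I) := K.e.ExteriorAlgebra

theorem frobLift_formBasis (T : Finset K.σ) : K.frobLift (K.formBasis T) = K.formBasis T := by
  rw [formBasis, ExteriorAlgebra.basis_apply]
  unfold ExteriorAlgebra.ιMulti_family
  rw [ExteriorAlgebra.ιMulti_apply, map_list_prod, List.map_ofFn]
  congr 2
  funext i
  exact K.frobLift_ι_e _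

theorem formBasis_repr_frobLift (x : LogForms ι I) (T : Finset K.σ) :
    K.formBasis.repr (K.frobLift x) T = K.formBasis.repr x T ^ p := by
  rw [← frob_apply]
  have hx := K.formBasis.mem_span x
  induction hx using Submodule.span_induction with
  | mem x h =>
    obtain ⟨S, rfl⟩ := h
    rw [frobLift_formBasis, K.formBasis.repr_self, Finsupp.single_apply]
    split_ifs
    · rw [map_one]
    · rw [map_zero]
  | zero => simp only [map_zero, Finsupp.zero_apply]
  | add x y _ _ hx hy => simp only [map_add, Finsupp.add_apply, hx, hy]
  | smul r x _ hx =>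
    rw [frobLift_smul, map_smul, Finsupp.smul_apply, hx, map_smul, Finsupp.smul_apply,
      smul_eq_mul, smul_eq_mul, map_mul, frob_apply p r]

attribute [irreducible] frobLift frobLift1

end LogCoordinates

end Coordinates

/-! ### The local Cartier isomorphism -/

section LocalCartier

variable {p : ℕ} [Fact p.Prime] {A B : Type u} [CommRing A] [CommRing B] {ι : A →+* B} {I : Ideal A}

theorem exists_natCast_mul_eq_one {R : Type*} [CommRing R] [Fact ((p : R) = 0)] {k : ℕ}
    (h : (k : ZMod p) ≠ 0) : ∃ k' : ℕ, (k' : R) * k = 1 := by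
  obtain ⟨k', hk'⟩ : ∃ k' : ℕ, (k' : ZMod p) * k = 1 :=
    ⟨((k : ZMod p)⁻¹).val, by rw [ZMod.natCast_val, ZMod.cast_id, inv_mul_cancel₀ h]⟩
  refine ⟨k', ?_⟩
  have hp : p ∣ k' * k - 1 ∨ False := by
    left
    have h1 : ((k' * k : ℕ) : ZMod p) = (1 : ℕ) := by push_cast; exact hk'
    rw [ZMod.natCast_eq_natCast_iff] at h1
    rcases Nat.eq_zero_or_pos (k' * k) with h0 | h0
    · rw [h0]; simp
    · exact (Nat.modEq_iff_dvd' h0).1 h1.symm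
  have hpos : 1 ≤ k' * k := by
    by_contra h0
    have : k' * k = 0 := by omega
    have h2 : ((k' * k : ℕ) : ZMod p) = 0 := by rw [this]; simp
    rw [Nat.cast_mul, hk'] at h2
    exact one_ne_zero h2
  obtain ⟨c, hc⟩ := hp.resolve_right id
  have : ((k' * k : ℕ) : R) = 1 := by
    rw [show k' * k = p * c + 1 by omega]
    push_cast
    rw [(Fact.out : (p : R) = 0)]
    ring
  exact_mod_cast this

theorem natCast_eq_zero_of_zmod {R : Type*} [CommRing R] [Fact ((p : R) = 0)] {k : ℕ}
    (h : (k : ZMod p) = 0) : (k : R) = 0 := by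
  obtain ⟨c, rfl⟩ := (ZMod.natCast_eq_zero_iff _ _).1 h
  rw [Nat.cast_mul, (Fact.out : (p : R) = 0), zero_mul]

namespace LogCoordinates

variable [Fact ((p : A ⧸ I) = 0)] (K : LogCoordinates p ι I)

/-- The expansion `(η_α)_α ↦ ∑ x^α G(η_α)`, where `G` is the Frobenius lift. -/
def formExpand : ((K.σ →₀ ZMod p) →₀ LogForms ι I) →+ LogForms ι I :=
  Finsupp.liftAddHom fun α ↦
    (DistribSMul.toAddMonoidHom _ (mon p K.x α)).comp K.frobLift.toAddMonoidHom

@[simp] theorem formExpand_single (α : K.σ →₀ ZMod p) (η : LogForms ι I) :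
    K.formExpand (Finsupp.single α η) = mon p K.x α • K.frobLift η := by
  rw [formExpand, Finsupp.liftAddHom_apply_single]
  rfl

theorem formBasis_repr_formExpand (c : (K.σ →₀ ZMod p) →₀ LogForms ι I) (T : Finset K.σ) :
    K.formBasis.repr (K.formExpand c) T =
      pExpand p K.x (c.mapRange (fun η ↦ K.formBasis.repr η T) (by simp)) := by
  induction c using Finsupp.induction_linear with
  | zero => simp
  | add c d hc hd =>
    rw [map_add, map_add, Finsupp.add_apply, hc, hd, ← map_add, ← Finsupp.mapRange_add]
    intro x y
    rw [map_add, Finsupp.add_apply]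
  | single α c =>
    rw [formExpand_single, Finsupp.mapRange_single, pExpand_single, map_smul, Finsupp.smul_apply,
      formBasis_repr_frobLift, smul_eq_mul]

/-- Every form is a sum of terms `x^α G(η_α)`, as the functions are generated by the monomials over
the `p`-th powers. -/
theorem formExpand_surjective : Function.Surjective K.formExpand := by
  intro ω
  change ω ∈ K.formExpand.range
  have hx := K.formBasis.mem_span ω
  induction hx using Submodule.span_induction with
  | mem x h =>
    obtain ⟨S, rfl⟩ := h
    exact ⟨Finsupp.single 0 (K.formBasis S), by
      rw [formExpand_single, mon_zero, one_smul, frobLift_formBasis]⟩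
  | zero => exact zero_mem _
  | add x y _ _ hx hy => exact add_mem hx hy
  | smul r x _ hx =>
    obtain ⟨c, rfl⟩ := hx
    obtain ⟨d, rfl⟩ := K.surjective r
    clear * -
    induction d using Finsupp.induction_linear with
    | zero => rw [map_zero, zero_smul]; exact zero_mem _
    | add d d' hd hd' => rw [map_add, add_smul]; exact add_mem hd hd'
    | single α a =>
      induction c using Finsupp.induction_linear with
      | zero => rw [map_zero, smul_zero]; exact zero_mem _
      | add c c' hc hc' => rw [map_add, smul_add]; exact add_mem hc hc'
      | single β η =>
        obtain ⟨z, hz⟩ := exists_mon_mul_mon (p := p) K.x α β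
        refine ⟨Finsupp.single (α + β) ((z * a) • η), ?_⟩
        rw [formExpand_single, pExpand_single, formExpand_single, frobLift_smul, smul_smul,
          smul_smul]
        congr 1
        rw [mul_pow]
        linear_combination (-(a ^ p)) * hz

theorem exists_eq_smul_iff (a : A ⧸ I) (ω : LogForms ι I) :
    (∃ η : LogForms ι I, ω = a • η) ↔ ∀ T, K.formBasis.repr ω T ∈ Ideal.span {a} := by
  constructor
  · rintro ⟨η, rfl⟩ T
    rw [map_smul, Finsupp.smul_apply, smul_eq_mul, mul_comm]
    exact Ideal.mul_mem_left _ _ (Ideal.mem_span_singleton_self a)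
  · intro h
    choose f hf using fun T ↦ Ideal.mem_span_singleton'.1 (h T)
    refine ⟨∑ T ∈ (K.formBasis.repr ω).support, f T • K.formBasis T, ?_⟩
    conv_lhs => rw [← K.formBasis.linearCombination_repr ω]
    rw [Finsupp.linearCombination_apply, Finsupp.sum, Finset.smul_sum]
    refine Finset.sum_congr rfl fun T _ ↦ ?_
    rw [smul_smul, mul_comm, hf]

open Classical in
theorem exists_eq_smul_of_formExpand {L : Finset K.σ} (hL : ↑L ⊆ K.J)
    {c : (K.σ →₀ ZMod p) →₀ LogForms ι I}
    (h : ∃ η, K.formExpand c = (∏ s ∈ L, K.x s) • η) (α : K.σ →₀ ZMod p) :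
    ∃ η, c α = (∏ s ∈ L with α s = 0, K.x s) • η := by
  rw [K.exists_eq_smul_iff] at h ⊢
  intro T
  have := h T
  rw [formBasis_repr_formExpand] at this
  exact K.mem_of_mem L hL _ this α

/-- The form `∑ a_s e_s`. -/
def weight : (K.σ →₀ ℕ) →+ LogForm1 ι I :=
  Finsupp.liftAddHom fun s ↦ (AddMonoidHom.flip (smulAddHom ℕ (LogForm1 ι I))) (K.e s)

@[simp] theorem weight_single (s : K.σ) (n : ℕ) : K.weight (Finsupp.single s n) = n • K.e s := by
  rw [weight, Finsupp.liftAddHom_apply_single]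
  rfl

theorem coord_weight (a : K.σ →₀ ℕ) (s : K.σ) : K.e.coord s (K.weight a) = a s := by
  induction a using Finsupp.induction_linear with
  | zero => simp
  | add a b ha hb => rw [map_add, map_add, ha, hb, Finsupp.add_apply, Nat.cast_add]
  | single t n =>
    classical
    rw [weight_single, map_nsmul, Module.Basis.coord_apply, Module.Basis.repr_self,
      Finsupp.single_apply, Finsupp.single_apply]
    split_ifs <;> simp

theorem weight_eq_zero {a : K.σ →₀ ℕ} (h : ∀ s, (a s : ZMod p) = 0) : K.weight a = 0 := by
  refine K.e.ext_elem fun s ↦ ?_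
  rw [map_zero, Finsupp.zero_apply, ← Module.Basis.coord_apply, K.coord_weight,
    natCast_eq_zero_of_zmod (p := p) (R := A ⧸ I) (h s)]

theorem frobLift_ι_weight (a : K.σ →₀ ℕ) :
    K.frobLift (ExteriorAlgebra.ι (A ⧸ I) (K.weight a)) =
      ExteriorAlgebra.ι (A ⧸ I) (K.weight a) := by
  induction a using Finsupp.induction_linear with
  | zero => simp
  | add a b ha hb => rw [map_add, map_add, map_add, ha, hb]
  | single t n => rw [weight_single, map_nsmul, map_nsmul, frobLift_ι_e]

/-- The exponent vector in `ℕ` of a monomial. -/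
def lift (α : K.σ →₀ ZMod p) : K.σ →₀ ℕ := α.mapRange ZMod.val ZMod.val_zero

theorem d_mon (α : K.σ →₀ ZMod p) :
    LogForm1.d ι I (mon p K.x α) = mon p K.x α • K.weight (K.lift α) := by
  have key (F : Finset K.σ) (a : K.σ → ℕ) : LogForm1.d ι I (∏ s ∈ F, K.x s ^ a s) =
      (∏ s ∈ F, K.x s ^ a s) • ∑ s ∈ F, a s • K.e s := by
    classical
    induction F using Finset.induction_on with
    | empty => simp
    | insert s F hs ih =>
      rw [Finset.prod_insert hs, Finset.sum_insert hs, Derivation.leibniz, ih,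
        Derivation.leibniz_pow, K.d_x, smul_smul, smul_add, add_comm]
      congr 1
      rcases Nat.eq_zero_or_pos (a s) with h | h
      · simp [h]
      · rw [smul_smul, smul_comm, smul_smul, ← pow_succ, Nat.sub_add_cancel h,
          smul_comm _ (a s), mul_comm]
  have h1 : K.weight (K.lift α) = ∑ s ∈ α.support, (α s).val • K.e s := by
    rw [weight, Finsupp.liftAddHom_apply, lift, Finsupp.sum_mapRange_index fun s ↦ map_zero _]
    rfl
  rw [h1]
  exact key _ fun s ↦ (α s).val

/-- The differential `ω ↦ dω + (∑ n_s e_s) ∧ ω`. -/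
def twistedExtD (n : K.σ →₀ ℕ) : LogForms ι I →+ LogForms ι I :=
  extD ι I + AddMonoidHom.mulLeft (ExteriorAlgebra.ι (A ⧸ I) (K.weight n))

theorem twistedExtD_apply (n : K.σ →₀ ℕ) (ω : LogForms ι I) :
    K.twistedExtD n ω = extD ι I ω + ExteriorAlgebra.ι (A ⧸ I) (K.weight n) * ω := rfl

theorem twistedExtD_mon_smul (n : K.σ →₀ ℕ) (α : K.σ →₀ ZMod p) (η : LogForms ι I) :
    K.twistedExtD n (mon p K.x α • K.frobLift η) = mon p K.x α •
      K.frobLift (ExteriorAlgebra.ι (A ⧸ I) (K.weight (K.lift α + n)) * η) := by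
  rw [twistedExtD_apply, extD_smul, extD_frobLift, smul_zero, add_zero, d_mon, map_mul,
    frobLift_ι_weight, map_add, map_add, ι_smul_mul, mul_smul_comm, add_mul, smul_add]

/-- The endomorphism of the coefficients of the expansion that corresponds to the differential. -/
def weightMul (n : K.σ →₀ ℕ) :
    ((K.σ →₀ ZMod p) →₀ LogForms ι I) →+ ((K.σ →₀ ZMod p) →₀ LogForms ι I) :=
  Finsupp.liftAddHom fun α ↦ (Finsupp.singleAddHom α).comp
    (AddMonoidHom.mulLeft (ExteriorAlgebra.ι (A ⧸ I) (K.weight (K.lift α + n))))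

theorem weightMul_single (n : K.σ →₀ ℕ) (α : K.σ →₀ ZMod p) (η : LogForms ι I) :
    K.weightMul n (Finsupp.single α η) =
      Finsupp.single α (ExteriorAlgebra.ι (A ⧸ I) (K.weight (K.lift α + n)) * η) := by
  rw [weightMul, Finsupp.liftAddHom_apply_single]
  rfl

theorem weightMul_apply (n : K.σ →₀ ℕ) (c : (K.σ →₀ ZMod p) →₀ LogForms ι I)
    (α : K.σ →₀ ZMod p) :
    K.weightMul n c α = ExteriorAlgebra.ι (A ⧸ I) (K.weight (K.lift α + n)) * c α := by
  induction c using Finsupp.induction_linear with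
  | zero => simp
  | add c d hc hd => rw [map_add, Finsupp.add_apply, hc, hd, Finsupp.add_apply, mul_add]
  | single β η =>
    classical
    rw [weightMul_single, Finsupp.single_apply, Finsupp.single_apply]
    split_ifs with h
    · rw [h]
    · rw [mul_zero]

theorem twistedExtD_formExpand (n : K.σ →₀ ℕ) (c : (K.σ →₀ ZMod p) →₀ LogForms ι I) :
    K.twistedExtD n (K.formExpand c) = K.formExpand (K.weightMul n c) := by
  induction c using Finsupp.induction_linear with
  | zero => simp
  | add c d hc hd => simp only [map_add, hc, hd]
  | single β η => rw [formExpand_single, weightMul_single, formExpand_single, twistedExtD_mon_smul]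

/-- The exponent `-n` modulo `p`. -/
def negExp (n : K.σ →₀ ℕ) : K.σ →₀ ZMod p := n.mapRange (fun k : ℕ ↦ -(k : ZMod p)) (by simp)

theorem negExp_apply (n : K.σ →₀ ℕ) (s : K.σ) : K.negExp n s = -(n s : ZMod p) := rfl

theorem lift_add_cast (α : K.σ →₀ ZMod p) (n : K.σ →₀ ℕ) (s : K.σ) :
    (((K.lift α + n) s : ℕ) : ZMod p) = α s + n s := by
  rw [Finsupp.add_apply, Nat.cast_add, lift, Finsupp.mapRange_apply, ZMod.natCast_val,
    ZMod.cast_id]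

open Classical in
theorem prod_dvd_mon_mul (L : Finset K.σ) (α : K.σ →₀ ZMod p) :
    (∏ s ∈ L, K.x s) ∣ mon p K.x α * (∏ s ∈ L with α s = 0, K.x s) ^ p := by
  rw [← Finset.prod_filter_mul_prod_filter_not L (fun s ↦ α s = 0), mul_comm (mon p K.x α)]
  refine mul_dvd_mul (dvd_pow_self _ (Fact.out : p.Prime).ne_zero) ?_
  rw [mon, Finsupp.prod]
  refine (Finset.prod_dvd_prod_of_subset _ α.support K.x fun s hs ↦
    Finsupp.mem_support_iff.2 (Finset.mem_filter.1 hs).2).trans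
    (Finset.prod_dvd_prod_of_dvd _ _ fun s hs ↦ ?_)
  · exact dvd_pow_self _ (by rw [Ne, ZMod.val_eq_zero]; exact Finsupp.mem_support_iff.1 hs)

/-- A form whose twisted differential vanishes modulo `∏_L x` is, modulo exact forms and modulo
`∏_L x`, of the form `x^{-n} G(ω')`: for an exponent `α ≠ -n`, some coordinate of
`∑ (α_s + n_s) e_s` is a unit, and contraction with it is a homotopy. -/
theorem exists_of_twistedExtD {n : K.σ →₀ ℕ} {L : Finset K.σ} (hL : ↑L ⊆ K.J) {ω : LogForms ι I}
    (h : ∃ η, K.twistedExtD n ω = (∏ s ∈ L, K.x s) • η) :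
    ∃ ω' η ζ, ω = mon p K.x (K.negExp n) • K.frobLift ω' + K.twistedExtD n η +
      (∏ s ∈ L, K.x s) • ζ := by
  classical
  let f₁ : LogForms ι I →+ LogForms ι I :=
    (DistribSMul.toAddMonoidHom _ (mon p K.x (K.negExp n))).comp K.frobLift.toAddMonoidHom
  let f₃ : LogForms ι I →+ LogForms ι I := DistribSMul.toAddMonoidHom _ (∏ s ∈ L, K.x s)
  suffices hmem : ω ∈ f₁.range ⊔ (K.twistedExtD n).range ⊔ f₃.range by
    obtain ⟨a, ha, _, ⟨ζ, rfl⟩, rfl⟩ := AddSubgroup.mem_sup.1 hmem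
    obtain ⟨_, ⟨ω', rfl⟩, _, ⟨η, rfl⟩, rfl⟩ := AddSubgroup.mem_sup.1 ha
    exact ⟨ω', η, ζ, rfl⟩
  obtain ⟨c, rfl⟩ := K.formExpand_surjective ω
  rw [twistedExtD_formExpand] at h
  have hc := K.exists_eq_smul_of_formExpand hL h
  have e : K.formExpand c = ∑ α ∈ c.support, mon p K.x α • K.frobLift (c α) := by
    rw [formExpand, Finsupp.liftAddHom_apply]
    rfl
  rw [e]
  refine sum_mem fun α _ ↦ ?_
  -- the part with exponent `-n` is the first term of the decomposition
  by_cases hα : α = K.negExp n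
  · refine AddSubgroup.mem_sup_left (AddSubgroup.mem_sup_left ⟨c α, ?_⟩)
    rw [hα]
    rfl
  · obtain ⟨s, hs⟩ : ∃ s, α s ≠ K.negExp n s := by
      by_contra! h
      exact hα (Finsupp.ext h)
    obtain ⟨k', hk'⟩ := exists_natCast_mul_eq_one (p := p) (R := A ⧸ I)
      (k := (K.lift α + n) s) (by
        rw [lift_add_cast]
        rw [negExp_apply] at hs
        exact fun h ↦ hs (eq_neg_of_add_eq_zero_left h))
    obtain ⟨ζ, hζ⟩ := hc α
    rw [weightMul_apply] at hζ
    set θ := K.weight (K.lift α + n)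
    -- on the other parts, contraction with a dual vector at which `θ` is invertible is a homotopy
    let i : LogForms ι I →ₗ[A ⧸ I] LogForms ι I :=
      CliffordAlgebra.contractLeft (Q := (0 : QuadraticForm (A ⧸ I) (LogForm1 ι I))) (K.e.coord s)
    have hi : i (ExteriorAlgebra.ι (A ⧸ I) θ * c α) =
        (((K.lift α + n) s : ℕ) : A ⧸ I) • c α - ExteriorAlgebra.ι (A ⧸ I) θ * i (c α) :=
      (CliffordAlgebra.contractLeft_ι_mul _ θ (c α)).trans (by rw [coord_weight])
    have h1 : c α = (∏ s ∈ L with α s = 0, K.x s) • ((k' : A ⧸ I) • i ζ) +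
        ExteriorAlgebra.ι (A ⧸ I) θ * ((k' : A ⧸ I) • i (c α)) := by
      rw [hζ, map_smul] at hi
      rw [smul_comm, hi, smul_sub, smul_smul, hk', one_smul, mul_smul_comm, sub_add_cancel]
    obtain ⟨z, hz⟩ := K.prod_dvd_mon_mul L α
    rw [h1, map_add, smul_add, frobLift_smul, ← twistedExtD_mon_smul, smul_smul, hz, mul_smul]
    refine add_mem (AddSubgroup.mem_sup_right ⟨_, rfl⟩)
      (AddSubgroup.mem_sup_left (AddSubgroup.mem_sup_right ⟨_, rfl⟩))

open Classical in
theorem exists_of_mon_smul_frobLift {n : K.σ →₀ ℕ} {L : Finset K.σ} (hL : ↑L ⊆ K.J)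
    {ω η : LogForms ι I}
    (h : ∃ ζ, mon p K.x (K.negExp n) • K.frobLift ω + K.twistedExtD n η =
      (∏ s ∈ L, K.x s) • ζ) : ∃ ζ, ω = (∏ s ∈ L with (n s : ZMod p) = 0, K.x s) • ζ := by
  obtain ⟨c, rfl⟩ := K.formExpand_surjective η
  rw [twistedExtD_formExpand, ← formExpand_single, ← map_add] at h
  obtain ⟨ζ, hζ⟩ := K.exists_eq_smul_of_formExpand hL h (K.negExp n)
  refine ⟨ζ, ?_⟩
  -- the differential vanishes on the part with exponent `-n`
  rw [Finsupp.add_apply, Finsupp.single_eq_same, weightMul_apply, K.weight_eq_zero fun s ↦ by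
    rw [lift_add_cast, negExp_apply, neg_add_cancel], map_zero, zero_mul, add_zero] at hζ
  simpa only [negExp_apply, neg_eq_zero] using hζ

attribute [irreducible] weight twistedExtD formExpand weightMul negExp lift

end LogCoordinates

end LocalCartier

/-! ### Homogeneous components -/

section Grading

variable {A B : Type u} [CommRing A] [CommRing B] {ι : A →+* B} {I : Ideal A}

variable (ι I) in
/-- The homogeneous component of degree `q` of a form. -/
def formProj (q : ℕ) : LogForms ι I →+ LogForms ι I :=
  GradedRing.proj (fun i : ℕ ↦ ⋀[A ⧸ I]^i (LogForm1 ι I)) q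

theorem formProj_mem (q : ℕ) (x : LogForms ι I) : formProj ι I q x ∈ LogForm ι I q :=
  SetLike.coe_mem _

theorem formProj_of_mem {q : ℕ} {x : LogForms ι I} (h : x ∈ LogForm ι I q) :
    formProj ι I q x = x :=
  DirectSum.decompose_of_mem_same (fun i : ℕ ↦ ⋀[A ⧸ I]^i (LogForm1 ι I)) h

theorem formProj_of_mem_ne {q r : ℕ} {x : LogForms ι I} (h : x ∈ LogForm ι I q) (hqr : q ≠ r) :
    formProj ι I r x = 0 :=
  DirectSum.decompose_of_mem_ne (fun i : ℕ ↦ ⋀[A ⧸ I]^i (LogForm1 ι I)) h hqr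

theorem form_induction {motive : LogForms ι I → Prop} (x : LogForms ι I) (zero : motive 0)
    (homogeneous : ∀ q, ∀ x ∈ LogForm ι I q, motive x)
    (add : ∀ x y, motive x → motive y → motive (x + y)) : motive x :=
  DirectSum.Decomposition.inductionOn (fun i : ℕ ↦ ⋀[A ⧸ I]^i (LogForm1 ι I)) zero
    (fun m ↦ homogeneous _ m m.2) add x

theorem formProj_comp {h : LogForms ι I →+ LogForms ι I} {k : ℕ}
    (hh : ∀ q, ∀ x ∈ LogForm ι I q, h x ∈ LogForm ι I (q + k)) (q : ℕ) (x : LogForms ι I) :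
    formProj ι I (q + k) (h x) = h (formProj ι I q x) := by
  induction x using form_induction with
  | zero => simp only [map_zero]
  | homogeneous r x hx =>
    by_cases hr : r = q
    · subst hr
      rw [formProj_of_mem (hh _ x hx), formProj_of_mem hx]
    · rw [formProj_of_mem_ne (hh _ x hx) (by omega), formProj_of_mem_ne hx hr, map_zero]
  | add x y hx hy => simp only [map_add, hx, hy]

theorem formProj_zero_comp {h : LogForms ι I →+ LogForms ι I} {k : ℕ} (hk : k ≠ 0)
    (hh : ∀ q, ∀ x ∈ LogForm ι I q, h x ∈ LogForm ι I (q + k)) (x : LogForms ι I) :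
    formProj ι I 0 (h x) = 0 := by
  induction x using form_induction with
  | zero => simp only [map_zero]
  | homogeneous r x hx => rw [formProj_of_mem_ne (hh _ x hx) (by omega)]
  | add x y hx hy => rw [map_add, map_add, hx, hy, add_zero]

theorem formProj_smul (q : ℕ) (a : A ⧸ I) (x : LogForms ι I) :
    formProj ι I q (a • x) = a • formProj ι I q x :=
  (formProj_comp (h := DistribSMul.toAddMonoidHom _ a) (k := 0)
    (fun _ _ hx ↦ Submodule.smul_mem _ _ hx) q x)

end Grading

section

variable {p : ℕ} [Fact p.Prime] {A B : Type u} [CommRing A] [CommRing B] {ι : A →+* B} {I : Ideal A}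

namespace LogCoordinates

variable [Fact ((p : A ⧸ I) = 0)] (K : LogCoordinates p ι I)

theorem twistedExtD_mem (n : K.σ →₀ ℕ) {q : ℕ} {x : LogForms ι I} (hx : x ∈ LogForm ι I q) :
    K.twistedExtD n x ∈ LogForm ι I (q + 1) := by
  rw [twistedExtD_apply]
  refine add_mem (extD_mem ι I hx) ?_
  rw [add_comm]
  exact mul_mem (ι_mem ι I _) hx

theorem exists_mem_of_twistedExtD {n : K.σ →₀ ℕ} {L : Finset K.σ} (hL : ↑L ⊆ K.J) {q : ℕ}
    {ω : LogForms ι I} (hω : ω ∈ LogForm ι I (q + 1))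
    (h : ∃ η, K.twistedExtD n ω = (∏ s ∈ L, K.x s) • η) :
    ∃ ω' ∈ LogForm ι I (q + 1), ∃ η ∈ LogForm ι I q, ∃ ζ ∈ LogForm ι I (q + 1),
      ω = mon p K.x (K.negExp n) • K.frobLift ω' + K.twistedExtD n η + (∏ s ∈ L, K.x s) • ζ := by
  obtain ⟨ω', η, ζ, e⟩ := K.exists_of_twistedExtD hL h
  refine ⟨_, formProj_mem (q + 1) ω', _, formProj_mem q η, _, formProj_mem (q + 1) ζ, ?_⟩
  conv_lhs => rw [← formProj_of_mem hω, e]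
  rw [map_add, map_add, formProj_smul, formProj_smul,
    formProj_comp (k := 1) fun _ _ hx ↦ K.twistedExtD_mem n hx]
  congr 3
  exact formProj_comp (h := K.frobLift.toAddMonoidHom) (k := 0) (fun _ _ hx ↦ K.frobLift_mem hx) _ _

theorem exists_mem_of_twistedExtD_zero {n : K.σ →₀ ℕ} {L : Finset K.σ} (hL : ↑L ⊆ K.J)
    {ω : LogForms ι I} (hω : ω ∈ LogForm ι I 0)
    (h : ∃ η, K.twistedExtD n ω = (∏ s ∈ L, K.x s) • η) :
    ∃ ω' ∈ LogForm ι I 0, ∃ ζ ∈ LogForm ι I 0,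
      ω = mon p K.x (K.negExp n) • K.frobLift ω' + (∏ s ∈ L, K.x s) • ζ := by
  obtain ⟨ω', η, ζ, e⟩ := K.exists_of_twistedExtD hL h
  refine ⟨_, formProj_mem 0 ω', _, formProj_mem 0 ζ, ?_⟩
  conv_lhs => rw [← formProj_of_mem hω, e]
  rw [map_add, map_add, formProj_smul, formProj_smul,
    formProj_zero_comp one_ne_zero fun _ _ hx ↦ K.twistedExtD_mem n hx, add_zero]
  congr 2
  exact formProj_comp (h := K.frobLift.toAddMonoidHom) (k := 0) (fun _ _ hx ↦ K.frobLift_mem hx) _ _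

theorem exists_mem_eq_smul {a : A ⧸ I} {q : ℕ} {ω : LogForms ι I} (hω : ω ∈ LogForm ι I q)
    (h : ∃ ζ, ω = a • ζ) : ∃ ζ ∈ LogForm ι I q, ω = a • ζ := by
  obtain ⟨ζ, e⟩ := h
  refine ⟨_, formProj_mem q ζ, ?_⟩
  rw [← formProj_smul, ← e, formProj_of_mem hω]

/-! ### The Frobenius lift modulo exact forms -/

/-- Additivity of `a ↦ a^{p-1} da` modulo exact forms, by the universal polynomial
`((X + Y)^p - X^p - Y^p) / p`. -/
theorem exists_pow_smul_d_add {R M : Type*} [CommRing R] [AddCommGroup M] [Module R M]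
    (δ : Derivation ℤ R M) (a b : R) : ∃ r, (a + b) ^ (p - 1) • δ (a + b) =
      a ^ (p - 1) • δ a + b ^ (p - 1) • δ b + δ r := by
  have hp := (Fact.out : p.Prime)
  let X₀ : MvPolynomial (Fin 2) ℤ := MvPolynomial.X 0
  let X₁ : MvPolynomial (Fin 2) ℤ := MvPolynomial.X 1
  obtain ⟨P, hP⟩ : ∃ P, (X₀ + X₁) ^ p = X₀ ^ p + X₁ ^ p + p * P := by
    obtain ⟨r, hr⟩ := exists_add_pow_prime_eq hp X₀ X₁
    exact ⟨X₀ * X₁ * r, by rw [hr]; ring⟩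
  let φ : MvPolynomial (Fin 2) ℤ →ₐ[ℤ] R := MvPolynomial.aeval ![a, b]
  have key (f : MvPolynomial (Fin 2) ℤ) : δ (φ f) =
      φ (MvPolynomial.pderiv 0 f) • δ a + φ (MvPolynomial.pderiv 1 f) • δ b := by
    induction f using MvPolynomial.induction_on with
    | C n => simp [φ]
    | add f g hf hg => simp only [map_add, hf, hg, add_smul]; abel
    | mul_X f i hf =>
      rw [map_mul, Derivation.leibniz, hf, Derivation.leibniz, Derivation.leibniz]
      fin_cases i
      · simp [φ, MvPolynomial.pderiv_X, add_smul, mul_smul, smul_comm a]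
        abel
      · simp [φ, MvPolynomial.pderiv_X, add_smul, mul_smul, smul_comm b]
        abel
  -- differentiate the identity that defines `P` and divide by `p`
  have h0 : (X₀ + X₁) ^ (p - 1) = X₀ ^ (p - 1) + MvPolynomial.pderiv 0 P := by
    have := congrArg (MvPolynomial.pderiv 0) hP
    have hpp : ((p : ℕ) : MvPolynomial (Fin 2) ℤ) ≠ 0 := Nat.cast_ne_zero.2 hp.ne_zero
    refine mul_left_cancel₀ hpp ?_
    simp only [Derivation.leibniz_pow, map_add, Derivation.leibniz, X₀, X₁,
      MvPolynomial.pderiv_X, smul_eq_mul, nsmul_eq_mul, Derivation.map_natCast] at this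
    simp at this
    rw [this]; ring
  have h1 : (X₀ + X₁) ^ (p - 1) = X₁ ^ (p - 1) + MvPolynomial.pderiv 1 P := by
    have := congrArg (MvPolynomial.pderiv 1) hP
    have hpp : ((p : ℕ) : MvPolynomial (Fin 2) ℤ) ≠ 0 := Nat.cast_ne_zero.2 hp.ne_zero
    refine mul_left_cancel₀ hpp ?_
    simp only [Derivation.leibniz_pow, map_add, Derivation.leibniz, X₀, X₁,
      MvPolynomial.pderiv_X, smul_eq_mul, nsmul_eq_mul, Derivation.map_natCast] at this
    simp at this
    rw [this]; ring
  refine ⟨φ P, ?_⟩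
  have e0 := congrArg φ h0
  have e1 := congrArg φ h1
  simp only [map_add, map_pow, φ, X₀, X₁, MvPolynomial.aeval_X, Matrix.cons_val_zero,
    Matrix.cons_val_one] at e0 e1
  rw [key, map_add, smul_add]
  nth_rewrite 1 [e0]
  rw [e1, add_smul, add_smul]
  abel

/-- The Frobenius lift maps `da` to `a^{p-1} da` modulo exact forms. Both sides are additive in `a`
up to exact forms, and they are equal for `a = x^α b^p`. -/
theorem frobLift_ι_d (a : A ⧸ I) :
    K.frobLift (ExteriorAlgebra.ι (A ⧸ I) (LogForm1.d ι I a)) -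
      a ^ (p - 1) • ExteriorAlgebra.ι (A ⧸ I) (LogForm1.d ι I a) ∈ (extD ι I).range := by
  have hp := (Fact.out : p.Prime)
  obtain ⟨c, rfl⟩ := K.surjective a
  induction c using Finsupp.induction_linear with
  | zero => simp only [map_zero, smul_zero, sub_zero]; exact zero_mem _
  | add c c' hc hc' =>
    obtain ⟨r, hr⟩ := exists_pow_smul_d_add (p := p) (LogForm1.d ι I) (pExpand p K.x c)
      (pExpand p K.x c')
    have hr' : (pExpand p K.x c + pExpand p K.x c') ^ (p - 1) • ExteriorAlgebra.ι (A ⧸ I)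
          (LogForm1.d ι I (pExpand p K.x c + pExpand p K.x c')) =
        pExpand p K.x c ^ (p - 1) • ExteriorAlgebra.ι (A ⧸ I) (LogForm1.d ι I (pExpand p K.x c)) +
        pExpand p K.x c' ^ (p - 1) • ExteriorAlgebra.ι (A ⧸ I)
          (LogForm1.d ι I (pExpand p K.x c')) + ExteriorAlgebra.ι (A ⧸ I) (LogForm1.d ι I r) := by
      have := congrArg (ExteriorAlgebra.ι (A ⧸ I)) hr
      rw [map_add, map_add, map_smul, map_smul, map_smul] at this
      exact this
    rw [map_add (pExpand p K.x), hr']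
    have h1 : ExteriorAlgebra.ι (A ⧸ I) (LogForm1.d ι I r) ∈ (extD ι I).range :=
      ⟨algebraMap _ _ r, extD_algebraMap ι I r⟩
    have := sub_mem (add_mem hc hc') h1
    convert this using 1
    simp only [map_add]
    abel
  | single α b =>
    suffices K.frobLift (ExteriorAlgebra.ι (A ⧸ I) (LogForm1.d ι I (pExpand p K.x
        (Finsupp.single α b)))) - pExpand p K.x (Finsupp.single α b) ^ (p - 1) •
          ExteriorAlgebra.ι (A ⧸ I) (LogForm1.d ι I (pExpand p K.x (Finsupp.single α b))) = 0 by
      rw [this]; exact zero_mem _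
    have h1 : LogForm1.d ι I (mon p K.x α * b ^ p) =
        (mon p K.x α * b ^ p) • K.weight (K.lift α) := by
      rw [Derivation.leibniz, d_pow, smul_zero, zero_add, d_mon, smul_smul, mul_comm]
    rw [pExpand_single, h1, map_smul, frobLift_smul, frobLift_ι_weight, smul_smul, ← pow_succ,
      Nat.sub_add_cancel hp.one_le, sub_self]

/-- The Frobenius lift fixes `dlog y` modulo exact forms, whether or not `y` is a monomial in the
coordinates. -/
theorem frobLift_ι_dlog (y : Additive Bˣ) :
    K.frobLift (ExteriorAlgebra.ι (A ⧸ I) (LogForm1.dlog ι I y)) -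
      ExteriorAlgebra.ι (A ⧸ I) (LogForm1.dlog ι I y) ∈ (extD ι I).range := by
  have hp := (Fact.out : p.Prime)
  obtain ⟨b, n, h⟩ := K.dlog_eq y
  have h1 : K.frobLift (ExteriorAlgebra.ι (A ⧸ I) (n.sum fun s i ↦ i • K.e s)) =
      ExteriorAlgebra.ι (A ⧸ I) (n.sum fun s i ↦ i • K.e s) := by
    simp only [Finsupp.sum, map_sum, map_zsmul, frobLift_ι_e]
  obtain ⟨z, hz⟩ := K.frobLift_ι_d (b : A ⧸ I)
  refine ⟨(↑b⁻¹ : A ⧸ I) ^ p • z, ?_⟩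
  rw [extD_pow_smul, hz, h, map_add, map_add, h1, add_sub_add_right_eq_sub, smul_sub, smul_smul,
    map_smul, frobLift_smul]
  congr 2
  obtain ⟨k, hk⟩ := Nat.exists_eq_succ_of_ne_zero hp.ne_zero
  rw [hk, Nat.succ_sub_one, pow_succ, mul_right_comm, ← mul_pow, Units.inv_mul, one_pow, one_mul]

end LogCoordinates

/-- Two ring homomorphisms to closed forms agree modulo exact forms if they do so on generators. -/
theorem sub_mem_range_extD {A' B' : Type u} [CommRing A'] [CommRing B'] {ι' : A' →+* B'}
    {I' : Ideal A'} (g h : LogForms ι I →+* LogForms ι' I') (hg : ∀ x, extD ι' I' (g x) = 0)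
    (hh : ∀ x, extD ι' I' (h x) = 0) (h₀ : ∀ r : A ⧸ I, g (algebraMap _ _ r) = h (algebraMap _ _ r))
    (h₁ : ∀ m, g (ExteriorAlgebra.ι (A ⧸ I) m) - h (ExteriorAlgebra.ι (A ⧸ I) m) ∈
      (extD ι' I').range) (x : LogForms ι I) : g x - h x ∈ (extD ι' I').range := by
  induction x using ExteriorAlgebra.induction with
  | algebraMap r => rw [h₀, sub_self]; exact zero_mem _
  | ι n => exact h₁ n
  | mul a b ha hb =>
    have := add_mem (exact_mul_closed ha (hg b)) (closed_mul_exact (hh a) hb)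
    rw [sub_mul, mul_sub, sub_add_sub_cancel] at this
    rwa [map_mul g, map_mul h]
  | add a b ha hb =>
    rw [map_add g, map_add h, add_sub_add_comm]
    exact add_mem ha hb

/-- The Frobenius lifts of different coordinate systems agree modulo exact forms. -/
theorem pull_frobLift {Λ : Type v} {P Q : LogDatum.{u} Λ} [Fact ((p : P.A ⧸ P.I) = 0)]
    [Fact ((p : Q.A ⧸ Q.I) = 0)] (f : P ⟶ Q) (K : LogCoordinates p P.ι P.I)
    (K' : LogCoordinates p Q.ι Q.I) (x : P.Forms) :
    LogDatum.pull f (K.frobLift x) - K'.frobLift (LogDatum.pull f x) ∈ (extD Q.ι Q.I).range := by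
  have hK (x) : extD Q.ι Q.I (LogDatum.pull f (K.frobLift x)) = 0 := by
    rw [← pull_extD, K.extD_frobLift, map_zero]
  refine sub_mem_range_extD ((LogDatum.pull f).comp K.frobLift)
    (K'.frobLift.comp (LogDatum.pull f)) hK (fun x ↦ K'.extD_frobLift _) (fun r ↦ ?_)
    (fun n ↦ ?_) x
  · rw [RingHom.comp_apply, RingHom.comp_apply, K.frobLift_algebraMap, LogDatum.pull_algebraMap,
      LogDatum.pull_algebraMap, K'.frobLift_algebraMap, map_pow]
  · rw [RingHom.comp_apply, RingHom.comp_apply]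
    have hd {z : P.Forms} (hz : z ∈ (extD P.ι P.I).range) :
        LogDatum.pull f z ∈ (extD Q.ι Q.I).range := by
      obtain ⟨z, rfl⟩ := hz
      exact ⟨_, (pull_extD f z).symm⟩
    induction n using LogForm1.induction with
    | d r =>
      have h1 := hd (K.frobLift_ι_d r)
      have h2 := K'.frobLift_ι_d (LogDatum.Hom.quot f r)
      rw [map_sub, LogDatum.pull_smul, map_pow, LogDatum.pull_ι, LogDatum.pullForm1_d] at h1
      rw [LogDatum.pull_ι, LogDatum.pullForm1_d]
      have := sub_mem h1 h2
      rwa [sub_sub_sub_cancel_right] at this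
    | dlog y =>
      have h1 := hd (K.frobLift_ι_dlog y)
      have h2 := K'.frobLift_ι_dlog (Additive.ofMul (Units.map (f.ψ : P.B →* Q.B) y.toMul))
      rw [map_sub, LogDatum.pull_ι, LogDatum.pullForm1_dlog] at h1
      rw [LogDatum.pull_ι, LogDatum.pullForm1_dlog]
      have := sub_mem h1 h2
      rwa [sub_sub_sub_cancel_right] at this
    | zero => simp only [map_zero, sub_zero]; exact zero_mem _
    | add x y hx hy =>
      rw [map_add, map_add, map_add, map_add, map_add, add_sub_add_comm]
      exact add_mem hx hy
    | smul r x hx =>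
      obtain ⟨z, hz⟩ := hx
      refine ⟨LogDatum.Hom.quot f r ^ p • z, ?_⟩
      rw [LogCoordinates.extD_pow_smul, hz, map_smul, K.frobLift_smul, LogDatum.pull_smul,
        LogDatum.pull_smul, K'.frobLift_smul, map_pow, smul_sub]

end

/-! ### Charts -/

/-- In `J / J' ⊗ M`, where `J = (a)` and `J' = (a b)` with `a` a nonzerodivisor, the element
`a ⊗ ω` vanishes only if `ω` is a multiple of `b`. -/
theorem exists_of_mk_tmul_eq_zero {A M : Type*} [CommRing A] [AddCommGroup M] [Module A M]
    {J J' : Ideal A} {a b : A} (ha : a ∈ nonZeroDivisors A) (hJ : J = Ideal.span {a})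
    (hJ' : J' = Ideal.span {b * a}) (haJ : a ∈ J) {ω : M}
    (h : (Submodule.Quotient.mk ⟨a, haJ⟩ : J ⧸ J'.submoduleOf J) ⊗ₜ[A] ω = 0) :
    ∃ η, ω = b • η := by
  let f : A →ₗ[A] J ⧸ J'.submoduleOf J :=
    (Submodule.mkQ _).comp (LinearMap.toSpanSingleton A J ⟨a, haJ⟩)
  have hf : Function.Surjective f := by
    intro x
    obtain ⟨⟨x, hx⟩, rfl⟩ := Submodule.Quotient.mk_surjective _ x
    obtain ⟨c, hc⟩ := Ideal.mem_span_singleton'.1 (hJ ▸ hx)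
    exact ⟨c, congrArg Submodule.Quotient.mk (Subtype.ext hc)⟩
  have hker : LinearMap.ker f = Ideal.span {b} := by
    ext c
    have : f c = 0 ↔ c * a ∈ J' := by
      change Submodule.Quotient.mk _ = (0 : J ⧸ J'.submoduleOf J) ↔ _
      rw [Submodule.Quotient.mk_eq_zero]
      rfl
    rw [LinearMap.mem_ker, this, hJ', Ideal.mem_span_singleton, Ideal.mem_span_singleton]
    refine ⟨fun ⟨d, hd⟩ ↦ ⟨d, ?_⟩, fun h ↦ mul_dvd_mul h dvd_rfl⟩
    rw [← mul_cancel_right_mem_nonZeroDivisors ha, hd]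
    ring
  let e := LinearMap.quotKerEquivOfSurjective f hf
  have he : LinearEquiv.rTensor M e ((TensorProduct.quotTensorEquivQuotSMul M (LinearMap.ker
      f)).symm
      (Submodule.Quotient.mk ω)) = 0 := by
    rw [TensorProduct.quotTensorEquivQuotSMul_symm_mk, ← h, LinearEquiv.rTensor_tmul]
    congr 1
    exact congrArg Submodule.Quotient.mk (one_smul A _)
  rw [LinearEquiv.map_eq_zero_iff, LinearEquiv.map_eq_zero_iff, Submodule.Quotient.mk_eq_zero, hker,
    Submodule.ideal_span_singleton_smul, Submodule.mem_smul_pointwise_iff_exists] at he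
  obtain ⟨η, -, he⟩ := he
  exact ⟨η, he.symm⟩

namespace LogDatum

variable {Λ : Type v} {P : LogDatum.{u} Λ}

namespace Uniformizers

variable (t : P.Uniformizers)

/-- The element `∏ π_i ^ m_i`. -/
def pi (m : Λ →₀ ℕ) : P.A := m.prod fun i n ↦ t.π i ^ n

theorem pi_add (m n : Λ →₀ ℕ) : t.pi (m + n) = t.pi m * t.pi n := by
  classical
  exact Finsupp.prod_add_index' (fun _ ↦ pow_zero _) fun _ _ _ ↦ pow_add _ _ _

theorem pi_nsmul (p : ℕ) (m : Λ →₀ ℕ) : t.pi (p • m) = t.pi m ^ p := by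
  induction p with
  | zero => simp [pi]
  | succ n ih => rw [succ_nsmul, pi_add, ih, pow_succ]

theorem ideal_eq (m : Λ →₀ ℕ) : P.ideal m = Ideal.span {t.pi m} := by
  simp only [ideal, pi, Finsupp.prod, t.span_π, Ideal.span_singleton_pow, Ideal.prod_span_singleton]

theorem pi_mem_nonZeroDivisors (h : ∀ i, t.π i ∈ nonZeroDivisors P.A) (m : Λ →₀ ℕ) :
    t.pi m ∈ nonZeroDivisors P.A :=
  Submonoid.prod_mem _ fun i _ ↦ pow_mem (h i) _

/-- The surjection `ω ↦ ∏ π_i^{m_i} ⊗ ω`. -/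
def twist (m l : Λ →₀ ℕ) (q : ℕ) : P.Form q →+ P.TwistedForm m l q :=
  (TensorProduct.mk P.A _ _ (Submodule.Quotient.mk ⟨t.pi m, t.prod_mem m⟩)).toAddMonoidHom

theorem twist_apply (m l : Λ →₀ ℕ) (q : ℕ) (ω : P.Form q) :
    t.twist m l q ω = P.tmul (t.prod_mem m) ω := rfl

theorem tmul_smul' {m l : Λ →₀ ℕ} {q : ℕ} (a : P.A) {x : P.A} (hx : x ∈ P.ideal m) (h) (ω : P.Form
    q) :
    (P.tmul (l := l) (x := a * x) h ω) = P.tmul hx (Ideal.Quotient.mk P.I a • ω) := by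
  have : P.tmul hx (Ideal.Quotient.mk P.I a • ω) = P.tmul (l := l) hx (a • ω) := rfl
  rw [this, tmul, tmul, ← TensorProduct.smul_tmul]
  rfl

theorem tmul_eq_twist {m l : Λ →₀ ℕ} {q : ℕ} {a x : P.A} (h : x = a * t.pi m)
    (hx : x ∈ P.ideal m) (ω : P.Form q) :
    P.tmul (l := l) hx ω = t.twist m l q (Ideal.Quotient.mk P.I a • ω) := by
  subst h
  exact tmul_smul' a (t.prod_mem m) hx ω

theorem twist_surjective (m l : Λ →₀ ℕ) (q : ℕ) : Function.Surjective (t.twist m l q) := by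
  intro z
  change z ∈ (t.twist m l q).range
  induction z using TensorProduct.induction_on with
  | zero => exact zero_mem _
  | add x y hx hy => exact add_mem hx hy
  | tmul x ω =>
    obtain ⟨⟨x, hx⟩, rfl⟩ := Submodule.Quotient.mk_surjective _ x
    obtain ⟨a, ha⟩ := Ideal.mem_span_singleton'.1 (t.ideal_eq m ▸ hx)
    exact ⟨_, (t.tmul_eq_twist ha.symm hx ω).symm⟩

theorem exists_of_twist_eq_zero (ht : ∀ i, t.π i ∈ nonZeroDivisors P.A) {m l : Λ →₀ ℕ} {q : ℕ}
    {ω : P.Form q} (h : t.twist m l q ω = 0) :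
    ∃ η : P.Form q, ω = Ideal.Quotient.mk P.I (t.pi l) • η := by
  refine exists_of_mk_tmul_eq_zero (a := t.pi m) (b := t.pi l) (t.pi_mem_nonZeroDivisors ht m)
      (t.ideal_eq m)
    (by rw [t.ideal_eq, add_comm, pi_add]) (t.prod_mem m) h

theorem twist_smul_eq_zero (m l : Λ →₀ ℕ) {q : ℕ} (η : P.Form q) :
    t.twist m l q (Ideal.Quotient.mk P.I (t.pi l) • η) = 0 := by
  have hx : t.pi l * t.pi m ∈ P.ideal m := Ideal.mul_mem_left _ _ (t.prod_mem m)
  rw [← t.tmul_eq_twist rfl hx, tmul, (Submodule.Quotient.mk_eq_zero _).2, TensorProduct.zero_tmul]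
  change t.pi l * t.pi m ∈ P.ideal (m + l)
  rw [← pi_add, add_comm]
  exact t.prod_mem _

/-- A map on `I^{(m)}/I^{(m+l)} ⊗ ω̃^q`, from a map on `ω̃^q` that kills multiples of `π^l`. -/
def descend (ht : ∀ i, t.π i ∈ nonZeroDivisors P.A) {m l : Λ →₀ ℕ} {q : ℕ} {N : Type*}
    [AddCommGroup N] (g : P.Form q →+ N) (hg : ∀ η, g (Ideal.Quotient.mk P.I (t.pi l) • η) = 0) :
    P.TwistedForm m l q →+ N :=
  (t.twist m l q).liftOfSurjective (t.twist_surjective m l q) ⟨g, fun ω hω ↦ by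
    obtain ⟨η, rfl⟩ := t.exists_of_twist_eq_zero ht hω
    exact hg η⟩

theorem descend_twist (ht : ∀ i, t.π i ∈ nonZeroDivisors P.A) {m l : Λ →₀ ℕ} {q : ℕ} {N : Type*}
    [AddCommGroup N] (g : P.Form q →+ N) (hg) (ω : P.Form q) :
    t.descend (m := m) (l := l) ht g hg (t.twist m l q ω) = g ω :=
  AddMonoidHom.liftOfRightInverse_comp_apply ..

/-- The form `∑ m_i dlog(π_i)`. -/
def dlogSum (m : Λ →₀ ℕ) : LogForm1 P.ι P.I :=
  m.sum fun i n ↦ n • LogForm1.dlog P.ι P.I (Additive.ofMul (t.unit i))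

theorem dlogSum_add (m n : Λ →₀ ℕ) : t.dlogSum (m + n) = t.dlogSum m + t.dlogSum n := by
  classical
  exact Finsupp.sum_add_index' (fun _ ↦ zero_smul _ _) fun _ _ _ ↦ add_smul _ _ _

theorem coe_twistedD (m : Λ →₀ ℕ) {q : ℕ} (ω : P.Form q) :
    (t.twistedD m ω : P.Forms) = extD P.ι P.I ω + ExteriorAlgebra.ι _ (t.dlogSum m) * (ω : P.Forms)
        := by
  simp only [twistedD, dlogSum, Finsupp.sum, map_sum, Finset.sum_mul, Submodule.coe_add,
    Submodule.coe_sum, map_nsmul, smul_mul_assoc, Submodule.coe_smul_of_tower]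
  rfl

theorem twistedD_add (m : Λ →₀ ℕ) {q : ℕ} (ω η : P.Form q) :
    t.twistedD m (ω + η) = t.twistedD m ω + t.twistedD m η := Subtype.ext <| by
  rw [coe_twistedD, Submodule.coe_add, Submodule.coe_add, coe_twistedD, coe_twistedD, map_add,
    mul_add, add_add_add_comm]

theorem d_pi (m : Λ →₀ ℕ) : LogForm1.d P.ι P.I (Ideal.Quotient.mk P.I (t.pi m)) =
    Ideal.Quotient.mk P.I (t.pi m) • t.dlogSum m := by
  have h := LogForm1.d_mk P.ι P.I (t.pi m) (m.prod fun i n ↦ t.unit i ^ n) (by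
    simp [pi, Finsupp.prod, t.ι_π])
  rw [h]
  congr 1
  simp only [dlogSum, Finsupp.sum, Finsupp.prod, ofMul_prod, map_sum, ofMul_pow, map_nsmul]

/-- `D_m(π^l η) = π^l D_{m+l}(η)`. -/
theorem twistedD_pi_smul (m l : Λ →₀ ℕ) {q : ℕ} (η : P.Form q) :
    t.twistedD m (Ideal.Quotient.mk P.I (t.pi l) • η) =
      Ideal.Quotient.mk P.I (t.pi l) • t.twistedD (m + l) η := Subtype.ext <| by
  rw [coe_twistedD, Submodule.coe_smul, Submodule.coe_smul, coe_twistedD, extD_smul, d_pi,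
    ι_smul_mul, mul_smul_comm, ← smul_add, ← smul_add, dlogSum_add, map_add, add_mul]
  congr 1
  abel

theorem twistedD_twistedD (m : Λ →₀ ℕ) {q : ℕ} (η : P.Form q) :
    t.twistedD m (t.twistedD m η) = 0 := Subtype.ext <| by
  have h : extD P.ι P.I (ExteriorAlgebra.ι _ (t.dlogSum m)) = 0 := by
    simp only [dlogSum, Finsupp.sum, map_sum, map_nsmul, extD_dlog, smul_zero,
        Finset.sum_const_zero]
  rw [coe_twistedD, coe_twistedD, map_add, extD_extD, extD_ι_mul _ _ h, mul_add,
    ι_mul_ι_mul_self]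
  simp

/-- `D_m` as an additive map. -/
def twistedDHom (m : Λ →₀ ℕ) (q : ℕ) : P.Form q →+ P.Form (q + 1) :=
  AddMonoidHom.mk' (t.twistedD m) (t.twistedD_add m)

/-- The twisted differential on sections. -/
def differential (ht : ∀ i, t.π i ∈ nonZeroDivisors P.A) (m l : Λ →₀ ℕ) (q : ℕ) :
    P.TwistedForm m l q →+ P.TwistedForm m l (q + 1) :=
  t.descend ht ((t.twist m l (q + 1)).comp (t.twistedDHom m q)) fun η ↦ by
    change t.twist m l (q + 1) (t.twistedD m _) = 0
    rw [twistedD_pi_smul, twist_smul_eq_zero]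

theorem differential_twist (ht : ∀ i, t.π i ∈ nonZeroDivisors P.A) (m l : Λ →₀ ℕ) (q : ℕ)
    (ω : P.Form q) :
    t.differential ht m l q (t.twist m l q ω) = t.twist m l (q + 1) (t.twistedD m ω) :=
  t.descend_twist ht _ _ ω

theorem differential_differential (ht : ∀ i, t.π i ∈ nonZeroDivisors P.A) (m l : Λ →₀ ℕ) (q : ℕ)
    (z : P.TwistedForm m l q) :
    t.differential ht m l (q + 1) (t.differential ht m l q z) = 0 := by
  obtain ⟨ω, rfl⟩ := t.twist_surjective m l q z
  rw [differential_twist, differential_twist, twistedD_twistedD, map_zero]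

/-- The twisted differential is given by the same formula in terms of any elements of the ideals
of the components that become units. -/
theorem differential_tmul (ht : ∀ i, t.π i ∈ nonZeroDivisors P.A) (m l : Λ →₀ ℕ) (q : ℕ)
    {z : Λ → P.A} (hz : ∀ i, z i ∈ P.comp i) (v : Λ → P.Bˣ) (hv : ∀ i, P.ι (z i) = v i)
    (ω : P.Form q) (η : P.Form (q + 1))
    (hη : (η : P.Forms) = extD P.ι P.I ω + ExteriorAlgebra.ι _
      (m.sum fun i n ↦ n • LogForm1.dlog P.ι P.I (Additive.ofMul (v i))) * (ω : P.Forms)) :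
    t.differential ht m l q (P.tmul (P.prod_mem_ideal hz m) ω) =
      P.tmul (P.prod_mem_ideal hz m) η := by
  choose c hc using fun i ↦ Ideal.mem_span_singleton'.1 (t.span_π i ▸ hz i)
  let w (i : Λ) : P.Bˣ := v i * (t.unit i)⁻¹
  have hw (i) : P.ι (c i) = w i := by
    rw [Units.val_mul, Units.eq_mul_inv_iff_mul_eq, ← hv, ← hc, map_mul, t.ι_π]
  let C : P.A := m.prod fun i n ↦ c i ^ n
  have e : (m.prod fun i n ↦ z i ^ n) = C * t.pi m := by
    simp only [C, pi, Finsupp.prod, ← hc, mul_pow, Finset.prod_mul_distrib]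
  have hC := LogForm1.d_mk P.ι P.I C (m.prod fun i n ↦ w i ^ n) (by
    simp [C, Finsupp.prod, hw])
  have hsum : LogForm1.dlog P.ι P.I (Additive.ofMul (m.prod fun i n ↦ w i ^ n)) + t.dlogSum m =
      m.sum fun i n ↦ n • LogForm1.dlog P.ι P.I (Additive.ofMul (v i)) := by
    simp only [dlogSum, Finsupp.sum, Finsupp.prod, ofMul_prod, map_sum, ofMul_pow, map_nsmul,
      ← Finset.sum_add_distrib, ← smul_add, ← map_add, ← ofMul_mul, w]
    simp
  have key : t.twistedD m (Ideal.Quotient.mk P.I C • ω) = Ideal.Quotient.mk P.I C • η := by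
    refine Subtype.ext ?_
    rw [coe_twistedD, Submodule.coe_smul, Submodule.coe_smul, extD_smul, hC, ι_smul_mul,
      mul_smul_comm, ← smul_add, ← smul_add, hη, ← hsum, map_add, add_mul]
    congr 1
    abel
  have h₁ := t.tmul_eq_twist (l := l) e (P.prod_mem_ideal hz m) ω
  have h₂ := t.tmul_eq_twist (l := l) e (P.prod_mem_ideal hz m) η
  exact (congrArg (t.differential ht m l q) h₁).trans
    (((t.differential_twist ht m l q _).trans (congrArg _ key)).trans h₂.symm)

theorem pi_eq (m : Λ →₀ ℕ) : t.pi m = ∏ i ∈ m.support, t.π i ^ m i := rfl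

theorem dlogSum_zero : t.dlogSum 0 = 0 := Finsupp.sum_zero_index

theorem dlogSum_single (i : Λ) (k : ℕ) : t.dlogSum (Finsupp.single i k) =
    k • LogForm1.dlog P.ι P.I (Additive.ofMul (t.unit i)) :=
  Finsupp.sum_single_index (zero_smul _ _)

attribute [irreducible] pi dlogSum twist descend differential

end Uniformizers

end LogDatum

open LogDatum

/-- A chart: uniformizers of the components and logarithmic `p`-coordinates in which each
uniformizer is the product of some of the coordinates. -/
structure CartierChart {Λ : Type v} (P : LogDatum.{u} Λ) (p : ℕ) [Fact p.Prime]
    [Fact ((p : P.A ⧸ P.I) = 0)] extends LogCoordinates p P.ι P.I where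
  unif : P.Uniformizers
  nonZeroDivisors (i : Λ) : unif.π i ∈ nonZeroDivisors P.A
  S : Λ → Finset σ
  disjoint {i j : Λ} (h : i ≠ j) : Disjoint (S i) (S j)
  subset (i : Λ) : ↑(S i) ⊆ J
  mk_π (i : Λ) : Ideal.Quotient.mk P.I (unif.π i) = ∏ s ∈ S i, x s
  dlog_unit (i : Λ) : LogForm1.dlog P.ι P.I (Additive.ofMul (unif.unit i)) = ∑ s ∈ S i, e s

open LogDatum

attribute [local irreducible] Uniformizers.twistedD LogDatum.ideal LogForm.d extD

/-! ### The inverse Cartier map over a chart -/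

section

variable {Λ : Type v} {p : ℕ} [Fact p.Prime]

/-- The exponents of `p m' - m` are at most `p - 1`. -/
theorem lt_of_isLeast {m m' : Λ →₀ ℕ} (hm : IsLeast {n : Λ →₀ ℕ | m ≤ p • n} m') (i : Λ) :
    p * m' i < m i + p := by
  classical
  by_contra! h
  have hp := (Fact.out : p.Prime).pos
  have h1 : m' i ≠ 0 := by
    intro h0
    rw [h0] at h
    omega
  have h2 : m ≤ p • (m' - Finsupp.single i 1) := by
    intro j
    have hj := hm.1 j
    simp only [Finsupp.smul_apply, smul_eq_mul, Finsupp.tsub_apply, Finsupp.single_apply] at hj ⊢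
    split_ifs with hij
    · subst hij
      rw [Nat.mul_sub, mul_one]
      omega
    · simpa using hj
  have h3 := hm.2 h2 i
  simp only [Finsupp.tsub_apply, Finsupp.single_eq_same] at h3
  omega

end

section

variable {R E M : Type*} [CommRing R] [AddCommGroup E] [Module R E] [AddCommGroup M]

theorem eq_smul_of_coe {N : Submodule R E} {x y : N} {a : R} (h : (x : E) = a • (y : E)) :
    x = a • y :=
  Subtype.ext h

theorem coe_eq_smul {N : Submodule R E} {x y : N} {a : R} (h : x = a • y) :
    (x : E) = a • (y : E) :=
  congrArg Subtype.val h

theorem eq_smul_add_smul_of_coe {N : Submodule R E} {x y z : N} {a b : R}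
    (h : (x : E) = a • (y : E) + b • (z : E)) : x = a • y + b • z :=
  Subtype.ext h

theorem eq_smul_add_add_smul_of_coe {N : Submodule R E} {x y w z : N} {a b : R}
    (h : (x : E) = a • (y : E) + (w : E) + b • (z : E)) : x = a • y + w + b • z :=
  Subtype.ext h

theorem smul_sub_coe_eq_smul {N : Submodule R E} {x y z : N} {a b : R}
    (h : a • x - y = b • z) : a • (x : E) - (y : E) = b • (z : E) :=
  congrArg Subtype.val h

theorem smul_coe_eq_smul {N : Submodule R E} {x z : N} {a b : R}
    (h : a • x = b • z) : a • (x : E) = b • (z : E) :=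
  congrArg Subtype.val h

theorem map_smul_smul_of_eq (T : E →+ M) {a b c : R} (h : a * b = c) (x : E) :
    T (a • b • x) = T (c • x) := by
  rw [smul_smul, h]

theorem map_smul_of_eq_zero (T : E →+ M) (a : R) {x : E} (h : x = 0) : T (a • x) = 0 := by
  rw [h, smul_zero, map_zero]

theorem map_sub_map_eq_zero (T : E →+ M) {x y z : E} (h : x = y + z) (hz : T z = 0) :
    T x - T y = 0 := by
  rw [h, map_add, hz, add_zero, sub_self]

theorem map_sub_map_eq (T : E →+ M) {x y w z : E} (h : x = y + w + z) (hz : T z = 0) :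
    T w = T x - T y := by
  rw [h, map_add, map_add, hz, add_zero, add_sub_cancel_left]

theorem map_sub_eq_zero (T : E →+ M) {x y : E} (h : T x = T y) : T (x - y) = 0 := by
  rw [map_sub, h, sub_self]

end

namespace LogDatum.Uniformizers

variable {Λ : Type v} {P : LogDatum.{u} Λ} (t : P.Uniformizers)
  (ht : ∀ i, t.π i ∈ nonZeroDivisors P.A)

/-- The image of the incoming twisted differential, which is zero in degree `0`. -/
def boundary (m l : Λ →₀ ℕ) : (q : ℕ) → AddSubgroup (P.TwistedForm m l q)
  | 0 => ⊥
  | q + 1 => (t.differential ht m l q).range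

variable {p : ℕ} [Fact p.Prime] [Fact ((p : P.A ⧸ P.I) = 0)]

theorem dlogSum_nsmul (m : Λ →₀ ℕ) : t.dlogSum (p • m) = 0 := by
  have h (k : ℕ) (m : Λ →₀ ℕ) : t.dlogSum (k • m) = k • t.dlogSum m := by
    induction k with
    | zero => simp [dlogSum_zero]
    | succ k ih => rw [succ_nsmul, dlogSum_add, ih, succ_nsmul]
  rw [h, ← Nat.cast_smul_eq_nsmul (P.A ⧸ P.I), (Fact.out : (p : P.A ⧸ P.I) = 0), zero_smul]

theorem twistedD_nsmul_pow_smul {m' : Λ →₀ ℕ} (c : P.A ⧸ P.I) {q : ℕ} {η : P.Form q}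
    {ω : P.Form (q + 1)} (h : extD P.ι P.I η = ω) :
    t.twistedD (p • m') (c ^ p • η) = c ^ p • ω := by
  apply Subtype.ext
  refine (t.coe_twistedD _ _).trans ?_
  rw [t.dlogSum_nsmul m', map_zero, zero_mul]
  refine (add_zero _).trans ((LogCoordinates.extD_pow_smul (p := p) c (η : P.Forms)).trans ?_)
  rw [h]
  rfl

/-- The forms `x^p ⊗ dη` are exact. -/
theorem tmul_pow_mem_boundary {m m' l : Λ →₀ ℕ} (h : m ≤ p • m') {x : P.A} (hx : x ∈ P.ideal m')
    {q : ℕ} {ω : P.Form q} (hω : (ω : P.Forms) ∈ (extD P.ι P.I).range) :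
    P.tmul (l := l) (P.pow_mem_ideal h hx) ω ∈ t.boundary ht m l q := by
  obtain ⟨η, hη⟩ := hω
  rcases q with _ | q
  · have : ω = 0 := Subtype.ext <| by
      rw [← formProj_of_mem ω.2, ← hη,
        formProj_zero_comp one_ne_zero (fun _ _ ↦ extD_mem P.ι P.I)]
      rfl
    rw [this, tmul, TensorProduct.tmul_zero]
    exact zero_mem _
  · obtain ⟨a, rfl⟩ := Ideal.mem_span_singleton'.1 (t.ideal_eq m' ▸ hx)
    obtain ⟨η', hη'⟩ : ∃ η' : P.Form q, (ω : P.Forms) = extD P.ι P.I η' := by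
      refine ⟨⟨formProj P.ι P.I q η, formProj_mem q η⟩, ?_⟩
      rw [← formProj_of_mem ω.2, ← hη, formProj_comp (k := 1) (fun _ _ ↦ extD_mem P.ι P.I)]
    have e : (a * t.pi m') ^ p = (a ^ p * t.pi (p • m' - m)) * t.pi m := by
      rw [mul_pow, ← pi_nsmul, mul_assoc, ← pi_add, tsub_add_cancel_of_le h]
    rw [t.tmul_eq_twist e]
    refine ⟨t.twist m l q (Ideal.Quotient.mk P.I (t.pi (p • m' - m)) •
      (Ideal.Quotient.mk P.I a ^ p • η')), ?_⟩
    have hc : Ideal.Quotient.mk P.I (t.pi (p • m' - m)) * Ideal.Quotient.mk P.I a ^ p =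
        Ideal.Quotient.mk P.I (a ^ p * t.pi (p • m' - m)) := by
      rw [map_mul, map_pow, mul_comm]
    rw [differential_twist, twistedD_pi_smul, add_tsub_cancel_of_le h,
      t.twistedD_nsmul_pow_smul (m' := m') _ hη'.symm]
    exact map_smul_smul_of_eq _ hc ω

end LogDatum.Uniformizers

namespace CartierChart

variable {Λ : Type v} {P Q : LogDatum.{u} Λ} {p : ℕ} [Fact p.Prime]
  [Fact ((p : Q.A ⧸ Q.I) = 0)] (K' : CartierChart Q p) (f : P ⟶ Q)

theorem tmul_congr {m l : Λ →₀ ℕ} {q : ℕ} {x y : Q.A} (h : x = y) (hx : x ∈ Q.ideal m)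
    (hy : y ∈ Q.ideal m) (ω : Q.Form q) : Q.tmul (l := l) hx ω = Q.tmul hy ω := by
  subst h
  rfl

theorem map_tmul' {m l : Λ →₀ ℕ} {q : ℕ} {x : P.A} (hx : x ∈ P.ideal m) (ω : P.Form q) :
    TwistedForm.map f m l q (P.tmul hx ω) = Q.tmul (Hom.map_ideal f m hx) (Form.map f q ω) := rfl

theorem coe_form_map {q : ℕ} (ω : P.Form q) :
    (Form.map f q ω : Q.Forms) = pull f (ω : P.Forms) := rfl

theorem pull_ι_dlogSum (t : P.Uniformizers) (m : Λ →₀ ℕ) :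
    pull f (ExteriorAlgebra.ι _ (t.dlogSum m)) = ExteriorAlgebra.ι _
      (m.sum fun i n ↦ n • LogForm1.dlog Q.ι Q.I
        (Additive.ofMul (Units.map f.ψ (t.unit i)))) := by
  let g (i : Λ) (n : ℕ) := n • LogForm1.dlog Q.ι Q.I (Additive.ofMul (Units.map f.ψ (t.unit i)))
  change _ = ExteriorAlgebra.ι _ (m.sum g)
  induction m using Finsupp.induction_linear with
  | zero => simp [Uniformizers.dlogSum_zero]
  | add m n hm hn =>
    classical
    rw [Uniformizers.dlogSum_add, map_add, map_add, hm, hn,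
      Finsupp.sum_add_index' (h := g) (fun _ ↦ zero_smul _ _) fun _ _ _ ↦ add_smul _ _ _, map_add]
  | single i k =>
    rw [Uniformizers.dlogSum_single, Finsupp.sum_single_index (h := g) (zero_smul _ _), map_nsmul,
      map_nsmul, map_nsmul, pull_ι, pullForm1_dlog]
    rfl

/-- The twisted differential over a chart is given by the expected formula in terms of the
restrictions of arbitrary uniformizers. -/
theorem differential_map_tmul (t : P.Uniformizers) (m l : Λ →₀ ℕ) (q : ℕ) (ω : P.Form q) :
    K'.unif.differential K'.nonZeroDivisors m l q
        (TwistedForm.map f m l q (P.tmul (t.prod_mem m) ω)) =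
      TwistedForm.map f m l (q + 1) (P.tmul (t.prod_mem m) (t.twistedD m ω)) := by
  have hz (i) : f.φ (t.π i) ∈ Q.comp i :=
    f.map_comp i (t.span_π i ▸ Ideal.mem_span_singleton_self _)
  have e : f.φ (m.prod fun i n ↦ t.π i ^ n) = m.prod fun i n ↦ f.φ (t.π i) ^ n := by
    simp only [Finsupp.prod, map_prod, map_pow]
  have hv (i) : Q.ι (f.φ (t.π i)) = (Units.map f.ψ (t.unit i) : Q.Bˣ) := by
    rw [← f.comm, t.ι_π]
    rfl
  have key := K'.unif.differential_tmul K'.nonZeroDivisors m l q hz _ hv (Form.map f q ω)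
    (Form.map f (q + 1) (t.twistedD m ω)) (by
      rw [coe_form_map, coe_form_map, Uniformizers.coe_twistedD, map_add, map_mul, pull_extD,
        pull_ι_dlogSum])
  rw [map_tmul', map_tmul']
  exact ((congrArg _ (tmul_congr e _ _ _)).trans key).trans (tmul_congr e _ _ _).symm

theorem form_map_mem_logSubgroup {q : ℕ} {ω : P.Form q}
    (hω : ω ∈ LogForm.logSubgroup P.ι P.I q) :
    Form.map f q ω ∈ LogForm.logSubgroup Q.ι Q.I q := by
  change ω ∈ (LogForm.logSubgroup Q.ι Q.I q).comap (Form.map f q)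
  refine (AddSubgroup.closure_le _).2 ?_ hω
  rintro _ ⟨y, rfl⟩
  refine AddSubgroup.subset_closure ⟨fun i ↦ Units.map f.ψ (y i), Subtype.ext ?_⟩
  rw [coe_form_map, exteriorPower.ιMulti_apply_coe, exteriorPower.ιMulti_apply_coe,
    ExteriorAlgebra.ιMulti_apply, ExteriorAlgebra.ιMulti_apply, map_list_prod, List.map_ofFn]
  congr 1
  refine congrArg List.ofFn (funext fun i ↦ ?_)
  exact ((pull_ι f _).trans (pullForm1_dlog f _)).symm

end CartierChart

namespace CartierChart

variable {Λ : Type v} {P : LogDatum.{u} Λ} {p : ℕ} [Fact p.Prime] [Fact ((p : P.A ⧸ P.I) = 0)]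
  (K : CartierChart P p)

/-- The exponent of the monomial `∏ π_i ^ m_i` in terms of the coordinates. -/
def expo : (Λ →₀ ℕ) →+ (K.σ →₀ ℕ) :=
  Finsupp.liftAddHom fun i ↦ ∑ s ∈ K.S i, Finsupp.singleAddHom s

theorem expo_single (i : Λ) (k : ℕ) :
    K.expo (Finsupp.single i k) = ∑ s ∈ K.S i, Finsupp.single s k := by
  rw [expo, Finsupp.liftAddHom_apply_single, AddMonoidHom.finsetSum_apply]
  rfl

theorem expo_apply_of_mem (m : Λ →₀ ℕ) {i : Λ} {s : K.σ} (hs : s ∈ K.S i) :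
    K.expo m s = m i := by
  classical
  induction m using Finsupp.induction_linear with
  | zero => simp
  | add m n hm hn => simp only [map_add, Finsupp.add_apply, hm, hn]
  | single j k =>
    rw [expo_single, Finsupp.finsetSum_apply]
    simp only [Finsupp.single_apply, Finset.sum_ite_eq']
    by_cases hij : j = i
    · subst hij; simp [hs]
    · rw [if_neg, if_neg hij]
      exact fun h ↦ Finset.disjoint_left.1 (K.disjoint hij) h hs

theorem expo_apply_of_forall_notMem (m : Λ →₀ ℕ) {s : K.σ} (hs : ∀ i, s ∉ K.S i) :
    K.expo m s = 0 := by
  classical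
  induction m using Finsupp.induction_linear with
  | zero => simp
  | add m n hm hn => simp only [map_add, Finsupp.add_apply, hm, hn]
  | single j k =>
    rw [expo_single, Finsupp.finsetSum_apply]
    simp only [Finsupp.single_apply, Finset.sum_ite_eq']
    rw [if_neg (hs j)]

theorem dlogSum_eq (m : Λ →₀ ℕ) : K.unif.dlogSum m = K.weight (K.expo m) := by
  induction m using Finsupp.induction_linear with
  | zero => simp [Uniformizers.dlogSum_zero]
  | add m n hm hn => rw [Uniformizers.dlogSum_add, hm, hn, map_add, map_add]
  | single j k =>
    rw [expo_single, map_sum, Uniformizers.dlogSum_single,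
      dlog_unit, Finset.smul_sum]
    exact Finset.sum_congr rfl fun s _ ↦ (K.weight_single s k).symm

theorem twistedExtD_eq (m : Λ →₀ ℕ) {q : ℕ} (ω : P.Form q) :
    (K.unif.twistedD m ω : P.Forms) = K.twistedExtD (K.expo m) ω := by
  rw [Uniformizers.coe_twistedD, dlogSum_eq, K.twistedExtD_apply]

open Classical in
/-- The coordinates that divide `∏ π_i^{l_i}`. -/
def support (l : Λ →₀ ℕ) : Finset K.σ := l.support.biUnion K.S

theorem support_subset (l : Λ →₀ ℕ) : ↑(K.support l) ⊆ K.J := by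
  intro s hs
  obtain ⟨i, -, h⟩ := Finset.mem_biUnion.1 (Finset.mem_coe.1 hs)
  exact K.subset i h

theorem mk_pi (l : Λ →₀ ℕ) : Ideal.Quotient.mk P.I (K.unif.pi l) =
    ∏ s ∈ K.support l, K.x s ^ K.expo l s := by
  classical
  rw [support, Finset.prod_biUnion fun i _ j _ h ↦ K.disjoint h, Uniformizers.pi_eq,
    map_prod]
  refine Finset.prod_congr rfl fun i _ ↦ ?_
  rw [map_pow, K.mk_π, ← Finset.prod_pow]
  exact Finset.prod_congr rfl fun s hs ↦ by rw [K.expo_apply_of_mem l hs]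

theorem mk_pi_of_le_one {l : Λ →₀ ℕ} (hl : ∀ i, l i ≤ 1) :
    Ideal.Quotient.mk P.I (K.unif.pi l) = ∏ s ∈ K.support l, K.x s := by
  classical
  rw [mk_pi]
  refine Finset.prod_congr rfl fun s hs ↦ ?_
  obtain ⟨i, hi, h⟩ := Finset.mem_biUnion.1 hs
  have := Finsupp.mem_support_iff.1 hi
  have := hl i
  rw [K.expo_apply_of_mem l h, show l i = 1 by omega, pow_one]

/-- The monomial with exponent `-m` modulo `p`, which is the one surviving in the cohomology, is
the image of `π^{p m' - m}`. -/
theorem mon_negExp {m m' : Λ →₀ ℕ} (hm : IsLeast {n : Λ →₀ ℕ | m ≤ p • n} m') :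
    mon p K.x (K.negExp (K.expo m)) = Ideal.Quotient.mk P.I (K.unif.pi (p • m' - m)) := by
  classical
  have hv {i : Λ} {s : K.σ} (hs : s ∈ K.S i) :
      (K.negExp (K.expo m) s).val = (p • m' - m) i := by
    have h1 := lt_of_isLeast hm i
    have h2 := hm.1 i
    rw [Finsupp.smul_apply, smul_eq_mul] at h2
    rw [K.negExp_apply, K.expo_apply_of_mem m hs, Finsupp.tsub_apply, Finsupp.smul_apply,
      smul_eq_mul]
    have h3 : -((m i : ℕ) : ZMod p) = ((p * m' i - m i : ℕ) : ZMod p) := by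
      rw [Nat.cast_sub h2]
      simp
    rw [h3, ZMod.val_cast_of_lt (by omega)]
  rw [mk_pi, mon_eq_prod (F := K.support (p • m' - m))]
  · refine Finset.prod_congr rfl fun s hs ↦ ?_
    obtain ⟨i, hi, h⟩ := Finset.mem_biUnion.1 hs
    rw [hv h, K.expo_apply_of_mem _ h]
  · intro s hs
    rw [Finsupp.mem_support_iff] at hs
    by_cases h : ∃ i, s ∈ K.S i
    · obtain ⟨i, hi⟩ := h
      refine Finset.mem_biUnion.2 ⟨i, Finsupp.mem_support_iff.2 ?_, hi⟩
      rw [← hv hi]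
      rwa [Ne, ZMod.val_eq_zero]
    · push Not at h
      rw [K.negExp_apply, K.expo_apply_of_forall_notMem m h] at hs
      simp at hs

/-- The Frobenius lift on `q`-forms. -/
def frobForm (q : ℕ) : P.Form q →+ P.Form q :=
  AddMonoidHom.mk' (fun ω ↦ ⟨K.frobLift ω, K.frobLift_mem ω.2⟩) fun _ _ ↦
    Subtype.ext (map_add K.frobLift _ _)

theorem coe_frobForm {q : ℕ} (ω : P.Form q) : (K.frobForm q ω : P.Forms) = K.frobLift ω := rfl

theorem frobForm_smul {q : ℕ} (a : P.A ⧸ P.I) (ω : P.Form q) :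
    K.frobForm q (a • ω) = a ^ p • K.frobForm q ω :=
  Subtype.ext (K.frobLift_smul _ _)

attribute [irreducible] frobForm

section Cartier

variable {m m' l : Λ →₀ ℕ} (hm : IsLeast {n : Λ →₀ ℕ | m ≤ p • n} m') (hl : ∀ i, l i ≤ 1)

theorem le_add_filter (hm : IsLeast {n : Λ →₀ ℕ | m ≤ p • n} m') (hl : ∀ i, l i ≤ 1) :
    l ≤ p • m' - m + p • l.filter fun i ↦ p ∣ m i := by
  intro i
  have h2 := hm.1 i
  have hp := (Fact.out : p.Prime).pos
  have hi := hl i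
  simp only [Finsupp.add_apply, Finsupp.tsub_apply, Finsupp.smul_apply, smul_eq_mul,
    Finsupp.filter_apply] at h2 ⊢
  split_ifs with h
  · have := Nat.le_mul_of_pos_left (l i) hp
    omega
  · have : p * m' i ≠ m i := fun h3 ↦ h ⟨_, h3.symm⟩
    omega

/-- The inverse Cartier map before dividing out the kernel. -/
def preCartier (r m l : Λ →₀ ℕ) (q : ℕ) : P.Form q →+ P.TwistedForm m l q :=
  (K.unif.twist m l q).comp ((DistribSMul.toAddMonoidHom (P.Form q)
    (Ideal.Quotient.mk P.I (K.unif.pi r))).comp (K.frobForm q))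

theorem preCartier_apply (r m l : Λ →₀ ℕ) (q : ℕ) (ω : P.Form q) : K.preCartier r m l q ω =
    K.unif.twist m l q (Ideal.Quotient.mk P.I (K.unif.pi r) • K.frobForm q ω) := rfl

theorem preCartier_smul {r m l l' : Λ →₀ ℕ} (h : l ≤ r + p • l') (q : ℕ) (η : P.Form q) :
    K.preCartier r m l q (Ideal.Quotient.mk P.I (K.unif.pi l') • η) = 0 := by
  obtain ⟨s, hs⟩ := exists_add_of_le h
  have e : Ideal.Quotient.mk P.I (K.unif.pi r) *
      Ideal.Quotient.mk P.I (K.unif.pi l') ^ p =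
      Ideal.Quotient.mk P.I (K.unif.pi l) * Ideal.Quotient.mk P.I (K.unif.pi s) := by
    rw [← map_pow, ← Uniformizers.pi_nsmul, ← map_mul, ← map_mul, ← Uniformizers.pi_add, hs,
      Uniformizers.pi_add]
  rw [preCartier_apply, frobForm_smul, smul_smul, e, mul_smul, Uniformizers.twist_smul_eq_zero]

/-- The inverse Cartier map `x ⊗ ω ↦ x^p ⊗ G(ω)`. -/
def cartier (q : ℕ) :
    P.TwistedForm m' (l.filter fun i ↦ p ∣ m i) q →+ P.TwistedForm m l q :=
  K.unif.descend K.nonZeroDivisors (K.preCartier (p • m' - m) m l q)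
    (K.preCartier_smul (le_add_filter hm hl) q)

theorem cartier_twist (q : ℕ) (ω : P.Form q) :
    K.cartier hm hl q (K.unif.twist m' _ q ω) =
      K.unif.twist m l q (Ideal.Quotient.mk P.I (K.unif.pi (p • m' - m)) • K.frobForm q ω) :=
  K.unif.descend_twist _ _ _ ω

theorem cartier_tmul (q : ℕ) {x : P.A} (hx : x ∈ P.ideal m') (ω : P.Form q) :
    K.cartier hm hl q (P.tmul hx ω) = P.tmul (P.pow_mem_ideal hm.1 hx) (K.frobForm q ω) := by
  obtain ⟨a, ha⟩ := Ideal.mem_span_singleton'.1 (K.unif.ideal_eq m' ▸ hx)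
  have e : x ^ p = (a ^ p * K.unif.pi (p • m' - m)) * K.unif.pi m := by
    rw [← ha, mul_pow, ← Uniformizers.pi_nsmul, mul_assoc, ← Uniformizers.pi_add,
      tsub_add_cancel_of_le hm.1]
  have hc : Ideal.Quotient.mk P.I (K.unif.pi (p • m' - m)) * Ideal.Quotient.mk P.I a ^ p =
      Ideal.Quotient.mk P.I (a ^ p * K.unif.pi (p • m' - m)) := by
    rw [map_mul, map_pow, mul_comm]
  rw [K.unif.tmul_eq_twist ha.symm, K.unif.tmul_eq_twist e, cartier_twist, frobForm_smul]
  exact map_smul_smul_of_eq _ hc _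

theorem differential_cartier (q : ℕ) (z) :
    K.unif.differential K.nonZeroDivisors m l q (K.cartier hm hl q z) = 0 := by
  obtain ⟨ω, rfl⟩ := K.unif.twist_surjective _ _ q z
  rw [cartier_twist, Uniformizers.differential_twist, Uniformizers.twistedD_pi_smul,
    add_tsub_cancel_of_le hm.1]
  have : K.unif.twistedD (p • m') (K.frobForm q ω) = 0 := Subtype.ext <| by
    rw [Uniformizers.coe_twistedD, Uniformizers.dlogSum_nsmul, map_zero, zero_mul]
    exact (add_zero _).trans ((congrArg _ (K.coe_frobForm ω)).trans (K.extD_frobLift _))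
  exact map_smul_of_eq_zero _ _ this

/-- Surjectivity of the local inverse Cartier map: each closed form is in its image up to exact
forms. -/
theorem exists_of_differential_eq_zero (q : ℕ) {z : P.TwistedForm m l q}
    (hz : K.unif.differential K.nonZeroDivisors m l q z = 0) :
    ∃ z', z - K.cartier hm hl q z' ∈ K.unif.boundary K.nonZeroDivisors m l q := by
  obtain ⟨ω, rfl⟩ := K.unif.twist_surjective _ _ q z
  rw [Uniformizers.differential_twist] at hz
  obtain ⟨η, hη⟩ := K.unif.exists_of_twist_eq_zero K.nonZeroDivisors hz
  have h : ∃ η, K.twistedExtD (K.expo m) ω = (∏ s ∈ K.support l, K.x s) • η :=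
    ⟨η, by rw [← twistedExtD_eq, coe_eq_smul hη, mk_pi_of_le_one K hl]⟩
  rcases q with _ | q
  · obtain ⟨ω', hω', ζ, hζ, e⟩ :=
      K.exists_mem_of_twistedExtD_zero (K.support_subset l) ω.2 h
    refine ⟨K.unif.twist _ _ _ ⟨ω', hω'⟩, ?_⟩
    have e' : ω = Ideal.Quotient.mk P.I (K.unif.pi (p • m' - m)) • K.frobForm 0 ⟨ω', hω'⟩ +
        Ideal.Quotient.mk P.I (K.unif.pi l) • (⟨ζ, hζ⟩ : P.Form 0) :=
      eq_smul_add_smul_of_coe <| by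
        rw [e, mon_negExp K hm, ← mk_pi_of_le_one K hl, K.coe_frobForm]
    rw [cartier_twist, map_sub_map_eq_zero _ e' (Uniformizers.twist_smul_eq_zero _ _ _ _)]
    exact zero_mem _
  · obtain ⟨ω', hω', η, hη, ζ, hζ, e⟩ :=
      K.exists_mem_of_twistedExtD (K.support_subset l) ω.2 h
    refine ⟨K.unif.twist _ _ _ ⟨ω', hω'⟩, K.unif.twist m l q ⟨η, hη⟩, ?_⟩
    have e' : ω = Ideal.Quotient.mk P.I (K.unif.pi (p • m' - m)) • K.frobForm _ ⟨ω', hω'⟩ +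
        K.unif.twistedD m (⟨η, hη⟩ : P.Form q) +
        Ideal.Quotient.mk P.I (K.unif.pi l) • (⟨ζ, hζ⟩ : P.Form (q + 1)) :=
      eq_smul_add_add_smul_of_coe <| by
        rw [e, mon_negExp K hm, ← mk_pi_of_le_one K hl, K.twistedExtD_eq m ⟨η, hη⟩,
          K.coe_frobForm]
    rw [cartier_twist, Uniformizers.differential_twist]
    exact map_sub_map_eq _ e' (Uniformizers.twist_smul_eq_zero _ _ _ _)

/-- Injectivity of the local inverse Cartier map on cohomology. -/
theorem eq_zero_of_cartier_mem (q : ℕ) {z : P.TwistedForm m' (l.filter fun i ↦ p ∣ m i) q}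
    (hz : K.cartier hm hl q z ∈ K.unif.boundary K.nonZeroDivisors m l q) : z = 0 := by
  classical
  obtain ⟨ω, rfl⟩ := K.unif.twist_surjective _ _ q z
  rw [cartier_twist] at hz
  obtain ⟨η, ζ, e⟩ : ∃ (η : P.Forms) (ζ : P.Forms),
      mon p K.x (K.negExp (K.expo m)) • K.frobLift ω + K.twistedExtD (K.expo m) η =
        (∏ s ∈ K.support l, K.x s) • ζ := by
    rcases q with _ | q
    · obtain ⟨ζ, hζ⟩ := K.unif.exists_of_twist_eq_zero K.nonZeroDivisors (AddSubgroup.mem_bot.1 hz)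
      refine ⟨0, ζ, ?_⟩
      rw [map_zero, add_zero, mon_negExp K hm, ← mk_pi_of_le_one K hl, ← K.coe_frobForm]
      exact smul_coe_eq_smul hζ
    · obtain ⟨w, hw⟩ := hz
      obtain ⟨η, rfl⟩ := K.unif.twist_surjective _ _ q w
      rw [Uniformizers.differential_twist] at hw
      obtain ⟨ζ, hζ⟩ := K.unif.exists_of_twist_eq_zero K.nonZeroDivisors
        (map_sub_eq_zero _ hw.symm)
      refine ⟨-η, ζ, ?_⟩
      rw [map_neg, ← twistedExtD_eq, mon_negExp K hm, ← mk_pi_of_le_one K hl, ← sub_eq_add_neg,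
        ← K.coe_frobForm]
      exact smul_sub_coe_eq_smul hζ
  obtain ⟨ξ, hξ⟩ := K.exists_of_mon_smul_frobLift (K.support_subset l) ⟨ζ, e⟩
  -- `s` with `m_s = 0` modulo `p` are the coordinates of the components with `p ∣ m_i`
  have hL : ({s ∈ K.support l | (K.expo m s : ZMod p) = 0} : Finset _) =
      K.support (l.filter fun i ↦ p ∣ m i) := by
    ext s
    simp only [support, Finset.mem_filter, Finset.mem_biUnion, Finsupp.mem_support_iff,
      Finsupp.filter_apply, ne_eq, ite_eq_right_iff, Classical.not_imp]
    constructor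
    · rintro ⟨⟨i, hi, hs⟩, h⟩
      rw [K.expo_apply_of_mem m hs, ZMod.natCast_eq_zero_iff] at h
      exact ⟨i, ⟨h, hi⟩, hs⟩
    · rintro ⟨i, ⟨h, hi⟩, hs⟩
      refine ⟨⟨i, hi, hs⟩, ?_⟩
      rwa [K.expo_apply_of_mem m hs, ZMod.natCast_eq_zero_iff]
  have hξ' : (ω : P.Forms) = (∏ s ∈ K.support (l.filter fun i ↦ p ∣ m i), K.x s) • ξ := by
    rw [← hL]
    convert hξ
  obtain ⟨ξ, h, e'⟩ := LogCoordinates.exists_mem_eq_smul ω.2 ⟨ξ, hξ'⟩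
  have : ω = Ideal.Quotient.mk P.I (K.unif.pi (l.filter fun i ↦ p ∣ m i)) •
      (⟨ξ, h⟩ : P.Form q) := eq_smul_of_coe <| by
    rw [e', mk_pi_of_le_one K fun i ↦ ?_]
    rw [Finsupp.filter_apply]
    split_ifs
    · exact hl i
    · exact Nat.zero_le _
  rw [this, Uniformizers.twist_smul_eq_zero]

/-- The Frobenius lift fixes the logarithmic forms modulo exact forms. -/
theorem frobForm_sub_mem (q : ℕ) {ω : P.Form q} (hω : ω ∈ LogForm.logSubgroup P.ι P.I q) :
    (ω - K.frobForm q ω : P.Form q).1 ∈ (extD P.ι P.I).range := by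
  let h : P.Form q →+ P.Forms := (P.Form q).subtype.toAddMonoidHom.comp
    (AddMonoidHom.id _ - K.frobForm q)
  change ω ∈ (extD P.ι P.I).range.comap h
  refine (AddSubgroup.closure_le _).2 ?_ hω
  rintro _ ⟨y, rfl⟩
  change (_ : P.Forms) - (K.frobForm q _ : P.Forms) ∈ (extD P.ι P.I).range
  rw [coe_frobForm]
  rw [exteriorPower.ιMulti_apply_coe, ExteriorAlgebra.ιMulti_apply]
  clear h hω ω
  let w (q : ℕ) (y : Fin q → P.Bˣ) : P.Forms := (List.ofFn fun i ↦ ExteriorAlgebra.ι (P.A ⧸ P.I)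
    (LogForm1.dlog P.ι P.I (Additive.ofMul (y i)))).prod
  change w q y - K.frobLift (w q y) ∈ (extD P.ι P.I).range
  induction q with
  | zero =>
    have : w 0 y = 1 := by simp only [w, List.ofFn_zero, List.prod_nil]
    rw [this, map_one, sub_self]
    exact zero_mem _
  | succ q ih =>
    have e : w (q + 1) y = ExteriorAlgebra.ι (P.A ⧸ P.I)
        (LogForm1.dlog P.ι P.I (Additive.ofMul (y 0))) * w q fun i ↦ y i.succ := by
      simp only [w, List.ofFn_succ, List.prod_cons]
    have h1 := neg_mem (K.frobLift_ι_dlog (Additive.ofMul (y 0)))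
    rw [neg_sub] at h1
    have h3 := ih fun i ↦ y i.succ
    generalize (w q fun i ↦ y i.succ) = v at e h3
    have h2 : extD P.ι P.I v = 0 := by
      obtain ⟨z, hz⟩ := h3
      rw [← sub_add_cancel v (K.frobLift v), map_add, K.extD_frobLift, ← hz, extD_extD, add_zero]
    -- `a v - G(a) G(v) = (a - G(a)) v + G(a) (v - G(v))`, exact by induction
    have := add_mem (exact_mul_closed h1 h2) (closed_mul_exact (K.extD_frobLift
      (ExteriorAlgebra.ι (P.A ⧸ P.I) (LogForm1.dlog P.ι P.I (Additive.ofMul (y 0))))) h3)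
    rw [sub_mul, mul_sub, sub_add_sub_cancel] at this
    rwa [e, map_mul K.frobLift]

theorem tmul_sub_cartier_mem (q : ℕ) {x : P.A} (hx : x ∈ P.ideal m') {ω : P.Form q}
    (hω : ω ∈ LogForm.logSubgroup P.ι P.I q) :
    P.tmul (P.pow_mem_ideal hm.1 hx) ω - K.cartier hm hl q (P.tmul hx ω) ∈
      K.unif.boundary K.nonZeroDivisors m l q := by
  have := K.unif.tmul_pow_mem_boundary K.nonZeroDivisors (l := l) hm.1 hx
    (K.frobForm_sub_mem q hω)
  rwa [tmul, TensorProduct.tmul_sub, ← tmul, ← tmul, ← cartier_tmul K hm hl] at this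

end Cartier

section Naturality

variable {Q : LogDatum.{u} Λ} [Fact ((p : Q.A ⧸ Q.I) = 0)] (K' : CartierChart Q p) (f : P ⟶ Q)

/-- The twisted differential commutes with restriction. -/
theorem map_differential (m l : Λ →₀ ℕ) (q : ℕ) (z : P.TwistedForm m l q) :
    TwistedForm.map f m l (q + 1) (K.unif.differential K.nonZeroDivisors m l q z) =
      K'.unif.differential K'.nonZeroDivisors m l q (TwistedForm.map f m l q z) := by
  obtain ⟨ω, rfl⟩ := K.unif.twist_surjective _ _ q z
  rw [K.unif.differential_twist, K.unif.twist_apply, K.unif.twist_apply]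
  exact (K'.differential_map_tmul f K.unif m l q ω).symm

/-- The inverse Cartier map commutes with restriction up to exact forms. -/
theorem map_cartier {m m' l : Λ →₀ ℕ} (hm : IsLeast {n : Λ →₀ ℕ | m ≤ p • n} m')
    (hl : ∀ i, l i ≤ 1) (q : ℕ) (z) :
    TwistedForm.map f m l q (K.cartier hm hl q z) -
      K'.cartier hm hl q (TwistedForm.map f m' _ q z) ∈
        K'.unif.boundary K'.nonZeroDivisors m l q := by
  obtain ⟨ω, rfl⟩ := K.unif.twist_surjective _ _ q z
  have hx := K.unif.prod_mem m'
  have h : (Form.map f q (K.frobForm q ω) - K'.frobForm q (Form.map f q ω) : Q.Form q).1 ∈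
      (extD Q.ι Q.I).range := by
    have := pull_frobLift f K.toLogCoordinates K'.toLogCoordinates (ω : P.Forms)
    rwa [← K.coe_frobForm, ← coe_form_map f ω, ← coe_form_map f, ← K'.coe_frobForm] at this
  have := K'.unif.tmul_pow_mem_boundary K'.nonZeroDivisors (l := l) hm.1
    (Hom.map_ideal f m' hx) h
  rw [tmul, TensorProduct.tmul_sub, ← tmul, ← tmul] at this
  have e₁ := (congrArg (TwistedForm.map f m l q) (K.cartier_tmul hm hl q hx ω)).trans
    ((map_tmul' f _ _).trans (tmul_congr (map_pow f.φ _ _) _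
      (Q.pow_mem_ideal hm.1 (Hom.map_ideal f m' hx)) _))
  have e₂ := (congrArg (K'.cartier hm hl q) (map_tmul' f hx ω)).trans
    (K'.cartier_tmul hm hl q (Hom.map_ideal f m' hx) (Form.map f q ω))
  rw [K.unif.twist_apply]
  exact (congrArg₂ (· - ·) e₁ e₂) ▸ this

end Naturality

end CartierChart

/-! ### Sections of étale sheaves -/

section Sections

variable {X : Scheme.{u}}

/-- The morphisms `V ⟶ U` with the property `Q` generate a covering sieve of `U`. -/
def Locally (U : X.AffineEtale) (Q : ∀ V : X.AffineEtale, (V ⟶ U) → Prop) : Prop :=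
  Sieve.generate (fun V ↦ {g : V ⟶ U | Q V g}) ∈ Scheme.AffineEtale.topology X U

namespace Locally

variable {U : X.AffineEtale} {Q Q' : ∀ V : X.AffineEtale, (V ⟶ U) → Prop}

theorem of_mem {S : Sieve U} (hS : S ∈ Scheme.AffineEtale.topology X U)
    (h : ∀ (V : X.AffineEtale) (g : V ⟶ U), S g → Q V g) : Locally U Q :=
  GrothendieckTopology.superset_covering _ (fun V g hg ↦ ⟨V, 𝟙 V, g, h V g hg, Category.id_comp g⟩)
    hS

theorem bind (h : Locally U Q)
    (h' : ∀ V (g : V ⟶ U), Q V g → Locally V fun W k ↦ Q' W (k ≫ g)) : Locally U Q' := by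
  refine GrothendieckTopology.transitive _ h _ ?_
  rintro V _ ⟨W, k, g, hg, rfl⟩
  rw [Sieve.pullback_comp]
  refine GrothendieckTopology.pullback_stable _ _
    (GrothendieckTopology.superset_covering _ ?_ (h' W g hg))
  rintro T _ ⟨T', j, i, hi, rfl⟩
  exact ⟨T', j, i ≫ g, hi, (Category.assoc _ _ _).symm⟩

theorem mono (h : Locally U Q) (h' : ∀ V (g : V ⟶ U), Q V g → Q' V g) : Locally U Q' :=
  GrothendieckTopology.superset_covering _
    (by rintro V _ ⟨W, k, g, hg, rfl⟩; exact ⟨W, k, g, h' W g hg, rfl⟩) h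

theorem mem {S : Sieve U} (h : Locally U fun _ g ↦ S g) : S ∈ Scheme.AffineEtale.topology X U :=
  GrothendieckTopology.superset_covering _
    (by rintro V _ ⟨W, k, g, hg, rfl⟩; exact S.downward_closed hg k) h

end Locally

/-- Restriction of sections. -/
abbrev res (F : (X.AffineEtale)ᵒᵖ ⥤ AddCommGrpCat.{u}) {U V : X.AffineEtale} (g : V ⟶ U) :
    F.obj (op U) →+ F.obj (op V) := (F.map g.op).hom

theorem res_comp (F : (X.AffineEtale)ᵒᵖ ⥤ AddCommGrpCat.{u}) {U V W : X.AffineEtale} (g : V ⟶ U)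
    (h : W ⟶ V) (s : F.obj (op U)) : res F (h ≫ g) s = res F h (res F g s) := by
  simp [res]

theorem res_app {F G : (X.AffineEtale)ᵒᵖ ⥤ AddCommGrpCat.{u}} (φ : F ⟶ G) {U V : X.AffineEtale}
    (g : V ⟶ U) (s : F.obj (op U)) :
    res G g ((φ.app (op U)).hom s) = (φ.app (op V)).hom (res F g s) :=
  (ConcreteCategory.congr_hom (φ.naturality g.op) s).symm

instance : (Scheme.AffineEtale.topology X).HasSheafCompose (forget AddCommGrpCat.{u}) where
  isSheaf P hP := by
    rw [isSheaf_iff_isSheaf_of_type]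
    exact Presieve.isSheaf_iso _
      (Functor.isoWhiskerLeft P AddCommGrpCat.coyonedaObjIsoForget) (hP _)

instance (U : X.AffineEtale) :
    PreservesLimits ((sheafSections (Scheme.AffineEtale.topology X) AddCommGrpCat.{u}).obj (op U))
        :=
  inferInstanceAs (PreservesLimits (sheafToPresheaf (Scheme.AffineEtale.topology X)
      AddCommGrpCat.{u} ⋙
    (evaluation _ _).obj (op U)))

theorem eq_of_locally_eq (F : EtaleAbSheaf X) {U : X.AffineEtale} {s t : F.obj.obj (op U)}
    (h : Locally U fun _ g ↦ res F.obj g s = res F.obj g t) : s = t := by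
  refine (((isSheaf_iff_isSheaf_of_type _ _).1
    ((sheafCompose (Scheme.AffineEtale.topology X) (forget AddCommGrpCat.{u})).obj F).property) _
        h).isSeparatedFor.ext ?_
  rintro V _ ⟨W, k, g, hg, rfl⟩
  change res F.obj (k ≫ g) s = res F.obj (k ≫ g) t
  rw [res_comp, res_comp, hg]

theorem locally_exists_toSheafify (F : (X.AffineEtale)ᵒᵖ ⥤ AddCommGrpCat.{u}) {U : X.AffineEtale}
    (s : (sheafify (Scheme.AffineEtale.topology X) F).obj (op U)) :
    Locally U fun V g ↦ ∃ t : F.obj (op V), ((toSheafify (Scheme.AffineEtale.topology X) F).app (op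
        V)).hom t =
      res (sheafify (Scheme.AffineEtale.topology X) F) g s :=
  .of_mem (Presheaf.imageSieve_mem (Scheme.AffineEtale.topology X) (toSheafify
      (Scheme.AffineEtale.topology X) F) s) fun _ _ h ↦ h

theorem locally_eq_of_toSheafify_eq (F : (X.AffineEtale)ᵒᵖ ⥤ AddCommGrpCat.{u}) {U : X.AffineEtale}
    {s t : F.obj (op U)}
    (h : ((toSheafify (Scheme.AffineEtale.topology X) F).app (op U)).hom s = ((toSheafify
        (Scheme.AffineEtale.topology X) F).app (op U)).hom t) :
    Locally U fun _ g ↦ res F g s = res F g t :=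
  .of_mem (Presheaf.equalizerSieve_mem (Scheme.AffineEtale.topology X) (toSheafify
      (Scheme.AffineEtale.topology X) F) s t h) fun _ _ h ↦ h

theorem locally_exists_of_epi {F G : EtaleAbSheaf X} (φ : F ⟶ G) [Epi φ] {U : X.AffineEtale}
    (s : G.obj.obj (op U)) :
    Locally U fun V g ↦ ∃ t : F.obj.obj (op V), (φ.hom.app (op V)).hom t = res G.obj g s := by
  have : Sheaf.IsLocallySurjective φ := by
    rw [Sheaf.isLocallySurjective_iff_epi']
    infer_instance
  exact .of_mem (Presheaf.imageSieve_mem (Scheme.AffineEtale.topology X) φ.hom s) fun _ _ h ↦ h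

theorem app_injective_of_mono {F G : EtaleAbSheaf X} (φ : F ⟶ G) [Mono φ] (U : X.AffineEtale) :
    Function.Injective (φ.hom.app (op U)).hom := by
  have : Mono (((sheafSections (Scheme.AffineEtale.topology X) AddCommGrpCat.{u}).obj (op U)).map φ)
      := inferInstance
  exact (AddCommGrpCat.mono_iff_injective _).1 this

theorem isIso_of_locally {F G : EtaleAbSheaf X} (φ : F ⟶ G)
    (h₁ : ∀ (U : X.AffineEtale) (s : F.obj.obj (op U)), (φ.hom.app (op U)).hom s = 0 →
      Locally U fun _ g ↦ res F.obj g s = 0)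
    (h₂ : ∀ (U : X.AffineEtale) (s : G.obj.obj (op U)),
      Locally U fun V g ↦ ∃ t : F.obj.obj (op V), (φ.hom.app (op V)).hom t = res G.obj g s) :
    IsIso φ := by
  refine (Sheaf.isLocallyBijective_iff_isIso φ).1 ⟨?_, ?_⟩
  · exact ⟨fun {U} s t hst ↦ Locally.mem ((h₁ U.unop (s - t) (by
      rw [map_sub, sub_eq_zero]; exact hst)).mono fun V g hg ↦ by
        rw [map_sub, sub_eq_zero] at hg; exact hg)⟩
  · exact ⟨fun {U} s ↦ Locally.mem (h₂ U s)⟩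

theorem exists_of_exact {S : ShortComplex (EtaleAbSheaf X)} (hS : S.Exact) [Mono S.f]
    {U : X.AffineEtale} (s : S.X₂.obj.obj (op U)) (hs : (S.g.hom.app (op U)).hom s = 0) :
    ∃ t, (S.f.hom.app (op U)).hom t = s := by
  have := hS.map_of_mono_of_preservesKernel ((sheafSections (Scheme.AffineEtale.topology X)
      AddCommGrpCat.{u}).obj (op U))
    inferInstance inferInstance
  rw [ShortComplex.ab_exact_iff] at this
  exact this s hs

theorem locally_exists_of_exact {S : ShortComplex (EtaleAbSheaf X)} (hS : S.Exact)
    {U : X.AffineEtale} (s : S.X₂.obj.obj (op U)) (hs : (S.g.hom.app (op U)).hom s = 0) :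
    Locally U fun V g ↦ ∃ t, (S.f.hom.app (op V)).hom t = res S.X₂.obj g s := by
  have h : (ShortComplex.mk S.iCycles S.g S.iCycles_g).Exact :=
    ShortComplex.exact_of_f_is_kernel _ S.cyclesIsKernel
  have : Mono (ShortComplex.mk S.iCycles S.g S.iCycles_g).f := inferInstanceAs (Mono S.iCycles)
  obtain ⟨t, ht⟩ := exists_of_exact h s hs
  have : Epi S.toCycles := S.exact_iff_epi_toCycles.1 hS
  refine (locally_exists_of_epi S.toCycles t).mono fun V g ⟨r, hr⟩ ↦ ⟨r, ?_⟩
  have e := congrArg (S.iCycles.hom.app (op V)).hom hr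
  rw [← res_app] at e
  refine Eq.trans ?_ (e.trans (congrArg _ ht))
  rw [← S.toCycles_i]
  rfl

/-- Morphisms from a sheafification agree if they agree on the presheaf, over a class of objects
by which everything can be covered. -/
theorem sheafify_hom_ext_of_locally {F : (X.AffineEtale)ᵒᵖ ⥤ AddCommGrpCat.{u}} {G : EtaleAbSheaf X}
    {Q : X.AffineEtale → Prop} (hQ : ∀ U, Locally U fun V _ ↦ Q V)
    {f g : (presheafToSheaf (Scheme.AffineEtale.topology X) AddCommGrpCat.{u}).obj F ⟶ G}
    (h : ∀ V, Q V → ∀ s : F.obj (op V), (f.hom.app (op V)).hom (((toSheafify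
        (Scheme.AffineEtale.topology X) F).app (op V)).hom s) =
      (g.hom.app (op V)).hom (((toSheafify (Scheme.AffineEtale.topology X) F).app (op V)).hom s)) :
          f = g := by
  apply Sheaf.hom_ext
  refine sheafify_hom_ext _ _ _ G.property ?_
  ext U s
  refine eq_of_locally_eq G ((hQ U.unop).mono fun V k hV ↦ ?_)
  have := h V hV (res F k s)
  rw [← res_app (toSheafify (Scheme.AffineEtale.topology X) F), ← res_app f.hom, ← res_app g.hom] at this
  exact this

/-- Compatible homomorphisms given over a class of objects by which everything can be covered
define a morphism on the sheafification. -/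
theorem exists_sheafify_hom {F : (X.AffineEtale)ᵒᵖ ⥤ AddCommGrpCat.{u}} {G : EtaleAbSheaf X}
    {Q : ObjectProperty X.AffineEtale} (hQ : ∀ U, Locally U fun V _ ↦ Q V)
    (φ : ∀ V, Q V → (F.obj (op V) →+ G.obj.obj (op V)))
    (hφ : ∀ V (hV : Q V) W (hW : Q W) (k : W ⟶ V) (s : F.obj (op V)),
      φ W hW (res F k s) = res G.obj k (φ V hV s)) :
    ∃ f : (presheafToSheaf (Scheme.AffineEtale.topology X) AddCommGrpCat.{u}).obj F ⟶ G,
      ∀ V (hV : Q V) (s : F.obj (op V)),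
        (f.hom.app (op V)).hom (((toSheafify (Scheme.AffineEtale.topology X) F).app (op V)).hom s) =
            φ V hV s := by
  have : Q.ι.IsCoverDense (Scheme.AffineEtale.topology X) := ⟨fun U ↦ Locally.mem <| (hQ U).mono fun V g hV ↦
    ⟨⟨⟨V, hV⟩, 𝟙 V, g, Category.id_comp g⟩⟩⟩
  let α : Q.ι.op ⋙ F ⟶ Q.ι.op ⋙ G.obj :=
    { app := fun V ↦ AddCommGrpCat.ofHom (φ V.unop.obj V.unop.property)
      naturality := fun V W k ↦ by
        ext s
        exact hφ _ _ _ _ _ s }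
  let β : F ⟶ G.obj := Functor.IsCoverDense.sheafHom α
  have hβ : Functor.whiskerLeft Q.ι.op β = α := Functor.IsCoverDense.sheafHom_restrict_eq α
  refine ⟨⟨sheafifyLift (Scheme.AffineEtale.topology X) β G.property⟩, fun V hV s ↦ ?_⟩
  have h₁ := ConcreteCategory.congr_hom (congr_app (toSheafify_sheafifyLift
      (Scheme.AffineEtale.topology X) β G.property) (op V)) s
  have h₂ := ConcreteCategory.congr_hom (congr_app hβ (op (⟨V, hV⟩ : Q.FullSubcategory))) s
  exact h₁.trans h₂

end Sections

/-! ### Complexes of étale sheaves -/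

section Complex

variable {X : Scheme.{u}} (K : CochainComplex (EtaleAbSheaf X) ℕ)

/-- The value of a morphism of sheaves on a section. -/
abbrev ev {F G : EtaleAbSheaf X} (φ : F ⟶ G) (U : X.AffineEtale) :
    F.obj.obj (op U) →+ G.obj.obj (op U) := (φ.hom.app (op U)).hom

theorem ev_comp {F G H : EtaleAbSheaf X} (φ : F ⟶ G) (ψ : G ⟶ H) (U : X.AffineEtale) (s) :
    ev (φ ≫ ψ) U s = ev ψ U (ev φ U s) := rfl

theorem res_ev {F G : EtaleAbSheaf X} (φ : F ⟶ G) {U V : X.AffineEtale} (g : V ⟶ U) (s) :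
    res G.obj g (ev φ U s) = ev φ V (res F.obj g s) := res_app φ.hom g s

theorem ev_iCycles_injective (q : ℕ) (U : X.AffineEtale) :
    Function.Injective (ev (K.iCycles q) U) := app_injective_of_mono _ U

theorem exists_ev_iCycles (q : ℕ) {U : X.AffineEtale} {s : (K.X q).obj.obj (op U)}
    (hs : ev (K.d q (q + 1)) U s = 0) : ∃ z, ev (K.iCycles q) U z = s := by
  have h : (ShortComplex.mk (K.iCycles q) (K.d q (q + 1)) (by simp)).Exact :=
    ShortComplex.exact_of_f_is_kernel _ (K.cyclesIsKernel q (q + 1) (by simp))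
  have : Mono (ShortComplex.mk (K.iCycles q) (K.d q (q + 1)) (by simp)).f :=
    inferInstanceAs (Mono (K.iCycles q))
  exact exists_of_exact h s hs

theorem ev_d_iCycles (q : ℕ) {U : X.AffineEtale} (z) :
    ev (K.d q (q + 1)) U (ev (K.iCycles q) U z) = 0 := by
  rw [← ev_comp, K.iCycles_d]
  rfl

theorem homologyπ_eq_zero_of_d {i q : ℕ} {U : X.AffineEtale} {z : (K.cycles q).obj.obj (op U)} {w}
    (h : ev (K.iCycles q) U z = ev (K.d i q) U w) : ev (K.homologyπ q) U z = 0 := by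
  have e : z = ev (K.toCycles i q) U w := ev_iCycles_injective K q U <| by
    rw [h, ← ev_comp, K.toCycles_i]
  rw [e, ← ev_comp, K.toCycles_comp_homologyπ]
  rfl

theorem locally_exists_d {q : ℕ} {U : X.AffineEtale} {z : (K.cycles q).obj.obj (op U)}
    (h : ev (K.homologyπ q) U z = 0) :
    Locally U fun V g ↦ ∃ w, ev (K.iCycles q) V (res (K.cycles q).obj g z) =
      ev (K.d ((ComplexShape.up ℕ).prev q) q) V w := by
  have h' : (ShortComplex.mk (K.toCycles ((ComplexShape.up ℕ).prev q) q) (K.homologyπ q)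
      (by simp)).Exact :=
    ShortComplex.exact_of_g_is_cokernel _ (K.homologyIsCokernel _ q rfl)
  refine (locally_exists_of_exact h' z h).mono fun V g ⟨w, hw⟩ ↦ ⟨w, ?_⟩
  have e := congrArg (ev (K.iCycles q) V) hw
  rw [← ev_comp, K.toCycles_i] at e
  exact e.symm

theorem locally_exists_homologyπ {q : ℕ} {U : X.AffineEtale} (s : (K.homology q).obj.obj (op U)) :
    Locally U fun V g ↦ ∃ z, ev (K.homologyπ q) V z = res (K.homology q).obj g s :=
  locally_exists_of_epi (K.homologyπ q) s

end Complex

/-! ### The differential and the inverse Cartier map over a chart -/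

section Chart

variable {Λ : Type v}

/-- There is a chart; in particular `p = 0` in `A/I`. -/
def HasChart (P : LogDatum.{u} Λ) (p : ℕ) [Fact p.Prime] : Prop :=
  ∃ _ : Fact ((p : P.A ⧸ P.I) = 0), Nonempty (CartierChart P p)

namespace HasChart

open LogDatum

variable {p : ℕ} [Fact p.Prime] {P Q : LogDatum.{u} Λ} (h : HasChart P p) (h' : HasChart Q p)
  (f : P ⟶ Q) (m : Λ →₀ ℕ) {m' : Λ →₀ ℕ} (l : Λ →₀ ℕ) (hm : IsLeast {n : Λ →₀ ℕ | m ≤ p • n} m')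
  (hl : ∀ i, l i ≤ 1) (q : ℕ)

/-- The twisted differential given by some chart. -/
def differential : P.TwistedForm m l q →+ P.TwistedForm m l (q + 1) :=
  have := h.choose
  h.choose_spec.some.unif.differential h.choose_spec.some.nonZeroDivisors m l q

/-- The image of the incoming twisted differential, which is zero in degree `0`. -/
def boundary : AddSubgroup (P.TwistedForm m l q) :=
  have := h.choose
  h.choose_spec.some.unif.boundary h.choose_spec.some.nonZeroDivisors m l q

variable {m l} in
/-- The inverse Cartier map given by some chart. -/
def cartier : P.TwistedForm m' (l.filter fun i ↦ p ∣ m i) q →+ P.TwistedForm m l q :=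
  have := h.choose
  h.choose_spec.some.cartier hm hl q

variable {q}

theorem mem_boundary_zero {z} : z ∈ h.boundary m l 0 ↔ z = 0 := AddSubgroup.mem_bot

theorem mem_boundary_succ {z} : z ∈ h.boundary m l (q + 1) ↔ ∃ w, h.differential m l q w = z :=
  Iff.rfl

theorem differential_differential (z) :
    h.differential m l (q + 1) (h.differential m l q z) = 0 :=
  have := h.choose
  Uniformizers.differential_differential _ _ _ _ _ _

theorem differential_of_mem_boundary {z} (hz : z ∈ h.boundary m l q) :
    h.differential m l q z = 0 := by
  rcases q with _ | q
  · rw [h.mem_boundary_zero] at hz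
    rw [hz, map_zero]
  · obtain ⟨w, rfl⟩ := (h.mem_boundary_succ m l).1 hz
    exact h.differential_differential m l w

theorem map_differential (z) : TwistedForm.map f m l (q + 1) (h.differential m l q z) =
    h'.differential m l q (TwistedForm.map f m l q z) :=
  have := h.choose
  have := h'.choose
  CartierChart.map_differential _ _ _ _ _ _ _

theorem differential_map_tmul (t : P.Uniformizers) (ω : P.Form q) :
    h'.differential m l q (TwistedForm.map f m l q (P.tmul (t.prod_mem m) ω)) =
      TwistedForm.map f m l (q + 1) (P.tmul (t.prod_mem m) (t.twistedD m ω)) :=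
  have := h'.choose
  CartierChart.differential_map_tmul _ _ _ _ _ _ _

theorem exists_uniformizers : ∃ t : P.Uniformizers, ∀ z : P.TwistedForm m l q, ∃ ω : P.Form q,
    z = P.tmul (t.prod_mem m) ω ∧
      h.differential m l q z = P.tmul (t.prod_mem m) (t.twistedD m ω) := by
  have := h.choose
  let K : CartierChart P p := h.choose_spec.some
  refine ⟨K.unif, fun z ↦ ?_⟩
  obtain ⟨ω, rfl⟩ := K.unif.twist_surjective m l q z
  exact ⟨ω, K.unif.twist_apply _ _ _ _, (K.unif.differential_twist _ _ _ _ _).trans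
    (K.unif.twist_apply _ _ _ _)⟩

variable {m l}

theorem differential_cartier (z) : h.differential m l q (h.cartier hm hl q z) = 0 :=
  have := h.choose
  CartierChart.differential_cartier _ hm hl _ _

theorem exists_of_differential_eq_zero {z} (hz : h.differential m l q z = 0) :
    ∃ z', z - h.cartier hm hl q z' ∈ h.boundary m l q :=
  have := h.choose
  CartierChart.exists_of_differential_eq_zero _ hm hl _ hz

theorem eq_zero_of_cartier_mem {z} (hz : h.cartier hm hl q z ∈ h.boundary m l q) : z = 0 :=
  have := h.choose
  CartierChart.eq_zero_of_cartier_mem _ hm hl _ hz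

theorem map_cartier (z) : TwistedForm.map f m l q (h.cartier hm hl q z) -
    h'.cartier hm hl q (TwistedForm.map f m' _ q z) ∈ h'.boundary m l q :=
  have := h.choose
  have := h'.choose
  CartierChart.map_cartier _ _ _ hm hl _ _

theorem tmul_sub_cartier_mem {x : P.A} (hx : x ∈ P.ideal m') {ω : P.Form q}
    (hω : ω ∈ LogForm.logSubgroup P.ι P.I q) :
    P.tmul (P.pow_mem_ideal hm.1 hx) ω - h.cartier hm hl q (P.tmul hx ω) ∈ h.boundary m l q :=
  have := h.choose
  CartierChart.tmul_sub_cartier_mem _ hm hl _ hx hω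

attribute [irreducible] differential boundary cartier

end HasChart

end Chart

/-! ### From charts to sheaves -/

section Global

open LogDatum

variable {X : Scheme.{u}} {Λ : Type v} {P : (X.AffineEtale)ᵒᵖ ⥤ LogDatum.{u} Λ} {p : ℕ}
  [Fact p.Prime]

theorem res_toOmega (m l : Λ →₀ ℕ) (q : ℕ) {U V : X.AffineEtale} (g : V ⟶ U)
    (z : (P.obj (op U)).TwistedForm m l q) :
    res (omega P m l q).obj g (toOmega P m l q U z) =
      toOmega P m l q V (TwistedForm.map (P.map g.op) m l q z) :=
  res_app (toSheafify _ (P ⋙ LogDatum.twistedForms m l q)) g z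

theorem locally_eq_zero_of_toOmega {m l : Λ →₀ ℕ} {q : ℕ} {U : X.AffineEtale}
    {z : (P.obj (op U)).TwistedForm m l q} (h : toOmega P m l q U z = 0) :
    Locally U fun _ g ↦ TwistedForm.map (P.map g.op) m l q z = 0 :=
  (locally_eq_of_toSheafify_eq (P ⋙ LogDatum.twistedForms m l q) (s := z) (t := 0)
    (h.trans (map_zero _).symm)).mono fun _ _ hg ↦ hg.trans (map_zero _)

theorem locally_exists_toOmega (m l : Λ →₀ ℕ) (q : ℕ) {U : X.AffineEtale}
    (s : (omega P m l q).obj.obj (op U)) :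
    Locally U fun V g ↦ ∃ z, toOmega P m l q V z = res (omega P m l q).obj g s :=
  locally_exists_toSheafify (P ⋙ LogDatum.twistedForms m l q) s

theorem map_comp_apply (m l : Λ →₀ ℕ) (q : ℕ) {U V W : X.AffineEtale} (g : V ⟶ U) (k : W ⟶ V)
    (z : (P.obj (op U)).TwistedForm m l q) :
    TwistedForm.map (P.map (k ≫ g).op) m l q z =
      TwistedForm.map (P.map k.op) m l q (TwistedForm.map (P.map g.op) m l q z) :=
  res_comp (P ⋙ LogDatum.twistedForms m l q) g k z

theorem locally_eq_zero_of_toOmega' {m l : Λ →₀ ℕ} {q : ℕ} {U : X.AffineEtale}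
    (hP : ∀ U : X.AffineEtale, Locally U fun V _ ↦ HasChart (P.obj (op V)) p)
    {z : (P.obj (op U)).TwistedForm m l q} (h : toOmega P m l q U z = 0) :
    Locally U fun V g ↦ HasChart (P.obj (op V)) p ∧ TwistedForm.map (P.map g.op) m l q z = 0 :=
  (locally_eq_zero_of_toOmega h).bind fun V g hg ↦ (hP V).mono fun W k hW ↦
    ⟨hW, by rw [map_comp_apply, hg, map_zero]⟩

theorem locally_eq_of_toOmega' {m l : Λ →₀ ℕ} {q : ℕ} {U : X.AffineEtale}
    (hP : ∀ U : X.AffineEtale, Locally U fun V _ ↦ HasChart (P.obj (op V)) p)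
    {z z' : (P.obj (op U)).TwistedForm m l q}
    (h : toOmega P m l q U z = toOmega P m l q U z') :
    Locally U fun V g ↦ HasChart (P.obj (op V)) p ∧
      TwistedForm.map (P.map g.op) m l q z = TwistedForm.map (P.map g.op) m l q z' :=
  (locally_eq_of_toSheafify_eq (P ⋙ LogDatum.twistedForms m l q) h).bind fun V g hg ↦
    (hP V).mono fun W k hW ↦ ⟨hW, by
      rw [map_comp_apply, map_comp_apply]
      exact congrArg _ hg⟩

theorem locally_exists_toOmega' (m l : Λ →₀ ℕ) (q : ℕ) {U : X.AffineEtale}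
    (hP : ∀ U : X.AffineEtale, Locally U fun V _ ↦ HasChart (P.obj (op V)) p)
    (s : (omega P m l q).obj.obj (op U)) :
    Locally U fun V g ↦ HasChart (P.obj (op V)) p ∧
      ∃ z, toOmega P m l q V z = res (omega P m l q).obj g s :=
  (locally_exists_toOmega m l q s).bind fun V g ⟨z, hz⟩ ↦ (hP V).mono fun W k hW ↦
    ⟨hW, TwistedForm.map (P.map k.op) m l q z, by rw [res_comp, ← hz, res_toOmega]⟩

/-- A twisted differential is given over a chart by the twisted differential of the chart. -/
theorem d_toOmega {m l : Λ →₀ ℕ} (δ : TwistedDifferential P m l) (q : ℕ) {V : X.AffineEtale}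
    (hV : HasChart (P.obj (op V)) p) (z : (P.obj (op V)).TwistedForm m l q) :
    ev (δ.d q) V (toOmega P m l q V z) =
      toOmega P m l (q + 1) V (hV.differential m l q z) := by
  obtain ⟨t, ht⟩ := hV.exists_uniformizers m l (q := q)
  obtain ⟨ω, rfl, h⟩ := ht z
  rw [h]
  exact δ.d_tmul V t q ω

theorem twistedDifferential_subsingleton
    (hP : ∀ U : X.AffineEtale, Locally U fun V _ ↦ HasChart (P.obj (op V)) p)
    {m l : Λ →₀ ℕ} (δ δ' : TwistedDifferential P m l) : δ = δ' := by
  ext q : 2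
  exact sheafify_hom_ext_of_locally hP fun V hV z ↦
    (d_toOmega δ q hV z).trans (d_toOmega δ' q hV z).symm

theorem exists_twistedDifferential
    (hP : ∀ U : X.AffineEtale, Locally U fun V _ ↦ HasChart (P.obj (op V)) p)
    (m l : Λ →₀ ℕ) : Nonempty (TwistedDifferential P m l) := by
  have h (q : ℕ) : ∃ d : omega P m l q ⟶ omega P m l (q + 1),
      ∀ V (hV : HasChart (P.obj (op V)) p) (z : (P.obj (op V)).TwistedForm m l q),
        ev d V (toOmega P m l q V z) =
          toOmega P m l (q + 1) V (hV.differential m l q z) :=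
    exists_sheafify_hom (F := P ⋙ LogDatum.twistedForms m l q) (G := omega P m l (q + 1)) hP
      (fun V hV ↦ (toOmega P m l (q + 1) V).comp (hV.differential m l q))
      fun V hV W hW k z ↦ ((res_toOmega m l (q + 1) k _).trans
        (congrArg _ (hV.map_differential hW (P.map k.op) m l z))).symm
  choose d hd using h
  refine ⟨⟨d, fun q ↦ ?_, fun U t q ω ↦ ?_⟩⟩
  · refine sheafify_hom_ext_of_locally hP fun V hV
      (z : (P.obj (op V)).TwistedForm m l q) ↦ ?_
    have hz := congrArg (ev (d (q + 1)) V) (hd q V hV z)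
    rw [hd (q + 1) V hV, hV.differential_differential, map_zero] at hz
    exact hz
  · refine eq_of_locally_eq _ ((hP U).mono fun V g hV ↦ ?_)
    refine (res_ev (d q) g _).trans ?_
    rw [res_toOmega, res_toOmega, hd q V hV, hV.differential_map_tmul]

section Homology

variable {m m' l : Λ →₀ ℕ} (δ : TwistedDifferential P m l)

/-- The inclusion of the cocycles. -/
def cyclesHom (q : ℕ) : δ.complex.cycles q ⟶ omega P m l q := δ.complex.iCycles q

theorem complex_d (q : ℕ) : δ.complex.d q (q + 1) = δ.d q := by
  change CochainComplex.of.d (omega P m l) δ.d q (q + 1) = _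
  exact
  CochainComplex.of_d (omega P m l) δ.d q

theorem ev_cyclesHom_injective (q : ℕ) (U : X.AffineEtale) :
    Function.Injective (ev (cyclesHom δ q) U) := ev_iCycles_injective _ q U

theorem exists_cycle {q : ℕ} {U : X.AffineEtale} {s : (omega P m l q).obj.obj (op U)}
    (hs : ev (δ.d q) U s = 0) :
    ∃ z : (δ.complex.cycles q).obj.obj (op U), ev (cyclesHom δ q) U z = s :=
  exists_ev_iCycles δ.complex q (s := s) (by rw [complex_d]; exact hs)

theorem ev_d_cyclesHom {q : ℕ} {U : X.AffineEtale} (z) :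
    ev (δ.d q) U (ev (cyclesHom δ q) U z) = 0 := by
  rw [← complex_d]
  exact ev_d_iCycles δ.complex q z

theorem homologyπ_eq_zero_of_cyclesHom_eq_d {q : ℕ} {U : X.AffineEtale}
    {z : (δ.complex.cycles (q + 1)).obj.obj (op U)} {w}
    (h : ev (cyclesHom δ (q + 1)) U z = ev (δ.d q) U w) :
    ev (δ.complex.homologyπ (q + 1)) U z = 0 := by
  rw [← complex_d] at h
  exact homologyπ_eq_zero_of_d δ.complex h

theorem locally_cyclesHom_eq_zero {U : X.AffineEtale} {z : (δ.complex.cycles 0).obj.obj (op U)}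
    (h : ev (δ.complex.homologyπ 0) U z = 0) :
    Locally U fun V g ↦ ev (cyclesHom δ 0) V (res (δ.complex.cycles 0).obj g z) = 0 :=
  (locally_exists_d δ.complex h).mono fun V g ⟨w, hw⟩ ↦ by
    rw [δ.complex.shape _ _ (by simp)] at hw
    exact hw

theorem locally_exists_cyclesHom_eq_d {q : ℕ} {U : X.AffineEtale}
    {z : (δ.complex.cycles (q + 1)).obj.obj (op U)}
    (h : ev (δ.complex.homologyπ (q + 1)) U z = 0) :
    Locally U fun V g ↦ ∃ w, ev (cyclesHom δ (q + 1)) V (res (δ.complex.cycles (q + 1)).obj g z) =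
      ev (δ.d q) V w :=
  (locally_exists_d δ.complex h).mono fun V g ⟨w, hw⟩ ↦ by
    have e : (ComplexShape.up ℕ).prev (q + 1) = q := by simp
    generalize (ComplexShape.up ℕ).prev (q + 1) = i at e w hw
    subst e
    rw [complex_d] at hw
    exact ⟨w, hw⟩

theorem homologyπ_eq_zero_of_mem_boundary {q : ℕ} {V : X.AffineEtale}
    (hV : HasChart (P.obj (op V)) p) {z : (δ.complex.cycles q).obj.obj (op V)}
    {y : (P.obj (op V)).TwistedForm m l q} (hy : y ∈ hV.boundary m l q)
    (h : ev (cyclesHom δ q) V z = toOmega P m l q V y) :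
    ev (δ.complex.homologyπ q) V z = 0 := by
  rcases q with _ | q
  · rw [hV.mem_boundary_zero] at hy
    rw [hy, map_zero, ← map_zero (ev (cyclesHom δ 0) V)] at h
    rw [ev_cyclesHom_injective _ _ _ h, map_zero]
  · obtain ⟨w, rfl⟩ := (hV.mem_boundary_succ m l).1 hy
    rw [← d_toOmega δ q hV] at h
    exact homologyπ_eq_zero_of_cyclesHom_eq_d δ h

theorem locally_mem_boundary
    (hP : ∀ U : X.AffineEtale, Locally U fun V _ ↦ HasChart (P.obj (op V)) p) {q : ℕ}
    {U : X.AffineEtale} {z : (δ.complex.cycles q).obj.obj (op U)}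
    {y : (P.obj (op U)).TwistedForm m l q}
    (hz : ev (δ.complex.homologyπ q) U z = 0)
    (h : ev (cyclesHom δ q) U z = toOmega P m l q U y) :
    Locally U fun V g ↦ ∃ hV : HasChart (P.obj (op V)) p,
      TwistedForm.map (P.map g.op) m l q y ∈ hV.boundary m l q := by
  rcases q with _ | q
  · refine (locally_cyclesHom_eq_zero δ hz).bind fun V g hg ↦ ?_
    rw [← res_ev, h, res_toOmega] at hg
    refine (locally_eq_zero_of_toOmega' hP hg).mono fun W k ⟨hW, hk⟩ ↦ ⟨hW, ?_⟩
    rw [hW.mem_boundary_zero, map_comp_apply, hk]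
  · refine (locally_exists_cyclesHom_eq_d δ hz).bind fun V g ⟨w, hg⟩ ↦ ?_
    rw [← res_ev, h, res_toOmega] at hg
    refine (locally_exists_toOmega' m l q hP w).bind fun W k ⟨hW, w', hw'⟩ ↦ ?_
    have e : toOmega P m l (q + 1) W (TwistedForm.map (P.map k.op) m l (q + 1)
        (TwistedForm.map (P.map g.op) m l (q + 1) y)) =
          toOmega P m l (q + 1) W (hW.differential m l q w') := by
      rw [← res_toOmega, hg, res_ev, ← hw', d_toOmega δ q hW]
    refine (locally_eq_of_toOmega' hP e).mono fun T j h ↦ ⟨h.1, ?_⟩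
    have hT := h.1
    have hj := h.2.trans (hW.map_differential hT (P.map j.op) m l w')
    have e₁ := (map_comp_apply m l (q + 1) g (j ≫ k) y).trans
      ((map_comp_apply m l (q + 1) k j _).trans hj)
    exact (hT.mem_boundary_succ m l).2 ⟨_, e₁.symm⟩

theorem homologyπ_eq_res {q : ℕ} {V W : X.AffineEtale} (hW : HasChart (P.obj (op W)) p) (k : W ⟶ V)
    {y : (P.obj (op V)).TwistedForm m l q} {y' : (P.obj (op W)).TwistedForm m l q}
    (hy : TwistedForm.map (P.map k.op) m l q y - y' ∈ hW.boundary m l q)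
    {a : (δ.complex.cycles q).obj.obj (op V)} {b : (δ.complex.cycles q).obj.obj (op W)}
    (ha : ev (cyclesHom δ q) V a = toOmega P m l q V y)
    (hb : ev (cyclesHom δ q) W b = toOmega P m l q W y') :
    ev (δ.complex.homologyπ q) W b =
      res (δ.complex.homology q).obj k (ev (δ.complex.homologyπ q) V a) := by
  rw [res_ev, eq_comm, ← sub_eq_zero, ← map_sub]
  refine homologyπ_eq_zero_of_mem_boundary δ hW hy ?_
  rw [map_sub (ev (cyclesHom δ q) W), map_sub (toOmega P m l q W), ← res_ev, ha, hb, res_toOmega]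

/-- The cocycle given by the inverse Cartier map of a chart. -/
theorem exists_cartierCycle (hm : IsLeast {n : Λ →₀ ℕ | m ≤ p • n} m') (hl : ∀ i, l i ≤ 1) (q : ℕ)
    {V : X.AffineEtale} (hV : HasChart (P.obj (op V)) p) :
    ∃ c : (P.obj (op V)).TwistedForm m' (l.filter fun i ↦ p ∣ m i) q →+
        (δ.complex.cycles q).obj.obj (op V),
      ∀ z, ev (cyclesHom δ q) V (c z) = toOmega P m l q V (hV.cartier hm hl q z) := by
  have h (z) : ∃ c : (δ.complex.cycles q).obj.obj (op V),
      ev (cyclesHom δ q) V c = toOmega P m l q V (hV.cartier hm hl q z) :=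
    exists_cycle δ (by rw [d_toOmega δ q hV, hV.differential_cartier, map_zero])
  choose c hc using h
  refine ⟨AddMonoidHom.mk' c fun x y ↦ ev_cyclesHom_injective δ q V ?_, hc⟩
  rw [map_add, hc, hc, hc, map_add, map_add]

theorem ev_d_toOmega_eq_zero
    (hP : ∀ U : X.AffineEtale, Locally U fun V _ ↦ HasChart (P.obj (op V)) p) {q : ℕ}
    {U : X.AffineEtale} {y : (P.obj (op U)).TwistedForm m l q}
    (h : ∀ V (g : V ⟶ U) (hV : HasChart (P.obj (op V)) p),
      hV.differential m l q (TwistedForm.map (P.map g.op) m l q y) = 0) :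
    ev (δ.d q) U (toOmega P m l q U y) = 0 :=
  eq_of_locally_eq _ <| (hP U).mono fun V g hV ↦ by
    rw [res_ev, res_toOmega, d_toOmega δ q hV, h V g hV, map_zero, map_zero]

theorem differential_eq_zero_of_sub_mem {Q : LogDatum.{u} Λ} (h : HasChart Q p)
    (hm : IsLeast {n : Λ →₀ ℕ | m ≤ p • n} m') (hl : ∀ i, l i ≤ 1) {q : ℕ}
    {y : Q.TwistedForm m l q} {x}
    (hy : y - h.cartier hm hl q x ∈ h.boundary m l q) : h.differential m l q y = 0 := by
  have h₁ := h.differential_of_mem_boundary m l hy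
  rwa [map_sub, h.differential_cartier, sub_zero] at h₁

/-- The inverse Cartier maps of the charts glue to an isomorphism onto the cohomology sheaf, which
is given by `x ⊗ ω ↦ x^p ⊗ ω` on logarithmic forms. -/
theorem exists_inverseCartier (hm : IsLeast {n : Λ →₀ ℕ | m ≤ p • n} m') (hl : ∀ i, l i ≤ 1)
    (hP : ∀ U : X.AffineEtale, Locally U fun V _ ↦ HasChart (P.obj (op V)) p) (q : ℕ) :
    ∃ C : omega P m' (l.filter fun i ↦ p ∣ m i) q ≅ δ.complex.homology q,
      IsInverseCartier δ hm.1 (l.filter fun i ↦ p ∣ m i) q C.hom := by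
  choose c hc using fun V (hV : HasChart (P.obj (op V)) p) ↦ exists_cartierCycle δ hm hl q hV
  have hcomp : ∀ V (hV : HasChart (P.obj (op V)) p) W (hW : HasChart (P.obj (op W)) p)
      (k : W ⟶ V) z, ev (δ.complex.homologyπ q) W (c W hW (TwistedForm.map (P.map k.op) m' _ q z)) =
        res (δ.complex.homology q).obj k (ev (δ.complex.homologyπ q) V (c V hV z)) := by
    intro V hV W hW k z
    exact homologyπ_eq_res δ hW k (hV.map_cartier hW (P.map k.op) hm hl z) (hc V hV z) (hc W hW _)
  -- the classes of the local cocycles are compatible with restriction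
  obtain ⟨C, hC⟩ : ∃ C : omega P m' (l.filter fun i ↦ p ∣ m i) q ⟶ δ.complex.homology q,
      ∀ V (hV : HasChart (P.obj (op V)) p) z, ev C V (toOmega P m' _ q V z) =
        ev (δ.complex.homologyπ q) V (c V hV z) :=
    exists_sheafify_hom (F := P ⋙ LogDatum.twistedForms m' _ q) hP
      (fun V hV ↦ (ev (δ.complex.homologyπ q) V).comp (c V hV)) hcomp
  have : IsIso C := by
    refine isIso_of_locally C (fun U s hs ↦ ?_) fun U s ↦ ?_
    -- injectivity: a section with exact image is locally given by a form that maps to an exact one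
    · refine (locally_exists_toOmega' m' _ q hP s).bind fun V g ⟨hV, z, hz⟩ ↦ ?_
      have e : ev C V (toOmega P m' _ q V z) = 0 := by
        rw [hz, ← res_ev]
        exact (congrArg _ hs).trans (map_zero _)
      rw [hC V hV] at e
      refine (locally_mem_boundary δ hP e (hc V hV z)).mono fun W k ⟨hW, hk⟩ ↦ ?_
      have h₁ := sub_mem hk (hV.map_cartier hW (P.map k.op) hm hl z)
      rw [sub_sub_cancel] at h₁
      have h₂ := hW.eq_zero_of_cartier_mem hm hl h₁
      rw [res_comp, ← hz, res_toOmega, h₂, map_zero]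
    -- surjectivity: a class is locally given by a closed form on a chart
    · refine (locally_exists_homologyπ δ.complex s).bind fun V g ⟨z, hz⟩ ↦ ?_
      refine (locally_exists_toOmega' m l q hP (ev (cyclesHom δ q) V z)).bind
        fun W k ⟨hW, y, hy⟩ ↦ ?_
      have e : toOmega P m l (q + 1) W (hW.differential m l q y) = 0 := by
        rw [← d_toOmega δ q hW, hy, ← res_ev, ev_d_cyclesHom, map_zero]
      refine (locally_eq_zero_of_toOmega' hP e).mono fun T j ⟨hT, hj⟩ ↦ ?_
      rw [hW.map_differential hT] at hj
      obtain ⟨x, hx⟩ := hT.exists_of_differential_eq_zero hm hl hj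
      refine ⟨toOmega P m' _ q T x, ?_⟩
      have h₁ := homologyπ_eq_res δ hT j hx (hy.symm ▸ (res_ev (cyclesHom δ q) k z).symm) (hc T hT
          x)
      rw [← res_ev, hz, ← res_comp, ← res_comp] at h₁
      exact (hC T hT x).trans (h₁.trans (by rw [Category.assoc]))
  -- on logarithmic forms, `x^p ⊗ ω` differs from the local inverse Cartier map by an exact form
  refine ⟨asIso C, fun U x hx ω hω ↦ ?_⟩
  have hy (V) (g : V ⟶ U) (hV : HasChart (P.obj (op V)) p) :
      TwistedForm.map (P.map g.op) m l q ((P.obj (op U)).tmul ((P.obj (op U)).pow_mem_ideal hm.1 hx)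
          ω) -
        hV.cartier hm hl q (TwistedForm.map (P.map g.op) m' _ q ((P.obj (op U)).tmul hx ω)) ∈
          hV.boundary m l q := by
    have := hV.tmul_sub_cartier_mem hm hl (Hom.map_ideal (P.map g.op) m' hx)
      (CartierChart.form_map_mem_logSubgroup (P.map g.op) hω)
    have e : TwistedForm.map (P.map g.op) m l q
        ((P.obj (op U)).tmul ((P.obj (op U)).pow_mem_ideal hm.1 hx) ω) = _ :=
      (CartierChart.map_tmul' (P.map g.op) _ ω).trans (CartierChart.tmul_congr
        (map_pow (P.map g.op).φ x p) _ ((P.obj (op V)).pow_mem_ideal hm.1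
          (Hom.map_ideal (P.map g.op) m' hx)) _)
    rw [e]
    exact this
  obtain ⟨z, hz⟩ := exists_cycle δ (ev_d_toOmega_eq_zero δ hP fun V g hV ↦
    differential_eq_zero_of_sub_mem hV hm hl (hy V g hV))
  refine ⟨z, hz, eq_of_locally_eq _ <| (hP U).mono fun V g hV ↦ ?_⟩
  have h₁ := homologyπ_eq_res δ hV g (hy V g hV) hz (hc V hV _)
  rw [← hC V hV, ← res_toOmega, ← res_ev C] at h₁
  exact h₁

end Homology

end Global

/-! ### Monomial coordinates on a quotient of a ring with a `p`-basis -/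

section MonomialCoordinates

variable {p : ℕ} [Fact p.Prime] {E : Type*} [CommRing E] [Fact ((p : E) = 0)] {σ : Type*}

open Classical in
/-- The properties of the images `x_s` of the members of a `p`-basis `x'_s` in the quotient by
`∏_{s ∈ J} x'_s`: the monomials in the `x_s` generate the ring over its `p`-th powers, and a linear
combination of them lies in the ideal generated by `∏_{s ∈ L} x_s`, with `L ⊆ J`, only for the
obvious reason. -/
structure MonomialCoordinates (p : ℕ) [Fact p.Prime] {E : Type*} [CommRing E]
    [Fact ((p : E) = 0)] (x : σ → E) (J : Finset σ) : Prop where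
  surjective : Function.Surjective (pExpand p x)
  mem_of_mem (L : Finset σ) (hL : L ⊆ J) (c : (σ →₀ ZMod p) →₀ E)
    (h : pExpand p x c ∈ Ideal.span {∏ s ∈ L, x s}) (α : σ →₀ ZMod p) :
    c α ∈ Ideal.span {∏ s ∈ L with α s = 0, x s}
  prod_eq_zero : ∏ s ∈ J, x s = 0

theorem mul_pExpand (x : σ → E) (a : E) (c : (σ →₀ ZMod p) →₀ E) :
    a ^ p * pExpand p x c =
      pExpand p x (c.mapRange (a * ·) (mul_zero a)) := by
  induction c using Finsupp.induction_linear with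
  | zero => simp
  | add c d hc hd =>
    rw [map_add, mul_add, hc, hd, ← map_add, ← Finsupp.mapRange_add (mul_add a)]
  | single α c =>
    rw [Finsupp.mapRange_single, pExpand_single, pExpand_single, mul_pow]
    ring

/-- The images of a `p`-basis in the quotient by a product of some of its members are monomial
coordinates. -/
theorem MonomialCoordinates.of_isPBasis {E' : Type*} [CommRing E'] [Fact ((p : E') = 0)]
    {x : σ → E'} (hx : IsPBasis p x) {J : Finset σ} {q : E' →+* E} (hq : Function.Surjective q)
    (hker : RingHom.ker q = Ideal.span {∏ s ∈ J, x s}) :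
    MonomialCoordinates p (fun s ↦ q (x s)) J := by
  classical
  refine ⟨fun a ↦ ?_, fun L hL c h α ↦ ?_, ?_⟩
  · obtain ⟨a, rfl⟩ := hq a
    obtain ⟨c, rfl⟩ := hx.2 a
    exact ⟨_, (pExpand_map q x c).symm⟩
  · obtain ⟨c, rfl⟩ : ∃ c' : (σ →₀ ZMod p) →₀ E', c'.mapRange q (map_zero q) = c :=
      Finsupp.mapRange_surjective q (map_zero q) hq c
    rw [← pExpand_map, ← map_prod, Ideal.mem_span_singleton'] at h
    obtain ⟨a, ha⟩ := h
    obtain ⟨a, rfl⟩ := hq a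
    have hmem : pExpand p x c ∈ Ideal.span {∏ s ∈ L, x s} := by
      have h1 : a * (∏ s ∈ L, x s) - pExpand p x c ∈ RingHom.ker q := by
        rw [RingHom.mem_ker, map_sub, map_mul, ha, sub_self]
      rw [hker] at h1
      have h2 : Ideal.span {∏ s ∈ J, x s} ≤ Ideal.span {∏ s ∈ L, x s} :=
        Ideal.span_singleton_le_span_singleton.2 (Finset.prod_dvd_prod_of_subset _ _ _ hL)
      have h3 := Ideal.mul_mem_left _ a (Ideal.mem_span_singleton_self (∏ s ∈ L, x s))
      exact (Submodule.sub_mem_iff_right _ h3).1 (h2 h1)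
    obtain ⟨b, hb⟩ := Ideal.mem_span_singleton'.1 hmem
    obtain ⟨d, rfl⟩ := hx.2 b
    -- multiplication by `∏_{s ∈ L} x_s` permutes the monomials up to `p`-th powers
    have key (d : (σ →₀ ZMod p) →₀ E') : ∃ c', pExpand p x c' = pExpand p x d * ∏ s ∈ L, x s ∧
        ∀ α, c' α ∈ Ideal.span {∏ s ∈ L with α s = 0, x s} := by
      induction d using Finsupp.induction_linear with
      | zero => exact ⟨0, by simp, fun α ↦ zero_mem _⟩
      | add d d' h h' =>
        obtain ⟨c, hc, hc'⟩ := h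
        obtain ⟨c', hd, hd'⟩ := h'
        exact ⟨c + c', by rw [map_add, hc, hd, map_add, add_mul],
          fun α ↦ add_mem (hc' α) (hd' α)⟩
      | single β b =>
        refine ⟨Finsupp.single (β + expInd p L)
          (b * ∏ s ∈ L with (β + expInd p L) s = 0, x s), ?_, fun α ↦ ?_⟩
        · rw [pExpand_single, pExpand_single, mul_pow, mul_right_comm, mul_comm (mon p x β),
            prod_mul_mon]
          ring
        · by_cases h : β + expInd p L = α
          · subst h
            rw [Finsupp.single_eq_same]
            exact Ideal.mul_mem_left _ _ (Ideal.mem_span_singleton_self _)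
          · rw [Finsupp.single_eq_of_ne (Ne.symm h)]
            exact zero_mem _
    obtain ⟨c', hc', h'⟩ := key d
    obtain rfl : c' = c := hx.1 (hc'.trans hb)
    obtain ⟨e, he⟩ := Ideal.mem_span_singleton'.1 (h' α)
    rw [Finsupp.mapRange_apply, ← he, map_mul, map_prod]
    exact Ideal.mul_mem_left _ _ (Ideal.mem_span_singleton_self _)
  · rw [← map_prod, ← RingHom.mem_ker, hker]
    exact Ideal.mem_span_singleton_self _

/-- Monomial coordinates are preserved by localization. -/
theorem MonomialCoordinates.localization {x : σ → E} {J : Finset σ}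
    (h : MonomialCoordinates p x J) (M : Submonoid E) {F : Type*} [CommRing F]
    [Fact ((p : F) = 0)] [Algebra E F] [IsLocalization M F] :
    MonomialCoordinates p (fun s ↦ algebraMap E F (x s)) J := by
  classical
  have hp := (Fact.out : p.Prime)
  refine ⟨fun a ↦ ?_, fun L hL c hc α ↦ ?_, ?_⟩
  · obtain ⟨⟨a, s⟩, rfl⟩ := IsLocalization.mk'_surjective M a
    dsimp only
    -- `a / s = (a s ^ (p - 1)) / s ^ p`
    obtain ⟨c, hc⟩ := h.surjective (a * s ^ (p - 1))
    obtain ⟨u, hu⟩ := (IsLocalization.map_units F s).exists_right_inv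
    refine ⟨(c.mapRange (algebraMap E F) (map_zero _)).mapRange (u * ·) (mul_zero u), ?_⟩
    rw [← mul_pExpand, ← pExpand_map, hc, map_mul, map_pow, IsLocalization.eq_mk'_iff_mul_eq]
    calc _ = algebraMap E F a * (algebraMap E F s * u) * (algebraMap E F s * u) ^ (p - 1) := by
          obtain ⟨n, hn⟩ := Nat.exists_eq_succ_of_ne_zero hp.ne_zero
          rw [hn, Nat.succ_sub_one, pow_succ, mul_pow]
          ring
      _ = _ := by rw [hu, one_pow, mul_one, mul_one]
  -- clear the denominators of the coefficients, multiplying the relation by `s ^ p` and `u ^ p`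
  · obtain ⟨s, hs⟩ := IsLocalization.exist_integer_multiples_of_finset M (c.support.image c)
    have hs' (β) : ∃ e : E, algebraMap E F e = algebraMap E F s * c β := by
      by_cases hβ : c β = 0
      · exact ⟨0, by rw [hβ, map_zero, mul_zero]⟩
      · obtain ⟨e, he⟩ := hs (c β) (Finset.mem_image_of_mem c (Finsupp.mem_support_iff.2 hβ))
        exact ⟨e, he.trans (Algebra.smul_def _ _)⟩
    choose e he using hs'
    let c' : (σ →₀ ZMod p) →₀ E := Finsupp.onFinset c.support
      (fun β ↦ if c β = 0 then 0 else e β) fun β hβ ↦ Finsupp.mem_support_iff.2 fun h0 ↦ by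
        simp [h0] at hβ
    have hc' : c'.mapRange (algebraMap E F) (map_zero _) =
        c.mapRange (algebraMap E F s * ·) (mul_zero _) := by
      ext β
      simp only [c', Finsupp.mapRange_apply, Finsupp.onFinset_apply]
      split_ifs with h0
      · rw [h0, map_zero, mul_zero]
      · exact he β
    have h1 : algebraMap E F (pExpand p x c') ∈
        (Ideal.span {∏ s ∈ L, x s}).map (algebraMap E F) := by
      rw [pExpand_map, hc', ← mul_pExpand, Ideal.map_span, Set.image_singleton, map_prod]
      exact Ideal.mul_mem_left _ _ hc
    obtain ⟨u, hu, h2⟩ := (IsLocalization.algebraMap_mem_map_algebraMap_iff M F _ _).1 h1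
    have h3 : pExpand p x (c'.mapRange (u * ·) (mul_zero u)) ∈ Ideal.span {∏ s ∈ L, x s} := by
      obtain ⟨n, hn⟩ := Nat.exists_eq_succ_of_ne_zero hp.ne_zero
      rw [← mul_pExpand, show u ^ p = u ^ n * u by rw [hn, pow_succ], mul_assoc]
      exact Ideal.mul_mem_left _ _ h2
    have h4 := Ideal.mem_map_of_mem (algebraMap E F) (h.mem_of_mem L hL _ h3 α)
    have h5 := DFunLike.congr_fun hc' α
    rw [Finsupp.mapRange_apply, Finsupp.mapRange_apply] at h5
    rw [Finsupp.mapRange_apply, map_mul, h5, Ideal.map_span, Set.image_singleton, map_prod] at h4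
    exact (Ideal.unit_mul_mem_iff_mem _ (IsLocalization.map_units F s)).1
      ((Ideal.unit_mul_mem_iff_mem _ (IsLocalization.map_units F ⟨u, hu⟩)).1 h4)
  · rw [← map_prod, h.prod_eq_zero, map_zero]

/-! ### The grading by the exponents of the monomials modulo `p` -/

namespace MonomialCoordinates

variable {x : σ → E} {J : Finset σ}

theorem mon_mul_pow_eq_zero (h : MonomialCoordinates p x J) {c : (σ →₀ ZMod p) →₀ E} (hc : pExpand p
    x c = 0) (α : σ →₀ ZMod p) :
    mon p x α * c α ^ p = 0 := by
  classical
  have h1 := h.mem_of_mem J subset_rfl c (by rw [hc]; exact zero_mem _) α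
  obtain ⟨a, ha⟩ := Ideal.mem_span_singleton'.1 h1
  have h2 : ∏ s ∈ J, x s ∣ mon p x α * c α ^ p := by
    rw [← ha, mul_pow, mul_left_comm]
    refine Dvd.dvd.mul_left ?_ _
    rw [← Finset.prod_filter_mul_prod_filter_not J fun s ↦ α s = 0, mul_comm]
    refine mul_dvd_mul ?_ (dvd_pow_self _ (Fact.out : p.Prime).ne_zero)
    rw [mon_eq_prod x α (F := J ∪ α.support) Finset.subset_union_right]
    refine (Finset.prod_dvd_prod_of_dvd _ _ fun s hs ↦ ?_).trans
      (Finset.prod_dvd_prod_of_subset _ _ _ fun s hs ↦ Finset.mem_union_left _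
        (Finset.mem_filter.1 hs).1)
    refine dvd_pow_self _ fun h0 ↦ (Finset.mem_filter.1 hs).2 ((ZMod.val_eq_zero _).1 h0)
  rw [h.prod_eq_zero] at h2
  exact zero_dvd_iff.1 h2

theorem val_add_cast (a b : ZMod p) : ((a + b).val : E) = a.val + b.val := by
  rw [ZMod.val_add, ← Nat.cast_add]
  conv_rhs => rw [← Nat.mod_add_div (a.val + b.val) p]
  rw [Nat.cast_add, Nat.cast_mul, (Fact.out : (p : E) = 0), zero_mul, add_zero]

variable (x) in
/-- The additive map `(c_α)_α ↦ ∑ α_s x^α c_α^p`. -/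
def weightSum (s : σ) : ((σ →₀ ZMod p) →₀ E) →+ E :=
  Finsupp.liftAddHom fun α ↦
    (AddMonoidHom.mulLeft ((α s).val * mon p x α)).comp (frob p E).toAddMonoidHom

theorem weightSum_single (s : σ) (α : σ →₀ ZMod p) (c : E) :
    weightSum x s (Finsupp.single α c) = (α s).val * mon p x α * c ^ p := by
  rw [weightSum, Finsupp.liftAddHom_apply_single]
  rfl

theorem ker_le_ker_weightSum (h : MonomialCoordinates p x J) (s : σ) : (pExpand p x).ker ≤
    (weightSum (p := p) x s).ker := by
  intro c hc
  rw [AddMonoidHom.mem_ker, weightSum, Finsupp.liftAddHom_apply]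
  refine Finset.sum_eq_zero fun α _ ↦ ?_
  have := h.mon_mul_pow_eq_zero hc α
  change (α s).val * mon p x α * c α ^ p = 0
  rw [mul_assoc, this, mul_zero]

/-- The Euler derivation of the coordinate `x_s` as an additive map. -/
def weightHom (h : MonomialCoordinates p x J) (s : σ) : E →+ E :=
  (pExpand p x).liftOfSurjective h.surjective ⟨weightSum x s, h.ker_le_ker_weightSum s⟩

theorem weightHom_pExpand (h : MonomialCoordinates p x J) (s : σ) (c) : h.weightHom s (pExpand p x
    c) = weightSum x s c :=
  AddMonoidHom.liftOfRightInverse_comp_apply _ _ _ ⟨weightSum x s, h.ker_le_ker_weightSum s⟩ c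

theorem weightHom_mon (h : MonomialCoordinates p x J) (s : σ) (α : σ →₀ ZMod p) (c : E) :
    h.weightHom s (mon p x α * c ^ p) = (α s).val * (mon p x α * c ^ p) := by
  rw [← pExpand_single, weightHom_pExpand, weightSum_single, pExpand_single, mul_assoc]

/-- An additive predicate holds on `E` if it holds for the multiples of monomials by `p`-th
powers. -/
theorem induction (h : MonomialCoordinates p x J) {P : E → Prop} (zero : P 0) (add : ∀ a b, P a → P
    b → P (a + b))
    (mon : ∀ α c, P (mon p x α * c ^ p)) (a : E) : P a := by
  obtain ⟨c, rfl⟩ := h.surjective a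
  induction c using Finsupp.induction_linear with
  | zero => rwa [map_zero]
  | add c d hc hd => rw [map_add]; exact add _ _ hc hd
  | single α c => rw [pExpand_single]; exact mon α c

/-- The Euler derivation of the coordinate `x_s`. -/
def weight (h : MonomialCoordinates p x J) (s : σ) : Derivation ℤ E E :=
  Derivation.mk' (h.weightHom s).toIntLinearMap fun a b ↦ by
    change h.weightHom s (a * b) = a * h.weightHom s b + b * h.weightHom s a
    refine h.induction (P := fun a ↦ h.weightHom s (a * b) = a * h.weightHom s b + b * h.weightHom s
        a)
      (by simp) (fun a a' h1 h2 ↦ ?_) (fun α c ↦ ?_) a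
    · rw [add_mul, map_add, h1, h2, map_add]; ring
    refine h.induction (P := fun b ↦ h.weightHom s (mon p x α * c ^ p * b) =
        mon p x α * c ^ p * h.weightHom s b + b * h.weightHom s (mon p x α * c ^ p))
      (by simp) (fun b b' h1 h2 ↦ ?_) (fun β d ↦ ?_) b
    · rw [mul_add, map_add, h1, h2, map_add]; ring
    obtain ⟨z, hz⟩ := exists_mon_mul_mon x α β
    have : mon p x α * c ^ p * (mon p x β * d ^ p) = mon p x (α + β) * (z * c * d) ^ p := by
      calc _ = mon p x α * mon p x β * (c ^ p * d ^ p) := by ring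
        _ = _ := by rw [hz]; ring
    rw [this, h.weightHom_mon, h.weightHom_mon, h.weightHom_mon, ← this, Finsupp.add_apply,
      val_add_cast]
    ring

theorem weight_x_self (h : MonomialCoordinates p x J) (s : σ) : h.weight s (x s) = x s := by
  have : Fact (1 < p) := ⟨(Fact.out : p.Prime).one_lt⟩
  have h1 := h.weightHom_mon s (Finsupp.single s 1) 1
  simp only [mon, pow_zero, Finsupp.prod_single_index, ZMod.val_one, one_pow, mul_one,
    pow_one, Finsupp.single_eq_same, Nat.cast_one, one_mul, ZMod.val_zero] at h1
  exact h1

theorem weight_x_of_ne (h : MonomialCoordinates p x J) {s s' : σ} (hs : s ≠ s') : h.weight s (x s')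
    = 0 := by
  have : Fact (1 < p) := ⟨(Fact.out : p.Prime).one_lt⟩
  have h1 := h.weightHom_mon s (Finsupp.single s' 1) 1
  simp only [mon, pow_zero, Finsupp.prod_single_index, ZMod.val_one, one_pow, mul_one,
    pow_one, Finsupp.single_eq_of_ne hs, Nat.cast_zero, zero_mul, ZMod.val_zero] at h1
  exact h1

/-- The values of a derivation lie in every submodule containing its values on the coordinates. -/
theorem derivation_mem (h : MonomialCoordinates p x J) {M : Type*} [AddCommGroup M] [Module E M] (δ
    : Derivation ℤ E M)
    (W : Submodule E M) (hW : ∀ s, δ (x s) ∈ W) (a : E) : δ a ∈ W := by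
  let R : Subring E :=
    { carrier := {a | δ a ∈ W}
      mul_mem' := fun {a b} ha hb ↦ by
        change δ (a * b) ∈ W
        rw [δ.leibniz]
        exact W.add_mem (W.smul_mem _ hb) (W.smul_mem _ ha)
      one_mem' := by change δ 1 ∈ W; rw [δ.map_one_eq_zero]; exact W.zero_mem
      add_mem' := fun {a b} ha hb ↦ by
        change δ (a + b) ∈ W
        rw [map_add]; exact W.add_mem ha hb
      zero_mem' := by change δ 0 ∈ W; rw [map_zero]; exact W.zero_mem
      neg_mem' := fun {a} ha ↦ by
        change δ (-a) ∈ W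
        rw [map_neg]; exact W.neg_mem ha }
  have hp (c : E) : c ^ p ∈ R := by
    change δ (c ^ p) ∈ W
    rw [Derivation.leibniz_pow, ← Nat.cast_smul_eq_nsmul E, (Fact.out : (p : E) = 0), zero_smul]
    exact W.zero_mem
  change a ∈ R
  refine h.induction R.zero_mem (fun a b ↦ R.add_mem) (fun α c ↦ R.mul_mem ?_ (hp c)) a
  exact R.prod_mem fun s _ ↦ R.pow_mem (hW s) _

end MonomialCoordinates

end MonomialCoordinates

/-! ### Units of a localization at prime elements -/

section Units

variable {A B : Type*} [CommRing A] [IsDomain A] [CommRing B] [Algebra A B] {σ : Type*}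
  {t : σ → A} {N : Finset σ}

/-- A divisor of a power of `∏ t_s`, with the `t_s` prime, is a monomial in the `t_s` up to a
unit. -/
theorem exists_eq_unit_mul_prod (ht : ∀ s ∈ N, Prime (t s)) {x a u : A} {k : ℕ} (hu : IsUnit u)
    (h : x * a = u * (∏ s ∈ N, t s) ^ k) : ∃ (v : Aˣ) (n : σ → ℕ), x = v * ∏ s ∈ N, t s ^ n s := by
  classical
  have h1 : x * a = u * ∏ i ∈ N ×ˢ Finset.range k, t i.1 := by
    rw [h, Finset.prod_product]
    simp [Finset.prod_pow]
  obtain ⟨T, _, b, c, hT, -, hbc, hx, -⟩ :=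
    mul_eq_mul_prime_prod (fun i hi ↦ ht i.1 (Finset.mem_product.1 hi).1) h1
  have hb : IsUnit b := isUnit_of_dvd_unit (Dvd.intro c hbc.symm) hu
  refine ⟨hb.unit, fun s ↦ (T.filter fun i ↦ i.1 = s).card, ?_⟩
  rw [hx, IsUnit.unit_spec, ← Finset.prod_fiberwise_of_maps_to (s := T) (t := N) (g := Prod.fst)]
  · congr 1
    refine Finset.prod_congr rfl fun s _ ↦ ?_
    rw [Finset.prod_congr rfl fun i hi ↦ by rw [(Finset.mem_filter.1 hi).2], Finset.prod_const]
  · intro i hi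
    exact (Finset.mem_product.1 (hT ▸ Finset.mem_union_left _ hi)).1

theorem le_of_dvd_prod (ht : ∀ s ∈ N, Prime (t s))
    (hne : ∀ s ∈ N, ∀ s' ∈ N, s ≠ s' → ¬ t s ∣ t s') {n : σ → ℕ} {s : σ} (hs : s ∈ N)
    (h : t s ∣ ∏ s ∈ N, t s ^ n s) : n s ≠ 0 := by
  obtain ⟨s', hs', h1⟩ := ((ht s hs).dvd_finsetProd_iff _).1 h
  have h2 := (ht s hs).dvd_of_dvd_pow h1
  by_cases h3 : s = s'
  · subst h3
    intro h0
    rw [h0, pow_zero] at h1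
    exact (ht s hs).not_isUnit (isUnit_of_dvd_one h1)
  · exact absurd h2 (hne s hs s' hs' h3)

variable (t N) [IsLocalization.Away (∏ s ∈ N, t s) B]

/-- The unit of the localization given by `t_s`. -/
def unitOf (s : N) : Bˣ :=
  (isUnit_of_dvd_unit (map_dvd (algebraMap A B) (Finset.dvd_prod_of_mem t s.2))
    (IsLocalization.Away.algebraMap_isUnit (∏ s ∈ N, t s))).unit

variable (B) in
theorem unitOf_val (s : N) : (unitOf (B := B) t N s : B) = algebraMap A B (t s) := rfl

variable (B) in
/-- The homomorphism `(u, n) ↦ u ∏ t_s ^ n_s`. -/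
def monomialUnit : Additive Aˣ × (N → ℤ) →+ Additive Bˣ where
  toFun z := Additive.ofMul (Units.map (algebraMap A B : A →* B) z.1.toMul) +
    ∑ s, z.2 s • Additive.ofMul (unitOf t N s)
  map_zero' := by simp
  map_add' z w := by
    simp only [Prod.fst_add, toMul_add, map_mul, ofMul_mul, Prod.snd_add, Pi.add_apply, add_zsmul,
      Finset.sum_add_distrib]
    abel

/-- Natural exponents as integral exponents. -/
def natExp {σ : Type*} (N : Finset σ) (n : σ → ℕ) : N → ℤ := fun s ↦ n s

theorem val_monomialUnit_nat (v : Aˣ) (n : σ → ℕ) :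
    ((monomialUnit B t N (Additive.ofMul v, natExp N n)).toMul : B) =
      algebraMap A B (v * ∏ s ∈ N, t s ^ n s) := by
  change ((Units.map (algebraMap A B : A →* B) v * (∑ s : N, natExp N n s • Additive.ofMul
    (unitOf (B := B) t N s)).toMul : Bˣ) : B) = _
  rw [toMul_sum, Units.val_mul, Units.coe_prod, map_mul, map_prod, ← Finset.prod_coe_sort N]
  congr 1
  refine Finset.prod_congr rfl fun s _ ↦ ?_
  rw [natExp, natCast_zsmul, toMul_nsmul, Units.val_pow_eq_pow_val, map_pow]
  rfl

variable {t N} (ht : ∀ s ∈ N, Prime (t s)) (hne : ∀ s ∈ N, ∀ s' ∈ N, s ≠ s' → ¬ t s ∣ t s')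

theorem algebraMap_injective_away (ht : ∀ s ∈ N, Prime (t s)) :
    Function.Injective (algebraMap A B) :=
  IsLocalization.injective B (M := Submonoid.powers (∏ s ∈ N, t s))
    (powers_le_nonZeroDivisors_of_noZeroDivisors
      (Finset.prod_ne_zero_iff.2 fun s hs ↦ (ht s hs).ne_zero))

/-- The decomposition of a unit of `A[1/∏ t_s]` into a unit of `A` and a monomial in the primes
`t_s` is unique. -/
theorem monomialUnit_injective (ht : ∀ s ∈ N, Prime (t s))
    (hne : ∀ s ∈ N, ∀ s' ∈ N, s ≠ s' → ¬ t s ∣ t s') :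
    Function.Injective (monomialUnit B t N) := by
  classical
  -- compare the monomials with the positive and with the negative exponents
  have key (v w : Aˣ) (n n' : σ → ℕ) (h0 : ∀ s ∈ N, n s = 0 ∨ n' s = 0)
      (h : monomialUnit B t N (Additive.ofMul v, natExp N n) =
        monomialUnit B t N (Additive.ofMul w, natExp N n')) :
      v = w ∧ ∀ s ∈ N, n s = 0 ∧ n' s = 0 := by
    have h1 := congrArg (fun z : Additive Bˣ ↦ (z.toMul : B)) h
    simp only [val_monomialUnit_nat] at h1
    replace h1 := algebraMap_injective_away (B := B) ht h1
    have h2 (v w : Aˣ) (n n' : σ → ℕ) (h0 : ∀ s ∈ N, n s = 0 ∨ n' s = 0)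
        (h1 : v * ∏ s ∈ N, t s ^ n s = w * ∏ s ∈ N, t s ^ n' s) (s) (hs : s ∈ N) : n s = 0 := by
      by_contra hn
      have h3 : t s ∣ w * ∏ s ∈ N, t s ^ n' s := by
        rw [← h1]
        exact (((dvd_pow_self (t s) hn).trans
          (Finset.dvd_prod_of_mem (fun s ↦ t s ^ n s) hs))).mul_left _
      exact le_of_dvd_prod ht hne hs (w.isUnit.dvd_mul_left.1 h3) ((h0 s hs).resolve_left hn)
    have h3 := h2 v w n n' h0 h1
    have h4 := h2 w v n' n (fun s hs ↦ (h0 s hs).symm) h1.symm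
    refine ⟨?_, fun s hs ↦ ⟨h3 s hs, h4 s hs⟩⟩
    rw [Finset.prod_eq_one fun s hs ↦ by rw [h3 s hs, pow_zero],
      Finset.prod_eq_one fun s hs ↦ by rw [h4 s hs, pow_zero], mul_one, mul_one] at h1
    exact Units.ext h1
  refine (injective_iff_map_eq_zero _).2 ?_
  rintro ⟨v, n⟩ h
  let n₁ : σ → ℕ := fun s ↦ if hs : s ∈ N then (n ⟨s, hs⟩).toNat else 0
  let n₂ : σ → ℕ := fun s ↦ if hs : s ∈ N then (- n ⟨s, hs⟩).toNat else 0
  have hn (s : N) : n s = n₁ s - n₂ s := by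
    simp only [n₁, n₂, s.2, dif_pos]
    have := Int.toNat_sub_toNat_neg (n s)
    exact this.symm
  obtain ⟨h1, h2⟩ := key v.toMul 1 n₁ n₂ (fun s hs ↦ by
    simp only [n₁, n₂, hs, dif_pos]
    omega) (by
    rw [← sub_eq_zero, ← map_sub, ← h]
    refine congrArg _ (Prod.ext ?_ (funext fun s ↦ (hn s).symm))
    simp)
  refine Prod.ext (congrArg Additive.ofMul h1) (funext fun s ↦ ?_)
  change n s = 0
  rw [hn, (h2 s s.2).1, (h2 s s.2).2, sub_self]

theorem exists_monomialUnit_eq (ht : ∀ s ∈ N, Prime (t s)) {x : A} {y : Bˣ}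
    (h : algebraMap A B x = y) : ∃ (v : Aˣ) (n : σ → ℕ), x = v * ∏ s ∈ N, t s ^ n s ∧
      Additive.ofMul y = monomialUnit B t N (Additive.ofMul v, natExp N n) := by
  obtain ⟨k, a, ha⟩ := IsLocalization.Away.surj (∏ s ∈ N, t s) (↑y⁻¹ : B)
  have h1 : x * a = 1 * (∏ s ∈ N, t s) ^ k := by
    apply algebraMap_injective_away (B := B) ht
    rw [map_mul, ← ha, h, one_mul, map_pow, Units.mul_inv_cancel_left]
  obtain ⟨v, n, rfl⟩ := exists_eq_unit_mul_prod ht isUnit_one h1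
  refine ⟨v, n, rfl, ?_⟩
  refine congrArg Additive.ofMul (Units.ext ?_ : y = (monomialUnit B t N _).toMul)
  rw [← h, val_monomialUnit_nat]

theorem monomialUnit_surjective (ht : ∀ s ∈ N, Prime (t s)) :
    Function.Surjective (monomialUnit B t N) := by
  intro y
  obtain ⟨k, a, ha⟩ := IsLocalization.Away.surj (∏ s ∈ N, t s) (y.toMul : B)
  have hk : algebraMap A B ((∏ s ∈ N, t s) ^ k) =
      (monomialUnit B t N (Additive.ofMul 1, natExp N fun _ ↦ k)).toMul := by
    rw [val_monomialUnit_nat, Units.val_one, one_mul, Finset.prod_pow]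
  obtain ⟨v, n, -, h2⟩ := exists_monomialUnit_eq (B := B) ht (x := a)
    (y := y.toMul * (monomialUnit B t N
      (Additive.ofMul 1, natExp N fun _ ↦ k)).toMul) (by
    rw [Units.val_mul, ← hk, ← ha, map_pow])
  refine ⟨(Additive.ofMul v, natExp N n) -
    (Additive.ofMul 1, natExp N fun _ ↦ k), ?_⟩
  rw [map_sub, ← h2, ofMul_mul]
  exact add_sub_cancel_right y _

/-- The decomposition of the units of the localization. -/
def monomialUnitEquiv (ht : ∀ s ∈ N, Prime (t s))
    (hne : ∀ s ∈ N, ∀ s' ∈ N, s ≠ s' → ¬ t s ∣ t s') :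
    Additive Aˣ × (N → ℤ) ≃+ Additive Bˣ :=
  AddEquiv.ofBijective _ ⟨monomialUnit_injective ht hne, monomialUnit_surjective ht⟩

end Units

/-! ### The basis of `ω̃¹` and the existence of charts -/

section LogBasis

variable {p : ℕ} [Fact p.Prime] {A B : Type u} [CommRing A] [CommRing B] [IsDomain A] [Algebra A B]
  {I : Ideal A} [Fact ((p : A ⧸ I) = 0)] {σ : Type u} {t : σ → A} {N J : Finset σ} {x : σ → A ⧸ I}
  [IsLocalization.Away (∏ s ∈ N, t s) B]

/-- The logarithmic derivative `u ↦ u⁻¹ δ(u)` on units. -/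
def logDeriv (δ : Derivation ℤ (A ⧸ I) (A ⧸ I)) : Additive Aˣ →+ A ⧸ I where
  toFun u := Ideal.Quotient.mk I ↑(u.toMul⁻¹ : Aˣ) * δ (Ideal.Quotient.mk I u.toMul)
  map_zero' := by simp
  map_add' u v := by
    have h1 (u : Aˣ) : Ideal.Quotient.mk I (↑(u⁻¹ : Aˣ)) * Ideal.Quotient.mk I u = 1 := by
      rw [← map_mul, Units.inv_mul, map_one]
    simp only [toMul_add, Units.val_mul, mul_inv, map_mul, Derivation.leibniz, smul_eq_mul]
    linear_combination (Ideal.Quotient.mk I ↑(v.toMul⁻¹ : Aˣ) * δ (Ideal.Quotient.mk I v.toMul)) *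
      h1 u.toMul + (Ideal.Quotient.mk I ↑(u.toMul⁻¹ : Aˣ) * δ (Ideal.Quotient.mk I u.toMul)) *
      h1 v.toMul

open Classical in
/-- The additive map on units of the localization extending the logarithmic Euler derivation of the
coordinate `x_s`. -/
def unitWeight (h : MonomialCoordinates p x J) (ht : ∀ s ∈ N, Prime (t s))
    (hne : ∀ s ∈ N, ∀ s' ∈ N, s ≠ s' → ¬ t s ∣ t s') (s : σ) : Additive Bˣ →+ A ⧸ I :=
  ((logDeriv (h.weight s)).coprod
    (if hs : s ∈ N then (Int.castAddHom (A ⧸ I)).comp (Pi.evalAddMonoidHom _ (⟨s, hs⟩ : N)) else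
        0)).comp
      (monomialUnitEquiv ht hne).symm.toAddMonoidHom

open Classical in
theorem unitWeight_monomialUnit (h : MonomialCoordinates p x J) (ht : ∀ s ∈ N, Prime (t s))
    (hne : ∀ s ∈ N, ∀ s' ∈ N, s ≠ s' → ¬ t s ∣ t s') (s : σ) (v : Additive Aˣ) (n : N → ℤ) :
    unitWeight (B := B) h ht hne s (monomialUnit B t N (v, n)) = logDeriv (h.weight s) v +
      if hs : s ∈ N then (n ⟨s, hs⟩ : A ⧸ I) else 0 := by
  have : (monomialUnitEquiv ht hne).symm (monomialUnit B t N (v, n)) = (v, n) :=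
    (monomialUnitEquiv ht hne).symm_apply_apply _
  change AddMonoidHom.coprod _ _ ((monomialUnitEquiv ht hne).symm _) = _
  rw [this, AddMonoidHom.coprod_apply]
  congr 1
  split_ifs <;> rfl

/-- The functionals `h.weight s` on `dA` and `unitWeight s` on units of `B` respect the relation
`(da, 0) = (0, a ⊗ a)` that defines `ω̃¹`, for functions `a` invertible in `B`. -/
theorem weight_eq_mul_unitWeight (h : MonomialCoordinates p x J) (ht : ∀ s ∈ N, Prime (t s))
    (hne : ∀ s ∈ N, ∀ s' ∈ N, s ≠ s' → ¬ t s ∣ t s')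
    (htx : ∀ s ∈ N, Ideal.Quotient.mk I (t s) = x s) (s : σ) (a : A) (y : Bˣ)
    (hy : algebraMap A B a = y) : h.weight s (Ideal.Quotient.mk I a) =
      Ideal.Quotient.mk I a • unitWeight h ht hne s (Additive.ofMul y) := by
  classical
  obtain ⟨v, n, rfl, h1⟩ := exists_monomialUnit_eq ht hy
  rw [h1, unitWeight_monomialUnit, map_mul, map_prod, Derivation.leibniz]
  simp only [smul_eq_mul, map_pow]
  rw [Finset.prod_congr rfl fun s hs ↦ by rw [htx s hs]]
  have h2 (s' : σ) : h.weight s (x s') = x s' * if s' = s then 1 else 0 := by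
    split_ifs with h3
    · rw [h3, h.weight_x_self, mul_one]
    · rw [h.weight_x_of_ne (Ne.symm h3), mul_zero]
  have h3 (N' : Finset σ) : h.weight s (∏ s ∈ N', x s ^ n s) =
      (∏ s ∈ N', x s ^ n s) * if s ∈ N' then (n s : A ⧸ I) else 0 := by
    induction N' using Finset.induction_on with
    | empty => simp
    | insert s' N' hs' ih =>
      have h4 : h.weight s (x s' ^ n s') = x s' ^ n s' * if s' = s then (n s' : A ⧸ I) else 0 := by
        rw [Derivation.leibniz_pow, h2]
        rcases n s' with _ | k
        · simp
        · simp only [Nat.add_sub_cancel, smul_eq_mul, nsmul_eq_mul]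
          split_ifs <;> ring
      rw [Finset.prod_insert hs', Derivation.leibniz, ih, h4]
      by_cases h5 : s' = s
      · subst h5
        simp only [hs', if_true, if_false, smul_eq_mul, Finset.mem_insert_self]
        ring
      · simp only [h5, Finset.mem_insert, if_false, Ne.symm h5, false_or, smul_eq_mul]
        ring
  have h6 : Ideal.Quotient.mk I (↑(v⁻¹ : Aˣ)) * Ideal.Quotient.mk I v = 1 := by
    rw [← map_mul, Units.inv_mul, map_one]
  have h7 : logDeriv (h.weight s) (Additive.ofMul v) =
    Ideal.Quotient.mk I ↑(v⁻¹ : Aˣ) * h.weight s (Ideal.Quotient.mk I v) := rfl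
  have h8 : (if hs : s ∈ N then ((natExp N n ⟨s, hs⟩ : ℤ) : A ⧸ I) else 0) =
      if s ∈ N then (n s : A ⧸ I) else 0 := by
    split_ifs with hs
    · simp [natExp]
    · rfl
  rw [h3, h7, h8]
  linear_combination - (∏ s ∈ N, x s ^ n s) * h.weight s (Ideal.Quotient.mk I v) * h6

/-- The linear functional on `ω̃¹` dual to the coordinate `x_s`. -/
def logDual (h : MonomialCoordinates p x J) (ht : ∀ s ∈ N, Prime (t s))
    (hne : ∀ s ∈ N, ∀ s' ∈ N, s ≠ s' → ¬ t s ∣ t s')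
    (htx : ∀ s ∈ N, Ideal.Quotient.mk I (t s) = x s) (s : σ) :
    LogForm1 (algebraMap A B) I →ₗ[A ⧸ I] A ⧸ I :=
  LogForm1.lift (h.weight s) (unitWeight h ht hne s)
    (weight_eq_mul_unitWeight h ht hne htx s)

theorem logDual_d (h : MonomialCoordinates p x J) (ht : ∀ s ∈ N, Prime (t s))
    (hne : ∀ s ∈ N, ∀ s' ∈ N, s ≠ s' → ¬ t s ∣ t s')
    (htx : ∀ s ∈ N, Ideal.Quotient.mk I (t s) = x s) (s : σ) (a : A ⧸ I) :
    logDual (B := B) h ht hne htx s (LogForm1.d _ I a) = h.weight s a :=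
  LogForm1.lift_d ..

theorem logDual_dlog (h : MonomialCoordinates p x J) (ht : ∀ s ∈ N, Prime (t s))
    (hne : ∀ s ∈ N, ∀ s' ∈ N, s ≠ s' → ¬ t s ∣ t s')
    (htx : ∀ s ∈ N, Ideal.Quotient.mk I (t s) = x s) (s : σ) (y : Additive Bˣ) :
    logDual (B := B) h ht hne htx s (LogForm1.dlog _ I y) = unitWeight h ht hne s y :=
  LogForm1.lift_dlog ..

open Classical in
/-- The form `dlog x_s`. -/
def logForm (B : Type u) [CommRing B] [Algebra A B] [IsLocalization.Away (∏ s ∈ N, t s) B]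
    (hx : ∀ s ∉ N, IsUnit (x s)) (s : σ) :
    LogForm1 (algebraMap A B) I :=
  if hs : s ∈ N then LogForm1.dlog _ I (Additive.ofMul (unitOf t N ⟨s, hs⟩))
  else (↑(hx s hs).unit⁻¹ : A ⧸ I) • LogForm1.d _ I (x s)

open Classical in
theorem ofMul_unitOf (s : N) :
    Additive.ofMul (unitOf (B := B) t N s) = monomialUnit B t N (0, Pi.single s 1) := by
  change _ = Additive.ofMul (Units.map (algebraMap A B : A →* B) 1) + ∑ s', _
  rw [map_one, ofMul_one, zero_add, Finset.sum_eq_single s]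
  · simp
  · intro s' _ hs'
    simp [hs']
  · simp

theorem logDual_logForm_self (h : MonomialCoordinates p x J) (ht : ∀ s ∈ N, Prime (t s))
    (hne : ∀ s ∈ N, ∀ s' ∈ N, s ≠ s' → ¬ t s ∣ t s')
    (htx : ∀ s ∈ N, Ideal.Quotient.mk I (t s) = x s) (hx : ∀ s ∉ N, IsUnit (x s)) (s : σ) :
    logDual (B := B) h ht hne htx s (logForm (t := t) B hx s) = 1 := by
  unfold logForm
  split_ifs with hs
  · rw [logDual_dlog, ofMul_unitOf, unitWeight_monomialUnit, dif_pos hs, map_zero, zero_add]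
    simp
  · rw [map_smul, logDual_d, h.weight_x_self, smul_eq_mul]
    exact (hx s hs).val_inv_mul

theorem logDual_logForm_of_ne (h : MonomialCoordinates p x J) (ht : ∀ s ∈ N, Prime (t s))
    (hne : ∀ s ∈ N, ∀ s' ∈ N, s ≠ s' → ¬ t s ∣ t s')
    (htx : ∀ s ∈ N, Ideal.Quotient.mk I (t s) = x s) (hx : ∀ s ∉ N, IsUnit (x s)) {s s' : σ}
    (hs : s ≠ s') :
    logDual (B := B) h ht hne htx s (logForm (t := t) B hx s') = 0 := by
  classical
  unfold logForm
  split_ifs with hs'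
  · rw [logDual_dlog, ofMul_unitOf, unitWeight_monomialUnit, map_zero, zero_add]
    split_ifs with h1
    · rw [Pi.single_eq_of_ne (by simpa using hs), Int.cast_zero]
    · rfl
  · rw [map_smul, logDual_d, h.weight_x_of_ne hs, smul_zero]

theorem d_x_eq (htx : ∀ s ∈ N, Ideal.Quotient.mk I (t s) = x s) (hx : ∀ s ∉ N, IsUnit (x s))
    (s : σ) : LogForm1.d (algebraMap A B) I (x s) = x s • logForm (t := t) B hx s := by
  unfold logForm
  split_ifs with hs
  · rw [← htx s hs]
    exact LogForm1.d_mk _ _ _ _ (unitOf_val B t N ⟨s, hs⟩).symm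
  · rw [smul_smul, (hx s hs).mul_val_inv, one_smul]

open Classical in
theorem dlog_eq_sum (ht : ∀ s ∈ N, Prime (t s)) (hx : ∀ s ∉ N, IsUnit (x s)) (y : Additive Bˣ) :
    ∃ (b : (A ⧸ I)ˣ) (n : σ →₀ ℤ), LogForm1.dlog (algebraMap A B) I y =
      (↑b⁻¹ : A ⧸ I) • LogForm1.d _ I b + n.sum fun s i ↦ i • logForm (t := t) B hx s := by
  obtain ⟨⟨v, n⟩, rfl⟩ := monomialUnit_surjective (B := B) ht y
  refine ⟨Units.map (Ideal.Quotient.mk I : A →* A ⧸ I) v.toMul,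
    Finsupp.onFinset N (fun s ↦ if hs : s ∈ N then n ⟨s, hs⟩ else 0) (fun s hs ↦ by
      by_contra h; simp [h] at hs), ?_⟩
  change LogForm1.dlog _ I (Additive.ofMul (Units.map (algebraMap A B : A →* B) v.toMul) +
    ∑ s, n s • Additive.ofMul (unitOf t N s)) = _
  rw [map_add]
  congr 1
  · have := LogForm1.d_mk (algebraMap A B) I (v.toMul : A)
      (Units.map (algebraMap A B : A →* B) v.toMul) rfl
    rw [Units.coe_map, MonoidHom.coe_coe, this, smul_smul]
    have h1 : (↑(Units.map (Ideal.Quotient.mk I : A →* A ⧸ I) v.toMul)⁻¹ : A ⧸ I) *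
      Ideal.Quotient.mk I v.toMul = 1 := Units.inv_mul (Units.map (Ideal.Quotient.mk I : A →* A ⧸ I)
          v.toMul)
    rw [h1, one_smul]
  · rw [Finsupp.onFinset_sum (g := fun s i ↦ i • logForm (t := t) B hx s) _ (fun _ ↦ zero_smul _ _),
      map_sum, ← Finset.sum_coe_sort N]
    refine Finset.sum_congr rfl fun s _ ↦ ?_
    rw [map_zsmul, dif_pos s.2, logForm, dif_pos s.2]

theorem span_logForm (h : MonomialCoordinates p x J) (ht : ∀ s ∈ N, Prime (t s))
    (htx : ∀ s ∈ N, Ideal.Quotient.mk I (t s) = x s) (hx : ∀ s ∉ N, IsUnit (x s)) :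
    ⊤ ≤ Submodule.span (A ⧸ I) (Set.range (logForm (t := t) B hx)) := by
  have hs (s : σ) : logForm (t := t) B hx s ∈ Submodule.span (A ⧸ I) (Set.range (logForm (t :=
      t) B hx)) :=
    Submodule.subset_span ⟨s, rfl⟩
  have hd (a : A ⧸ I) : LogForm1.d (algebraMap A B) I a ∈
      Submodule.span (A ⧸ I) (Set.range (logForm (t := t) B hx)) :=
    h.derivation_mem _ _ (fun s ↦ (congrArg (· ∈ Submodule.span (A ⧸ I) _)
      (d_x_eq (t := t) (B := B) htx hx s)).mpr (Submodule.smul_mem _ _ (hs s))) a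
  rw [← LogForm1.span_eq_top, Submodule.span_le]
  rintro _ (⟨a, rfl⟩ | ⟨y, rfl⟩)
  · exact hd a
  · obtain ⟨b, n, h1⟩ := dlog_eq_sum (t := t) (x := x) (B := B) ht hx y
    rw [h1]
    exact add_mem (Submodule.smul_mem _ _ (hd _))
      (Submodule.sum_mem _ fun s _ ↦ zsmul_mem (hs s) _)

/-- Logarithmic coordinates from monomial coordinates, those at the boundary being induced by prime
elements. -/
def MonomialCoordinates.logCoordinates (h : MonomialCoordinates p x J) (ht : ∀ s ∈ N, Prime (t s))
    (hne : ∀ s ∈ N, ∀ s' ∈ N, s ≠ s' → ¬ t s ∣ t s')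
    (htx : ∀ s ∈ N, Ideal.Quotient.mk I (t s) = x s) (hx : ∀ s ∉ N, IsUnit (x s)) :
    LogCoordinates p (algebraMap A B) I where
  σ := σ
  x := x
  e := .mk (v := logForm (t := t) B hx)
    (.of_pairwise_dual_eq_zero_one _ (logDual h ht hne htx)
      (fun _ _ hs ↦ logDual_logForm_of_ne h ht hne htx hx hs)
      (logDual_logForm_self h ht hne htx hx)) (span_logForm h ht htx hx)
  d_x s := by rw [Module.Basis.mk_apply, d_x_eq (t := t) htx hx]
  e_eq s := by
    rw [Module.Basis.mk_apply, logForm]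
    split_ifs with hs
    · exact .inl ⟨_, rfl⟩
    · exact .inr ⟨(hx s hs).unit, rfl⟩
  dlog_eq y := by
    simp only [Module.Basis.mk_apply]
    exact dlog_eq_sum (t := t) ht hx y
  J := J
  surjective := h.surjective
  mem_of_mem L hL c hc α := h.mem_of_mem L (Finset.coe_subset.1 hL) c hc α

theorem MonomialCoordinates.logCoordinates_e (h : MonomialCoordinates p x J)
    (ht : ∀ s ∈ N, Prime (t s)) (hne : ∀ s ∈ N, ∀ s' ∈ N, s ≠ s' → ¬ t s ∣ t s')
    (htx : ∀ s ∈ N, Ideal.Quotient.mk I (t s) = x s) (hx : ∀ s ∉ N, IsUnit (x s)) (s : σ) :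
    (h.logCoordinates (B := B) ht hne htx hx).e s = logForm (t := t) B hx s :=
  Module.Basis.mk_apply _ (span_logForm h ht htx hx) s

end LogBasis

open LogDatum in
/-- Monomial coordinates on `A/I` define a chart if those at the boundary lift to pairwise
nonassociated primes `t_s` of `A`, whose product is inverted in `B`, and the components are cut out
by
products of the `t_s`. -/
theorem HasChart.of_monomialCoordinates {p : ℕ} [Fact p.Prime] {Λ : Type v} (P : LogDatum.{u} Λ)
    [IsDomain P.A] [Fact ((p : P.A ⧸ P.I) = 0)] {σ : Type u} {t : σ → P.A} {N J : Finset σ}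
    {x : σ → P.A ⧸ P.I} (h : MonomialCoordinates p x J) (hJN : J ⊆ N) (ht : ∀ s ∈ N, Prime (t s))
    (hne : ∀ s ∈ N, ∀ s' ∈ N, s ≠ s' → ¬ t s ∣ t s')
    (htx : ∀ s ∈ N, Ideal.Quotient.mk P.I (t s) = x s) (hx : ∀ s ∉ N, IsUnit (x s))
    (hB : letI := P.ι.toAlgebra; IsLocalization.Away (∏ s ∈ N, t s) P.B)
    (S : Λ → Finset σ) (hSJ : ∀ i, S i ⊆ J) (hS : ∀ i j, i ≠ j → Disjoint (S i) (S j))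
    (hcomp : ∀ i, P.comp i = Ideal.span {∏ s ∈ S i, t s}) : HasChart P p := by
  classical
  let := P.ι.toAlgebra
  have : IsLocalization.Away (∏ s ∈ N, t s) P.B := hB
  let K : LogCoordinates p P.ι P.I := h.logCoordinates (B := P.B) ht hne htx hx
  let eK : σ → LogForm1 P.ι P.I := fun s ↦ K.e s
  have hSN (i) : S i ⊆ N := (hSJ i).trans hJN
  let unit (i : Λ) : P.Bˣ := ∏ s : S i, unitOf t N ⟨s, hSN i s.2⟩
  refine ⟨inferInstance, ⟨{ toLogCoordinates := K
                            unif := ⟨fun i ↦ ∏ s ∈ S i, t s, unit, fun i ↦ ?_, hcomp⟩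
                            nonZeroDivisors := fun i ↦ ?_
                            S := S
                            disjoint := fun h ↦ hS _ _ h
                            subset := fun i ↦ Finset.coe_subset.2 (hSJ i)
                            mk_π := fun i ↦ ?_
                            dlog_unit := fun i ↦ ?_ }⟩⟩
  · rw [map_prod, ← Finset.prod_coe_sort (S i)]
    simp only [unit, Units.coe_prod]
    rfl
  · exact mem_nonZeroDivisors_of_ne_zero
      (Finset.prod_ne_zero_iff.2 fun s hs ↦ (ht s (hSN i hs)).ne_zero)
  · change Ideal.Quotient.mk P.I (∏ s ∈ S i, t s) = ∏ s ∈ S i, x s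
    rw [map_prod]
    exact Finset.prod_congr rfl fun s hs ↦ htx s (hSN i hs)
  · change LogForm1.dlog P.ι P.I (Additive.ofMul (unit i)) = ∑ s ∈ S i, eK s
    have h1 (s : S i) : eK s = LogForm1.dlog P.ι P.I
        (Additive.ofMul (unitOf t N ⟨s, hSN i s.2⟩)) := by
      refine (h.logCoordinates_e (B := P.B) ht hne htx hx s).trans ?_
      rw [logForm, dif_pos (hSN i s.2)]
      rfl
    rw [ofMul_prod, map_sum, ← Finset.sum_coe_sort (S i) eK]
    exact Finset.sum_congr rfl fun s _ ↦ (h1 s).symm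

/-! ### Regular local rings -/

section Regular

open IsLocalRing

/-- Prime avoidance for a coset `x + J`. -/
theorem exists_add_notMem {R : Type u} [CommRing R] (x : R) (J : Ideal R) (F : Finset (Ideal R))
    (hF : ∀ P ∈ F, P.IsPrime) (hinc : ∀ P ∈ F, ∀ Q ∈ F, P ≤ Q → P = Q)
    (h : ∀ P ∈ F, ¬ (x ∈ P ∧ J ≤ P)) : ∃ y ∈ J, ∀ P ∈ F, x + y ∉ P := by
  classical
  obtain ⟨F₁, hF₁⟩ : ∃ F₁ : Finset (Ideal R), ∀ P, P ∈ F₁ ↔ P ∈ F ∧ x ∈ P :=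
    ⟨F.filter fun P ↦ x ∈ P, fun P ↦ Finset.mem_filter⟩
  obtain ⟨F₂, hF₂⟩ : ∃ F₂ : Finset (Ideal R), ∀ P, P ∈ F₂ ↔ P ∈ F ∧ x ∉ P :=
    ⟨F.filter fun P ↦ x ∉ P, fun P ↦ Finset.mem_filter⟩
  obtain ⟨K, hK⟩ : ∃ K : Ideal R, K = J * ∏ P ∈ F₂, P := ⟨_, rfl⟩
  -- `K` is contained in the members of `F` that do not contain `x`, but in none of the others
  have h1 : ¬ ∃ P ∈ F₁, K ≤ P := by
    rintro ⟨P, hP, h1⟩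
    rw [hF₁] at hP
    have hprime := hF P hP.1
    rw [hK, hprime.mul_le] at h1
    rcases h1 with h2 | h2
    · exact h P hP.1 ⟨hP.2, h2⟩
    · rw [hprime.prod_le] at h2
      obtain ⟨Q, hQ, h3⟩ := h2
      rw [hF₂] at hQ
      exact hQ.2 (hinc Q hQ.1 P hP.1 h3 ▸ hP.2)
  have h2 := Ideal.subset_union_prime (s := F₁) (f := fun P : Ideal R ↦ P) ⊥ ⊥
    (fun P hP _ _ ↦ hF P ((hF₁ P).1 hP).1) (I := K)
  obtain ⟨y, hy, hy'⟩ := Set.not_subset.1 (mt h2.1 h1)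
  have hyJ : y ∈ J := by
    have h3 : K ≤ J := hK ▸ Ideal.mul_le_left
    exact h3 hy
  refine ⟨y, hyJ, fun P hP hxy ↦ ?_⟩
  by_cases hx : x ∈ P
  · refine hy' (Set.mem_biUnion (Finset.mem_coe.2 ((hF₁ P).2 ⟨hP, hx⟩)) ?_)
    exact (Submodule.add_mem_iff_right P hx).1 hxy
  · have h3 : K ≤ P := by
      rw [hK]
      refine Ideal.mul_le_right.trans (Ideal.prod_le_inf.trans ?_)
      exact Finset.inf_le (f := fun P : Ideal R ↦ P) ((hF₂ P).2 ⟨hP, hx⟩)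
    exact hx ((Submodule.add_mem_iff_left P (h3 hy)).1 hxy)

/-- A noetherian local ring of dimension `≥ n` whose maximal ideal has `n` generators is a
domain. -/
theorem isDomain_of_card_le_ringKrullDim (n : ℕ) (R : Type u) [CommRing R] [IsLocalRing R]
    [IsNoetherianRing R] (s : Finset R) (hs : Ideal.span (s : Set R) = maximalIdeal R)
    (hn : s.card ≤ n) (hd : (n : WithBot ℕ∞) ≤ ringKrullDim R) : IsDomain R := by
  classical
  induction n generalizing R with
  | zero =>
    obtain rfl := Finset.card_eq_zero.1 (Nat.le_zero.1 hn)
    rw [Finset.coe_empty, Ideal.span_empty, eq_comm, ← isField_iff_maximalIdeal_eq] at hs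
    exact hs.isDomain
  | succ n ih =>
    -- the dimension is positive, so the maximal ideal is not a minimal prime
    have hm : (maximalIdeal R) ∉ minimalPrimes R := by
      intro h
      rw [← Ideal.height_eq_zero_iff, ← WithBot.coe_inj, maximalIdeal_height_eq_ringKrullDim] at h
      rw [h] at hd
      have : ((n + 1 : ℕ) : WithBot ℕ∞) ≤ ((0 : ℕ) : WithBot ℕ∞) := hd
      exact absurd (Nat.cast_le.1 this) (by omega)
    have hfin := minimalPrimes.finite_of_isNoetherianRing R
    have hs0 : s.Nonempty := by
      rw [Finset.nonempty_iff_ne_empty]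
      rintro rfl
      rw [Finset.coe_empty, Ideal.span_empty, eq_comm, ← isField_iff_maximalIdeal_eq] at hs
      have := hs.isDomain
      refine hm ?_
      rw [isField_iff_maximalIdeal_eq.1 hs, IsDomain.minimalPrimes_eq_singleton_bot]
      rfl
    obtain ⟨t, ht⟩ := hs0
    -- replace the generator `t` by a generator `x = t + y` outside all minimal primes
    obtain ⟨y, hy, hxy⟩ := exists_add_notMem t (Ideal.span (s.erase t : Set R)) hfin.toFinset
      (fun P hP ↦ (hfin.mem_toFinset.1 hP).1.1)
      (fun P hP Q hQ h ↦ le_antisymm h ((hfin.mem_toFinset.1 hQ).2 (hfin.mem_toFinset.1 hP).1 h))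
      (fun P hP ⟨h1, h2⟩ ↦ by
        have hP' := hfin.mem_toFinset.1 hP
        refine hm ?_
        have : maximalIdeal R ≤ P := by
          rw [← hs, Ideal.span_le]
          intro z hz
          by_cases h : z = t
          · exact h ▸ h1
          · exact h2 (Ideal.subset_span (Finset.mem_coe.2 (Finset.mem_erase.2 ⟨h, hz⟩)))
        rwa [← (le_maximalIdeal hP'.1.1.ne_top).antisymm this])
    set x := t + y with hx
    have hyt : Ideal.span (s.erase t : Set R) ≤ maximalIdeal R := by
      rw [← hs]
      exact Ideal.span_mono (Finset.coe_subset.2 (Finset.erase_subset _ _))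
    have hxm : x ∈ maximalIdeal R :=
      add_mem (hs ▸ Ideal.subset_span (Finset.mem_coe.2 ht)) (hyt hy)
    have hxt : Ideal.span {x} ≠ ⊤ := by
      rw [Ne, Ideal.span_singleton_eq_top]
      exact hxm
    let R' := R ⧸ Ideal.span {x}
    have : Nontrivial R' := Ideal.Quotient.nontrivial_iff.2 hxt
    have hloc : IsLocalRing R' := .of_surjective' (Ideal.Quotient.mk _) Ideal.Quotient.mk_surjective
    have hmax : (maximalIdeal R).map (Ideal.Quotient.mk (Ideal.span {x})) = maximalIdeal R' :=
      map_maximalIdeal_of_surjective (Ideal.Quotient.mk _) Ideal.Quotient.mk_surjective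
    -- the induction hypothesis applies to `R / x`
    have hdom : IsDomain R' := by
      refine ih R' ((s.erase t).image (Ideal.Quotient.mk _)) ?_ ?_ ?_
      · rw [← hmax, Finset.coe_image, ← Ideal.map_span]
        refine le_antisymm (Ideal.map_mono hyt) ?_
        rw [← hs, Ideal.map_le_iff_le_comap, Ideal.span_le]
        intro z hz
        by_cases h : z = t
        · have h1 : z = x + -y := by rw [hx, h]; ring
          rw [SetLike.mem_coe, Ideal.mem_comap, h1, map_add, Ideal.Quotient.eq_zero_iff_mem.2
            (Ideal.mem_span_singleton_self x), zero_add]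
          exact Ideal.mem_map_of_mem _ (neg_mem hy)
        · exact Ideal.mem_map_of_mem _ (Ideal.subset_span
            (Finset.mem_coe.2 (Finset.mem_erase.2 ⟨h, hz⟩)))
      · refine Finset.card_image_le.trans ?_
        rw [Finset.card_erase_of_mem ht]
        omega
      · have h1 := hd.trans (ringKrullDim_le_ringKrullDim_quotient_add_card {x} (by
          rw [Finset.coe_singleton, Set.singleton_subset_iff]
          rw [SetLike.mem_coe, ringJacobson_eq_maximalIdeal]
          exact hxm))
        rw [Finset.coe_singleton, Finset.card_singleton, Nat.cast_add, Nat.cast_one] at h1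
        exact ENat.WithBot.add_le_add_one_right_iff.1 h1
    have hprime : (Ideal.span {x}).IsPrime := (Ideal.Quotient.isDomain_iff_prime _).1 hdom
    -- a minimal prime `Q` below the prime `(x)` satisfies `Q = x Q`, so it is zero by Nakayama
    obtain ⟨Q, hQ, hQx⟩ := Ideal.exists_minimalPrimes_le (bot_le : ⊥ ≤ Ideal.span {x})
    have hxQ : x ∉ Q := hxy Q (hfin.mem_toFinset.2 hQ)
    have hQ0 : Q = ⊥ := by
      refine Submodule.eq_bot_of_le_smul_of_le_jacobson_bot (Ideal.span {x}) Q
        (IsNoetherian.noetherian _) (fun q hq ↦ ?_) ?_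
      · obtain ⟨r, rfl⟩ := Ideal.mem_span_singleton'.1 (hQx hq)
        have hr : r ∈ Q := (hQ.1.1.mem_or_mem hq).resolve_right hxQ
        rw [mul_comm]
        exact Submodule.smul_mem_smul (Ideal.mem_span_singleton_self x) hr
      · rw [jacobson_eq_maximalIdeal _ bot_ne_top]
        exact le_maximalIdeal hxt
    have := hQ.1.1
    rw [hQ0] at this
    exact IsDomain.of_bot_isPrime R

/-- A family of elements such that the ideals generated by the subfamilies are prime and do not
contain the remaining members. -/
def IsNCSystem {R ι : Type*} [CommRing R] (t : ι → R) : Prop :=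
  ∀ K : Finset ι, (Ideal.span (t '' K)).IsPrime ∧ ∀ j ∉ K, t j ∉ Ideal.span (t '' K)

/-- A regular system of parameters. -/
structure IsParameterSystem {R ι : Type*} [CommRing R] [IsLocalRing R] [Fintype ι] (t : ι → R) :
    Prop where
  span_range : Ideal.span (Set.range t) = maximalIdeal R
  card_le : (Fintype.card ι : WithBot ℕ∞) ≤ ringKrullDim R

/-- Subsets of a regular system of parameters generate prime ideals, the quotients being regular
local rings, hence domains. -/
theorem IsParameterSystem.isNCSystem {R : Type u} {ι : Type*} [CommRing R] [IsLocalRing R]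
    [IsNoetherianRing R] [Fintype ι] {t : ι → R} (ht : IsParameterSystem t) : IsNCSystem t := by
  classical
  have hmem (j) : t j ∈ maximalIdeal R := ht.span_range ▸ Ideal.subset_span ⟨j, rfl⟩
  refine fun K ↦ ⟨?_, fun j hj h ↦ ?_⟩
  · have hle : Ideal.span (t '' K) ≤ maximalIdeal R := by
      rw [Ideal.span_le]
      rintro _ ⟨j, -, rfl⟩
      exact hmem j
    let R' := R ⧸ Ideal.span (t '' K)
    have : Nontrivial R' := Ideal.Quotient.nontrivial_iff.2
      fun h ↦ (maximalIdeal.isMaximal R).ne_top (top_le_iff.1 (h.symm.trans_le hle))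
    have hloc : IsLocalRing R' := .of_surjective' (Ideal.Quotient.mk _) Ideal.Quotient.mk_surjective
    have hmax : (maximalIdeal R).map (Ideal.Quotient.mk (Ideal.span (t '' K))) = maximalIdeal R' :=
      map_maximalIdeal_of_surjective (Ideal.Quotient.mk _) Ideal.Quotient.mk_surjective
    rw [← Ideal.Quotient.isDomain_iff_prime]
    -- the quotient is generated by the remaining parameters, and its dimension is large enough
    refine isDomain_of_card_le_ringKrullDim (Fintype.card ι - K.card) R'
      (Kᶜ.image fun j ↦ Ideal.Quotient.mk _ (t j)) ?_ ?_ ?_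
    · rw [← hmax, ← ht.span_range, Ideal.map_span]
      refine le_antisymm (Ideal.span_mono ?_) (Ideal.span_le.2 ?_)
      · intro z hz
        obtain ⟨j, -, rfl⟩ := Finset.mem_image.1 (Finset.mem_coe.1 hz)
        exact ⟨t j, ⟨j, rfl⟩, rfl⟩
      · rintro _ ⟨_, ⟨j, rfl⟩, rfl⟩
        by_cases hj : j ∈ K
        · rw [Ideal.Quotient.eq_zero_iff_mem.2 (Ideal.subset_span (Set.mem_image_of_mem t
            (Finset.mem_coe.2 hj)))]
          exact zero_mem _
        · exact Ideal.subset_span (Finset.mem_coe.2 (Finset.mem_image.2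
            ⟨j, Finset.mem_compl.2 hj, rfl⟩))
    · exact Finset.card_image_le.trans (Finset.card_compl K).le
    · have h1 := ht.card_le.trans (ringKrullDim_le_ringKrullDim_quotient_add_card (K.image t) (by
        intro z hz
        obtain ⟨j, -, rfl⟩ := Finset.mem_image.1 (Finset.mem_coe.1 hz)
        rw [SetLike.mem_coe, ringJacobson_eq_maximalIdeal]
        exact hmem j))
      have h2 : ((K.image t).card : WithBot ℕ∞) ≤ K.card := Nat.cast_le.2 Finset.card_image_le
      rw [Finset.coe_image] at h1
      have h3 := h1.trans (add_le_add_right h2 _)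
      have h4 : Fintype.card ι = Fintype.card ι - K.card + K.card :=
        (Nat.sub_add_cancel (Finset.card_le_univ K)).symm
      rw [h4, Nat.cast_add] at h3
      exact ENat.WithBot.add_le_add_natCast_right_iff.1 h3
  -- otherwise `t_j` could be omitted from the generators of the maximal ideal
  · have h1 : maximalIdeal R = Ideal.span ((Finset.univ.erase j).image t : Set R) := by
      rw [← ht.span_range]
      refine le_antisymm (Ideal.span_le.2 ?_) (Ideal.span_mono ?_)
      · rintro _ ⟨i, rfl⟩
        by_cases hi : i = j
        · subst hi
          refine Ideal.span_mono ?_ h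
          rintro _ ⟨k, hk, rfl⟩
          exact Finset.mem_coe.2 (Finset.mem_image.2 ⟨k, Finset.mem_erase.2
            ⟨fun h' ↦ hj (h' ▸ hk), Finset.mem_univ _⟩, rfl⟩)
        · exact Ideal.subset_span (Finset.mem_coe.2 (Finset.mem_image.2 ⟨i, Finset.mem_erase.2
            ⟨hi, Finset.mem_univ _⟩, rfl⟩))
      · intro z hz
        obtain ⟨i, -, rfl⟩ := Finset.mem_image.1 (Finset.mem_coe.1 hz)
        exact ⟨i, rfl⟩
    have h2 := ht.card_le.trans (ringKrullDim_le_spanFinrank_maximalIdeal R)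
    have h3 : (maximalIdeal R).spanFinrank ≤ Fintype.card ι - 1 := by
      rw [h1]
      refine (Submodule.spanFinrank_span_le_ncard_of_finite (Finset.finite_toSet _)).trans ?_
      rw [Set.ncard_coe_finset]
      refine Finset.card_image_le.trans ?_
      rw [Finset.card_erase_of_mem (Finset.mem_univ _), Finset.card_univ]
    have h4 : Fintype.card ι ≤ (maximalIdeal R).spanFinrank := by exact_mod_cast h2
    have : 0 < Fintype.card ι := Fintype.card_pos_iff.2 ⟨j⟩
    omega

theorem exists_isParameterSystem (R : Type u) [CommRing R]
    [h : IsRegularLocalRing R] : ∃ (s : Finset R), IsParameterSystem (Subtype.val : s → R) := by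
  have hfg : (maximalIdeal R).FG := IsNoetherian.noetherian _
  obtain ⟨s, hs, h1⟩ := Submodule.FG.exists_span_finset_card_eq_spanFinrank hfg
  refine ⟨s, ?_, ?_⟩
  · rw [Subtype.range_coe]
    exact h1
  · rw [Fintype.card_coe, hs]
    exact h.spanFinrank_maximalIdeal.le

/-- A local ring of an étale algebra over `R` has the expected maximal ideal and dimension. -/
theorem maximalIdeal_and_dim_of_etale {R A : Type u} [CommRing R] [CommRing A] [Algebra R A]
    [Algebra.Etale R A] [IsNoetherianRing R] [IsNoetherianRing A] (p : Ideal R) [p.IsPrime]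
    (q : Ideal A) [q.IsPrime] [q.LiesOver p] :
    p.map (algebraMap R (Localization.AtPrime q)) = maximalIdeal (Localization.AtPrime q) ∧
      ringKrullDim (Localization.AtPrime p) ≤ ringKrullDim (Localization.AtPrime q) := by
  constructor
  · let := Localization.AtPrime.algebraOfLiesOver p q
    have h : Algebra.IsUnramifiedAt R q := inferInstance
    exact ((Algebra.isUnramifiedAt_iff_map_eq R p q).1 h).2
  · rw [IsLocalization.AtPrime.ringKrullDim_eq_height p (Localization.AtPrime p),
      IsLocalization.AtPrime.ringKrullDim_eq_height q (Localization.AtPrime q),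
      Ideal.height_eq_height_add_of_liesOver_of_hasGoingDown p q]
    exact WithBot.coe_le_coe.2 le_self_add

theorem IsParameterSystem.of_etale {R A : Type u} [CommRing R] [CommRing A] [Algebra R A]
    [Algebra.Etale R A] [IsNoetherianRing R] [IsNoetherianRing A] (p : Ideal R) [p.IsPrime]
    (q : Ideal A) [q.IsPrime] [h : q.LiesOver p] {ι : Type*} [Fintype ι]
    {t : ι → Localization.AtPrime p} (ht : IsParameterSystem t) :
    IsParameterSystem fun i ↦ Localization.localRingHom p q (algebraMap R A) h.over (t i) := by
  obtain ⟨h1, h2⟩ := maximalIdeal_and_dim_of_etale p q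
  refine ⟨?_, ht.card_le.trans h2⟩
  have h3 : (algebraMap R (Localization.AtPrime q)) =
      (Localization.localRingHom p q (algebraMap R A) h.over).comp
        (algebraMap R (Localization.AtPrime p)) := by
    ext x
    rw [RingHom.comp_apply, Localization.localRingHom_to_map, ← IsScalarTower.algebraMap_apply]
  rw [← h1, h3, ← Ideal.map_map, Localization.AtPrime.map_eq_maximalIdeal, ← ht.span_range,
    Ideal.map_span, ← Set.range_comp]
  rfl

/-- The local rings of an étale algebra over a regular ring are domains. -/
theorem isDomain_localization_of_etale {R A : Type u} [CommRing R] [CommRing A] [Algebra R A]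
    [Algebra.Etale R A] [IsRegularRing R] [IsNoetherianRing A] (q : Ideal A)
    [q.IsPrime] : IsDomain (Localization.AtPrime q) := by
  have : IsRegularLocalRing (Localization.AtPrime (q.under R)) := inferInstance
  obtain ⟨s, hs⟩ := exists_isParameterSystem (Localization.AtPrime (q.under R))
  have h1 := ((hs.of_etale (q.under R) q).isNCSystem ∅).1
  rw [Finset.coe_empty, Set.image_empty, Ideal.span_empty] at h1
  exact IsDomain.of_bot_isPrime _

theorem ker_localRingHom {E F : Type*} [CommRing E] [CommRing F] {f : E →+* F}
    (hf : Function.Surjective f) (w : Ideal E) [w.IsPrime] (v : Ideal F) [v.IsPrime]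
    (h : w = v.comap f) : RingHom.ker (Localization.localRingHom w v f h) =
      (RingHom.ker f).map (algebraMap E (Localization.AtPrime w)) := by
  refine IsLocalization.ker_map (M := w.primeCompl) (Localization.AtPrime v) f (T :=
      v.primeCompl) ?_
  ext y
  rw [Submonoid.mem_map]
  constructor
  · rintro ⟨x, hx, rfl⟩
    subst h
    exact hx
  · intro hy
    obtain ⟨x, rfl⟩ := hf y
    subst h
    exact ⟨x, hy, rfl⟩

/-- The homomorphism of polynomial rings that kills the variables in `K`. -/
def killVars (k : Type u) [Field k] {n : ℕ} (K : Finset (Fin n)) :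
    MvPolynomial (Fin n) k →ₐ[k] MvPolynomial {j // j ∉ K} k :=
  MvPolynomial.aeval fun j ↦ if h : j ∈ K then 0 else MvPolynomial.X ⟨j, h⟩

theorem killVars_surjective (k : Type u) [Field k] {n : ℕ} (K : Finset (Fin n)) :
    Function.Surjective (killVars k K) := by
  intro f
  refine ⟨MvPolynomial.rename Subtype.val f, ?_⟩
  have : (killVars k K).comp (MvPolynomial.rename Subtype.val) = AlgHom.id k _ := by
    ext j
    simp [killVars, j.2]
  exact DFunLike.congr_fun this f

theorem ker_killVars (k : Type u) [Field k] {n : ℕ} (K : Finset (Fin n)) :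
    RingHom.ker (killVars k K) = Ideal.span ((MvPolynomial.X : Fin n → MvPolynomial (Fin n) k) '' K)
        := by
  refine le_antisymm (fun f hf ↦ ?_) (Ideal.span_le.2 ?_)
  · let I := Ideal.span ((MvPolynomial.X : Fin n → MvPolynomial (Fin n) k) '' K)
    have : ((Ideal.Quotient.mkₐ k I).comp (MvPolynomial.rename Subtype.val)).comp (killVars k K) =
        Ideal.Quotient.mkₐ k I := by
      ext j
      by_cases hj : j ∈ K
      · simp only [killVars, AlgHom.comp_apply, MvPolynomial.aeval_X, dif_pos hj, map_zero]
        exact (Ideal.Quotient.eq_zero_iff_mem.2 (Ideal.subset_span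
        (Set.mem_image_of_mem _ (Finset.mem_coe.2 hj)))).symm
      · simp [killVars, hj]
    have h1 := DFunLike.congr_fun this f
    rw [AlgHom.comp_apply, (RingHom.mem_ker).1 hf, map_zero] at h1
    exact Ideal.Quotient.eq_zero_iff_mem.1 h1.symm
  · rintro _ ⟨j, hj, rfl⟩
    simp [killVars, Finset.mem_coe.1 hj]

theorem ker_includeRight {R P E : Type*} [CommRing R] [CommRing P] [CommRing E] [Algebra R P]
    [Algebra R E] (h : Function.Surjective (algebraMap R P)) :
    RingHom.ker (Algebra.TensorProduct.includeRight (R := R) (A := P) (B := E)) =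
      (RingHom.ker (algebraMap R P)).map (algebraMap R E) := by
  refine le_antisymm (fun x hx ↦ ?_) ?_
  · have h1 : (1 : R) ⊗ₜ[R] x ∈ RingHom.ker (Algebra.TensorProduct.map (Algebra.ofId R P)
        (AlgHom.id R E)) := by
      rw [RingHom.mem_ker, Algebra.TensorProduct.map_tmul, map_one, AlgHom.id_apply]
      exact hx
    rw [Algebra.TensorProduct.rTensor_ker _ h] at h1
    have h2 := Ideal.mem_map_of_mem (Algebra.TensorProduct.lid R E) h1
    rw [Algebra.TensorProduct.lid_tmul, one_smul] at h2
    revert h2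
    refine fun h2 ↦ (?_ : Ideal.map _ _ ≤ _) h2
    rw [Ideal.map_le_iff_le_comap, Ideal.map_le_iff_le_comap]
    intro r hr
    rw [Ideal.mem_comap, Ideal.mem_comap, Algebra.TensorProduct.includeLeft_apply,
      Algebra.TensorProduct.lid_tmul, ← Algebra.algebraMap_eq_smul_one]
    exact Ideal.mem_map_of_mem _ hr
  · rw [Ideal.map_le_iff_le_comap]
    intro r hr
    rw [Ideal.mem_comap, RingHom.mem_ker, AlgHom.commutes, Algebra.TensorProduct.algebraMap_apply,
      (RingHom.mem_ker).1 hr, TensorProduct.zero_tmul]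

/-- The coordinates vanishing at a point of an étale scheme over affine space form a normal crossing
system: killing some of them gives an étale scheme over a smaller affine space, the local rings of
which are domains. -/
theorem isNCSystem_of_etale {k : Type u} [Field k] {n : ℕ} {E : Type u} [CommRing E]
    [Algebra (MvPolynomial (Fin n) k) E] [Algebra.Etale (MvPolynomial (Fin n) k) E]
    (w : Ideal E) [w.IsPrime] : IsNCSystem fun j : {j : Fin n //
      algebraMap (MvPolynomial (Fin n) k) E (MvPolynomial.X j) ∈ w} ↦
        algebraMap E (Localization.AtPrime w) (algebraMap (MvPolynomial (Fin n) k) E (MvPolynomial.X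
            j.1)) := by
  classical
  have : IsNoetherianRing E := Algebra.FiniteType.isNoetherianRing (MvPolynomial (Fin n) k) E
  intro K'
  let K : Finset (Fin n) := K'.image Subtype.val
  let P := MvPolynomial {j // j ∉ K} k
  let := (killVars k K).toRingHom.toAlgebra
  -- `F` is étale over the polynomial ring in the variables that are not in `K`
  let F := P ⊗[MvPolynomial (Fin n) k] E
  have : IsNoetherianRing F := Algebra.FiniteType.isNoetherianRing P F
  let f : E →+* F := (Algebra.TensorProduct.includeRight (R := MvPolynomial (Fin n) k) (A := P)
    (B := E)).toRingHom
  have hf : Function.Surjective f :=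
    Algebra.TensorProduct.includeRight_surjective _ (killVars_surjective k K)
  let T (j : Fin n) : E := algebraMap (MvPolynomial (Fin n) k) E (MvPolynomial.X j)
  have hker : RingHom.ker f = Ideal.span (T '' K) := by
    refine (ker_includeRight (E := E) (killVars_surjective k K)).trans ?_
    have h1 : RingHom.ker (algebraMap (MvPolynomial (Fin n) k) P) = _ := ker_killVars k K
    rw [h1, Ideal.map_span, ← Set.image_comp]
    rfl
  have hKw : RingHom.ker f ≤ w := by
    rw [hker, Ideal.span_le]
    rintro _ ⟨j, hj, rfl⟩
    obtain ⟨j, -, rfl⟩ := Finset.mem_image.1 (Finset.mem_coe.1 hj)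
    exact j.2
  let v : Ideal F := w.map f
  have hv : v.IsPrime := Ideal.map_isPrime_of_surjective hf hKw
  have hwv : w = v.comap f := by
    rw [Ideal.comap_map_of_surjective _ hf, eq_comm, sup_eq_left]
    exact hKw
  let g := Localization.localRingHom w v f hwv
  have hspan : Ideal.span ((fun j : {j : Fin n // T j ∈ w} ↦
      algebraMap E (Localization.AtPrime w) (T j.1)) '' K') = RingHom.ker g := by
    rw [ker_localRingHom hf w v hwv, hker, Ideal.map_span, Finset.coe_image, ← Set.image_comp,
      ← Set.image_comp]
    rfl
  -- the ideal is the kernel of `g`, whose target is a domain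
  have hdom : IsDomain (Localization.AtPrime v) := isDomain_localization_of_etale (R := P) v
  refine ⟨?_, fun j hj h ↦ ?_⟩
  · have := RingHom.ker_isPrime g
    exact hspan ▸ this
  · have h1 : g (algebraMap E _ (T j.1)) = 0 := (RingHom.mem_ker).1 (hspan ▸ h)
    have hjK : j.1 ∉ K := fun h ↦ hj (by
      obtain ⟨i, hi, h2⟩ := Finset.mem_image.1 h
      exact Subtype.ext h2 ▸ hi)
    -- the variable is a nonzerodivisor of `P`, and the local ring is flat over `P`
    have h2 : g (algebraMap E _ (T j.1)) =
        algebraMap P (Localization.AtPrime v) (MvPolynomial.X ⟨j.1, hjK⟩) := by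
      rw [Localization.localRingHom_to_map, IsScalarTower.algebraMap_apply P F]
      congr 1
      have h3 : f (T j.1) = algebraMap P F (algebraMap (MvPolynomial (Fin n) k) P
          (MvPolynomial.X j.1)) :=
        ((Algebra.TensorProduct.includeRight (R := MvPolynomial (Fin n) k) (A := P)
          (B := E)).commutes _).trans (IsScalarTower.algebraMap_apply _ P F _)
      rw [h3]
      congr 1
      change killVars k K (MvPolynomial.X j.1) = _
      simp [killVars, hjK]
    have : Module.Flat P (Localization.AtPrime v) := Module.Flat.trans P F _
    have h3 : algebraMap P (Localization.AtPrime v) (MvPolynomial.X ⟨j.1, hjK⟩) ≠ 0 := by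
      intro h0
      have h4 := Module.Flat.isSMulRegular_of_nonZeroDivisors (M := Localization.AtPrime v)
        (mem_nonZeroDivisors_of_ne_zero (MvPolynomial.X_ne_zero (R :=
            k) (⟨j.1, hjK⟩ : {j // j ∉ K})))
      refine one_ne_zero (α := Localization.AtPrime v) (h4 ?_)
      change MvPolynomial.X _ • (1 : Localization.AtPrime v) = MvPolynomial.X _ • 0
      rw [smul_zero, Algebra.smul_def, h0, zero_mul]
    exact h3 (h2.symm.trans h1)

end Regular

/-! ### Comparison of two systems of coordinates on a normal crossing divisor -/

section Matching

/-- The intersection of the ideals `(t_i, t_d : d ∈ D)` over `i ∈ S` is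
`(∏_{i ∈ S} t_i, t_d : d ∈ D)`. -/
theorem IsNCSystem.mem_of_forall_mem {R ι : Type*} [CommRing R] [DecidableEq ι] {t : ι → R}
    (ht : IsNCSystem t) (S D : Finset ι) (hSD : Disjoint S D) {x : R}
    (hx : ∀ i ∈ S, x ∈ Ideal.span (t '' (insert i D : Finset ι))) :
    x ∈ Ideal.span {∏ i ∈ S, t i} ⊔ Ideal.span (t '' D) := by
  induction S using Finset.induction_on with
  | empty => simp
  | insert i S hi ih =>
    obtain ⟨y, hy, z, hz, rfl⟩ := Submodule.mem_sup.1 (ih (Finset.disjoint_of_subset_left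
      (Finset.subset_insert _ _) hSD) fun j hj ↦ hx j (Finset.mem_insert_of_mem hj))
    obtain ⟨a, rfl⟩ := Ideal.mem_span_singleton'.1 hy
    have hprime := (ht (insert i D)).1
    have hz' : z ∈ Ideal.span (t '' (insert i D : Finset ι)) :=
      Ideal.span_mono (Set.image_mono (Finset.coe_subset.2 (Finset.subset_insert _ _))) hz
    have h1 := (Submodule.add_mem_iff_left _ hz').1 (hx i (Finset.mem_insert_self _ _))
    -- the product over `S` is nonzero modulo this prime ideal, so the ideal contains the cofactor
    -- `a`
    have h2 : ∏ j ∈ S, t j ∉ Ideal.span (t '' (insert i D : Finset ι)) := by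
      rw [hprime.prod_mem_iff]
      rintro ⟨j, hj, hj'⟩
      refine (ht (insert i D)).2 j (fun h ↦ ?_) hj'
      rcases Finset.mem_insert.1 h with rfl | h
      · exact hi hj
      · exact Finset.disjoint_left.1 hSD (Finset.mem_insert_of_mem hj) h
    have h3 := (hprime.mem_or_mem h1).resolve_right h2
    rw [Finset.coe_insert, Set.image_insert_eq, Ideal.mem_span_insert] at h3
    obtain ⟨b, w, hw, rfl⟩ := h3
    rw [Finset.prod_insert hi, add_mul, add_assoc]
    refine Submodule.add_mem_sup (Ideal.mem_span_singleton'.2 ⟨b, by ring⟩) ?_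
    exact add_mem (Ideal.mul_mem_right _ _ hw) hz

/-- The image of a family `t` in the quotient by `∏_{i ∈ S} t_i`, where the `t_i` are as in
`IsNCSystem`. -/
structure IsNCFamily {R ι : Type*} [CommRing R] [DecidableEq ι] (t : ι → R) (S : Finset ι) :
    Prop where
  prod_eq_zero : ∏ i ∈ S, t i = 0
  isPrime (K : Finset ι) (i : ι) (hi : i ∈ S) (hK : i ∈ K) : (Ideal.span (t '' K)).IsPrime
  mem (K : Finset ι) (i : ι) (hi : i ∈ S) (hK : i ∈ K) (j : ι) (hj : t j ∈ Ideal.span (t '' K)) :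
    j ∈ K
  mem_span (d : ι) (hd : d ∉ S) (x : R) (hx : ∀ i ∈ S, x ∈ Ideal.span {t i, t d}) :
    x ∈ Ideal.span {t d}

/-- The members of a normal crossing system induce a normal crossing family in the ring of the
divisor `∏_{i ∈ S} t_i = 0`. -/
theorem IsNCSystem.isNCFamily {R F ι : Type*} [CommRing R] [CommRing F] [DecidableEq ι] {t : ι → R}
    (ht : IsNCSystem t) (S : Finset ι) {f : R →+* F} (hf : Function.Surjective f)
    (hker : RingHom.ker f = Ideal.span {∏ i ∈ S, t i}) : IsNCFamily (fun i ↦ f (t i)) S := by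
  have hmap (K : Set ι) : Ideal.span ((fun i ↦ f (t i)) '' K) = (Ideal.span (t '' K)).map f := by
    rw [Ideal.map_span, ← Set.image_comp]; rfl
  have hle {K : Finset ι} {i : ι} (hi : i ∈ S) (hK : i ∈ K) :
      RingHom.ker f ≤ Ideal.span (t '' K) := by
    rw [hker, Ideal.span_singleton_le_iff_mem]
    exact Ideal.mem_of_dvd _ (Finset.dvd_prod_of_mem t hi) (Ideal.subset_span ⟨i, hK, rfl⟩)
  have hcomap {K : Finset ι} {i : ι} (hi : i ∈ S) (hK : i ∈ K) {x : R}
      (hx : f x ∈ (Ideal.span (t '' K)).map f) : x ∈ Ideal.span (t '' K) := by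
    have h1 : x ∈ ((Ideal.span (t '' K)).map f).comap f := hx
    rwa [Ideal.comap_map_of_surjective' f hf, sup_eq_left.2 (hle hi hK)] at h1
  refine ⟨?_, fun K i hi hK ↦ ?_, fun K i hi hK j hj ↦ ?_, fun d hd x hx ↦ ?_⟩
  · rw [← map_prod, ← RingHom.mem_ker, hker]
    exact Ideal.mem_span_singleton_self _
  · rw [hmap]
    have := (ht K).1
    exact Ideal.map_isPrime_of_surjective hf (hle hi hK)
  · rw [hmap] at hj
    by_contra h
    exact (ht K).2 j h (hcomap hi hK hj)
  · obtain ⟨x, rfl⟩ := hf x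
    have h1 := ht.mem_of_forall_mem S {d} (Finset.disjoint_singleton_right.2 hd) (x := x)
      fun i hi ↦ hcomap hi (Finset.mem_insert_self _ _) (by
        rw [← hmap]
        have := hx i hi
        rwa [Finset.coe_insert, Finset.coe_singleton, Set.image_pair])
    have h2 := Ideal.mem_map_of_mem f h1
    rwa [Ideal.map_sup, Ideal.map_span, Set.image_singleton, map_prod, ← hmap,
      Finset.coe_singleton, Set.image_singleton, ← map_prod,
      RingHom.mem_ker.1 (hker ▸ Ideal.mem_span_singleton_self _), Ideal.span_singleton_zero,
      bot_sup_eq] at h2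

variable {R ι κ : Type*} [CommRing R] [DecidableEq ι] [DecidableEq κ] {t : ι → R} {T : κ → R}
  {S D : Finset ι} {J C : Finset κ}

theorem IsNCFamily.span_pair_isPrime (ht : IsNCFamily t S) {i : ι} (hi : i ∈ S) (d : ι) :
    (Ideal.span {t i, t d}).IsPrime := by
  have := ht.isPrime {i, d} i hi (Finset.mem_insert_self _ _)
  rwa [Finset.coe_insert, Finset.coe_singleton, Set.image_pair] at this

theorem IsNCFamily.eq_or_eq (ht : IsNCFamily t S) {i : ι} (hi : i ∈ S) {d j : ι}
    (h : t j ∈ Ideal.span {t i, t d}) : j = i ∨ j = d := by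
  have := ht.mem {i, d} i hi (Finset.mem_insert_self _ _) j (by
    rwa [Finset.coe_insert, Finset.coe_singleton, Set.image_pair])
  simpa using this

theorem IsNCFamily.span_singleton_isPrime (ht : IsNCFamily t S) {i : ι} (hi : i ∈ S) :
    (Ideal.span {t i}).IsPrime := by
  simpa using ht.span_pair_isPrime hi i

theorem IsNCFamily.eq_of_mem (ht : IsNCFamily t S) {i : ι} (hi : i ∈ S) {j : ι}
    (h : t j ∈ Ideal.span {t i}) : j = i := by
  simpa using ht.eq_or_eq hi (d := i) (by simpa using h)

theorem IsNCFamily.exists_mem (ht : IsNCFamily t S) (Q : Ideal R) [hQ : Q.IsPrime] :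
    ∃ i ∈ S, t i ∈ Q :=
  (hQ.prod_mem_iff).1 (by rw [ht.prod_eq_zero]; exact zero_mem _)

/-- The components of a normal crossing divisor match. -/
theorem IsNCFamily.exists_component (ht : IsNCFamily t S) (hT : IsNCFamily T J) {i : ι}
    (hi : i ∈ S) : ∃ j ∈ J, Ideal.span {t i} = Ideal.span {T j} := by
  have hQ := ht.span_singleton_isPrime hi
  obtain ⟨j, hj, h1⟩ := hT.exists_mem (Ideal.span {t i})
  have hQ' := hT.span_singleton_isPrime hj
  obtain ⟨i', hi', h2⟩ := ht.exists_mem (Ideal.span {T j})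
  have h3 : Ideal.span {T j} ≤ Ideal.span {t i} := (Ideal.span_singleton_le_iff_mem _).2 h1
  obtain rfl := ht.eq_of_mem hi (h3 h2)
  exact ⟨j, hj, le_antisymm ((Ideal.span_singleton_le_iff_mem _).2 h2) h3⟩

/-- On the component `t_i = 0` the divisors of the two systems have the same branches. -/
theorem IsNCFamily.exists_pair (ht : IsNCFamily t S) (hT : IsNCFamily T J) (hSD : Disjoint S D)
    (h : ∀ Q : Ideal R, Q.IsPrime → (∏ i ∈ D, t i ∈ Q ↔ ∏ j ∈ C, T j ∈ Q)) {i d : ι}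
    (hi : i ∈ S) (hd : d ∈ D) {j : κ} (hj : j ∈ J) (hij : Ideal.span {t i} = Ideal.span {T j}) :
    ∃ c ∈ C, Ideal.span {t i, t d} = Ideal.span {T j, T c} := by
  have hQ := ht.span_pair_isPrime hi d
  obtain ⟨c, hc, h1⟩ := (hQ.prod_mem_iff).1 ((h _ hQ).1 ((hQ.prod_mem_iff).2
    ⟨d, hd, Ideal.subset_span (by simp)⟩))
  have hQ' := hT.span_pair_isPrime hj c
  obtain ⟨d', hd', h2⟩ := (hQ'.prod_mem_iff).1 ((h _ hQ').2 ((hQ'.prod_mem_iff).2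
    ⟨c, hc, Ideal.subset_span (by simp)⟩))
  have hi1 : t i ∈ Ideal.span {T j} := hij ▸ Ideal.mem_span_singleton_self _
  have hj1 : T j ∈ Ideal.span {t i} := hij ▸ Ideal.mem_span_singleton_self _
  have h3 : Ideal.span {T j, T c} ≤ Ideal.span {t i, t d} := by
    rw [Ideal.span_insert, Ideal.span_insert, sup_le_iff]
    refine ⟨hij ▸ le_sup_left, ?_⟩
    rw [Ideal.span_singleton_le_iff_mem, ← Ideal.span_insert]
    exact h1
  obtain rfl : d' = d := (ht.eq_or_eq hi (h3 h2)).resolve_left fun h4 ↦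
    Finset.disjoint_left.1 hSD hi (h4 ▸ hd')
  refine ⟨c, hc, le_antisymm ?_ h3⟩
  rw [Ideal.span_insert, Ideal.span_insert, sup_le_iff]
  refine ⟨hij ▸ le_sup_left, ?_⟩
  rw [Ideal.span_singleton_le_iff_mem, ← Ideal.span_insert]
  exact h2

/-- The divisors on a normal crossing variety match: the branch `c` on which `T_c` cuts out the same
divisor as `t_d` on the component `i` does not depend on `i`, as one sees on the intersection of
all components. -/
theorem IsNCFamily.exists_divisor (ht : IsNCFamily t S) (hT : IsNCFamily T J) (hSD : Disjoint S D)
    (hJC : Disjoint J C) (hS : S.Nonempty)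
    (h : ∀ Q : Ideal R, Q.IsPrime → (∏ i ∈ D, t i ∈ Q ↔ ∏ j ∈ C, T j ∈ Q)) {d : ι}
    (hd : d ∈ D) : ∃ c ∈ C, Ideal.span {t d} = Ideal.span {T c} := by
  obtain ⟨i₀, hi₀⟩ := hS
  have : Nonempty κ := ⟨(ht.exists_component hT hi₀).choose⟩
  choose! φ hφJ hφ using fun i (hi : i ∈ S) ↦ ht.exists_component hT hi
  choose! c hc hφc using fun i (hi : i ∈ S) ↦ ht.exists_pair hT hSD h hi hd (hφJ i hi) (hφ i hi)
  -- both systems define the same intersection of all components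
  have hP : Ideal.span (t '' S) = Ideal.span (T '' J) := by
    refine le_antisymm (Ideal.span_le.2 ?_) (Ideal.span_le.2 ?_)
    · rintro _ ⟨i, hi, rfl⟩
      have : t i ∈ Ideal.span {T (φ i)} := hφ i hi ▸ Ideal.mem_span_singleton_self _
      refine Ideal.span_mono ?_ this
      rw [Set.singleton_subset_iff]
      exact ⟨_, hφJ i hi, rfl⟩
    · rintro _ ⟨j, hj, rfl⟩
      obtain ⟨i, hi, h1⟩ := hT.exists_component ht hj
      have : T j ∈ Ideal.span {t i} := h1 ▸ Ideal.mem_span_singleton_self _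
      refine Ideal.span_mono ?_ this
      rw [Set.singleton_subset_iff]
      exact ⟨_, hi, rfl⟩
  have hPd (i) (hi : i ∈ S) : Ideal.span (t '' S) ⊔ Ideal.span {t d} =
      Ideal.span (T '' (insert (c i) J : Finset κ)) := by
    rw [Finset.coe_insert, Set.image_insert_eq, Ideal.span_insert, ← hP, sup_comm]
    have h1 : Ideal.span {t i} ≤ Ideal.span (t '' S) :=
      Ideal.span_mono (Set.singleton_subset_iff.2 ⟨i, hi, rfl⟩)
    have h2 := hφc i hi
    rw [Ideal.span_insert, Ideal.span_insert, ← hφ i hi] at h2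
    rw [← sup_eq_right.2 h1, ← sup_assoc, ← sup_assoc, sup_comm _ (Ideal.span {t i}),
      sup_comm _ (Ideal.span {t i}), h2]
  -- the divisor `T_{c i}` is the same for all `i`, since it is so on the intersection
  have hcc (i) (hi : i ∈ S) : c i = c i₀ := by
    have h1 : T (c i) ∈ Ideal.span (T '' (insert (c i₀) J : Finset κ)) := by
      rw [← hPd i₀ hi₀, hPd i hi]
      exact Ideal.subset_span ⟨c i, by simp, rfl⟩
    have h2 := hT.mem _ (φ i₀) (hφJ i₀ hi₀) (Finset.mem_insert_of_mem (hφJ i₀ hi₀)) _ h1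
    exact (Finset.mem_insert.1 h2).resolve_right fun h3 ↦
      Finset.disjoint_left.1 hJC h3 (hc i hi)
  -- an equality of the ideals on each component implies that of the principal ideals
  refine ⟨c i₀, hc i₀ hi₀, le_antisymm ?_ ?_⟩
  · rw [Ideal.span_singleton_le_iff_mem]
    refine hT.mem_span _ (fun h1 ↦ Finset.disjoint_left.1 hJC h1 (hc i₀ hi₀)) _ fun j hj ↦ ?_
    obtain ⟨i, hi, h1⟩ := hT.exists_component ht hj
    have h2 := hφc i hi
    rw [hcc i hi, Ideal.span_insert (T _), ← hφ i hi, ← h1, ← Ideal.span_insert] at h2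
    rw [← h2]
    exact Ideal.subset_span (by simp)
  · rw [Ideal.span_singleton_le_iff_mem]
    refine ht.mem_span _ (fun h1 ↦ Finset.disjoint_left.1 hSD h1 hd) _ fun i hi ↦ ?_
    rw [hφc i hi, hcc i hi]
    exact Ideal.subset_span (by simp)

theorem exists_unit_of_span_eq [IsLocalRing R] {a b : R} (h : Ideal.span {a} = Ideal.span {b}) :
    ∃ u : Rˣ, a = u * b := by
  obtain ⟨x, hx⟩ := Ideal.mem_span_singleton'.1 (h ▸ Ideal.mem_span_singleton_self a)
  obtain ⟨y, hy⟩ := Ideal.mem_span_singleton'.1 (h.symm ▸ Ideal.mem_span_singleton_self b)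
  have h1 : b * (1 - y * x) = 0 := by
    rw [mul_sub, mul_one, sub_eq_zero]
    calc b = y * a := hy.symm
      _ = b * (y * x) := by rw [← hx]; ring
  rcases IsLocalRing.isUnit_or_isUnit_of_add_one (sub_add_cancel 1 (y * x)) with h2 | h2
  · have hb : b = 0 := (h2.mul_left_eq_zero).1 h1
    refine ⟨1, ?_⟩
    rw [← hx, hb, mul_zero, mul_zero]
  · obtain ⟨u, hu⟩ := isUnit_of_mul_isUnit_right h2
    exact ⟨u, by rw [hu, hx]⟩

/-- Comparison of the coordinates of two systems describing the same normal crossing divisor on the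
same normal crossing variety, over a local ring. -/
theorem IsNCFamily.exists_matching [IsLocalRing R] (ht : IsNCFamily t S) (hT : IsNCFamily T J)
    (hSD : Disjoint S D) (hJC : Disjoint J C)
    (h : ∀ Q : Ideal R, Q.IsPrime → (∏ i ∈ D, t i ∈ Q ↔ ∏ j ∈ C, T j ∈ Q)) :
    ∃ (φ : κ → ι) (u : κ → Rˣ), (∀ j ∈ J, φ j ∈ S) ∧ (∀ j ∈ C, φ j ∈ D) ∧
      (∀ j ∈ J ∪ C, T j = u j * t (φ j)) ∧ Set.InjOn φ (J ∪ C : Finset κ) ∧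
      (∀ i ∈ S, ∃ j ∈ J, φ j = i) ∧ ∀ i ∈ D, ∃ j ∈ C, φ j = i := by
  classical
  have hS : S.Nonempty := by
    rw [Finset.nonempty_iff_ne_empty]
    rintro rfl
    exact one_ne_zero (α := R) (by simpa using ht.prod_eq_zero)
  have hJ : J.Nonempty := by
    rw [Finset.nonempty_iff_ne_empty]
    rintro rfl
    exact one_ne_zero (α := R) (by simpa using hT.prod_eq_zero)
  obtain ⟨i₀, hi₀⟩ := hS
  obtain ⟨j₀, hj₀⟩ := hJ
  have : Nonempty ι := ⟨i₀⟩
  -- match the components, then the divisors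
  choose! f hf hf' using fun j (hj : j ∈ J) ↦ hT.exists_component ht hj
  choose! g hg hg' using fun j (hj : j ∈ C) ↦ hT.exists_divisor ht hJC hSD ⟨j₀, hj₀⟩
    (fun Q hQ ↦ (h Q hQ).symm) hj
  let φ (j : κ) : ι := if j ∈ J then f j else g j
  have hφJ (j) (hj : j ∈ J) : φ j = f j := if_pos hj
  have hφC (j) (hj : j ∈ C) : φ j = g j := if_neg (Finset.disjoint_right.1 hJC hj)
  have hspan (j) (hj : j ∈ J ∪ C) : Ideal.span {T j} = Ideal.span {t (φ j)} := by
    rcases Finset.mem_union.1 hj with hj | hj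
    · rw [hφJ j hj, hf' j hj]
    · rw [hφC j hj, hg' j hj]
  -- different coordinates cannot have the same partner, as they generate different ideals
  have hinj (j j') (hj : j ∈ J ∪ C) (hj' : j' ∈ J ∪ C) (h1 : φ j = φ j') : j = j' := by
    have h2 : Ideal.span {T j} = Ideal.span {T j'} := by rw [hspan j hj, hspan j' hj', h1]
    have h3 : T j ∈ Ideal.span {T j₀, T j'} := by
      rw [Ideal.span_insert, ← h2, ← Ideal.span_insert]
      exact Ideal.subset_span (by simp)
    rcases hT.eq_or_eq hj₀ h3 with h4 | h4
    · subst h4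
      exact (hT.eq_of_mem hj₀ (h2 ▸ Ideal.mem_span_singleton_self _)).symm
    · exact h4
  have hu (j) : ∃ u : Rˣ, j ∈ J ∪ C → T j = u * t (φ j) := by
    by_cases hj : j ∈ J ∪ C
    · obtain ⟨u, hu⟩ := exists_unit_of_span_eq (hspan j hj)
      exact ⟨u, fun _ ↦ hu⟩
    · exact ⟨1, fun h ↦ absurd h hj⟩
  choose u hu using hu
  refine ⟨φ, u, fun j hj ↦ hφJ j hj ▸ hf j hj, fun j hj ↦ hφC j hj ▸ hg j hj, fun j hj ↦ hu j hj,
    fun j hj j' hj' h1 ↦ hinj j j' hj hj' h1, fun i hi ↦ ?_, fun i hi ↦ ?_⟩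
  · obtain ⟨j, hj, h1⟩ := ht.exists_component hT hi
    refine ⟨j, hj, ?_⟩
    rw [hφJ j hj]
    refine ht.eq_of_mem hi ?_
    rw [h1, hf' j hj]
    exact Ideal.mem_span_singleton_self _
  · obtain ⟨j, hj, h1⟩ := ht.exists_divisor hT hSD hJC ⟨i₀, hi₀⟩ h hi
    refine ⟨j, hj, ?_⟩
    rw [hφC j hj]
    have h2 : t (g j) ∈ Ideal.span {t i₀, t i} := by
      rw [Ideal.span_insert, h1, hg' j hj, ← Ideal.span_insert]
      exact Ideal.subset_span (by simp)
    exact (ht.eq_or_eq hi₀ h2).resolve_left fun h3 ↦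
      Finset.disjoint_left.1 hSD hi₀ (h3 ▸ hg j hj)

end Matching

/-! ### The boundary in a regular local ring -/

section Boundary

variable {O ι : Type*} [CommRing O] {t : ι → O}

theorem IsNCSystem.isDomain (ht : IsNCSystem t) : IsDomain O := by
  have := (ht ∅).1
  rw [Finset.coe_empty, Set.image_empty, Ideal.span_empty] at this
  exact IsDomain.of_bot_isPrime O

theorem IsNCSystem.span_isPrime (ht : IsNCSystem t) (i : ι) : (Ideal.span {t i}).IsPrime := by
  simpa using (ht {i}).1

theorem IsNCSystem.ne_zero (ht : IsNCSystem t) (i : ι) : t i ≠ 0 := by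
  have := (ht ∅).2 i (Finset.notMem_empty i)
  rwa [Finset.coe_empty, Set.image_empty, Ideal.span_empty, Ideal.mem_bot] at this

theorem IsNCSystem.prime (ht : IsNCSystem t) (i : ι) : Prime (t i) :=
  (Ideal.span_singleton_prime (ht.ne_zero i)).1 (ht.span_isPrime i)

theorem IsNCSystem.eq_of_mem (ht : IsNCSystem t) {i j : ι} (h : t j ∈ Ideal.span {t i}) : j = i :=
    by
  by_contra hij
  exact (ht {i}).2 j (by simpa using hij) (by simpa using h)

theorem IsNCSystem.mem_prod (ht : IsNCSystem t) (S : Finset ι) {x : O}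
    (hx : ∀ i ∈ S, x ∈ Ideal.span {t i}) : x ∈ Ideal.span {∏ i ∈ S, t i} := by
  classical
  simpa using ht.mem_of_forall_mem S ∅ (Finset.disjoint_empty_right S) (by simpa using hx)

theorem IsNCSystem.isRadical (ht : IsNCSystem t) (S : Finset ι) :
    (Ideal.span {∏ i ∈ S, t i}).IsRadical := by
  rintro x ⟨n, hn⟩
  refine ht.mem_prod S fun i hi ↦ (ht.span_isPrime i).mem_of_pow_mem n ?_
  exact Ideal.span_singleton_le_span_singleton.2 (Finset.dvd_prod_of_mem t hi) hn

variable {Y D : Set (PrimeSpectrum O)} {S S₁ : Finset ι} {ϖ : O}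

/-- The prime of the branch `t_i = 0`. -/
def IsNCSystem.branch (ht : IsNCSystem t) (i : ι) : PrimeSpectrum O :=
  ⟨Ideal.span {t i}, ht.span_isPrime i⟩

theorem IsNCSystem.branch_le (ht : IsNCSystem t) {i : ι} {P : PrimeSpectrum O} :
    ht.branch i ≤ P ↔ t i ∈ P.asIdeal :=
  Ideal.span_singleton_le_iff_mem _

/-- The zero locus of a function dividing a power of `∏_{i ∈ S} t_i` is a union of branches. -/
theorem IsNCSystem.exists_subset (ht : IsNCSystem t)
    (hS : ∀ P : PrimeSpectrum O, P ∈ Y ∪ D ↔ ∏ i ∈ S, t i ∈ P.asIdeal)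
    (hϖ : ∀ P : PrimeSpectrum O, P ∈ Y ↔ ϖ ∈ P.asIdeal) :
    ∃ S₁ ⊆ S, ∀ P : PrimeSpectrum O, P ∈ Y ↔ ∃ i ∈ S₁, t i ∈ P.asIdeal := by
  classical
  have := ht.isDomain
  have h1 : ∏ i ∈ S, t i ∈ (Ideal.span {ϖ}).radical := by
    rw [Ideal.radical_eq_sInf, Submodule.mem_sInf]
    rintro P ⟨hP, hP'⟩
    exact (hS ⟨P, hP'⟩).1 (.inl ((hϖ ⟨P, hP'⟩).2 (hP (Ideal.mem_span_singleton_self _))))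
  obtain ⟨n, hn⟩ := h1
  obtain ⟨a, ha⟩ := Ideal.mem_span_singleton'.1 hn
  -- a divisor of a power of `∏ t_i` is a unit times a monomial in the primes `t_i`
  obtain ⟨v, e, rfl⟩ := exists_eq_unit_mul_prod (fun i _ ↦ ht.prime i) isUnit_one
    ((mul_comm _ _).trans (ha.trans (one_mul _).symm))
  refine ⟨S.filter fun i ↦ e i ≠ 0, Finset.filter_subset _ _, fun P ↦ ?_⟩
  rw [hϖ, Ideal.unit_mul_mem_iff_mem _ v.isUnit, P.2.prod_mem_iff]
  constructor
  · rintro ⟨i, hi, h⟩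
    refine ⟨i, Finset.mem_filter.2 ⟨hi, fun h0 ↦ ?_⟩, P.2.mem_of_pow_mem _ h⟩
    rw [h0, pow_zero] at h
    exact P.2.ne_top ((Ideal.eq_top_iff_one _).2 h)
  · rintro ⟨i, hi, h⟩
    obtain ⟨hi, h0⟩ := Finset.mem_filter.1 hi
    exact ⟨i, hi, Ideal.pow_mem_of_mem _ h _ (Nat.pos_of_ne_zero h0)⟩

/-- If every point of `D ∩ Y` has a generization in `D \ Y`, then `D` is the union of the remaining
branches along `Y`. -/
theorem IsNCSystem.mem_divisor_iff [DecidableEq ι] (ht : IsNCSystem t)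
    (hS : ∀ P : PrimeSpectrum O, P ∈ Y ∪ D ↔ ∏ i ∈ S, t i ∈ P.asIdeal)
    (hS₁ : ∀ P : PrimeSpectrum O, P ∈ Y ↔ ∃ i ∈ S₁, t i ∈ P.asIdeal)
    (hD : ∀ P P' : PrimeSpectrum O, P ≤ P' → P ∈ D → P' ∈ D)
    (hgen : ∀ P ∈ Y, P ∈ D → ∃ P' ≤ P, P' ∈ D ∧ P' ∉ Y) (P : PrimeSpectrum O) (hP : P ∈ Y) :
    P ∈ D ↔ ∏ i ∈ S \ S₁, t i ∈ P.asIdeal := by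
  rw [P.2.prod_mem_iff]
  constructor
  · intro h
    obtain ⟨P', hP', h1, h2⟩ := hgen P hP h
    obtain ⟨i, hi, h3⟩ := (P'.2.prod_mem_iff).1 ((hS P').1 (.inr h1))
    exact ⟨i, Finset.mem_sdiff.2 ⟨hi, fun h4 ↦ h2 ((hS₁ P').2 ⟨i, h4, h3⟩)⟩, hP' h3⟩
  · rintro ⟨i, hi, h⟩
    obtain ⟨hi, hi'⟩ := Finset.mem_sdiff.1 hi
    refine hD (ht.branch i) P (ht.branch_le.2 h) ?_
    have h1 : ht.branch i ∈ Y ∪ D := (hS _).2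
      (Ideal.mem_of_dvd _ (Finset.dvd_prod_of_mem t hi) (Ideal.mem_span_singleton_self _))
    refine h1.resolve_left fun h2 ↦ ?_
    obtain ⟨j, hj, h3⟩ := (hS₁ _).1 h2
    exact hi' (ht.eq_of_mem h3 ▸ hj)

/-- The sets `C_i` are the closures, within a normal crossing divisor `Y`, of sets `M_i` of generic
points of `Y`. -/
structure IsComponentFamily {Λ : Type*} {O : Type*} [CommRing O] (Y : Set (PrimeSpectrum O))
    (C M : Λ → Set (PrimeSpectrum O)) : Prop where
  mono (i : Λ) (P P' : PrimeSpectrum O) (h : P ≤ P') (hP : P ∈ C i) : P' ∈ C i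
  generic_subset (i : Λ) : M i ⊆ C i
  exists_generic (i : Λ) (P) (h : P ∈ C i) : ∃ P' ≤ P, P' ∈ M i
  subset (i : Λ) : C i ⊆ Y
  minimal (i : Λ) (P P' : PrimeSpectrum O) (h : P ≤ P') (hP : P ∈ Y) (hP' : P' ∈ M i) : P ∈ M i
  eq (i j : Λ) (P) (hi : P ∈ M i) (hj : P ∈ M j) : i = j

/-- The sets `C_l` are unions of branches of `Y`, and different ones have no branch in common. -/
theorem IsNCSystem.exists_components (ht : IsNCSystem t) {Λ : Type*}
    {C M : Λ → Set (PrimeSpectrum O)} (hC : IsComponentFamily Y C M)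
    (hS₁ : ∀ P : PrimeSpectrum O, P ∈ Y ↔ ∃ i ∈ S₁, t i ∈ P.asIdeal) :
    ∃ s : Λ → Finset ι, (∀ l, s l ⊆ S₁) ∧ (∀ l l', l ≠ l' → Disjoint (s l) (s l')) ∧
      ∀ (l : Λ) (P : PrimeSpectrum O), P ∈ C l ↔ ∏ i ∈ s l, t i ∈ P.asIdeal := by
  classical
  have hY {i : ι} (hi : i ∈ S₁) : ht.branch i ∈ Y :=
    (hS₁ _).2 ⟨i, hi, Ideal.mem_span_singleton_self _⟩
  refine ⟨fun l ↦ S₁.filter fun i ↦ ht.branch i ∈ M l, fun l ↦ Finset.filter_subset _ _,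
    fun l l' hl ↦ Finset.disjoint_left.2 fun i hi hi' ↦ hl (hC.eq l l' _
      (Finset.mem_filter.1 hi).2 (Finset.mem_filter.1 hi').2), fun l P ↦ ?_⟩
  rw [P.2.prod_mem_iff]
  constructor
  · intro h
    obtain ⟨P', hP', h1⟩ := hC.exists_generic l P h
    obtain ⟨i, hi, h2⟩ := (hS₁ P').1 (hC.subset l (hC.generic_subset l h1))
    exact ⟨i, Finset.mem_filter.2 ⟨hi, hC.minimal l _ P' (ht.branch_le.2 h2) (hY hi) h1⟩, hP' h2⟩
  · rintro ⟨i, hi, h⟩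
    exact hC.mono l _ P (ht.branch_le.2 h) (hC.generic_subset l (Finset.mem_filter.1 hi).2)

end Boundary

/-! ### Spreading out from a local ring -/

section Spreading

variable {A : Type u} [CommRing A] (w : Ideal A) [w.IsPrime]

/-- The element `g` kills the difference between the ideal `I` and its contraction from the local
ring at `w`. -/
def Saturates (g : A) (I : Ideal A) : Prop :=
  ∀ x, algebraMap A (Localization.AtPrime w) x ∈ I.map (algebraMap A (Localization.AtPrime w)) →
    g * x ∈ I

/-- An ideal of a noetherian ring agrees with its contraction from the local ring at `w` on a
neighbourhood of `w`. -/
theorem exists_saturates [IsNoetherianRing A] (I : Ideal A) : ∃ g ∉ w, Saturates w g I := by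
  classical
  obtain ⟨s, hs⟩ := IsNoetherian.noetherian
    ((I.map (algebraMap A (Localization.AtPrime w))).comap (algebraMap A (Localization.AtPrime w)))
  have h1 (x : A) : ∃ m ∉ w, x ∈ s → m * x ∈ I := by
    by_cases hx : x ∈ s
    · have h2 : x ∈ (I.map (algebraMap A (Localization.AtPrime w))).comap
          (algebraMap A (Localization.AtPrime w)) := hs ▸ Submodule.subset_span hx
      obtain ⟨m, hm, h3⟩ := (IsLocalization.algebraMap_mem_map_algebraMap_iff w.primeCompl
        (Localization.AtPrime w) I x).1 h2
      exact ⟨m, hm, fun _ ↦ h3⟩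
    · exact ⟨1, fun h ↦ w.one_notMem h, fun h ↦ absurd h hx⟩
  choose m hm hm' using h1
  refine ⟨∏ x ∈ s, m x, fun h ↦ ?_, fun x hx ↦ ?_⟩
  · obtain ⟨x, -, hx⟩ := (‹w.IsPrime›.prod_mem_iff).1 h
    exact hm x hx
  · have h2 : x ∈ Submodule.span A (s : Set A) := by
      rw [hs]; exact hx
    clear hx
    induction h2 using Submodule.span_induction with
    | mem y hy =>
      obtain ⟨c, hc⟩ := Finset.dvd_prod_of_mem m (Finset.mem_coe.1 hy)
      rw [hc, mul_right_comm]
      exact Ideal.mul_mem_right _ _ (hm' y hy)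
    | zero => rw [mul_zero]; exact zero_mem _
    | add y z hy hz h h' =>
      rw [mul_add]
      exact add_mem h h'
    | smul a y hy h =>
      rw [smul_eq_mul, mul_left_comm]
      exact Ideal.mul_mem_left _ _ h

variable {w}

theorem Saturates.of_dvd {g g' : A} {I : Ideal A} (h : Saturates w g I) (hg : g ∣ g') :
    Saturates w g' I := by
  obtain ⟨c, rfl⟩ := hg
  intro x hx
  rw [mul_right_comm]
  exact Ideal.mul_mem_right _ _ (h x hx)

variable {g : A} (B : Type u) [CommRing B] [Algebra A B] [IsLocalization.Away g B]

/-- The map from `A[1/g]` to the local ring. -/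
def awayToLocal (hg : g ∉ w) : B →+* Localization.AtPrime w :=
  IsLocalization.Away.lift (S := B) g (g := algebraMap A (Localization.AtPrime w))
    (IsLocalization.map_units _ (⟨g, hg⟩ : w.primeCompl))

theorem awayToLocal_algebraMap (hg : g ∉ w) (x : A) :
    awayToLocal B hg (algebraMap A B x) = algebraMap A (Localization.AtPrime w) x :=
  IsLocalization.Away.lift_eq ..

variable {B} in
theorem Saturates.map_eq_comap {I : Ideal A} (h : Saturates w g I) (hg : g ∉ w) :
    I.map (algebraMap A B) =
      (I.map (algebraMap A (Localization.AtPrime w))).comap (awayToLocal B hg) := by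
  refine le_antisymm ?_ fun y hy ↦ ?_
  · rw [Ideal.map_le_iff_le_comap]
    intro x hx
    rw [Ideal.mem_comap, Ideal.mem_comap, awayToLocal_algebraMap]
    exact Ideal.mem_map_of_mem _ hx
  · obtain ⟨k, x, hx⟩ := IsLocalization.Away.surj g y
    have hgu : IsUnit (algebraMap A B g) := IsLocalization.Away.algebraMap_isUnit g
    have h1 : algebraMap A (Localization.AtPrime w) x ∈
        I.map (algebraMap A (Localization.AtPrime w)) := by
      rw [← awayToLocal_algebraMap B hg, ← hx, map_mul]
      exact Ideal.mul_mem_right _ _ hy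
    have h2 := Ideal.mem_map_of_mem (algebraMap A B) (h x h1)
    rw [map_mul, ← hx, Ideal.unit_mul_mem_iff_mem _ hgu,
      Ideal.mul_unit_mem_iff_mem _ (hgu.pow k)] at h2
    exact h2

theorem Saturates.map_eq_map {I J : Ideal A} (h : Saturates w g I) (h' : Saturates w g J)
    (hg : g ∉ w) (hIJ : I.map (algebraMap A (Localization.AtPrime w)) =
      J.map (algebraMap A (Localization.AtPrime w))) :
    I.map (algebraMap A B) = J.map (algebraMap A B) := by
  rw [h.map_eq_comap hg, h'.map_eq_comap hg, hIJ]

/-- Vanishing ideals localize. -/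
theorem map_vanishingIdeal_away (g : A) [IsLocalization.Away g B] (C : Set (PrimeSpectrum A)) :
    PrimeSpectrum.vanishingIdeal (PrimeSpectrum.comap (algebraMap A B) ⁻¹' C) =
      (PrimeSpectrum.vanishingIdeal C).map (algebraMap A B) := by
  refine le_antisymm (fun y hy ↦ ?_) ?_
  · obtain ⟨k, x, hx⟩ := IsLocalization.Away.surj g y
    have hgu : IsUnit (algebraMap A B g) := IsLocalization.Away.algebraMap_isUnit g
    have h1 : g * x ∈ PrimeSpectrum.vanishingIdeal C := by
      rw [PrimeSpectrum.mem_vanishingIdeal]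
      intro P hP
      by_cases hgP : g ∈ P.asIdeal
      · exact Ideal.mul_mem_right _ _ hgP
      · obtain ⟨Q, rfl⟩ : P ∈ Set.range (PrimeSpectrum.comap (algebraMap A B)) := by
          rw [PrimeSpectrum.localization_away_comap_range B g]
          exact hgP
        rw [PrimeSpectrum.mem_vanishingIdeal] at hy
        refine Ideal.mul_mem_left _ _ (?_ : algebraMap A B x ∈ Q.asIdeal)
        rw [← hx]
        exact Ideal.mul_mem_right _ _ (hy Q hP)
    have h2 := Ideal.mem_map_of_mem (algebraMap A B) h1
    rw [map_mul, ← hx, Ideal.unit_mul_mem_iff_mem _ hgu,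
      Ideal.mul_unit_mem_iff_mem _ (hgu.pow k)] at h2
    exact h2
  · rw [Ideal.map_le_iff_le_comap]
    intro x hx
    rw [Ideal.mem_comap, PrimeSpectrum.mem_vanishingIdeal]
    intro Q hQ
    exact (PrimeSpectrum.mem_vanishingIdeal _ _).1 hx _ hQ

/-- The vanishing ideal becomes in the local ring every radical ideal with the same zero locus. -/
theorem map_vanishingIdeal_eq (C : Set (PrimeSpectrum A)) (hC : IsClosed C)
    {I : Ideal (Localization.AtPrime w)} (hI : I.IsRadical)
    (h : ∀ Q : PrimeSpectrum (Localization.AtPrime w),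
      PrimeSpectrum.comap (algebraMap A _) Q ∈ C ↔ I ≤ Q.asIdeal) :
    (PrimeSpectrum.vanishingIdeal C).map (algebraMap A (Localization.AtPrime w)) = I := by
  have hrad : ((PrimeSpectrum.vanishingIdeal C).map
      (algebraMap A (Localization.AtPrime w))).IsRadical := by
    rintro y ⟨n, hn⟩
    obtain ⟨x, s, rfl⟩ := IsLocalization.exists_mk'_eq w.primeCompl y
    have hs := IsLocalization.map_units (Localization.AtPrime w) s
    have hy : IsLocalization.mk' (Localization.AtPrime w) x s * algebraMap A _ s =
      algebraMap A _ x := IsLocalization.mk'_spec _ x s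
    have h1 : algebraMap A (Localization.AtPrime w) (x ^ n) ∈ (PrimeSpectrum.vanishingIdeal C).map
        (algebraMap A (Localization.AtPrime w)) := by
      rw [map_pow, ← hy, mul_pow]
      exact Ideal.mul_mem_right _ _ hn
    obtain ⟨m, hm, h2⟩ := (IsLocalization.algebraMap_mem_map_algebraMap_iff w.primeCompl _ _ _).1 h1
    have h3 : m * x ∈ PrimeSpectrum.vanishingIdeal C := by
      rw [PrimeSpectrum.mem_vanishingIdeal] at h2 ⊢
      intro P hP
      rcases P.2.mem_or_mem (h2 P hP) with h4 | h4
      · exact Ideal.mul_mem_right _ _ h4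
      · exact Ideal.mul_mem_left _ _ (P.2.mem_of_pow_mem _ h4)
    have h4 := Ideal.mem_map_of_mem (algebraMap A (Localization.AtPrime w)) h3
    rw [map_mul, Ideal.unit_mul_mem_iff_mem _ (IsLocalization.map_units _ (⟨m, hm⟩ : w.primeCompl)),
      ← hy, Ideal.mul_unit_mem_iff_mem _ hs] at h4
    exact h4
  have key (Q : Ideal (Localization.AtPrime w)) (hQ : Q.IsPrime) :
      (PrimeSpectrum.vanishingIdeal C).map (algebraMap A _) ≤ Q ↔ I ≤ Q := by
    have h1 (P : PrimeSpectrum A) : P ∈ C ↔ PrimeSpectrum.vanishingIdeal C ≤ P.asIdeal := by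
      rw [← SetLike.coe_subset_coe, ← PrimeSpectrum.mem_zeroLocus,
        PrimeSpectrum.zeroLocus_vanishingIdeal_eq_closure, hC.closure_eq]
    rw [← h ⟨Q, hQ⟩, Ideal.map_le_iff_le_comap, h1]
    rfl
  rw [← hrad.radical, ← hI.radical, Ideal.radical_eq_sInf, Ideal.radical_eq_sInf]
  congr 1
  ext Q
  exact ⟨fun h ↦ ⟨(key Q h.2).1 h.1, h.2⟩, fun h ↦ ⟨(key Q h.2).2 h.1, h.2⟩⟩

end Spreading

/-! ### Comparison of the two models at a point -/

section LocalModels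

theorem isRadical_eq_of_le_iff {R : Type*} [CommRing R] {I J : Ideal R} (hI : I.IsRadical)
    (hJ : J.IsRadical) (h : ∀ P : PrimeSpectrum R, I ≤ P.asIdeal ↔ J ≤ P.asIdeal) : I = J := by
  rw [← hI.radical, ← hJ.radical, Ideal.radical_eq_sInf, Ideal.radical_eq_sInf]
  congr 1
  ext Q
  exact ⟨fun h' ↦ ⟨(h ⟨Q, h'.2⟩).1 h'.1, h'.2⟩, fun h' ↦ ⟨(h ⟨Q, h'.2⟩).2 h'.1, h'.2⟩⟩

theorem span_prod_eq_of_isUnit {R ι : Type*} [CommRing R] (s : Finset ι) (p : ι → Prop)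
    [DecidablePred p] {y : ι → R} (hy : ∀ i ∈ s, ¬ p i → IsUnit (y i)) :
    Ideal.span {∏ i ∈ s, y i} = Ideal.span {∏ i ∈ s.subtype p, y i} := by
  rw [Finset.prod_subtype_eq_prod_filter, ← Finset.prod_filter_mul_prod_filter_not s p,
    Ideal.span_singleton_mul_right_unit]
  refine (Finset.prod_induction _ IsUnit (fun _ _ ↦ IsUnit.mul) isUnit_one fun i hi ↦ ?_)
  exact hy i (Finset.mem_filter.1 hi).1 (Finset.mem_filter.1 hi).2

variable {A E E' k : Type u} [CommRing A] [CommRing E] [CommRing E'] [Field k] {N a b n : ℕ}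
  [Algebra (MvPolynomial (Fin N) k) E']

/-- The pullback to `E'` of the coordinate `T_j` of affine space. -/
abbrev coord (k E' : Type u) [CommRing E'] [Field k] {N : ℕ} [Algebra (MvPolynomial (Fin N) k) E']
    (j : Fin N) : E' :=
  algebraMap (MvPolynomial (Fin N) k) E' (MvPolynomial.X j)

open Classical in
/-- At a point `v` of `Y = Spec E`, the coordinates `T_j` of a model of the normal crossing variety
`Y` and of the divisor `D ∩ Y` agree up to units with the members of a regular system of parameters
`t` of the ambient regular scheme `Spec A` that cut out `Y ∪ D`. -/
theorem exists_local_matching [Algebra.Etale (MvPolynomial (Fin N) k) E']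
    {f : A →+* E} (hf : Function.Surjective f) {h : E' →+* E} (hh : Function.Surjective h)
    (hker : RingHom.ker h = Ideal.span {∏ j : Fin N with j.val < a, coord k E' j})
    (v : Ideal E) [v.IsPrime] {t : Fin n → A}
    (ht : IsNCSystem fun i ↦ algebraMap A (Localization.AtPrime (v.comap f)) (t i))
    {S : Finset (Fin n)} {Y D : Set (PrimeSpectrum A)} {ϖ : A}
    (hS : ∀ P : PrimeSpectrum (Localization.AtPrime (v.comap f)),
      PrimeSpectrum.comap (algebraMap A _) P ∈ Y ∪ D ↔ algebraMap A _ (∏ i ∈ S, t i) ∈ P.asIdeal)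
    (hϖ : ∀ P : PrimeSpectrum A, P ∈ Y ↔ ϖ ∈ P.asIdeal)
    (hY : ∀ P : PrimeSpectrum A, P ∈ Y ↔ RingHom.ker f ≤ P.asIdeal)
    (hD : ∀ P P' : PrimeSpectrum A, P ≤ P' → P ∈ D → P' ∈ D)
    (hgen : ∀ P : PrimeSpectrum (Localization.AtPrime (v.comap f)),
      PrimeSpectrum.comap (algebraMap A _) P ∈ Y → PrimeSpectrum.comap (algebraMap A _) P ∈ D →
      ∃ P' ≤ P, PrimeSpectrum.comap (algebraMap A _) P' ∈ D ∧
        PrimeSpectrum.comap (algebraMap A _) P' ∉ Y)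
    (hDE : ∀ Q : PrimeSpectrum E, Q.asIdeal ≤ v → (PrimeSpectrum.comap f Q ∈ D ↔
      ∏ j : Fin N with a ≤ j.val ∧ j.val < a + b, h (coord k E' j) ∈ Q.asIdeal)) :
    ∃ S₁ ⊆ S, (∀ P : PrimeSpectrum (Localization.AtPrime (v.comap f)),
        PrimeSpectrum.comap (algebraMap A _) P ∈ Y ↔ ∃ i ∈ S₁, algebraMap A _ (t i) ∈ P.asIdeal) ∧
      (RingHom.ker f).map (algebraMap A (Localization.AtPrime (v.comap f))) =
        Ideal.span {∏ i ∈ S₁, algebraMap A _ (t i)} ∧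
      ∃ (φ : Fin N → Fin n) (u : Fin N → (Localization.AtPrime v)ˣ),
        (∀ j, j.val < a + b → h (coord k E' j) ∈ v →
          algebraMap E (Localization.AtPrime v) (h (coord k E' j)) =
            u j * algebraMap E _ (f (t (φ j)))) ∧
        Set.InjOn φ {j | j.val < a + b ∧ h (coord k E' j) ∈ v} ∧
        (Finset.univ.filter fun j : Fin N ↦ j.val < a + b ∧ h (coord k E' j) ∈ v).image φ = S ∧
        (Finset.univ.filter fun j : Fin N ↦ j.val < a ∧ h (coord k E' j) ∈ v).image φ = S₁ := by
  have hsys := isNCSystem_of_etale (k := k) (n := N) (v.comap h)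
  let p (j : Fin N) : Prop := coord k E' j ∈ v.comap h
  let fv := Localization.localRingHom (v.comap f) v f rfl
  let hv := Localization.localRingHom (v.comap h) v h rfl
  have hfv : Function.Surjective fv := RingHom.surjective_localRingHom_of_surjective f hf v
  have hhv : Function.Surjective hv := RingHom.surjective_localRingHom_of_surjective h hh v
  let tL (i : Fin n) := algebraMap A (Localization.AtPrime (v.comap f)) (t i)
  let TL (j : {j // p j}) := algebraMap E' (Localization.AtPrime (v.comap h)) (coord k E' j.1)
  let J : Finset {j // p j} := (Finset.univ.filter fun j : Fin N ↦ j.val < a).subtype p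
  let C : Finset {j // p j} :=
    (Finset.univ.filter fun j : Fin N ↦ a ≤ j.val ∧ j.val < a + b).subtype p
  -- on the side of the model, the branches are the coordinates that vanish at `v`
  have hkerh : RingHom.ker hv = Ideal.span {∏ j ∈ J, TL j} := by
    rw [ker_localRingHom hh _ v rfl, hker, Ideal.map_span, Set.image_singleton, map_prod]
    exact span_prod_eq_of_isUnit _ p fun j _ hj ↦
      IsLocalization.map_units _ (⟨_, hj⟩ : (v.comap h).primeCompl)
  -- the model is reduced
  have hred : IsReduced (Localization.AtPrime v) := by
    refine ⟨fun x ⟨m, hm⟩ ↦ ?_⟩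
    obtain ⟨x, rfl⟩ := hhv x
    rw [← map_pow, ← RingHom.mem_ker, hkerh] at hm
    rw [← RingHom.mem_ker, hkerh]
    exact hsys.isRadical J ⟨m, hm⟩
  -- on the side of `A`, the parameters in `S₁` cut out `Y`, and the others in `S` cut out `D`
  obtain ⟨S₁, hS₁S, hS₁⟩ := ht.exists_subset
    (Y := PrimeSpectrum.comap (algebraMap A (Localization.AtPrime (v.comap f))) ⁻¹' Y)
    (D := PrimeSpectrum.comap (algebraMap A (Localization.AtPrime (v.comap f))) ⁻¹' D)
    (S := S) (ϖ := algebraMap A _ ϖ) (fun P ↦ by rw [← map_prod]; exact hS P)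
    (fun P ↦ hϖ _)
  -- both ideals are radical and have the same zero locus
  have hkerf : RingHom.ker fv = Ideal.span {∏ i ∈ S₁, tL i} := by
    refine isRadical_eq_of_le_iff ?_ (ht.isRadical S₁) fun P ↦ ?_
    · rintro x ⟨m, hm⟩
      rw [RingHom.mem_ker, map_pow] at hm
      exact eq_zero_of_pow_eq_zero hm
    · rw [ker_localRingHom hf _ v rfl, Ideal.map_le_iff_le_comap, Ideal.span_singleton_le_iff_mem,
        P.2.prod_mem_iff, ← hS₁]
      exact (hY (PrimeSpectrum.comap (algebraMap A _) P)).symm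
  have hfv' (x : A) : fv (algebraMap A _ x) = algebraMap E _ (f x) :=
    Localization.localRingHom_to_map ..
  have hhv' (x : E') : hv (algebraMap E' _ x) = algebraMap E _ (h x) :=
    Localization.localRingHom_to_map ..
  have hunit {x : E} (hx : x ∉ v) : IsUnit (algebraMap E (Localization.AtPrime v) x) :=
    IsLocalization.map_units _ (⟨x, hx⟩ : v.primeCompl)
  obtain ⟨φ, u, hφ₁, hφ₂, hu, hinj, hφS, hφC⟩ := (ht.isNCFamily S₁ hfv hkerf).exists_matching
    (hsys.isNCFamily J hhv hkerh) (D := S \ S₁) (C := C) Finset.disjoint_sdiff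
    (Finset.disjoint_left.2 fun j hj hj' ↦ by
      simp only [J, C, Finset.mem_subtype, Finset.mem_filter] at hj hj'
      omega) fun Q hQ ↦ by
    let P : PrimeSpectrum (Localization.AtPrime (v.comap f)) := PrimeSpectrum.comap fv ⟨Q, hQ⟩
    let R : PrimeSpectrum E := PrimeSpectrum.comap (algebraMap E _) ⟨Q, hQ⟩
    have hPR : PrimeSpectrum.comap (algebraMap A _) P = PrimeSpectrum.comap f R := by
      ext x
      change fv (algebraMap A _ x) ∈ Q ↔ algebraMap E _ (f x) ∈ Q
      rw [hfv']
    have hPY : PrimeSpectrum.comap (algebraMap A _) P ∈ Y := by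
      rw [hPR, hY]
      intro x hx
      change algebraMap E _ (f x) ∈ Q
      rw [RingHom.mem_ker.1 hx, map_zero]
      exact zero_mem _
    have hRv : R.asIdeal ≤ v := by
      intro x hx
      by_contra hxv
      exact hQ.ne_top (Ideal.eq_top_of_isUnit_mem _ hx (hunit hxv))
    have h1 := ht.mem_divisor_iff
      (Y := PrimeSpectrum.comap (algebraMap A (Localization.AtPrime (v.comap f))) ⁻¹' Y)
      (D := PrimeSpectrum.comap (algebraMap A (Localization.AtPrime (v.comap f))) ⁻¹' D)
      (S := S) (fun P ↦ by rw [← map_prod]; exact hS P) hS₁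
      (fun P P' hP ↦ hD _ _ (Ideal.comap_mono hP)) hgen P hPY
    have h2 := hDE R hRv
    have h3 : ∏ j : Fin N with a ≤ j.val ∧ j.val < a + b, h (coord k E' j) ∈ R.asIdeal ↔
        ∏ j ∈ C, algebraMap E (Localization.AtPrime v) (h (coord k E' j.1)) ∈ Q := by
      rw [← Ideal.span_singleton_le_iff_mem, ← Ideal.span_singleton_le_iff_mem (I := Q),
        ← span_prod_eq_of_isUnit _ p (y := fun j ↦ algebraMap E (Localization.AtPrime v)
          (h (coord k E' j))) fun j _ hj ↦ hunit hj, Ideal.span_singleton_le_iff_mem,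
        Ideal.span_singleton_le_iff_mem, ← map_prod (algebraMap E (Localization.AtPrime v))]
      rfl
    rw [Set.mem_preimage, hPR, h2, h3] at h1
    simp only [hhv']
    rw [h1, ← map_prod]
    rfl
  have hne : Nonempty (Fin n) := by
    obtain ⟨i, -, -⟩ := (ht.isNCFamily S₁ hfv hkerf).exists_mem (IsLocalRing.maximalIdeal _)
    exact ⟨i⟩
  -- extend `φ` and `u` by arbitrary values to the coordinates that do not vanish at `v`
  have hφ' (j : {j // p j}) : Function.extend Subtype.val φ (fun _ ↦ hne.some) j.1 = φ j :=
    Subtype.val_injective.extend_apply _ _ _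
  have hu' (j : {j // p j}) : Function.extend Subtype.val u (fun _ ↦ 1) j.1 = u j :=
    Subtype.val_injective.extend_apply _ _ _
  have hmem (j : {j // p j}) : j ∈ J ∪ C ↔ j.1.val < a + b := by
    simp only [J, C, Finset.mem_union, Finset.mem_subtype, Finset.mem_filter, Finset.mem_univ,
      true_and]
    omega
  have hmemJ (j : {j // p j}) : j ∈ J ↔ j.1.val < a := by
    simp only [J, Finset.mem_subtype, Finset.mem_filter, Finset.mem_univ, true_and]
  refine ⟨S₁, hS₁S, hS₁, ?_, Function.extend Subtype.val φ fun _ ↦ hne.some,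
    Function.extend Subtype.val u fun _ ↦ 1, fun j hj hj' ↦ ?_, ?_, ?_, ?_⟩
  · rw [← ker_localRingHom hf _ v rfl]
    exact hkerf
  · have h1 := hu ⟨j, hj'⟩ ((hmem _).2 hj)
    rw [← hφ' ⟨j, hj'⟩, ← hu' ⟨j, hj'⟩] at h1
    rw [← hhv', h1, ← hfv']
  · rintro j ⟨hj, hj'⟩ i ⟨hi, hi'⟩ hij
    change Function.extend Subtype.val φ (fun _ ↦ hne.some) (⟨j, hj'⟩ : {j // p j}).1 =
      Function.extend Subtype.val φ (fun _ ↦ hne.some) (⟨i, hi'⟩ : {j // p j}).1 at hij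
    rw [hφ', hφ'] at hij
    exact congrArg Subtype.val (hinj (Finset.mem_coe.2 ((hmem _).2 hj))
      (Finset.mem_coe.2 ((hmem _).2 hi)) hij)
  · ext i
    simp only [Finset.mem_image, Finset.mem_filter, Finset.mem_univ, true_and]
    constructor
    · rintro ⟨j, ⟨hj, hj'⟩, rfl⟩
      rw [hφ' ⟨j, hj'⟩]
      rcases Finset.mem_union.1 ((hmem ⟨j, hj'⟩).2 hj) with h1 | h1
      · exact hS₁S (hφ₁ _ h1)
      · exact (Finset.mem_sdiff.1 (hφ₂ _ h1)).1
    · intro hi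
      by_cases hi' : i ∈ S₁
      · obtain ⟨j, hj, rfl⟩ := hφS i hi'
        exact ⟨j.1, ⟨(hmem j).1 (Finset.mem_union_left _ hj), j.2⟩, hφ' j⟩
      · obtain ⟨j, hj, rfl⟩ := hφC i (Finset.mem_sdiff.2 ⟨hi, hi'⟩)
        exact ⟨j.1, ⟨(hmem j).1 (Finset.mem_union_right _ hj), j.2⟩, hφ' j⟩
  · ext i
    simp only [Finset.mem_image, Finset.mem_filter, Finset.mem_univ, true_and]
    constructor
    · rintro ⟨j, ⟨hj, hj'⟩, rfl⟩
      rw [hφ' ⟨j, hj'⟩]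
      exact hφ₁ _ ((hmemJ _).2 hj)
    · intro hi
      obtain ⟨j, hj, rfl⟩ := hφS i hi
      exact ⟨j.1, ⟨(hmemJ j).1 hj, j.2⟩, hφ' j⟩

/-- The elements divisible by some element outside the prime `w` form the neighbourhoods of `w`. -/
def divisibleFilter (w : Ideal A) [hw : w.IsPrime] : Filter A where
  sets := {s | ∃ g ∉ w, ∀ g', g ∣ g' → g' ∈ s}
  univ_sets := ⟨1, w.one_notMem, fun _ _ ↦ trivial⟩
  sets_of_superset := fun ⟨g, hg, h⟩ hst ↦ ⟨g, hg, fun g' hg' ↦ hst (h g' hg')⟩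
  inter_sets := fun ⟨g, hg, h⟩ ⟨g', hg', h'⟩ ↦ ⟨g * g', hw.mul_notMem hg hg', fun x hx ↦
    ⟨h x (dvd_of_mul_right_dvd hx), h' x (dvd_of_mul_left_dvd hx)⟩⟩

theorem exists_notMem_of_eventually {w : Ideal A} [w.IsPrime] {Q : A → Prop}
    (h : ∀ᶠ g in divisibleFilter w, Q g) : ∃ g ∉ w, Q g := by
  obtain ⟨g, hg, h⟩ := h
  exact ⟨g, hg, h g dvd_rfl⟩

theorem eventually_dvd {w : Ideal A} [w.IsPrime] {x : A} (hx : x ∉ w) :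
    ∀ᶠ g in divisibleFilter w, x ∣ g :=
  ⟨x, hx, fun _ h ↦ h⟩

theorem eventually_saturates [IsNoetherianRing A] (w : Ideal A) [w.IsPrime] (I : Ideal A) :
    ∀ᶠ g in divisibleFilter w, Saturates w g I := by
  obtain ⟨g, hg, h⟩ := exists_saturates w I
  exact ⟨g, hg, fun _ ↦ h.of_dvd⟩

/-- Localization of a quotient ring. -/
theorem exists_away_quotient {B : Type*} [CommRing B] [Algebra A B] {f : A →+* E}
    (hf : Function.Surjective f) (g : A) [IsLocalization.Away g B] {I : Ideal B}
    (hI : I = (RingHom.ker f).map (algebraMap A B)) :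
    ∃ ψ : E →+* B ⧸ I, (∀ x, ψ (f x) = Ideal.Quotient.mk I (algebraMap A B x)) ∧
      letI := ψ.toAlgebra; IsLocalization.Away (f g) (B ⧸ I) := by
  let ψ : E →+* B ⧸ I := RingHom.liftOfSurjective f hf
    ⟨(Ideal.Quotient.mk I).comp (algebraMap A B), fun x hx ↦ by
      rw [RingHom.mem_ker, RingHom.comp_apply, Ideal.Quotient.eq_zero_iff_mem, hI]
      exact Ideal.mem_map_of_mem _ hx⟩
  have hψ (x) : ψ (f x) = Ideal.Quotient.mk I (algebraMap A B x) :=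
    RingHom.liftOfRightInverse_comp_apply ..
  have hgu : IsUnit (algebraMap A B g) := IsLocalization.Away.algebraMap_isUnit g
  refine ⟨ψ, hψ, ?_⟩
  let := ψ.toAlgebra
  have hψ' (x) : algebraMap E (B ⧸ I) x = ψ x := rfl
  refine (isLocalization_iff (Submonoid.powers (f g)) _).2 ⟨?_, ?_, fun {x y} h ↦ ?_⟩
  · rintro ⟨_, m, rfl⟩
    rw [hψ']
    change IsUnit (ψ (f g ^ m))
    rw [← map_pow, hψ]
    exact ((map_pow (algebraMap A B) g m ▸ hgu.pow m).map _)
  · intro z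
    obtain ⟨z, rfl⟩ := Ideal.Quotient.mk_surjective z
    obtain ⟨m, x, hx⟩ := IsLocalization.Away.surj g z
    refine ⟨⟨f x, ⟨_, m, rfl⟩⟩, ?_⟩
    dsimp only
    rw [hψ', hψ', hψ, ← hx]
    change _ * ψ (f g ^ m) = _
    rw [← map_pow, hψ, map_mul, map_pow, map_pow]
  · obtain ⟨x, rfl⟩ := hf x
    obtain ⟨y, rfl⟩ := hf y
    rw [hψ', hψ', hψ, hψ, Ideal.Quotient.eq, ← map_sub, hI,
      IsLocalization.algebraMap_mem_map_algebraMap_iff (Submonoid.powers g)] at h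
    obtain ⟨_, ⟨m, rfl⟩, h⟩ := h
    refine ⟨⟨_, m, rfl⟩, ?_⟩
    rw [RingHom.mem_ker, map_mul, map_sub, mul_sub, sub_eq_zero, map_pow] at h
    exact h

theorem IsPBasis.ne_zero {p : ℕ} [Fact p.Prime] {R σ : Type*} [CommRing R] [Nontrivial R]
    [Fact ((p : R) = 0)] {x : σ → R} (h : IsPBasis p x) (s : σ) : x s ≠ 0 := by
  classical
  intro hs
  have h1 : pExpand p x (Finsupp.single (Finsupp.single s 1) 1) = pExpand p x 0 := by
    rw [pExpand_single, mon, Finsupp.prod_single_index (by simp), hs, ZMod.val_one, map_zero]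
    simp
  have h2 := h.1 h1
  rw [Finsupp.single_eq_zero] at h2
  exact one_ne_zero h2

theorem MonomialCoordinates.of_isUnit {p : ℕ} [Fact p.Prime] {R σ : Type*} [CommRing R]
    [Fact ((p : R) = 0)] {x : σ → R} {J J' : Finset σ} (h : MonomialCoordinates p x J')
    (hJ : J ⊆ J') (hu : ∀ s ∈ J', s ∉ J → IsUnit (x s)) : MonomialCoordinates p x J := by
  classical
  refine ⟨h.surjective, fun L hL ↦ h.mem_of_mem L (hL.trans hJ), ?_⟩
  have h1 := h.prod_eq_zero
  rw [← Finset.prod_sdiff hJ] at h1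
  refine (IsUnit.mul_right_eq_zero ?_).1 h1
  refine Finset.prod_induction _ IsUnit (fun _ _ ↦ IsUnit.mul) isUnit_one fun s hs ↦ ?_
  exact hu s (Finset.mem_sdiff.1 hs).1 (Finset.mem_sdiff.1 hs).2

end LocalModels

/-! ### Charts near a point of the closed fibre -/

section Charts

variable {A E E' k : Type u} [CommRing A] [CommRing E] [CommRing E'] [Field k] {N a b n : ℕ}
  [Algebra (MvPolynomial (Fin N) k) E']

open Classical in
/-- Étale coordinates at a point of a normal crossing variety, adapted to the point `v`: those
`T_j` that do not belong to the boundary are replaced by `T_j - 1` if they vanish at `v`. -/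
theorem exists_monomialCoordinates {p : ℕ} [Fact p.Prime] (hp : (p : k) = 0)
    [Fact ((p : E) = 0)] [Algebra.Etale (MvPolynomial (Fin N) k) E']
    {h : E' →+* E} (hh : Function.Surjective h)
    (hker : RingHom.ker h = Ideal.span {∏ j : Fin N with j.val < a, coord k E' j})
    (v : Ideal E) [v.IsPrime] :
    ∃ (τ : Type u) (x : Fin N ⊕ τ → E),
      MonomialCoordinates p x ((Finset.univ.filter fun j : Fin N ↦ j.val < a).map .inl) ∧
      (∀ s, IsUnit (x (.inr s))) ∧
      (∀ j, (j.val < a + b ∨ h (coord k E' j) ∉ v) → x (.inl j) = h (coord k E' j)) ∧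
      ∀ j, ¬ (j.val < a + b ∧ h (coord k E' j) ∈ v) → x (.inl j) ∉ v := by
  have : Fact ((p : k) = 0) := ⟨hp⟩
  have : Fact ((p : MvPolynomial (Fin N) k) = 0) := ⟨by
    rw [← map_natCast (MvPolynomial.C : k →+* _), hp, map_zero]⟩
  have : Fact ((p : E') = 0) := ⟨by
    rw [← map_natCast (algebraMap (MvPolynomial (Fin N) k) E'),
      (Fact.out : (p : MvPolynomial (Fin N) k) = 0), map_zero]⟩
  obtain ⟨B, hB⟩ := exists_isPBasis p k
  -- subtract `1` from the coordinates off the boundary that vanish at `v`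
  let ε (j : Fin N) : k := if ¬ j.val < a + b ∧ h (coord k E' j) ∈ v then 1 else 0
  have hx := (hB.withVars_sub ε).of_etale E'
  let x (s : Fin N ⊕ B) : E' := algebraMap (MvPolynomial (Fin N) k) E'
    (Sum.elim (fun j ↦ MvPolynomial.X j - MvPolynomial.C (ε j)) (fun s ↦ MvPolynomial.C s.1) s)
  have hxj (j : Fin N) (hj : ¬ (¬ j.val < a + b ∧ h (coord k E' j) ∈ v)) :
      x (.inl j) = coord k E' j := by
    simp only [x, Sum.elim_inl, ε, if_neg hj, map_zero, sub_zero]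
  refine ⟨B, fun s ↦ h (x s), ?_, fun s ↦ ?_, fun j hj ↦ ?_, fun j hj ↦ ?_⟩
  · refine MonomialCoordinates.of_isPBasis hx hh ?_
    rw [hker, Finset.prod_map]
    congr 2
    refine Finset.prod_congr rfl fun j hj ↦ (hxj j ?_).symm
    have := (Finset.mem_filter.1 hj).2
    exact fun h ↦ h.1 (by omega)
  · have := (hB.ne_zero s).isUnit
    exact ((this.map MvPolynomial.C).map (algebraMap (MvPolynomial (Fin N) k) E')).map h
  · dsimp only
    rw [hxj j (by tauto)]
  · by_cases hv : h (coord k E' j) ∈ v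
    · have hj' : ¬ j.val < a + b ∧ h (coord k E' j) ∈ v := ⟨fun h1 ↦ hj ⟨h1, hv⟩, hv⟩
      have : h (x (.inl j)) = h (coord k E' j) - 1 := by
        simp only [x, Sum.elim_inl, ε, if_pos hj', map_one, map_sub]
      intro h1
      dsimp only at h1
      rw [this] at h1
      refine v.one_notMem ?_
      have := v.sub_mem hv h1
      rwa [sub_sub_cancel] at this
    · dsimp only
      rwa [hxj j fun h1 ↦ hv h1.2]

open Classical in
/-- In the situation of `exists_local_matching` there is a chart on a neighbourhood `D(g)` of the
point. The sets `C_l` stand for the irreducible components of `Y`. -/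
theorem exists_hasChart_away [IsNoetherianRing A] {p : ℕ} [Fact p.Prime] (hp : (p : k) = 0)
    [Algebra.Etale (MvPolynomial (Fin N) k) E']
    {f : A →+* E} (hf : Function.Surjective f) {h : E' →+* E} (hh : Function.Surjective h)
    (hker : RingHom.ker h = Ideal.span {∏ j : Fin N with j.val < a, coord k E' j})
    (v : Ideal E) [v.IsPrime] {t : Fin n → A}
    (ht : IsNCSystem fun i ↦ algebraMap A (Localization.AtPrime (v.comap f)) (t i))
    {S : Finset (Fin n)} {Y D : Set (PrimeSpectrum A)} {ϖ : A}
    (hS : ∀ P : PrimeSpectrum (Localization.AtPrime (v.comap f)),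
      PrimeSpectrum.comap (algebraMap A _) P ∈ Y ∪ D ↔ algebraMap A _ (∏ i ∈ S, t i) ∈ P.asIdeal)
    (hϖ : ∀ P : PrimeSpectrum A, P ∈ Y ↔ ϖ ∈ P.asIdeal)
    (hY : ∀ P : PrimeSpectrum A, P ∈ Y ↔ RingHom.ker f ≤ P.asIdeal)
    (hD : ∀ P P' : PrimeSpectrum A, P ≤ P' → P ∈ D → P' ∈ D)
    (hgen : ∀ P : PrimeSpectrum (Localization.AtPrime (v.comap f)),
      PrimeSpectrum.comap (algebraMap A _) P ∈ Y → PrimeSpectrum.comap (algebraMap A _) P ∈ D →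
      ∃ P' ≤ P, PrimeSpectrum.comap (algebraMap A _) P' ∈ D ∧
        PrimeSpectrum.comap (algebraMap A _) P' ∉ Y)
    (hDE : ∀ Q : PrimeSpectrum E, Q.asIdeal ≤ v → (PrimeSpectrum.comap f Q ∈ D ↔
      ∏ j : Fin N with a ≤ j.val ∧ j.val < a + b, h (coord k E' j) ∈ Q.asIdeal))
    {Λ : Type v} [Finite Λ] {C M : Λ → Set (PrimeSpectrum A)} (hCc : ∀ l, IsClosed (C l))
    (hC : IsComponentFamily
      (PrimeSpectrum.comap (algebraMap A (Localization.AtPrime (v.comap f))) ⁻¹' Y)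
      (fun l ↦ PrimeSpectrum.comap (algebraMap A _) ⁻¹' C l)
      (fun l ↦ PrimeSpectrum.comap (algebraMap A _) ⁻¹' M l)) :
    ∃ g ∉ v.comap f, ∀ (P : LogDatum.{u} Λ) [Algebra A P.A] [IsLocalization.Away g P.A],
      P.I = PrimeSpectrum.vanishingIdeal (PrimeSpectrum.comap (algebraMap A P.A) ⁻¹' Y) →
      (∀ l, P.comp l =
        PrimeSpectrum.vanishingIdeal (PrimeSpectrum.comap (algebraMap A P.A) ⁻¹' C l)) →
      (letI := P.ι.toAlgebra; IsLocalization.Away (algebraMap A P.A (∏ i ∈ S, t i)) P.B) →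
      HasChart P p := by
  let w := v.comap f
  let L := Localization.AtPrime w
  obtain ⟨S₁, hS₁S, hS₁, hkerL, φ, u, hu, hinj, hφS, hφS₁⟩ :=
    exists_local_matching hf hh hker v ht hS hϖ hY hD hgen hDE
  obtain ⟨s, hs₁, hs, hsC⟩ := ht.exists_components hC hS₁
  have hpE : Fact ((p : E) = 0) := ⟨by
    rw [← map_natCast (h.comp ((algebraMap (MvPolynomial (Fin N) k) E').comp MvPolynomial.C)), hp,
      map_zero]⟩
  obtain ⟨τ, x, hx, hxτ, hxN, hxv⟩ := exists_monomialCoordinates (b := b) hp hh hker v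
  -- the relations between the two systems of coordinates, without denominators
  have hrel (j : Fin N) : ∃ α ∉ w, ∃ β ∉ w, j.val < a + b → h (coord k E' j) ∈ v →
      f β * h (coord k E' j) = f α * f (t (φ j)) := by
    by_cases hj : j.val < a + b ∧ h (coord k E' j) ∈ v
    swap
    · exact ⟨1, w.one_notMem, 1, w.one_notMem, fun h1 h2 ↦ absurd ⟨h1, h2⟩ hj⟩
    obtain ⟨α, β, hαβ⟩ := IsLocalization.exists_mk'_eq v.primeCompl (u j : Localization.AtPrime v)
    have h1 := IsLocalization.mk'_spec (Localization.AtPrime v) α β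
    have hα : α ∉ v := by
      intro hα
      refine (IsLocalization.AtPrime.isUnit_mk'_iff (Localization.AtPrime v) v α β).1
        (hαβ ▸ (u j).isUnit) hα
    rw [hαβ] at h1
    have h2 : algebraMap E (Localization.AtPrime v) (β * h (coord k E' j)) =
        algebraMap E _ (α * f (t (φ j))) := by
      rw [map_mul, hu j hj.1 hj.2, map_mul, ← h1]
      ring
    obtain ⟨c, hc⟩ := (IsLocalization.eq_iff_exists v.primeCompl _).1 h2
    obtain ⟨α', hα'⟩ := hf (c * α)
    obtain ⟨β', hβ'⟩ := hf (c * β)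
    have hv : v.IsPrime := inferInstance
    refine ⟨α', ?_, β', ?_, fun _ _ ↦ ?_⟩
    · rw [Ideal.mem_comap, hα']
      exact hv.mul_notMem c.2 hα
    · rw [Ideal.mem_comap, hβ']
      exact hv.mul_notMem c.2 β.2
    · rw [hα', hβ', mul_assoc, hc, mul_assoc]
  choose α hα β hβ hαβ using hrel
  -- lifts of the coordinates that do not belong to the boundary at the point
  have hunit (j : Fin N) : ∃ y ∉ w, ¬ (j.val < a + b ∧ h (coord k E' j) ∈ v) →
      f y = x (.inl j) := by
    by_cases hj : j.val < a + b ∧ h (coord k E' j) ∈ v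
    · exact ⟨1, w.one_notMem, fun h1 ↦ absurd hj h1⟩
    · obtain ⟨y, hy⟩ := hf (x (.inl j))
      exact ⟨y, fun h1 ↦ hxv j hj (hy ▸ h1), fun _ ↦ hy⟩
  choose y hy hyx using hunit
  -- on `D(g)` the relevant ideals are determined by the local ring and the denominators are units
  obtain ⟨g, hgw, hg₁, hg₂, hg₃, hg₄, hg₅, hg₆, hg₇, hg₈, hg₉⟩ := exists_notMem_of_eventually
    ((eventually_saturates w (⊥ : Ideal A)).and <|
    (eventually_saturates w (RingHom.ker f)).and <|
    (eventually_saturates w (PrimeSpectrum.vanishingIdeal Y)).and <|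
    (Filter.eventually_all.2 fun i ↦ eventually_saturates w (Ideal.span {t i})).and <|
    (Filter.eventually_all.2 fun l ↦ eventually_saturates w
      (PrimeSpectrum.vanishingIdeal (C l))).and <|
    (Filter.eventually_all.2 fun l ↦ eventually_saturates w (Ideal.span {∏ i ∈ s l, t i})).and <|
    (Filter.eventually_all.2 fun j ↦ eventually_dvd (hα j)).and <|
    (Filter.eventually_all.2 fun j ↦ eventually_dvd (hβ j)).and
    (Filter.eventually_all.2 fun j ↦ eventually_dvd (hy j)))
  refine ⟨g, hgw, fun P _ _ hPI hPC hPB ↦ ?_⟩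
  let ρ : P.A →+* L := awayToLocal P.A hgw
  have hρ (x : A) : ρ (algebraMap A P.A x) = algebraMap A L x := awayToLocal_algebraMap P.A hgw x
  have hgu {x : A} (hx : x ∣ g) : IsUnit (algebraMap A P.A x) :=
    isUnit_of_dvd_unit (map_dvd _ hx) (IsLocalization.Away.algebraMap_isUnit g)
  -- `P.A` embeds into the local ring of the point
  have hρinj : Function.Injective ρ := by
    rw [RingHom.injective_iff_ker_eq_bot, RingHom.ker_eq_comap_bot, ← Ideal.map_bot (f :=
        algebraMap A L),
      ← hg₁.map_eq_comap hgw, Ideal.map_bot]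
  have := ht.isDomain
  have : IsDomain P.A := hρinj.isDomain ρ
  -- the parameters remain nonassociated primes in `P.A`
  have hprime (i : Fin n) : Prime (algebraMap A P.A (t i)) := by
    rw [← Ideal.span_singleton_prime, ← Set.image_singleton, ← Ideal.map_span,
      (hg₄ i).map_eq_comap hgw, Ideal.map_span, Set.image_singleton]
    · have := ht.span_isPrime i
      exact Ideal.comap_isPrime _ _
    · intro h1
      refine ht.ne_zero i ?_
      rw [← hρ, h1, map_zero]
  have hdvd (i i' : Fin n) (h1 : algebraMap A P.A (t i) ∣ algebraMap A P.A (t i')) : i' = i := by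
    refine ht.eq_of_mem (Ideal.mem_span_singleton.2 ?_)
    have := map_dvd ρ h1
    rwa [hρ, hρ] at this
  have hYc : IsClosed Y := by
    have : Y = PrimeSpectrum.zeroLocus {ϖ} := by
      ext P
      rw [hϖ, PrimeSpectrum.mem_zeroLocus, Set.singleton_subset_iff]
      rfl
    rw [this]
    exact PrimeSpectrum.isClosed_zeroLocus _
  -- the ideals of `Y` and of its components in `P.A`
  have hPI' : P.I = (RingHom.ker f).map (algebraMap A P.A) := by
    rw [hPI, map_vanishingIdeal_away P.A g]
    refine hg₃.map_eq_map P.A hg₂ hgw ?_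
    rw [hkerL]
    refine map_vanishingIdeal_eq Y hYc (ht.isRadical S₁) fun Q ↦ ?_
    rw [hS₁, Ideal.span_singleton_le_iff_mem, Q.2.prod_mem_iff]
  have hPC' (l : Λ) : P.comp l = Ideal.span {∏ i ∈ s l, algebraMap A P.A (t i)} := by
    rw [hPC, map_vanishingIdeal_away P.A g, ← map_prod, ← Set.image_singleton, ← Ideal.map_span]
    refine (hg₅ l).map_eq_map P.A (hg₆ l) hgw ?_
    rw [Ideal.map_span, Set.image_singleton, map_prod]
    refine map_vanishingIdeal_eq (C l) (hCc l) (ht.isRadical (s l)) fun Q ↦ ?_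
    rw [Ideal.span_singleton_le_iff_mem, ← hsC]
    rfl
  obtain ⟨ψ, hψ, hψg⟩ := exists_away_quotient hf g hPI'
  let := ψ.toAlgebra
  have : Fact ((p : P.A ⧸ P.I) = 0) := ⟨by rw [← map_natCast ψ, hpE.out, map_zero]⟩
  -- `K` and `J` are the coordinates of the boundary and of `Y` that vanish at the point
  let K : Finset (Fin N) := Finset.univ.filter fun j ↦ j.val < a + b ∧ h (coord k E' j) ∈ v
  let J : Finset (Fin N) := Finset.univ.filter fun j ↦ j.val < a ∧ h (coord k E' j) ∈ v
  have hJK : J ⊆ K := fun j hj ↦ by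
    simp only [J, K, Finset.mem_filter] at hj ⊢
    exact ⟨hj.1, by omega, hj.2.2⟩
  have hKm {j : Fin N} : j ∈ K ↔ j.val < a + b ∧ h (coord k E' j) ∈ v := by simp [K]
  have hJm {j : Fin N} : j ∈ J ↔ j.val < a ∧ h (coord k E' j) ∈ v := by simp [J]
  have hψu (j : Fin N) (hj : j ∉ K) : IsUnit (ψ (x (.inl j))) := by
    rw [← hyx j (fun h1 ↦ hj (hKm.2 h1)), hψ]
    exact (hgu (hg₉ j)).map _
  -- the lifts `T` of the coordinates at the boundary are the parameters times units
  let z (j : Fin N) : P.Aˣ := (hgu (hg₇ j)).unit * (hgu (hg₈ j)).unit⁻¹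
  let T : Fin N ⊕ τ → P.A := Sum.elim (fun j ↦ z j * algebraMap A P.A (t (φ j))) fun _ ↦ 1
  have hassoc (K' : Finset (Fin N)) (hK' : K' ⊆ K) :
      Associated (∏ i ∈ K'.image φ, algebraMap A P.A (t i)) (∏ s ∈ K'.map .inl, T s) := by
    rw [Finset.prod_map, Finset.prod_image fun j hj j' hj' h1 ↦ hinj (hKm.1 (hK' hj))
      (hKm.1 (hK' hj')) h1]
    refine ⟨∏ j ∈ K', z j, ?_⟩
    rw [mul_comm, Units.coe_prod, ← Finset.prod_mul_distrib]
    rfl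
  -- coordinates of `Y` that do not vanish at the point are units and can be removed from `J`
  have hMC : MonomialCoordinates p (fun s ↦ ψ (x s)) (J.map .inl) := by
    refine (hx.localization (Submonoid.powers (f g)) (F := P.A ⧸ P.I)).of_isUnit ?_ ?_
    · refine Finset.map_subset_map.2 fun j hj ↦ ?_
      exact Finset.mem_filter.2 ⟨Finset.mem_univ _, (hJm.1 hj).1⟩
    · intro s hs hs'
      obtain ⟨j, hj, rfl⟩ := Finset.mem_map.1 hs
      refine hψu j fun hjK ↦ hs' (Finset.mem_map_of_mem _ (hJm.2 ⟨?_, (hKm.1 hjK).2⟩))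
      exact (Finset.mem_filter.1 hj).2
  refine HasChart.of_monomialCoordinates P (t := T) (N := K.map .inl) hMC
    (Finset.map_subset_map.2 hJK) ?_ ?_ ?_ ?_ ?_
    (fun l ↦ (J.filter fun j ↦ φ j ∈ s l).map .inl) ?_ ?_ ?_
  · intro q hq
    obtain ⟨j, hj, rfl⟩ := Finset.mem_map.1 hq
    exact (associated_unit_mul_right _ _ (z j).isUnit).prime (hprime (φ j))
  · intro q hq q' hq' hne h1
    obtain ⟨j, hj, rfl⟩ := Finset.mem_map.1 hq
    obtain ⟨j', hj', rfl⟩ := Finset.mem_map.1 hq'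
    refine hne (congrArg _ (hinj (hKm.1 hj) (hKm.1 hj') (hdvd _ _ ?_).symm))
    change (z j : P.A) * _ ∣ (z j' : P.A) * _ at h1
    rwa [Units.mul_left_dvd, Units.dvd_mul_left] at h1
  · intro q hq
    obtain ⟨j, hj, rfl⟩ := Finset.mem_map.1 hq
    have hj' := hKm.1 hj
    have h1 := congrArg ψ (hαβ j hj'.1 hj'.2)
    rw [map_mul, map_mul, hψ, hψ, hψ] at h1
    refine ((hgu (hg₈ j)).map (Ideal.Quotient.mk P.I)).mul_left_cancel ?_
    change _ = _ * ψ (x (.inl j))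
    rw [hxN j (.inl hj'.1), h1, ← map_mul, ← map_mul]
    congr 1
    change _ * ((z j : P.A) * _) = _
    have h2 : algebraMap A P.A (β j) * (z j : P.A) = algebraMap A P.A (α j) := by
      simp only [z, Units.val_mul]
      rw [mul_left_comm, IsUnit.mul_val_inv, mul_one]
      rfl
    rw [← mul_assoc, h2]
  · rintro (j | c) hs
    · exact hψu j fun hj ↦ hs (Finset.mem_map_of_mem _ hj)
    · exact (hxτ c).map ψ
  · let := P.ι.toAlgebra
    have : IsLocalization.Away (algebraMap A P.A (∏ i ∈ S, t i)) P.B := hPB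
    refine IsLocalization.Away.of_associated (r := algebraMap A P.A (∏ i ∈ S, t i)) ?_
    rw [map_prod, ← hφS]
    exact hassoc K subset_rfl
  · exact fun l ↦ Finset.map_subset_map.2 (Finset.filter_subset _ _)
  · intro l l' hl
    rw [Finset.disjoint_map, Finset.disjoint_left]
    intro j hj hj'
    exact Finset.disjoint_left.1 (hs l l' hl) (Finset.mem_filter.1 hj).2 (Finset.mem_filter.1 hj').2
  · intro l
    rw [hPC']
    refine Ideal.span_singleton_eq_span_singleton.2 ?_
    have h1 : (J.filter fun j ↦ φ j ∈ s l).image φ = s l := by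
      ext i
      simp only [Finset.mem_image, Finset.mem_filter]
      constructor
      · rintro ⟨j, ⟨-, hj⟩, rfl⟩
        exact hj
      · intro hi
        obtain ⟨j, hj, rfl⟩ := Finset.mem_image.1 (hφS₁.symm ▸ hs₁ l hi)
        exact ⟨j, ⟨hj, hi⟩, rfl⟩
    have := hassoc (J.filter fun j ↦ φ j ∈ s l) ((Finset.filter_subset _ _).trans hJK)
    rwa [h1] at this

end Charts

/-! ### Lifting étale algebras along surjections -/

section Lifting

/-- An algebra that is étale over two rings is, near a point, standard étale over both. -/
theorem exists_isStandardEtale_both {R R' E : Type*} [CommRing R] [CommRing R'] [CommRing E]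
    [Algebra R E] [Algebra R' E] [Algebra.Etale R E] [Algebra.Etale R' E] (v : Ideal E)
    [hv : v.IsPrime] : ∃ s ∉ v, Algebra.IsStandardEtale R (Localization.Away s) ∧
      Algebra.IsStandardEtale R' (Localization.Away s) := by
  obtain ⟨s, hs, h⟩ := Algebra.IsUnramifiedAt.exists_hasStandardEtaleSurjectionOn (R := R) v
  obtain ⟨s', hs', h'⟩ := Algebra.IsUnramifiedAt.exists_hasStandardEtaleSurjectionOn (R := R') v
  have : Algebra.Etale E (Localization.Away (s * s')) :=
    Algebra.Etale.of_isLocalizationAway (s * s')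
  have : Algebra.Etale R (Localization.Away (s * s')) := Algebra.Etale.comp R E _
  have : Algebra.Etale R' (Localization.Away (s * s')) := Algebra.Etale.comp R' E _
  exact ⟨s * s', hv.mul_notMem hs hs', (h.of_dvd (dvd_mul_right _ _)).isStandardEtale,
    (h'.of_dvd (dvd_mul_left _ _)).isStandardEtale⟩

/-- A standard étale algebra over a quotient of `A` is the quotient of an étale algebra over `A`. -/
theorem exists_etale_lift {A F G : Type u} [CommRing A] [CommRing F] [CommRing G] {q : A →+* F}
    (hq : Function.Surjective q) [Algebra F G] [Algebra.IsStandardEtale F G] :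
    ∃ (A' : Type u) (_ : CommRing A') (_ : Algebra A A') (φ : A' →+* G), Algebra.Etale A A' ∧
      Function.Surjective φ ∧ (∀ a, φ (algebraMap A A' a) = algebraMap F G (q a)) ∧
      RingHom.ker φ = (RingHom.ker q).map (algebraMap A A') := by
  let P : StandardEtalePresentation F G := Nonempty.some inferInstance
  let := q.toAlgebra
  let := ((algebraMap F G).comp q).toAlgebra
  have : IsScalarTower A F G := .of_algebraMap_eq fun _ ↦ rfl
  -- lift the monic polynomial `P.f`; the second polynomial is defined by the relation in `P.cond`,
  -- and
  -- it maps to a power of `P.g`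
  obtain ⟨f, hf⟩ := Polynomial.lifts_and_natDegree_eq_and_monic (f := q)
    (show P.f ∈ Polynomial.lifts q from (Polynomial.mem_lifts _).2 (Polynomial.map_surjective q hq
        _)) P.monic_f
  obtain ⟨p₁, p₂, n, hn⟩ := P.cond
  obtain ⟨p₁, rfl⟩ := Polynomial.map_surjective q hq p₁
  obtain ⟨p₂, rfl⟩ := Polynomial.map_surjective q hq p₂
  obtain ⟨g, hg⟩ := Polynomial.map_surjective q hq P.g
  let P' : StandardEtalePair A := ⟨f, hf.2.2, f.derivative * (p₁ * g) + f * (p₂ * g), p₁ * g, p₂ *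
      g,
    1, by rw [pow_one]⟩
  have hg' : P'.g.map q = P.g ^ (n + 1) := by
    simp only [P', Polynomial.map_add, Polynomial.map_mul, ← Polynomial.derivative_map, hf.1, hg,
      pow_succ, ← hn]
    ring
  have hmap {T : Type u} [CommRing T] [Algebra F T] [Algebra A T] [IsScalarTower A F T] (x : T) :
      P'.HasMap x ↔ P.HasMap x := by
    have h1 : Polynomial.aeval x P'.f = Polynomial.aeval x P.f := by
      rw [← hf.1]
      exact (Polynomial.aeval_map_algebraMap F x f).symm
    have h2 : Polynomial.aeval x P'.g = Polynomial.aeval x P.g ^ (n + 1) := by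
      rw [← map_pow, ← hg']
      exact (Polynomial.aeval_map_algebraMap F x P'.g).symm
    rw [StandardEtalePair.HasMap, StandardEtalePair.HasMap, h1, h2, isUnit_pow_succ_iff]
  -- both pairs have the same points in each `F`-algebra, so `P'.Ring ⧸ I` and `G` are isomorphic
  let φ : P'.Ring →ₐ[A] G := P'.lift P.x ((hmap P.x).2 P.hasMap)
  let I : Ideal P'.Ring := (RingHom.ker q).map (algebraMap A P'.Ring)
  have hI (a : A) (ha : q a = 0) : (Ideal.Quotient.mk I).comp (algebraMap A P'.Ring) a = 0 :=
    Ideal.Quotient.eq_zero_iff_mem.2 (Ideal.mem_map_of_mem _ ha)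
  let ψ : F →+* P'.Ring ⧸ I := RingHom.liftOfSurjective q hq
    ⟨(Ideal.Quotient.mk I).comp (algebraMap A P'.Ring), fun a ha ↦ hI a ha⟩
  have hψ (a) : ψ (q a) = Ideal.Quotient.mk I (algebraMap A P'.Ring a) :=
    RingHom.liftOfRightInverse_comp_apply ..
  let := ψ.toAlgebra
  have : IsScalarTower A F (P'.Ring ⧸ I) := .of_algebraMap_eq fun a ↦ (hψ a).symm
  have hx : P.HasMap (Ideal.Quotient.mk I P'.X) :=
    (hmap _).1 (P'.hasMap_X.map (Ideal.Quotient.mkₐ A I))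
  let θ : G →ₐ[F] P'.Ring ⧸ I := (P.lift _ hx).comp P.equivRing.toAlgHom
  have hθ : θ P.x = Ideal.Quotient.mk I P'.X := by
    simp [θ]
  have hφ : φ P'.X = P.x := P'.lift_X ..
  have hker : I ≤ RingHom.ker φ := by
    rw [Ideal.map_le_iff_le_comap]
    intro a ha
    rw [Ideal.mem_comap, RingHom.mem_ker, AlgHom.commutes]
    change algebraMap F G (q a) = 0
    rw [RingHom.mem_ker.1 ha, map_zero]
  let φ' : P'.Ring ⧸ I →+* G := Ideal.Quotient.lift I φ.toRingHom hker
  have h1 : (θ.restrictScalars A).comp φ = Ideal.Quotient.mkₐ A I := P'.hom_ext (by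
    change θ (φ P'.X) = _
    rw [hφ, hθ]
    rfl)
  have h2 : ∀ y, φ' (θ y) = y := by
    let φF : P'.Ring ⧸ I →ₐ[F] G := ⟨φ', fun c ↦ by
      obtain ⟨c, rfl⟩ := hq c
      change φ' (ψ (q c)) = _
      rw [hψ]
      exact φ.commutes c⟩
    have : φF.comp θ = AlgHom.id F G := P.hom_ext (by
      change φ' (θ P.x) = P.x
      rw [hθ]
      exact hφ)
    exact fun y ↦ congr($this y)
  refine ⟨P'.Ring, inferInstance, inferInstance, φ.toRingHom, inferInstance, fun y ↦ ?_,
    fun a ↦ φ.commutes a, le_antisymm (fun z hz ↦ ?_) hker⟩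
  · obtain ⟨z, hz⟩ := Ideal.Quotient.mk_surjective (θ y)
    refine ⟨z, (?_ : φ' (Ideal.Quotient.mk I z) = y)⟩
    rw [hz, h2]
  · have h3 : θ (φ z) = Ideal.Quotient.mk I z := congr($h1 z)
    rw [show φ z = 0 from hz, map_zero] at h3
    exact Ideal.Quotient.eq_zero_iff_mem.1 h3.symm

end Lifting

/-! ### Étale neighbourhoods -/

section Neighbourhoods

variable {X : Scheme.{u}}

/-- An affine scheme étale over an affine scheme étale over `X`. -/
abbrev etaleOver {U : X.AffineEtale} {R : CommRingCat.{u}} (φ : Spec R ⟶ Spec (ringOf U))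
    [Etale φ] : X.AffineEtale :=
  have : Etale (specHom U) := U.prop
  Scheme.AffineEtale.mk (φ ≫ specHom U)

/-- The structure morphism of `etaleOver φ`. -/
def etaleOverHom {U : X.AffineEtale} {R : CommRingCat.{u}} (φ : Spec R ⟶ Spec (ringOf U))
    [Etale φ] : etaleOver φ ⟶ U :=
  MorphismProperty.CostructuredArrow.homMk (Spec.preimage φ).op trivial
    (congrArg (· ≫ specHom U) (Spec.map_preimage φ))

theorem map_ringHomOf_etaleOverHom {U : X.AffineEtale} {R : CommRingCat.{u}}
    (φ : Spec R ⟶ Spec (ringOf U)) [Etale φ] : Spec.map (ringHomOf (etaleOverHom φ)) = φ :=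
  Spec.map_preimage φ

/-- A property holds locally if it holds on an étale neighbourhood of each point. -/
theorem locally_of_forall_point {U : X.AffineEtale} {Q : ∀ V : X.AffineEtale, (V ⟶ U) → Prop}
    (h : ∀ u : Spec (ringOf U), ∃ (R : CommRingCat.{u}) (φ : Spec R ⟶ Spec (ringOf U))
      (_ : Etale φ) (v : Spec R), φ v = u ∧ Q (etaleOver φ) (etaleOverHom φ)) : Locally U Q := by
  choose R φ hφ v hv hQ using h
  rw [Locally, Scheme.AffineEtale.topology, Functor.mem_inducedTopology_iff_of_isCoverDense]
  refine GrothendieckTopology.superset_covering _ ?_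
    ((Scheme.ofArrows_mem_smallEtaleTopology_iff
      fun u : Spec (ringOf U) ↦ (Scheme.AffineEtale.Spec X).map (etaleOverHom (φ u))).2 ?_)
  · rintro W _ ⟨_, k, _, ⟨u⟩, rfl⟩
    have h : Sieve.generate (fun V ↦ {g : V ⟶ U | Q V g}) (etaleOverHom (φ u)) :=
      Sieve.le_generate _ _ _ (hQ u)
    exact ⟨etaleOver (φ u), etaleOverHom (φ u), k, h, rfl⟩
  · have h (u : Spec (ringOf U)) : Spec.map (ringHomOf (etaleOverHom (φ u))) (v u) = u := by
      rw [map_ringHomOf_etaleOverHom]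
      exact hv u
    exact Set.eq_univ_of_forall fun u ↦ Set.mem_iUnion.2 ⟨u, v u, h u⟩

/-- Two étale neighbourhoods have a common affine refinement. -/
theorem exists_affine_refinement {V W T : Scheme.{u}} (a : V ⟶ T) (b : W ⟶ T) [Etale a] [Etale b]
    (v : V) (w : W) (h : a v = b w) : ∃ (A : CommRingCat.{u}) (c : Spec A ⟶ V) (d : Spec A ⟶ W)
      (z : Spec A), Etale c ∧ Etale d ∧ c ≫ a = d ≫ b ∧ c z = v ∧ d z = w := by
  obtain ⟨z, hz₁, hz₂⟩ := Scheme.Pullback.exists_preimage_pullback v w h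
  obtain ⟨A, j, hj, y, rfl⟩ := Scheme.exists_Spec_apply_eq z
  exact ⟨A, j ≫ pullback.fst a b, j ≫ pullback.snd a b, y, inferInstance, inferInstance,
    by rw [Category.assoc, Category.assoc, pullback.condition],
    by rw [Scheme.Hom.comp_apply]; exact hz₁, by rw [Scheme.Hom.comp_apply]; exact hz₂⟩

/-- The pullback of a closed immersion to an affine scheme. -/
theorem exists_isPullback_of_isClosedImmersion {Z X : Scheme.{u}} (i : Z ⟶ X) [IsClosedImmersion i]
    {A : CommRingCat.{u}} (c : Spec A ⟶ X) : ∃ (E : CommRingCat.{u}) (q : A ⟶ E) (j : Spec E ⟶ Z),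
      Function.Surjective q ∧ IsPullback j (Spec.map q) i c := by
  obtain ⟨I, e, he⟩ := IsClosedImmersion.Spec_iff.1
    (inferInstance : IsClosedImmersion (pullback.snd i c))
  refine ⟨.of (A ⧸ I), CommRingCat.ofHom (Ideal.Quotient.mk I), e.inv ≫ pullback.fst i c,
    Ideal.Quotient.mk_surjective, ?_⟩
  exact (IsPullback.of_hasPullback i c).of_iso e (Iso.refl _) (Iso.refl _) (Iso.refl _) (by simp)
    (by simp [he]) (by simp) (by simp)

end Neighbourhoods

/-! ### The closed fibre and its components -/

section Fibre

variable {O : Type u} [CommRing O] [IsLocalRing O] {X : Scheme.{u}} (f : X ⟶ Spec (.of O))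

instance : IsClosedImmersion (reducedFibreι f) := by
  have : IsClosedImmersion (Spec.map (CommRingCat.ofHom (IsLocalRing.residue O))) :=
    IsClosedImmersion.spec_of_surjective _ IsLocalRing.residue_surjective
  unfold reducedFibreι
  infer_instance

theorem mem_range_reducedFibreι (x : X) : x ∈ Set.range (reducedFibreι f) ↔
    IsLocalRing.maximalIdeal O ≤ (f x).asIdeal := by
  have h1 : Set.range (closedFibre f).nilradical.subschemeι = Set.univ := by
    rw [Scheme.IdealSheafData.range_subschemeι, Scheme.support_nilradical]
    rfl
  have h2 : x ∈ Set.range (reducedFibreι f) ↔ x ∈ Set.range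
      (pullback.fst f (Spec.map (CommRingCat.ofHom (IsLocalRing.residue O)))) := by
    constructor
    · rintro ⟨y, rfl⟩
      exact ⟨_, (Scheme.Hom.comp_apply _ _ _).symm⟩
    · rintro ⟨y, rfl⟩
      obtain ⟨z, rfl⟩ : y ∈ Set.range (closedFibre f).nilradical.subschemeι := h1 ▸ trivial
      exact ⟨z, Scheme.Hom.comp_apply _ _ _⟩
  rw [h2, Scheme.Pullback.range_fst, Set.mem_preimage]
  have h3 : Set.range (PrimeSpectrum.comap (IsLocalRing.residue O)) =
      PrimeSpectrum.zeroLocus (RingHom.ker (IsLocalRing.residue O)) :=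
    range_comap_of_surjective _ _ IsLocalRing.residue_surjective
  rw [IsLocalRing.ker_residue] at h3
  exact Set.ext_iff.1 h3 (f x)

theorem exists_uniformizer [IsDomain O] [IsDiscreteValuationRing O] {A : CommRingCat.{u}}
    (c : Spec A ⟶ X) :
    ∃ ϖ : A, ∀ P : Spec A, c P ∈ Set.range (reducedFibreι f) ↔ ϖ ∈ P.asIdeal := by
  obtain ⟨ϖ, hϖ⟩ := IsDiscreteValuationRing.exists_irreducible O
  obtain ⟨φ, hφ⟩ := Spec.map_surjective (c ≫ f)
  refine ⟨φ ϖ, fun P ↦ ?_⟩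
  rw [mem_range_reducedFibreι, ← Scheme.Hom.comp_apply, ← hφ, hϖ.maximalIdeal_eq,
    Ideal.span_singleton_le_iff_mem]
  rfl

/-- Every point of `D` on the closed fibre has a generization in `D` off the closed fibre. -/
theorem exists_generization [IsDomain O] [IsDiscreteValuationRing O] {D : Closeds X}
    (hD : Flat ((Scheme.IdealSheafData.vanishingIdeal D).subschemeι ≫ f)) {x : X} (hx : x ∈ D) :
    ∃ y : X, y ⤳ x ∧ y ∈ D ∧ y ∉ Set.range (reducedFibreι f) := by
  have h1 : Set.range (Scheme.IdealSheafData.vanishingIdeal D).subschemeι = D := by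
    rw [Scheme.IdealSheafData.range_subschemeι]
    simp
  obtain ⟨z, rfl⟩ : x ∈ Set.range (Scheme.IdealSheafData.vanishingIdeal D).subschemeι := by
    rw [h1]; exact hx
  let η : Spec (CommRingCat.of O) := (⊥ : PrimeSpectrum O)
  have hη : η ⤳ ((Scheme.IdealSheafData.vanishingIdeal D).subschemeι ≫ f) z :=
    (PrimeSpectrum.le_iff_specializes _ _).1 bot_le
  obtain ⟨y, hy, hy'⟩ := Flat.generalizingMap _ hη
  refine ⟨_, hy.map (Scheme.IdealSheafData.vanishingIdeal D).subschemeι.continuous, ?_, ?_⟩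
  · rw [← SetLike.mem_coe, ← h1]
    exact ⟨y, rfl⟩
  · rw [mem_range_reducedFibreι, ← Scheme.Hom.comp_apply, hy']
    intro h
    exact IsDiscreteValuationRing.not_a_field O (le_bot_iff.1 h)

theorem finite_fibreComponents [IsDomain O] [IsDiscreteValuationRing O] [LocallyOfFiniteType f]
    [QuasiCompact f] : Finite (FibreComponents f) := by
  have : IsNoetherianRing (CommRingCat.of O) := inferInstanceAs (IsNoetherianRing O)
  have : CompactSpace X := QuasiCompact.compactSpace_of_compactSpace f
  have : IsNoetherian X := { __ := LocallyOfFiniteType.isLocallyNoetherian f }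
  have : NoetherianSpace (reducedFibre f) :=
    (reducedFibreι f).isClosedEmbedding.isInducing.noetherianSpace
  exact NoetherianSpace.finite_irreducibleComponents

/-- The pullbacks of the irreducible components of the closed fibre along a flat morphism. -/
theorem isComponentFamily {A : CommRingCat.{u}} (c : Spec A ⟶ X) [Flat c] :
    IsComponentFamily (O := A) (Λ := FibreComponents f) (c ⁻¹' Set.range (reducedFibreι f))
      (fun i ↦ c ⁻¹' (reducedFibreι f '' i.1))
      (fun i ↦ c ⁻¹' (reducedFibreι f '' {y | IsGenericPoint y i.1})) := by
  have hc (i : FibreComponents f) : IsClosed i.1 :=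
    isClosed_of_mem_irreducibleComponents i.1 i.2
  have hcl (i : FibreComponents f) : IsClosed (c ⁻¹' (reducedFibreι f '' i.1)) :=
    ((reducedFibreι f).isClosedEmbedding.isClosedMap _ (hc i)).preimage c.continuous
  refine ⟨fun i P P' h hP ↦ ?_, fun i P ⟨y, hy, hyP⟩ ↦ ⟨y, hy.mem, hyP⟩, fun i P ⟨y, hy, hyP⟩ ↦ ?_,
    fun i P ⟨y, _, hy⟩ ↦ ⟨y, hy⟩, fun i P P' h ⟨y, hy⟩ ⟨z, hz, hz'⟩ ↦ ?_,
    fun i j P ⟨y, hy, hyP⟩ ⟨z, hz, hzP⟩ ↦ ?_⟩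
  · exact ((PrimeSpectrum.le_iff_specializes _ _).1 h).mem_closed (hcl i) hP
  · obtain ⟨z, hz⟩ := QuasiSober.sober i.2.1 (hc i)
    have h1 : reducedFibreι f z ⤳ c P := by
      rw [← hyP]
      exact (hz.specializes hy).map (reducedFibreι f).continuous
    obtain ⟨P', hP', h2⟩ := Flat.generalizingMap c h1
    exact ⟨P', (PrimeSpectrum.le_iff_specializes _ _).2 hP', z, hz, h2.symm⟩
  · refine ⟨y, ?_, hy⟩
    have h1 : c P ⤳ c P' := ((PrimeSpectrum.le_iff_specializes _ _).1 h).map c.continuous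
    rw [← hy, ← hz', (reducedFibreι f).isClosedEmbedding.isInducing.specializes_iff] at h1
    have h2 : i.1 ⊆ closure {y} := by
      rw [← hz.def]
      exact closure_minimal (Set.singleton_subset_iff.2 h1.mem_closure) isClosed_closure
    exact (i.2.2 isIrreducible_singleton.closure h2).antisymm h2
  · have h1 : y = z := (reducedFibreι f).isClosedEmbedding.injective (hyP.trans hzP.symm)
    subst h1
    exact Subtype.ext (hy.def.symm.trans hz.def)

end Fibre

/-! ### Existence of charts -/

section Existence

/-- Where the ideals vanish, there is a chart without coordinates. -/
theorem HasChart.of_eq_top {Λ : Type v} {P : LogDatum.{u} Λ} {p : ℕ} [Fact p.Prime]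
    (hI : P.I = ⊤) (hc : ∀ i, P.comp i = ⊤) : HasChart P p := by
  have : Subsingleton (P.A ⧸ P.I) := Ideal.Quotient.subsingleton_iff.2 hI
  have : Subsingleton (LogForm1 P.ι P.I) := Module.subsingleton (P.A ⧸ P.I) _
  refine ⟨⟨Subsingleton.elim _ _⟩, ⟨?_⟩⟩
  let := Fact.mk (Subsingleton.elim (p : P.A ⧸ P.I) 0)
  exact
  { σ := PEmpty
    x := PEmpty.elim
    e := Module.Basis.empty _
    d_x := fun s ↦ s.elim
    e_eq := fun s ↦ s.elim
    dlog_eq := fun y ↦ ⟨1, 0, Subsingleton.elim _ _⟩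
    J := ∅
    surjective := fun y ↦ ⟨0, Subsingleton.elim _ _⟩
    mem_of_mem := fun L hL c h α ↦ by
      rw [Subsingleton.elim (c α) 0]
      exact zero_mem _
    unif :=
    { π := fun _ ↦ 1
      unit := fun _ ↦ 1
      ι_π := fun _ ↦ by simp
      span_π := fun i ↦ by rw [hc, Ideal.span_singleton_one] }
    nonZeroDivisors := fun _ ↦ one_mem _
    S := fun _ ↦ ∅
    disjoint := fun _ ↦ Finset.disjoint_empty_left _
    subset := fun _ ↦ by simp
    mk_π := fun _ ↦ Subsingleton.elim _ _
    dlog_unit := fun _ ↦ Subsingleton.elim _ _ }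

theorem isLocalization_away_sections {R : CommRingCat.{u}} (s : R) (W : (Spec R).Opens)
    (hW : W = PrimeSpectrum.basicOpen s) :
    letI := ((Scheme.ΓSpecIso R).inv ≫
      (Spec R).presheaf.map (homOfLE le_top : W ⟶ ⊤).op).hom.toAlgebra
    IsLocalization.Away s Γ(Spec R, W) := by
  subst hW
  have h := StructureSheaf.IsLocalization.to_basicOpen R s
  have e : StructureSheaf.openAlgebra R (op (PrimeSpectrum.basicOpen s)) = ((Scheme.ΓSpecIso R).inv
      ≫
      (Spec R).presheaf.map (homOfLE le_top : PrimeSpectrum.basicOpen s ⟶ ⊤).op).hom.toAlgebra := by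
    refine Algebra.algebra_ext _ _ fun r ↦ ?_
    rfl
  exact e ▸ h

theorem algebra_etale_of_etale_specMap {R S : CommRingCat.{u}} (φ : R ⟶ S) [Etale (Spec.map φ)] :
    letI := φ.hom.toAlgebra
    Algebra.Etale R S :=
  (HasRingHomProperty.Spec_iff (P := @Etale)).1 inferInstance

theorem etale_specMap_of_algebra (R S : Type u) [CommRing R] [CommRing S] [Algebra R S]
    [Algebra.Etale R S] : Etale (Spec.map (CommRingCat.ofHom (algebraMap R S))) :=
  (HasRingHomProperty.Spec_iff (P := @Etale)).2 (RingHom.etale_algebraMap.2 inferInstance)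

/-- Around a point of an affine étale neighbourhood there is a standard étale neighbourhood
on which a given étale chart `e` lifts to an étale algebra over the polynomial ring. -/
theorem exists_model_neighbourhood {k : Type u} [Field k] {n a : ℕ} {Y V : Scheme.{u}} (g : V ⟶ Y)
    (e : V ⟶ Spec (.of (NCModel k n a))) [Etale g] [Etale e] {F : CommRingCat.{u}}
    (j : Spec F ⟶ Y) [Etale j] (v₁ : Spec F) (v₀ : V) (hv : j v₁ = g v₀) :
    ∃ (E E' : Type u) (_ : CommRing E) (_ : CommRing E') (_ : Algebra F E)
      (_ : Algebra (MvPolynomial (Fin n) k) E') (h : E' →+* E) (d : Spec (.of E) ⟶ V)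
      (v : PrimeSpectrum E),
      Algebra.IsStandardEtale F E ∧ Algebra.Etale (MvPolynomial (Fin n) k) E' ∧
      Function.Surjective h ∧
      RingHom.ker h = Ideal.span {∏ i : Fin n with i.val < a, coord k E' i} ∧
      Spec.map (CommRingCat.ofHom (algebraMap F E)) ≫ j = d ≫ g ∧
      PrimeSpectrum.comap (algebraMap F E) v = v₁ ∧
      ∀ (Q : PrimeSpectrum E) (x : MvPolynomial (Fin n) k),
        (Ideal.Quotient.mk _ x : NCModel k n a) ∈ (e (d Q)).asIdeal ↔
          h (algebraMap _ E' x) ∈ Q.asIdeal := by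
  obtain ⟨E₁, c, d, z, hc, hd, hcd, hz₁, hz₂⟩ := exists_affine_refinement j g v₁ v₀ hv
  obtain ⟨φ, rfl⟩ := Spec.map_surjective c
  obtain ⟨ψ, hψ⟩ := Spec.map_surjective (d ≫ e)
  have hψe : Etale (Spec.map ψ) := by rw [hψ]; infer_instance
  let a₁ : Algebra F E₁ := φ.hom.toAlgebra
  let a₂ : Algebra (NCModel k n a) E₁ := ψ.hom.toAlgebra
  have : Algebra.Etale F E₁ := algebra_etale_of_etale_specMap φ
  have : Algebra.Etale (NCModel k n a) E₁ := algebra_etale_of_etale_specMap ψ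
  have : (PrimeSpectrum.asIdeal (R := E₁) z).IsPrime := PrimeSpectrum.isPrime z
  obtain ⟨s, hs, h1, h2⟩ := exists_isStandardEtale_both (R := F) (R' := NCModel k n a)
    (PrimeSpectrum.asIdeal (R := E₁) z)
  obtain ⟨E', _, _, h, hE', hh, hhc, hker⟩ := exists_etale_lift (A := MvPolynomial (Fin n) k)
    (F := NCModel k n a) (G := Localization.Away s) Ideal.Quotient.mk_surjective
  let ρ : E₁ ⟶ .of (Localization.Away s) := CommRingCat.ofHom (algebraMap E₁ (Localization.Away s))
  obtain ⟨v, hv⟩ : z ∈ Set.range (PrimeSpectrum.comap (algebraMap E₁ (Localization.Away s))) := by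
    rw [PrimeSpectrum.localization_away_comap_range (Localization.Away s) s]
    exact hs
  refine ⟨Localization.Away s, E', inferInstance, inferInstance, inferInstance, inferInstance, h,
    Spec.map ρ ≫ d, v, h1, hE', hh, ?_, ?_, ?_, fun Q x ↦ ?_⟩
  · rw [hker, Ideal.mk_ker, Ideal.map_span, Set.image_singleton, map_prod]
  · rw [Category.assoc, ← hcd, ← Spec.map_comp_assoc]
    rfl
  · rw [← hz₁, ← hv]
    rfl
  · have h3 (Q : Spec (.of (Localization.Away s))) :
        e ((Spec.map ρ ≫ d) Q) = Spec.map (ψ ≫ ρ) Q := by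
      rw [← Scheme.Hom.comp_apply, Category.assoc, ← hψ, ← Spec.map_comp]
    rw [hhc]
    exact iff_of_eq (congrArg (_ ∈ PrimeSpectrum.asIdeal ·) (h3 Q))

end Existence

section Existence

variable {O : Type u} [CommRing O] [IsDomain O] [IsDiscreteValuationRing O] {p : ℕ} [Fact p.Prime]
  [CharP (IsLocalRing.ResidueField O) p] {X : Scheme.{u}} {f : X ⟶ Spec (.of O)} {D : Closeds X}

/-- At each point of the closed fibre there is an étale model of the closed fibre in which `D` is
given, near the point, by a product of coordinates; this product is empty off `D`. -/
theorem IsNormalCrossingSetting.exists_model (hX : IsNormalCrossingSetting f D) :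
    ∃ n : ℕ, ∀ y : reducedFibre f, ∃ (a b : ℕ) (V : Scheme.{u}) (g : V ⟶ reducedFibre f)
      (e : V ⟶ Spec (.of (NCModel (IsLocalRing.ResidueField O) n a))) (v₀ : V),
      Etale g ∧ Etale e ∧ g v₀ = y ∧ ∀ v, g v ⤳ y →
        (reducedFibreι f (g v) ∈ D ↔
          ncModelDivisor (IsLocalRing.ResidueField O) n a b ∈ (e v).asIdeal) := by
  obtain ⟨n, hY, hD⟩ := hX.exists_dim
  refine ⟨n, fun y ↦ ?_⟩
  by_cases hy : reducedFibreι f y ∈ D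
  · obtain ⟨a, b, -, -, -, V, g, e, hg, he, -, ⟨v₀, hv⟩, h⟩ := hD y hy
    exact ⟨a, b, V, g, e, v₀, hg, he, hv, fun v _ ↦ Set.ext_iff.1 h v⟩
  -- off `D` any model will do, with the empty product `b = 0`
  · obtain ⟨a, -, -, V, g, e, hg, he, -, v₀, hv⟩ := hY.2.2.2 y
    refine ⟨a, 0, V, g, e, v₀, hg, he, hv, fun v hv ↦ ⟨fun h ↦ ?_, fun h ↦ ?_⟩⟩
    · exact (hy ((hv.map (reducedFibreι f).continuous).mem_closed D.isClosed h)).elim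
    · refine ((e v).2.ne_top ((Ideal.eq_top_iff_one _).2 ?_)).elim
      have h0 : ncModelDivisor (IsLocalRing.ResidueField O) n a 0 = 1 := by
        rw [ncModelDivisor, ← map_one (Ideal.Quotient.mk _)]
        refine congrArg _ (Finset.prod_eq_one fun i hi ↦ ?_)
        have := (Finset.mem_filter.1 hi).2
        omega
      rwa [h0] at h

theorem IsNormalCrossingSetting.isNoetherianRing (hX : IsNormalCrossingSetting f D)
    {A : CommRingCat.{u}} (c : Spec A ⟶ X) [LocallyOfFiniteType c] : IsNoetherianRing A := by
  have := hX.locallyOfFiniteType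
  have : IsNoetherianRing (CommRingCat.of O) := inferInstanceAs (IsNoetherianRing O)
  have : IsLocallyNoetherian X := LocallyOfFiniteType.isLocallyNoetherian f
  have : IsLocallyNoetherian (Spec A) := LocallyOfFiniteType.isLocallyNoetherian c
  exact isLocallyNoetherian_Spec.1 this

/-- Étale locally at a point of the boundary `Y ∪ D` there is a regular system of parameters such
that a product of some of its members cuts out the boundary. -/
theorem IsNormalCrossingSetting.exists_parameters (hX : IsNormalCrossingSetting f D)
    {T : Scheme.{u}} (c : T ⟶ X) [Etale c] (u : T)
    (hu : c u ∈ Set.range (reducedFibreι f) ∪ (D : Set X)) :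
    ∃ (A : CommRingCat.{u}) (φ : Spec A ⟶ T) (z : PrimeSpectrum A) (n : ℕ) (t : Fin n → A)
      (S : Finset (Fin n)), Etale φ ∧ φ z = u ∧
      IsParameterSystem (fun i ↦ algebraMap A (Localization.AtPrime z.asIdeal) (t i)) ∧
      ∀ P : Spec A, (φ ≫ c) P ∈ Set.range (reducedFibreι f) ∪ (D : Set X) ↔
        ∏ i ∈ S, t i ∈ P.asIdeal := by
  obtain ⟨R, g, w, n, t, S, hg, hw, -, hdim, hspan, hS⟩ := hX.normalCrossing _ hu
  obtain ⟨A, φ, d, z, hφ, hd, hφd, hz₁, hz₂⟩ := exists_affine_refinement c g u w hw.symm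
  obtain ⟨ψ, rfl⟩ := Spec.map_surjective d
  refine ⟨A, φ, z, n, fun i ↦ ψ (t i), S, hφ, hz₁, ?_, fun P ↦ ?_⟩
  · have : IsNoetherianRing R := hX.isNoetherianRing g
    have : IsNoetherianRing A := hX.isNoetherianRing (φ ≫ c)
    let := ψ.hom.toAlgebra
    have : Algebra.Etale R A := algebra_etale_of_etale_specMap ψ
    have hz : (PrimeSpectrum.asIdeal (R := A) z).IsPrime := PrimeSpectrum.isPrime z
    have hlie : (PrimeSpectrum.asIdeal (R := A) z).LiesOver w.asIdeal := ⟨by rw [← hz₂]; rfl⟩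
    have h1 : IsParameterSystem fun i ↦ algebraMap R (Localization.AtPrime w.asIdeal) (t i) :=
      ⟨hspan, by rw [hdim, Fintype.card_fin]⟩
    have h2 := h1.of_etale w.asIdeal (PrimeSpectrum.asIdeal (R := A) z)
    simp only [Localization.localRingHom_to_map] at h2
    exact h2
  · have hcl : IsClosed (g ⁻¹' (Set.range (reducedFibreι f) ∪ (D : Set X))) :=
      ((isClosed_range_reducedFibreι f).union D.isClosed).preimage g.continuous
    rw [hφd, Scheme.Hom.comp_apply, ← Set.mem_preimage]
    have h1 := PrimeSpectrum.zeroLocus_vanishingIdeal_eq_closure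
      (g ⁻¹' (Set.range (reducedFibreι f) ∪ (D : Set X)) : Set (PrimeSpectrum R))
    rw [hS, PrimeSpectrum.zeroLocus_span] at h1
    have h2 := h1.trans hcl.closure_eq
    refine (Set.ext_iff.1 h2 (Spec.map ψ P)).symm.trans ?_
    rw [← map_prod]
    exact Set.singleton_subset_iff

/-- A point of the closed fibre has an étale neighbourhood with a chart. The étale model of the
closed fibre is lifted to an étale algebra over `A₁`, where it can be compared with the parameters
`t`. -/
theorem IsNormalCrossingSetting.exists_hasChart_mk (hX : IsNormalCrossingSetting f D)
    {A₁ : CommRingCat.{u}} (c₁ : Spec A₁ ⟶ X) [Etale c₁] (z : PrimeSpectrum A₁)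
    (hz : c₁ z ∈ Set.range (reducedFibreι f)) {n : ℕ} {t : Fin n → A₁} {S : Finset (Fin n)}
    (ht : IsParameterSystem fun i ↦ algebraMap A₁ (Localization.AtPrime z.asIdeal) (t i))
    (hS : ∀ P : Spec A₁, c₁ P ∈ Set.range (reducedFibreι f) ∪ (D : Set X) ↔
      ∏ i ∈ S, t i ∈ P.asIdeal) :
    ∃ (R : CommRingCat.{u}) (φ : Spec R ⟶ Spec A₁) (v : Spec R), Etale φ ∧ φ v = z ∧
      ∀ (c : Spec R ⟶ X) [Etale c], c = φ ≫ c₁ →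
        HasChart ((fibreDatum f D).obj (op (Scheme.AffineEtale.mk c))) p := by
  obtain ⟨N, hN⟩ := hX.exists_model
  -- `Spec E₁` is the closed fibre of `Spec A₁`, and `Spec E` an étale neighbourhood of the point
  -- in it which is also étale over the model
  obtain ⟨E₁, q, j, hq, hpb⟩ := exists_isPullback_of_isClosedImmersion (reducedFibreι f) c₁
  have hj : Etale j := MorphismProperty.of_isPullback (P := @Etale) hpb.flip inferInstance
  obtain ⟨y, hy⟩ := hz
  obtain ⟨v₁, hv₁, hv₁'⟩ := Scheme.exists_preimage_of_isPullback hpb y z hy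
  obtain ⟨a, b, V, g, e, v₀, hg, he, hv₀, hgD⟩ := hN y
  obtain ⟨E, E', _, _, _, _, h, d, v, hE, hE', hh, hker, hdg, hv, hmem⟩ :=
    exists_model_neighbourhood g e j v₁ v₀ (hv₁.trans hv₀.symm)
  -- `Spec A` is an étale neighbourhood in `Spec A₁` with closed fibre `Spec E`
  obtain ⟨A, _, _, fA, hA, hfA, hfAc, hfAk⟩ := exists_etale_lift (q := q.hom) hq (G := E)
  let α : Spec (.of A) ⟶ Spec A₁ := Spec.map (CommRingCat.ofHom (algebraMap A₁ A))
  have hα : Etale α := etale_specMap_of_algebra A₁ A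
  have hA₁ : IsNoetherianRing A₁ := hX.isNoetherianRing c₁
  have hAn : IsNoetherianRing A := hX.isNoetherianRing (α ≫ c₁)
  have hqv : PrimeSpectrum.comap q.hom (PrimeSpectrum.comap (algebraMap E₁ E) v) = z := by
    rw [hv]
    exact hv₁'
  have hcomp : (algebraMap E₁ E).comp q.hom = fA.comp (algebraMap A₁ A) :=
    RingHom.ext fun x ↦ (hfAc x).symm
  have hlie : (v.asIdeal.comap fA).LiesOver z.asIdeal := ⟨by
    rw [← hqv, Ideal.under, Ideal.comap_comap, ← hcomp]
    rfl⟩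
  have ht' : IsNCSystem fun i ↦ algebraMap A (Localization.AtPrime (v.asIdeal.comap fA))
      (algebraMap A₁ A (t i)) := by
    have h2 := ht.of_etale z.asIdeal (v.asIdeal.comap fA)
    simp only [Localization.localRingHom_to_map] at h2
    exact h2.isNCSystem
  -- the closed fibre and `D` on `Spec A`
  let c₂ : Spec (.of A) ⟶ X := α ≫ c₁
  let L := Localization.AtPrime (v.asIdeal.comap fA)
  let β : Spec (.of L) ⟶ Spec (.of A) := Spec.map (CommRingCat.ofHom (algebraMap A L))
  have hβ : Flat β := Flat.SpecMap_iff.2 (RingHom.flat_algebraMap_iff.2 (inferInstanceAs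
      (Module.Flat A L)))
  let Y' : Set (PrimeSpectrum A) := c₂ ⁻¹' Set.range (reducedFibreι f)
  let D' : Set (PrimeSpectrum A) := c₂ ⁻¹' (D : Set X)
  have hβ' (Z : Set X) : PrimeSpectrum.comap (algebraMap A L) ⁻¹' (c₂ ⁻¹' Z) = (β ≫ c₂) ⁻¹' Z := by
    rfl
  have hS' (P : PrimeSpectrum A) : P ∈ Y' ∪ D' ↔ ∏ i ∈ S, algebraMap A₁ A (t i) ∈ P.asIdeal := by
    rw [← map_prod]
    exact hS (α P)
  have hY (P : PrimeSpectrum A) : P ∈ Y' ↔ RingHom.ker fA ≤ P.asIdeal := by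
    rw [hfAk, Ideal.map_le_iff_le_comap]
    have h1 : Set.range (PrimeSpectrum.comap q.hom) = PrimeSpectrum.zeroLocus (RingHom.ker q.hom) :=
      range_comap_of_surjective _ _ hq
    refine Iff.trans ?_ (Set.ext_iff.1 h1 (PrimeSpectrum.comap (algebraMap A₁ A) P))
    constructor
    · rintro ⟨y, hy⟩
      obtain ⟨w, -, hw⟩ := Scheme.exists_preimage_of_isPullback hpb y (α P) hy
      exact ⟨w, hw⟩
    · rintro ⟨w, hw⟩
      exact ⟨j w, (congrArg (fun k : Spec E₁ ⟶ X ↦ k w) hpb.w).trans (congrArg c₁ hw)⟩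
  have hD' : IsClosed D' := D.isClosed.preimage c₂.continuous
  have hfib : Spec.map (CommRingCat.ofHom fA) ≫ c₂ = d ≫ g ≫ reducedFibreι f := by
    rw [← reassoc_of% hdg, hpb.w, ← Spec.map_comp_assoc, ← Spec.map_comp_assoc]
    exact congrArg (fun k ↦ Spec.map (CommRingCat.ofHom k) ≫ c₁) hcomp.symm
  have hdv : g (d v) = y := by
    rw [← hv₁, ← hv]
    exact congrArg (fun k : Spec (.of E) ⟶ reducedFibre f ↦ k v) hdg.symm
  -- the model describes `D` at the generizations of the point
  have hDE (Q : PrimeSpectrum E) (hQ : Q.asIdeal ≤ v.asIdeal) : PrimeSpectrum.comap fA Q ∈ D' ↔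
      ∏ j : Fin N with a ≤ j.val ∧ j.val < a + b, h (coord (IsLocalRing.ResidueField O) E' j) ∈
          Q.asIdeal := by
    have h1 : d Q ⤳ d v := ((PrimeSpectrum.le_iff_specializes Q v).1 hQ).map d.continuous
    have h2 : g (d Q) ⤳ y := hdv ▸ h1.map g.continuous
    have h3 := (hgD (d Q) h2).trans (hmem Q _)
    rw [map_prod, map_prod] at h3
    refine Iff.trans (iff_of_eq ?_) h3
    exact congrArg (fun k : Spec (.of E) ⟶ X ↦ k Q ∈ D) hfib
  -- the hypotheses of `exists_hasChart_away`; the flatness of `D` gives the generizations off `Y`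
  obtain ⟨ϖ, hϖ⟩ := exists_uniformizer f c₂
  have hCc (l : FibreComponents f) : IsClosed (X := PrimeSpectrum A) (c₂ ⁻¹' (reducedFibreι f ''
      l.1)) :=
    ((reducedFibreι f).isClosedEmbedding.isClosedMap _
      (isClosed_of_mem_irreducibleComponents l.1 l.2)).preimage c₂.continuous
  have := hX.locallyOfFiniteType
  have := hX.quasiCompact
  have := finite_fibreComponents f
  obtain ⟨s, hs, H⟩ := exists_hasChart_away (p := p) (k := IsLocalRing.ResidueField O) (n := n)
    (CharP.cast_eq_zero _ p) hfA hh hker v.asIdeal (t := fun i ↦ algebraMap A₁ A (t i)) (b := b)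
    ht' (S := S) (Y := Y') (D := D') (ϖ := ϖ)
    (fun P ↦ hS' (PrimeSpectrum.comap (algebraMap A L) P)) hϖ hY
    (fun P P' hP hP' ↦ ((PrimeSpectrum.le_iff_specializes _ _).1 hP).mem_closed hD' hP')
    (fun P hP hP' ↦ by
      obtain ⟨y, hy, hyD, hyY⟩ := exists_generization f hX.flat hP'
      have hy' : y ⤳ (β ≫ c₂) P := hy
      obtain ⟨P', hP', rfl⟩ := Flat.generalizingMap (β ≫ c₂) hy'
      exact ⟨P', (PrimeSpectrum.le_iff_specializes _ _).2 hP', hyD, hyY⟩)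
    hDE
    (Λ := FibreComponents f) (C := fun l ↦ c₂ ⁻¹' (reducedFibreι f '' l.1))
    (M := fun l ↦ c₂ ⁻¹' (reducedFibreι f '' {y | IsGenericPoint y l.1})) hCc
    (isComponentFamily f (β ≫ c₂))
  let γ : Spec (.of (Localization.Away s)) ⟶ Spec (.of A) :=
    Spec.map (CommRingCat.ofHom (algebraMap A (Localization.Away s)))
  have hAs : Algebra.Etale A (Localization.Away s) := Algebra.Etale.of_isLocalizationAway s
  have hγ : Etale γ := etale_specMap_of_algebra A (Localization.Away s)
  obtain ⟨v', hv'⟩ : PrimeSpectrum.comap fA v ∈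
      Set.range (PrimeSpectrum.comap (algebraMap A (Localization.Away s))) := by
    rw [PrimeSpectrum.localization_away_comap_range (Localization.Away s) s]
    exact hs
  -- the neighbourhood is the distinguished open subset `D(s)` of `Spec A`
  refine ⟨_, γ ≫ α, v', inferInstance, ?_, ?_⟩
  · rw [← hqv]
    refine (congrArg α hv').trans ?_
    exact congrArg (fun k ↦ PrimeSpectrum.comap k v) hcomp.symm
  · rintro _ _ rfl
    refine @H _ (inferInstanceAs (Algebra A (Localization.Away s)))
      (inferInstanceAs (IsLocalization.Away s (Localization.Away s))) rfl (fun _ ↦ rfl) ?_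
    refine isLocalization_away_sections _ _ ?_
    ext P
    have h1 : γ P ∈ (α ≫ c₁) ⁻¹' (boundaryCompl f D : Set X) ↔
      ∏ i ∈ S, algebraMap A₁ A (t i) ∉ (γ P).asIdeal := not_congr (hS' (γ P))
    exact h1

end Existence

section Existence

variable {O : Type u} [CommRing O] [IsDomain O] [IsDiscreteValuationRing O] (p : ℕ) [Fact p.Prime]
  [CharP (IsLocalRing.ResidueField O) p] {X : Scheme.{u}} {f : X ⟶ Spec (.of O)} {D : Closeds X}

/-- Charts exist étale locally in the normal crossing setting. -/
theorem IsNormalCrossingSetting.locally_hasChart (hX : IsNormalCrossingSetting f D)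
    (U : X.AffineEtale) : Locally U fun V _ ↦ HasChart ((fibreDatum f D).obj (op V)) p := by
  have hU : Etale (specHom U) := U.prop
  refine locally_of_forall_point fun u ↦ ?_
  by_cases hu : specHom U u ∈ Set.range (reducedFibreι f)
  · obtain ⟨A, φ, z, n, t, S, hφ, hz, ht, hS⟩ := hX.exists_parameters (specHom U) u (Or.inl hu)
    have hz' : (φ ≫ specHom U) z ∈ Set.range (reducedFibreι f) := by
      rw [← hz] at hu
      exact hu
    obtain ⟨R, ψ, v, hψ, hv, H⟩ := hX.exists_hasChart_mk (p := p) (φ ≫ specHom U) z hz' ht hS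
    refine ⟨R, ψ ≫ φ, inferInstance, v, ?_, H _ (Category.assoc _ _ _)⟩
    exact (congrArg φ hv).trans hz
  -- off the closed fibre all ideals are the unit ideal
  · let W : (Spec (ringOf U)).Opens := specHom U ⁻¹ᵁ
      ⟨(Set.range (reducedFibreι f))ᶜ, (isClosed_range_reducedFibreι f).isOpen_compl⟩
    obtain ⟨R, φ, hφ, ⟨v, hv⟩, hr⟩ := Scheme.exists_affine_mem_range_and_range_subset
      (U := W) (x := u) hu
    have hempty (Z : Set X) (hZ : Z ⊆ Set.range (reducedFibreι f)) :
        PrimeSpectrum.vanishingIdeal (R := R) ((φ ≫ specHom U) ⁻¹' Z) = ⊤ := by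
      have h : (φ ≫ specHom U) ⁻¹' Z = ∅ :=
        Set.eq_empty_of_forall_notMem fun P hP ↦ hr ⟨P, rfl⟩ (hZ hP)
      exact (congrArg (PrimeSpectrum.vanishingIdeal (R := R)) h).trans
        PrimeSpectrum.vanishingIdeal_empty
    exact ⟨R, φ, inferInstance, v, hv, HasChart.of_eq_top (hempty _ subset_rfl)
      fun i ↦ hempty _ (Set.image_subset_range _ _)⟩

end Existence

section Acyclic

variable {X : Scheme.{u}} {Λ : Type v} {P : (X.AffineEtale)ᵒᵖ ⥤ LogDatum.{u} Λ}

/-- `ω^q_{m,0} = 0`, since `I^{(m)} / I^{(m)} = 0`. -/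
theorem isZero_omega_zero (m : Λ →₀ ℕ) (q : ℕ) : IsZero (omega P m 0 q) := by
  have h : IsZero (P ⋙ LogDatum.twistedForms m 0 q) := by
    refine (Functor.isZero_iff _).2 fun U ↦ ?_
    have : Subsingleton ((P.obj U).Gr m 0) := by
      rw [Submodule.Quotient.subsingleton_iff, add_zero, Submodule.submoduleOf_self]
    have : Subsingleton ((P.obj U).TwistedForm m 0 q) := inferInstance
    exact AddCommGrpCat.isZero_of_subsingleton (.of ((P.obj U).TwistedForm m 0 q))
  exact (presheafToSheaf (Scheme.AffineEtale.topology X) AddCommGrpCat.{u}).map_isZero h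

/-- The smallest `n` with `m ≤ p • n` is obtained by rounding up `m / p`. -/
theorem exists_isLeast_le_smul {p : ℕ} (hp : 0 < p) (m : Λ →₀ ℕ) :
    ∃ m' : Λ →₀ ℕ, IsLeast {n | m ≤ p • n} m' :=
  ⟨m.mapRange (fun a ↦ (a + p - 1) / p) (by simp [Nat.div_eq_of_lt, hp]), fun i ↦ by
    have := Nat.lt_mul_div_succ (m i + p - 1) hp
    simp only [Finsupp.smul_apply, Finsupp.mapRange_apply, smul_eq_mul]
    rw [mul_add] at this
    omega, fun n hn i ↦ by
    have := hn i
    simp only [Finsupp.smul_apply, Finsupp.mapRange_apply, smul_eq_mul] at this ⊢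
    refine Nat.lt_succ_iff.1 ((Nat.div_lt_iff_lt_mul hp).2 ?_)
    rw [Nat.succ_mul, mul_comm]
    omega⟩

variable {p : ℕ} [Fact p.Prime]

/-- If `p` does not divide `m_i`, then `l' = 0` for `l = δ_i`, and the inverse Cartier isomorphism
shows that the cohomology sheaves vanish. -/
theorem acyclic_of_not_dvd
    (hP : ∀ U : X.AffineEtale, Locally U fun V _ ↦ HasChart (P.obj (op V)) p) {m : Λ →₀ ℕ} {i : Λ}
    (hi : ¬ p ∣ m i) (δ : TwistedDifferential P m (Finsupp.single i 1)) : δ.complex.Acyclic := by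
  intro q
  rw [HomologicalComplex.exactAt_iff_isZero_homology]
  obtain ⟨m', hm'⟩ := exists_isLeast_le_smul (Fact.out : p.Prime).pos m
  obtain ⟨C, -⟩ := exists_inverseCartier δ hm' (fun j ↦ by
    classical
    rw [Finsupp.single_apply]
    split_ifs <;> simp) hP q
  rw [Finsupp.filter_single_of_neg (fun i ↦ p ∣ m i) hi] at C
  exact (isZero_omega_zero m' q).of_iso C.symm

end Acyclic

end

end KatoCartier

theorem theorem3p1 {O : Type u} [CommRing O] [IsDomain O] [IsDiscreteValuationRing O]
    [HenselianLocalRing O] [CharZero O] (p : ℕ) [Fact p.Prime]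
    [CharP (IsLocalRing.ResidueField O) p]
    {X : AlgebraicGeometry.Scheme.{u}} (f : X ⟶ AlgebraicGeometry.Spec (.of O))
    (D : TopologicalSpace.Closeds X) (hX : KatoCartier.IsNormalCrossingSetting f D) :
    (∀ m l : KatoCartier.FibreComponents f →₀ ℕ, (∀ i, l i ≤ 1) →
      ∃ δ : KatoCartier.TwistedDifferential (KatoCartier.fibreDatum f D) m l,
        (∀ δ' : KatoCartier.TwistedDifferential (KatoCartier.fibreDatum f D) m l, δ' = δ) ∧
        ∀ (m' : KatoCartier.FibreComponents f →₀ ℕ) (hm' : IsLeast {n | m ≤ p • n} m') (q : ℕ),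
          ∃ C : KatoCartier.omega (KatoCartier.fibreDatum f D) m'
              (l.filter fun i ↦ p ∣ m i) q ≅ δ.complex.homology q,
            KatoCartier.IsInverseCartier δ hm'.1 (l.filter fun i ↦ p ∣ m i) q C.hom) ∧
    (∀ (m : KatoCartier.FibreComponents f →₀ ℕ) (i : KatoCartier.FibreComponents f), ¬ p ∣ m i →
      ∀ δ : KatoCartier.TwistedDifferential (KatoCartier.fibreDatum f D) m (Finsupp.single i 1),
        δ.complex.Acyclic) := by
  have hP := hX.locally_hasChart p
  refine ⟨fun m l hl ↦ ?_, fun m i hi δ ↦ KatoCartier.acyclic_of_not_dvd hP hi δ⟩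
  obtain ⟨δ⟩ := KatoCartier.exists_twistedDifferential hP m l
  exact ⟨δ, fun δ' ↦ KatoCartier.twistedDifferential_subsingleton hP δ' δ, fun m' hm' q ↦
    KatoCartier.exists_inverseCartier δ hm' hl hP q⟩
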